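/- **Proposition (Nonlinear control of $\rho$).** Let $d\ge 1$ and let $M>d/2$ be an integer. Let $\gamma\ge 1$, $C_W>0$, $C_0,\bar\lambda,\kappa>0$, $\frac1{2+\gamma}<s<1$, $\lambda_0>\lambda'>0$, $\sigma>d+8$, $\beta>2$. *Notation.* $|\cdot|$ is the Euclidean norm on $\mathbb Z^d$ and $\mathbb R^d$, $|k,\eta|=|k|+|\eta|$, $\langle x\rangle=(1+|x|^2)^{1/2}$. For $g$ on $\mathbb T^d\times\mathbb R^d$, $\mathbb T=\mathbb R/2\pi\mathbb Z$, put $\hat g_k(\eta)=(2\pi)^{-d}\int_{\mathbb T^d\times\mathbb R^d}e^{-ik\cdot z-i\eta\cdot v}g(z,v)\,dz\,dv$, extended to $L^2$, and $$\|g\|^2_{\mathcal G^{\lambda;\nu}}=\sum_{k\in\mathbb Z^d}\int_{\mathbb R^d}|\hat g_k(\eta)|^2e^{2\lambda\langle k,\eta\rangle^\nu}d\eta .$$ A function of $v$ alone is regarded as independent of $z$; thus $\widehat{f^0}(\eta)=\int_{\mathbb R^d} e^{-i\eta\cdot v}f^0(v)\,dv$. With $a=\frac{(2+\gamma)s-1}{1+\gamma}$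 let $$\lambda(t)=\tfrac18(\lambda_0-\lambda')(1-t)_++\tfrac12(\lambda_0+\lambda')+\tfrac14(\lambda_0-\lambda')\min(1,t^{-a}),\qquad A^{(\sigma')}_k(t,\eta)=e^{\lambda(t)\langle k,\eta\rangle^s}\langle k,\eta\rangle^{\sigma+\sigma'},\quad A=A^{(0)},$$ $\|A^{(\sigma')}g(t)\|_2^2=\sum_k\int|A^{(\sigma')}_k(t,\eta)\hat g_k(t,\eta)|^2d\eta$ and $\|A\rho(t)\|_2^2=\sum_k|A_k(t,kt)\hat\rho_k(t)|^2$, where $\hat\rho_k=(2\pi)^{-d}\int_{\mathbb T^d} e^{-ik\cdot x}\rho(x)\,dx$. *The equation.* Let $W$ be an interaction potential on $\mathbb T^d$, given by its Fourier coefficients $\widehat W(k)=\int_{\mathbb T^d} e^{-ik\cdot x}W(x)\,dx$, with $|\widehat W(k)|\le C_W|k|^{-1-\gamma}$ for $k\ne0$. Let $f^0(v)$ be an analytic homogeneous background satisfying condition **(L)** with constants $C_0,\bar\lambda,\kappa,M$: $\sum_{|\alpha|\le M}\|v^\alpha f^0\|^2_{\mathcal G^{\bar\lambda;1}}\le C_0$,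 and $\inf_{k\in\mathbb Z^d}|\mathcal L(\xi,k)-1|\ge\kappa$ for all $\xi\in\mathbb C$ with $\mathrm{Re}\,\xi<\bar\lambda$, where $\mathcal L(\xi,k)=-\int_0^\infty e^{\bar\xi|k|t}\widehat{f^0}(kt)\widehat W(k)|k|^2t\,dt$. Let $h_{in}$ have mean zero with $\sum_{|\alpha|\le M}\|v^\alpha h_{in}\|^2_{\mathcal G^{\lambda_0;s}}<\epsilon^2$, and let $f(t,z,v)$ be a classical solution on $[0,T^\star)\times\mathbb T^d\times\mathbb R^d$ of the Vlasov equation in the coordinates $z=x-vt$, $$\partial_tf+F(t,z+vt)\cdot(\nabla_v-t\nabla_z)f+F(t,z+vt)\cdot\nabla_vf^0=0,\qquad f(0)=h_{in},$$ $$F(t,x)=-\nabla W*\rho(t,x),\qquad \rho(t,x)=\int_{\mathbb R^d}f(t,x-vt,v)\,dv .$$ (Functions may be real or complex valued.) *Bootstrap hypotheses.* For constants $K_1,K_2,K_3$, for all $t\in[0,T^\star)$, $$\sum_{|\alpha|\le M}\|A^{(1)}(v^\alpha f)(t)\|_2^2\le4K_1\langle t\rangle^7\epsilon^2,\qquad \sum_{|\alpha|\le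 M}\|A^{(-\beta)}(v^\alpha f)(t)\|_2^2\le4K_2\epsilon^2,\qquad \int_0^t\|A\rho(\tau)\|_2^2\,d\tau\le4K_3\epsilon^2 .$$ *Claim.* There is $\bar K_3\ge1$, depending only on $d,M,\gamma,C_W,C_0,\bar\lambda,\kappa,s,\lambda_0,\lambda',\sigma,\beta$, such that for all $K_3\ge\bar K_3$ and all $K_1,K_2>0$ there is $\epsilon_0>0$, depending only on the same parameters and on $K_1,K_2,K_3$, such that for all $W,f^0,h_{in},f$ as above, all $0<\epsilon\le\epsilon_0$ and all $0<T^\star<\infty$, the bootstrap hypotheses on $[0,T^\star)$ imply $$\int_0^t\|A\rho(\tau)\|_2^2\,d\tau<2K_3\epsilon^2\qquad\text{for all }t\in[0,T^\star].$$ -/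

import Mathlib

open MeasureTheory
open scoped ENNReal FourierTransform

noncomputable section

namespace LandauDamping

/-- Velocity space `ℝ^d`; it also carries the space variable, functions on the torus
`𝕋^d = ℝ^d / (2πℤ)^d` being `2π`-periodic functions on `ℝ^d`. -/
abbrev E (d : ℕ) : Type := EuclideanSpace ℝ (Fin d)

/-- The lattice vector `k ∈ ℤ^d`, seen in `ℝ^d`. -/
def vec {d : ℕ} (k : Fin d → ℤ) : E d := WithLp.toLp 2 (fun j => (k j : ℝ))

/-- The fundamental cell `(0, 2π]^d` of the torus. -/
def cell (d : ℕ) : Set (E d) := {z | ∀ j, z j ∈ Set.Ioc (0 : ℝ) (2 * Real.pi)}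

/-- `⟨x⟩ = (1 + x²)^{1/2}`. -/
def jap (x : ℝ) : ℝ := Real.sqrt (1 + x ^ 2)

/-- `⟨k, η⟩ = (1 + |k, η|²)^{1/2}` with `|k, η| = |k| + |η|`. -/
def japPair {d : ℕ} (k : Fin d → ℤ) (η : E d) : ℝ := jap (‖vec k‖ + ‖η‖)

/-- The multi-indices `α ∈ ℕ^d` with `|α| ≤ M`. -/
def multiIndices (d M : ℕ) : Finset (Fin d → ℕ) :=
  (Fintype.piFinset (fun _ : Fin d => Finset.range (M + 1))).filter (fun α => ∑ j, α j ≤ M)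

/-- `v^α g`. -/
def moment {d : ℕ} (α : Fin d → ℕ) (g : E d → E d → ℂ) : E d → E d → ℂ :=
  fun z v => ((∏ j, v j ^ α j : ℝ) : ℂ) * g z v

/-- Fourier coefficient `(2π)^{-d} ∫_{𝕋^d} e^{-i k·x} u(x) dx` of a function on the torus. -/
def torusCoeff {d : ℕ} (u : E d → ℂ) (k : Fin d → ℤ) : ℂ :=
  (((2 * Real.pi) ^ d : ℝ) : ℂ)⁻¹ *
    ∫ x in cell d, Complex.exp (-Complex.I * (inner ℝ (vec k) x : ℝ)) * u x

/-- Fourier integral `∫_{ℝ^d} e^{-i v·η} u(v) dv` of an integrable function. -/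
def fourierInt {d : ℕ} (u : E d → ℂ) (η : E d) : ℂ :=
  ∫ v, Complex.exp (-Complex.I * (inner ℝ η v : ℝ)) * u v

/-- The extension of `fourierInt` to square integrable functions (defined almost everywhere).
Mathlib's transform has the kernel `e^{-2πi v·w}`, whence the evaluation at `w = η / 2π`. -/
def fourierL2 {d : ℕ} (u : E d → ℂ) (hu : MemLp u 2 volume) (η : E d) : ℂ :=
  (𝓕 (hu.toLp u) : Lp (α := E d) ℂ 2 volume) ((2 * Real.pi)⁻¹ • η)

/-- The partial Fourier coefficients in `z`: `v ↦ (2π)^{-d} ∫_{𝕋^d} e^{-i k·z} g(z,v) dz`. -/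
def zMode {d : ℕ} (g : E d → E d → ℂ) (k : Fin d → ℤ) (v : E d) : ℂ :=
  torusCoeff (fun z => g z v) k

open Classical in
/-- `∑_k ∫ |m_k(η) ĝ_k(η)|² dη` for a Fourier multiplier `m`, where
`ĝ_k(η) = (2π)^{-d} ∫∫ e^{-i k·z - i v·η} g(z,v) dz dv` is the Fourier transform on
`L²(𝕋^d × ℝ^d)`; the value is `∞` if `g` is not in that space. (The second half of the condition
follows from the first one by the Cauchy-Schwarz inequality.) -/
def multiplierNormSq {d : ℕ} (m : (Fin d → ℤ) → E d → ℝ) (g : E d → E d → ℂ) : ℝ≥0∞ :=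
  if h : MemLp (fun p : E d × E d => g p.1 p.2) 2 ((volume.restrict (cell d)).prod volume) ∧
      ∀ k, MemLp (zMode g k) 2 volume then
    ∑' k, ∫⁻ η, ENNReal.ofReal (m k η ^ 2) * ‖fourierL2 (zMode g k) (h.2 k) η‖ₑ ^ 2
  else ⊤

/-- The square `‖g‖²_{𝒢^{lam;ν}}` of the Gevrey-`1/ν` norm of radius `lam`. -/
def gevreyNormSq {d : ℕ} (lam ν : ℝ) (g : E d → E d → ℂ) : ℝ≥0∞ :=
  multiplierNormSq (fun k η => Real.exp (lam * japPair k η ^ ν)) g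

/-- The Fourier-Laplace symbol
`ℒ(ξ,k) = - ∫_0^∞ e^{ξ̄ |k| t} f̂⁰(kt) Ŵ(k) |k|² t dt`. -/
def laplaceSymbol {d : ℕ} (What : (Fin d → ℤ) → ℂ) (f0 : E d → ℂ) (ξ : ℂ) (k : Fin d → ℤ) : ℂ :=
  -∫ t in Set.Ioi (0 : ℝ),
    Complex.exp ((starRingEnd ℂ) ξ * ‖vec k‖ * t) * fourierInt f0 (t • vec k) * What k *
      (‖vec k‖ : ℂ) ^ 2 * t

/-- The linear stability condition **(L)** for the homogeneous background `f⁰`, with constants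
`C₀`, `lamBar`, `κ`, `M`. -/
structure StabilityL {d : ℕ} (What : (Fin d → ℤ) → ℂ) (f0 : E d → ℂ)
    (C₀ lamBar κ : ℝ) (M : ℕ) : Prop where
  analytic : AnalyticOnNhd ℝ f0 Set.univ
  localized : ∑ α ∈ multiIndices d M, gevreyNormSq lamBar 1 (moment α (fun _ v => f0 v))
    ≤ ENNReal.ofReal C₀
  stable : ∀ ξ : ℂ, ξ.re < lamBar → ∀ k : Fin d → ℤ, κ ≤ ‖laplaceSymbol What f0 ξ k - 1‖

/-- The density `ρ(t,x) = ∫ f(t, x - tv, v) dv` of the profile `f(t,z,v)`, `z = x - tv`. -/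
def density {d : ℕ} (f : ℝ → E d → E d → ℂ) (t : ℝ) (x : E d) : ℂ :=
  ∫ v, f t (x - t • v) v

/-- `ρ̂_k(t)`. -/
def densityHat {d : ℕ} (f : ℝ → E d → E d → ℂ) (t : ℝ) (k : Fin d → ℤ) : ℂ :=
  torusCoeff (density f t) k

/-- The `k`-th Fourier mode at `x` of the `j`-th component of the force `F = -∇W * ρ`,
where `Ŵ(k) = ∫_{𝕋^d} e^{-i k·x} W(x) dx`. -/
def forceMode {d : ℕ} (What : (Fin d → ℤ) → ℂ) (f : ℝ → E d → E d → ℂ) (t : ℝ) (j : Fin d)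
    (x : E d) (k : Fin d → ℤ) : ℂ :=
  -(Complex.I * (k j : ℂ) * What k * densityHat f t k *
    Complex.exp (Complex.I * (inner ℝ (vec k) x : ℝ)))

/-- The `j`-th component of the force field `F(t,x) = -(∇W * ρ(t))(x)`. -/
def force {d : ℕ} (What : (Fin d → ℤ) → ℂ) (f : ℝ → E d → E d → ℂ) (t : ℝ) (j : Fin d)
    (x : E d) : ℂ :=
  ∑' k, forceMode What f t j x k

/-- `∂_j u`. -/
def partialD {d : ℕ} (j : Fin d) (u : E d → ℂ) (x : E d) : ℂ :=
  fderiv ℝ u x (EuclideanSpace.single j 1)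

/-- `f(t,z,v)` is a classical solution on `[0,T)` of the Vlasov equation in the coordinates
`z = x - tv`,
`∂_t f + F(t,z+vt)·(∇_v - t∇_z) f + F(t,z+vt)·∇_v f⁰ = 0`, `f(0) = h_in`. -/
structure IsVlasovSolution {d : ℕ} (What : (Fin d → ℤ) → ℂ) (f0 : E d → ℂ)
    (hin : E d → E d → ℂ) (T : ℝ) (f : ℝ → E d → E d → ℂ) : Prop where
  periodic : ∀ t ∈ Set.Ico 0 T, ∀ (k : Fin d → ℤ) (z v : E d),
    f t (z + (2 * Real.pi) • vec k) v = f t z v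
  smooth : ∀ t ∈ Set.Ico 0 T, ContDiff ℝ 1 (fun p : E d × E d => f t p.1 p.2)
  integrable_density : ∀ t ∈ Set.Ico 0 T, ∀ x, Integrable (fun v => f t (x - t • v) v)
  summable_force : ∀ t ∈ Set.Ico 0 T, ∀ j x, Summable (forceMode What f t j x)
  initial : f 0 = hin
  equation : ∀ t ∈ Set.Ico 0 T, ∀ z v,
    HasDerivWithinAt (fun τ => f τ z v)
      (-(∑ j, force What f t j (z + t • v) *
            (partialD j (fun w => f t z w) v - (t : ℂ) * partialD j (fun y => f t y v) z)
          + ∑ j, force What f t j (z + t • v) * partialD j f0 v))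
      (Set.Ico 0 T) t

/-- The radius of regularity
`λ(t) = (λ₀-λ')(1-t)₊/8 + (λ₀+λ')/2 + (λ₀-λ') min(1, t^{-a})/4`, `a = ((2+γ)s-1)/(1+γ)`;
`max(1,t)^{-a}` stands for `min(1, t^{-a})`, which equals 1 at `t = 0`. -/
def radius (γ s lam0 lam' t : ℝ) : ℝ :=
  (1 / 8) * (lam0 - lam') * max (1 - t) 0 + (lam0 / 2 + lam' / 2)
    + (1 / 4) * (lam0 - lam') * (max 1 t) ^ (-(((2 + γ) * s - 1) / (1 + γ)))

/-- The multiplier `A^{(σ')}_k(t,η) = e^{λ(t)⟨k,η⟩^s} ⟨k,η⟩^{σ+σ'}`; `A = A^{(0)}`. -/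
def multA {d : ℕ} (γ s lam0 lam' σ σ' t : ℝ) (k : Fin d → ℤ) (η : E d) : ℝ :=
  Real.exp (radius γ s lam0 lam' t * japPair k η ^ s) * japPair k η ^ (σ + σ')

/-- `∑_{|α| ≤ M} ‖A^{(σ')} (v^α f)(t)‖₂²`. -/
def energy {d : ℕ} (γ s lam0 lam' σ σ' : ℝ) (M : ℕ) (f : ℝ → E d → E d → ℂ) (t : ℝ) : ℝ≥0∞ :=
  ∑ α ∈ multiIndices d M, multiplierNormSq (multA γ s lam0 lam' σ σ' t) (moment α (f t))

/-- `‖Aρ(t)‖₂² = ∑_k |A_k(t,kt) ρ̂_k(t)|²`. -/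
def densityNormSq {d : ℕ} (γ s lam0 lam' σ : ℝ) (f : ℝ → E d → E d → ℂ) (t : ℝ) : ℝ≥0∞ :=
  ∑' k : Fin d → ℤ,
    ENNReal.ofReal (multA γ s lam0 lam' σ 0 t k (t • vec k) ^ 2) * ‖densityHat f t k‖ₑ ^ 2

/-- The bootstrap hypotheses on `[0,T)`. -/
structure Bootstrap {d : ℕ} (γ s lam0 lam' σ β : ℝ) (M : ℕ) (K₁ K₂ K₃ ε T : ℝ)
    (f : ℝ → E d → E d → ℂ) : Prop where
  high : ∀ t ∈ Set.Ico 0 T,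
    energy γ s lam0 lam' σ 1 M f t ≤ ENNReal.ofReal (4 * K₁ * jap t ^ 7 * ε ^ 2)
  low : ∀ t ∈ Set.Ico 0 T,
    energy γ s lam0 lam' σ (-β) M f t ≤ ENNReal.ofReal (4 * K₂ * ε ^ 2)
  mid : ∀ t ∈ Set.Ico 0 T,
    ∫⁻ τ in Set.Ioc 0 t, densityNormSq γ s lam0 lam' σ f τ ≤ ENNReal.ofReal (4 * K₃ * ε ^ 2)

end LandauDamping

end

/-! ### The Japanese bracket. -/

namespace LandauDamping

/-! Evaluating Duhamel's formula for the profile at η = kt (`DecayingSolution.densityHat_volterra`)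
gives, for every mode k, ρ̂_k(t) = ĥ_k(kt) - ∫_0^t ∑_l N_{k,l}(t,τ) dτ + ∫_0^t ρ̂_k(τ) K_k(t-τ) dτ,
with the linear kernel K_k(t) = -f̂⁰(kt) Ŵ(k) |k|² t and the quadratic interactions N_{k,l} = Ŵ(l)
ρ̂_l(τ) (l·k)(t-τ) f̂_{k-l}(τ, kt-lτ). The mode k = 0 vanishes, because mass is conserved and the
datum has mean zero.

Linear part. Condition (L) keeps 1 minus the Laplace transform of K_k away from 0 in a half plane,
uniformly in k once time is rescaled by |k|. By Plancherel and a stepwise increase of an exponential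
weight, the resolvent of K_k decays like an exponential in |k|t, in an integrated sense
(`exists_resolvent_bound_scaled`). Since s < 1, the weight A_k(t,kt) grows from time τ to time t
more slowly than any exponential of |k|(t-τ) (`exists_multA_shift_le`). Hence the density is
controlled by the forcing in the weighted norm (`volterra_bound`, `exists_linear_estimate`).

Quadratic part. The difficulty is the growth factor |k|(t-τ). Put x = ⟨l,lτ⟩ for the frequency of
the density and y = ⟨k-l,kt-lτ⟩ for that of the profile. By strict concavity of x ↦ x^s the smaller
of the two needs only the fraction s of the radius, and the unused fraction 1-s yields any power of
it. If y ≤ x (reaction), the factor is the plasma echo, dangerous near kt = lτ. The decrease of the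
radius leaves the surplus exp((λ(τ)-λ(t)) x^s), and the exponent a is such that this surplus
dominates |k|(t-τ)/|l|^(1+γ) up to powers of y (`exists_echo_bound`); s > 1/(2+γ) means a > 0. With
|l|^(-γ) from the potential there remains the kernel |l| y^(-N), to which Schur's test applies
(`exists_reaction_schur`). The profile enters through the low norm. If x ≤ y (transport), |k|(t-τ) ≤
y(1+τ) costs one derivative of the profile, so the high norm enters; its growth ⟨τ⟩^7 is paid for by
powers of x (`exists_transport_schur`).

Both parts need point values of f̂ and its L² norms on lines t ↦ kt - a. The moments v^α f with |α|
≤ M, M > d/2, bound point values by local L² norms (`exists_trace_bound`), and a line of speed |k| ≥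
1 stays in a unit ball for a time at most 2 (`exists_line_trace`).

Altogether Q = ∫ ‖Aρ‖² satisfies Q ≤ Cε² + C(K₁+K₂)ε² Q (`exists_density_estimate`). Inserting Q ≤
4K₃ε² gives Q ≤ K₃ε² as soon as K₃ ≥ 2C and ε is small. -/

theorem one_le_jap (x : ℝ) : 1 ≤ jap x := by
  unfold jap
  rw [Real.one_le_sqrt]
  nlinarith [sq_nonneg x]

theorem jap_pos (x : ℝ) : 0 < jap x := lt_of_lt_of_le one_pos (one_le_jap x)

theorem abs_le_jap (x : ℝ) : |x| ≤ jap x := by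
  unfold jap
  rw [← Real.sqrt_sq_eq_abs]
  exact Real.sqrt_le_sqrt (by linarith)

theorem jap_sq (x : ℝ) : jap x ^ 2 = 1 + x ^ 2 := Real.sq_sqrt (by positivity)

theorem jap_le_jap {x y : ℝ} (hx : 0 ≤ x) (hxy : x ≤ y) : jap x ≤ jap y := by
  unfold jap
  exact Real.sqrt_le_sqrt (by gcongr)

/-- After squaring, only xy ≤ ⟨x⟩|y| is left to check. -/
theorem jap_add_le (x y : ℝ) : jap (x + y) ≤ jap x + |y| := by
  have h1 := jap_sq (x + y)
  have h2 := jap_sq x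
  have h3 := abs_le_jap x
  have h4 := jap_pos x
  refine abs_le_of_sq_le_sq' ?_ (by positivity) |>.2
  have : x * y ≤ jap x * |y| := by
    calc x * y ≤ |x * y| := le_abs_self _
      _ = |x| * |y| := abs_mul x y
      _ ≤ _ := by gcongr
  nlinarith [sq_abs y]

theorem continuous_jap : Continuous jap := by
  unfold jap
  fun_prop

/-! ### Lattice frequencies and the bracket ⟨k,η⟩. -/

section Pair

variable {d : ℕ}

theorem vec_add (k l : Fin d → ℤ) : vec (k + l) = vec k + vec l := by
  ext j; simp [vec]

theorem vec_sub (k l : Fin d → ℤ) : vec (k - l) = vec k - vec l := by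
  ext j; simp [vec]

theorem vec_zero : vec (0 : Fin d → ℤ) = 0 := by
  ext j; simp [vec]

theorem vec_neg (k : Fin d → ℤ) : vec (-k) = -vec k := by
  ext j; simp [vec]

theorem vec_apply (k : Fin d → ℤ) (j : Fin d) : vec k j = k j := rfl

theorem one_le_norm_vec {k : Fin d → ℤ} (hk : k ≠ 0) : 1 ≤ ‖vec k‖ := by
  obtain ⟨j, hj⟩ := Function.ne_iff.mp hk
  have h1 : (1 : ℝ) ≤ |(k j : ℝ)| := by
    rw [← Int.cast_abs]
    exact_mod_cast Int.one_le_abs hj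
  exact h1.trans (PiLp.norm_apply_le (vec k) j)

theorem one_le_japPair (k : Fin d → ℤ) (η : E d) : 1 ≤ japPair k η := one_le_jap _

theorem japPair_pos (k : Fin d → ℤ) (η : E d) : 0 < japPair k η := jap_pos _

theorem norm_add_norm_le_japPair (k : Fin d → ℤ) (η : E d) : ‖vec k‖ + ‖η‖ ≤ japPair k η :=
  (le_abs_self _).trans (abs_le_jap _)

theorem norm_vec_le_japPair (k : Fin d → ℤ) (η : E d) : ‖vec k‖ ≤ japPair k η := by
  linarith [norm_add_norm_le_japPair k η, norm_nonneg η]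

theorem norm_le_japPair (k : Fin d → ℤ) (η : E d) : ‖η‖ ≤ japPair k η := by
  linarith [norm_add_norm_le_japPair k η, norm_nonneg (vec k)]

/-- The increment is kept as a plain norm rather than a bracket, so that moving η by at most 1
changes the bracket by at most 1. -/
theorem japPair_le_add (k l : Fin d → ℤ) (η ξ : E d) :
    japPair k η ≤ japPair l ξ + (‖vec (k - l)‖ + ‖η - ξ‖) := by
  have h : ‖vec k‖ + ‖η‖ ≤ (‖vec l‖ + ‖ξ‖) + (‖vec (k - l)‖ + ‖η - ξ‖) := by
    rw [vec_sub]
    have h1 := norm_le_norm_add_norm_sub' (vec k) (vec l)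
    have h2 := norm_le_norm_add_norm_sub' η ξ
    linarith
  refine (jap_le_jap (by positivity) h).trans ((jap_add_le _ _).trans ?_)
  rw [abs_of_nonneg (by positivity)]
  rfl

theorem japPair_le_add_japPair (k l : Fin d → ℤ) (η ξ : E d) :
    japPair k η ≤ japPair l ξ + japPair (k - l) (η - ξ) :=
  (japPair_le_add k l η ξ).trans (by gcongr; exact norm_add_norm_le_japPair _ _)

theorem continuous_japPair (k : Fin d → ℤ) : Continuous (japPair (d := d) k) := by
  unfold japPair
  exact continuous_jap.comp (by fun_prop)

end Pair

/-! ### Fractional powers and exponentials. -/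

section Powers

/-- Bernoulli's inequality for the concave power. The gain over subadditivity is the factor s < 1 on
the smaller argument: in an exponent it leaves a share 1 - s unused, which pays for all polynomial
losses later on. -/
theorem add_rpow_le_of_le {s x y : ℝ} (hs : 0 < s) (hs1 : s < 1) (hy : 0 < y) (hxy : y ≤ x) :
    (x + y) ^ s ≤ x ^ s + s * y ^ s := by
  have hx : 0 < x := hy.trans_le hxy
  have h1 : x + y = x * (1 + y / x) := by field_simp
  have h2 : (1 + y / x) ^ s ≤ 1 + s * (y / x) :=
    rpow_one_add_le_one_add_mul_self (by linarith [div_pos hy hx]) hs.le hs1.le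
  have h3 : x ^ (s - 1) ≤ y ^ (s - 1) := Real.rpow_le_rpow_of_nonpos hy hxy (by linarith)
  have h4 : x ^ s = x ^ (s - 1) * x := by
    rw [← Real.rpow_add_one hx.ne', sub_add_cancel]
  have h5 : y ^ s = y ^ (s - 1) * y := by
    rw [← Real.rpow_add_one hy.ne', sub_add_cancel]
  rw [h1, Real.mul_rpow hx.le (by positivity)]
  calc x ^ s * (1 + y / x) ^ s ≤ x ^ s * (1 + s * (y / x)) := by gcongr
    _ = x ^ s + s * (x ^ (s - 1) * y) := by rw [h4]; field_simp
    _ ≤ x ^ s + s * (y ^ (s - 1) * y) := by gcongr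
    _ = _ := by rw [h5]

theorem exists_rpow_le_exp {c s : ℝ} (hc : 0 < c) (hs : 0 < s) (p : ℝ) :
    ∃ C : ℝ, 0 < C ∧ ∀ y : ℝ, 1 ≤ y → y ^ p ≤ C * Real.exp (c * y ^ s) := by
  -- The single term of order n ≥ p/s of the exponential series already dominates y^p for y ≥ 1.
  obtain ⟨n, hn⟩ := exists_nat_ge (p / s)
  refine ⟨n.factorial / c ^ n, by positivity, fun y hy => ?_⟩
  have hy0 : 0 < y := by linarith
  have h1 : (c * y ^ s) ^ n / n.factorial ≤ Real.exp (c * y ^ s) :=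
    Real.pow_div_factorial_le_exp _ (by positivity) n
  have h2 : y ^ p ≤ (y ^ s) ^ n := by
    rw [← Real.rpow_natCast, ← Real.rpow_mul hy0.le]
    apply Real.rpow_le_rpow_of_exponent_le hy
    rw [div_le_iff₀ hs] at hn
    linarith
  calc y ^ p ≤ (y ^ s) ^ n := h2
    _ = n.factorial / c ^ n * ((c * y ^ s) ^ n / n.factorial) := by
        rw [mul_pow]
        have : (n.factorial : ℝ) ≠ 0 := by positivity
        field_simp
    _ ≤ _ := by gcongr

/-- `X ^ p` is dominated by `exp X` on the half line. -/
theorem exists_rpow_le_exp_self {p : ℝ} (hp : 0 < p) :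
    ∃ C : ℝ, 0 < C ∧ ∀ x : ℝ, 0 ≤ x → x ^ p ≤ C * Real.exp x := by
  obtain ⟨C, hC, h⟩ := exists_rpow_le_exp one_pos one_pos p
  refine ⟨max C 1, by positivity, fun x hx => ?_⟩
  rcases le_total 1 x with h1 | h1
  · have := h x h1
    rw [Real.rpow_one, one_mul] at this
    exact this.trans (by gcongr; exact le_max_left _ _)
  · calc x ^ p ≤ 1 := Real.rpow_le_one hx h1 hp.le
      _ ≤ max C 1 * 1 := by simp
      _ ≤ _ := by gcongr; exact Real.one_le_exp hx

end Powers

/-! ### The decreasing radius of regularity. -/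

section Radius

variable {γ s lam0 lam' : ℝ}

theorem radius_exponent_pos (hγ : 1 ≤ γ) (hs : 1 / (2 + γ) < s) :
    0 < ((2 + γ) * s - 1) / (1 + γ) := by
  rw [div_lt_iff₀ (by linarith)] at hs
  apply div_pos <;> linarith

theorem radius_anti (hγ : 1 ≤ γ) (hs : 1 / (2 + γ) < s) (hlam : lam' < lam0) {τ t : ℝ}
    (hτt : τ ≤ t) : radius γ s lam0 lam' t ≤ radius γ s lam0 lam' τ := by
  have ha := radius_exponent_pos hγ hs
  unfold radius
  have h1 : max (1 - t) 0 ≤ max (1 - τ) 0 := max_le_max (by linarith) le_rfl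
  have h2 : (max 1 t) ^ (-(((2 + γ) * s - 1) / (1 + γ)))
      ≤ (max 1 τ) ^ (-(((2 + γ) * s - 1) / (1 + γ))) :=
    Real.rpow_le_rpow_of_nonpos (by positivity) (max_le_max le_rfl hτt) (by linarith)
  have h3 : 0 ≤ lam0 - lam' := by linarith
  gcongr

theorem lam'_le_radius (hlam : lam' < lam0) (t : ℝ) : lam' ≤ radius γ s lam0 lam' t := by
  unfold radius
  have h1 : 0 ≤ (1 / 8) * (lam0 - lam') * max (1 - t) 0 :=
    mul_nonneg (by linarith) (le_max_right _ _)
  have h2 : 0 ≤ (1 / 4) * (lam0 - lam') * (max 1 t) ^ (-(((2 + γ) * s - 1) / (1 + γ))) :=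
    mul_nonneg (by linarith) (by positivity)
  linarith

/-- The bound is the value at time 0. It lies (λ₀-λ')/8 below λ₀, and this gap absorbs the power
⟨k,η⟩^σ when the datum is measured with radius λ₀. -/
theorem radius_le (hγ : 1 ≤ γ) (hs : 1 / (2 + γ) < s) (hlam : lam' < lam0) {t : ℝ}
    (ht : 0 ≤ t) : radius γ s lam0 lam' t ≤ (7 * lam0 + lam') / 8 := by
  refine (radius_anti hγ hs hlam ht).trans ?_
  unfold radius
  norm_num
  linarith

theorem continuous_radius : Continuous (radius γ s lam0 lam') := by
  unfold radius
  have : Continuous fun t : ℝ => (max 1 t) ^ (-(((2 + γ) * s - 1) / (1 + γ))) :=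
    Continuous.rpow_const (by fun_prop) (fun t => Or.inl (by positivity))
  fun_prop

/-- After time 1 only the term t^(-a) varies; by convexity its graph lies above the tangent at t. -/
theorem radius_sub_ge (hγ : 1 ≤ γ) (hs : 1 / (2 + γ) < s) (hlam : lam' < lam0) {τ t : ℝ}
    (hτ : 1 ≤ τ) (hτt : τ ≤ t) :
    (1 / 4) * (lam0 - lam') * ((((2 + γ) * s - 1) / (1 + γ)) * (t - τ) *
      t ^ (-1 - ((2 + γ) * s - 1) / (1 + γ)))
      ≤ radius γ s lam0 lam' τ - radius γ s lam0 lam' t := by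
  have ha := radius_exponent_pos hγ hs
  unfold radius
  set a := ((2 + γ) * s - 1) / (1 + γ)
  have ht : 0 < t := by linarith
  have hτ0 : 0 < τ := by linarith
  rw [max_eq_right (by linarith : 1 - t ≤ 0), max_eq_right (by linarith : 1 - τ ≤ 0),
    max_eq_right hτ, max_eq_right (hτ.trans hτt)]
  have h1 : a * (t - τ) * t ^ (-1 - a) ≤ τ ^ (-a) - t ^ (-a) := by
    have h2 : 1 + (-a) * (τ / t - 1) ≤ (τ / t) ^ (-a) := by
      rw [Real.rpow_def_of_pos (div_pos hτ0 ht)]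
      have h5 := Real.log_le_sub_one_of_pos (div_pos hτ0 ht)
      have h6 := Real.add_one_le_exp (Real.log (τ / t) * -a)
      nlinarith
    rw [Real.div_rpow hτ0.le ht.le, le_div_iff₀ (by positivity)] at h2
    have h3 : t ^ (-a) = t ^ (-1 - a) * t := by
      rw [← Real.rpow_add_one ht.ne']; congr 1; ring
    have h4 : (1 + -a * (τ / t - 1)) * t ^ (-a) = t ^ (-a) + a * (t - τ) * t ^ (-1 - a) := by
      rw [add_mul, one_mul]
      congr 1
      rw [h3]
      field_simp
      ring
    linarith
  have h3 : 0 ≤ (1 / 4) * (lam0 - lam') := by linarith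
  nlinarith [mul_le_mul_of_nonneg_left h1 h3]

end Radius

/-! ### Plasma echoes. -/

section Kernel

variable {d : ℕ}

theorem norm_vec_le_two_mul {k l : Fin d → ℤ} (hl : l ≠ 0) (η : E d) :
    ‖vec k‖ ≤ 2 * ‖vec l‖ * japPair (k - l) η := by
  have h1 := norm_vec_le_japPair (k - l) η
  have h2 := one_le_japPair (k - l) η
  have h3 := one_le_norm_vec hl
  have h4 := norm_le_norm_add_norm_sub' (vec k) (vec l)
  rw [← vec_sub] at h4
  nlinarith

theorem norm_vec_le_two_mul' {k l : Fin d → ℤ} (hk : k ≠ 0) (η : E d) :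
    ‖vec l‖ ≤ 2 * ‖vec k‖ * japPair (k - l) η := by
  have h1 := norm_vec_le_japPair (k - l) η
  have h2 := one_le_japPair (k - l) η
  have h3 := one_le_norm_vec hk
  have h4 := norm_le_norm_add_norm_sub (vec k) (vec l)
  rw [← vec_sub] at h4
  nlinarith

/-- From (t-τ)k = (kt-lτ) - τ(k-l). It bounds the growth factor by the frequency of the profile
times 1+τ. -/
theorem norm_mul_sub_le (k l : Fin d → ℤ) {τ t : ℝ} (hτ : 0 ≤ τ) (hτt : τ ≤ t) :
    ‖vec k‖ * (t - τ) ≤ japPair (k - l) (t • vec k - τ • vec l) * (1 + τ) := by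
  have h1 : (t - τ) • vec k = (t • vec k - τ • vec l) - τ • vec (k - l) := by
    rw [vec_sub, sub_smul, smul_sub]; abel
  have h2 : ‖(t - τ) • vec k‖ ≤ ‖t • vec k - τ • vec l‖ + ‖τ • vec (k - l)‖ := by
    rw [h1]; exact norm_sub_le _ _
  rw [norm_smul, norm_smul, Real.norm_of_nonneg hτ, Real.norm_of_nonneg (by linarith)] at h2
  have h3 := norm_vec_le_japPair (k - l) (t • vec k - τ • vec l)
  have h4 := norm_le_japPair (k - l) (t • vec k - τ • vec l)
  nlinarith

/-- The identity τ(k-l) = (kt-lτ) - (t-τ)k together with |k-l| ≥ 1: if kt-lτ is small, then |k|(t-τ)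
is at least comparable to τ. -/
theorem le_japPair_add (k l : Fin d → ℤ) (hkl : k ≠ l) {τ t : ℝ} (hτ : 0 ≤ τ) (hτt : τ ≤ t) :
    τ ≤ japPair (k - l) (t • vec k - τ • vec l) + ‖vec k‖ * (t - τ) := by
  have h1 : τ • vec (k - l) = (t • vec k - τ • vec l) - (t - τ) • vec k := by
    rw [vec_sub, sub_smul, smul_sub]; abel
  have h2 : ‖τ • vec (k - l)‖ ≤ ‖t • vec k - τ • vec l‖ + ‖(t - τ) • vec k‖ := by
    rw [h1]; exact norm_sub_le _ _
  rw [norm_smul, norm_smul, Real.norm_of_nonneg hτ, Real.norm_of_nonneg (by linarith)] at h2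
  have h3 := one_le_norm_vec (sub_ne_zero.mpr hkl)
  have h4 := norm_le_japPair (k - l) (t • vec k - τ • vec l)
  nlinarith

set_option maxHeartbeats 1000000 in
/-- The gain from the decreasing radius of regularity at a plasma echo: up to powers of
`⟨k - l, kt - lτ⟩`, it compensates the growth of `|k| (t - τ)`. -/
theorem exists_echo_bound {γ s lam0 lam' : ℝ} (hγ : 1 ≤ γ) (hs : 1 / (2 + γ) < s) (hs1 : s < 1)
    (hlam : lam' < lam0) :
    ∃ C N : ℝ, 0 < C ∧ ∀ (k l : Fin d → ℤ) (τ t : ℝ), k ≠ 0 → l ≠ 0 → 0 ≤ τ → τ ≤ t →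
      ‖vec k‖ * (t - τ) ≤ C * ‖vec l‖ ^ (1 + γ) *
        japPair (k - l) (t • vec k - τ • vec l) ^ N *
        Real.exp ((radius γ s lam0 lam' τ - radius γ s lam0 lam' t) *
          japPair l (τ • vec l) ^ s) := by
  have ha := radius_exponent_pos hγ hs
  set a := ((2 + γ) * s - 1) / (1 + γ) with hadef
  -- This relation dictates the exponent a: the factor |l|^(s-1) met below is exactly
  -- |l|^(-(1+γ)(s-a)), so that τ appears only through τ/|l|^(1+γ).
  have hsa : (1 + γ) * (s - a) = 1 - s := by
    rw [hadef]; field_simp; ring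
  have hsa0 : 0 < s - a := by
    by_contra h
    push Not at h
    nlinarith
  have ha1 : a < 1 := by linarith
  have hs0 : 0 < s := by linarith
  obtain ⟨C₁, hC₁, hexp⟩ := exists_rpow_le_exp_self (p := 1 / (s - a)) (by positivity)
  set c : ℝ := (1 / 4) * (lam0 - lam') * a / 100 with hc
  have hc0 : 0 < c := by
    have : 0 < lam0 - lam' := by linarith
    positivity
  -- The drop of the radius loses y^5, which becomes y^(5/(s-a)) after a root is taken; one more
  -- power comes from |k|(t-τ) ≤ 2yτ.
  refine ⟨2 + 2 * (C₁ / c ^ (1 / (s - a))), 1 + 5 / (s - a), by positivity, ?_⟩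
  intro k l τ t hk hl hτ hτt
  set y := japPair (k - l) (t • vec k - τ • vec l) with hy
  set x := japPair l (τ • vec l) with hx
  set u := t - τ with hu
  have hy1 : 1 ≤ y := one_le_japPair _ _
  have hx1 : 1 ≤ x := one_le_japPair _ _
  have hk1 := one_le_norm_vec hk
  have hl1 := one_le_norm_vec hl
  have hu0 : 0 ≤ u := by simp only [hu]; linarith
  have hexp1 : 1 ≤ Real.exp ((radius γ s lam0 lam' τ - radius γ s lam0 lam' t) * x ^ s) := by
    apply Real.one_le_exp
    apply mul_nonneg _ (by positivity)
    linarith [radius_anti (γ := γ) (s := s) hγ hs hlam hτt]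
  have hyN : y ≤ y ^ (1 + 5 / (s - a)) := by
    apply Real.self_le_rpow_of_one_le hy1
    have : 0 < 5 / (s - a) := by positivity
    linarith
  have hlγ : 1 ≤ ‖vec l‖ ^ (1 + γ) := Real.one_le_rpow hl1 (by linarith)
  -- Regimes without echo: the exponential is at least 1 and a power of y suffices.
  have key : ∀ B : ℝ, B ≤ 2 * y → B ≤ (2 + 2 * (C₁ / c ^ (1 / (s - a)))) * ‖vec l‖ ^ (1 + γ) *
      y ^ (1 + 5 / (s - a)) *
      Real.exp ((radius γ s lam0 lam' τ - radius γ s lam0 lam' t) * x ^ s) := by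
    intro B hB
    calc B ≤ 2 * 1 * y * 1 := by linarith
      _ ≤ _ := by
        gcongr
        have : 0 < 2 * (C₁ / c ^ (1 / (s - a))) := by positivity
        linarith
  have hku := norm_mul_sub_le k l hτ hτt
  rw [← hy, ← hu] at hku
  rcases le_total τ 1 with hτ1 | hτ1
  · apply key; nlinarith
  rcases le_total (‖vec k‖ * u) y with h1 | h1
  · apply key; linarith
  -- For k = l one has y = ⟨|k|(t-τ)⟩ > |k|(t-τ), against the case assumption.
  have hkl : k ≠ l := by
    rintro rfl
    by_cases h0 : ‖vec k‖ * u = y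
    · have h2 : ‖t • vec k - τ • vec k‖ = u * ‖vec k‖ := by
        rw [← sub_smul, norm_smul, Real.norm_of_nonneg hu0]
      have h3 : y = jap (u * ‖vec k‖) := by
        rw [hy, japPair, h2]; simp [vec_zero]
      have h4 := jap_sq (u * ‖vec k‖)
      rw [← h3, ← h0] at h4
      nlinarith
    · have h2 := norm_le_japPair (k - k) (t • vec k - τ • vec k)
      rw [← sub_smul, norm_smul, Real.norm_of_nonneg hu0] at h2
      rw [← sub_smul] at hy
      rw [← hy] at h2
      exact h0 (le_antisymm (by linarith) h1)
  have h2 := le_japPair_add k l hkl hτ hτt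
  rw [← hy, ← hu] at h2
  have hτ2 : τ ≤ 2 * (‖vec k‖ * u) := by linarith
  have hkl2 : ‖vec k‖ ≤ 2 * ‖vec l‖ * y := norm_vec_le_two_mul hl _
  have hlk2 : ‖vec l‖ ≤ 2 * ‖vec k‖ * y := norm_vec_le_two_mul' hk _
  have hku2 : ‖vec k‖ * u ≤ 2 * (y * τ) := by nlinarith
  have hu_le : u ≤ 4 * y ^ 2 * τ := by
    have h3 : u ≤ ‖vec k‖ * u := by nlinarith
    nlinarith [mul_nonneg (by linarith : (0:ℝ) ≤ y) hτ]
  have ht_le : t ≤ 5 * y ^ 2 * τ := by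
    have : t = u + τ := by simp [hu]
    nlinarith [mul_nonneg (by linarith : (0:ℝ) ≤ y) hτ]
  have hτ0 : 0 < τ := by linarith
  have ht0 : 0 < t := by linarith
  have hl0 : 0 < ‖vec l‖ := by linarith
  have hy0 : 0 < y := by linarith
  -- In the echo regime the delay is not short: τ ≤ 2|k|u and |k| ≤ 2|l|y.
  have hu_ge : τ / (4 * ‖vec l‖ * y) ≤ u := by
    rw [div_le_iff₀ (by positivity)]
    nlinarith
  have hrad := radius_sub_ge (γ := γ) (s := s) hγ hs hlam hτ1 hτt
  rw [← hadef, ← hu] at hrad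
  have htpow : (25 * y ^ 4 * τ)⁻¹ * τ ^ (-a) ≤ t ^ (-1 - a) := by
    have h3 : (5 * y ^ 2 * τ) ^ (-1 - a) ≤ t ^ (-1 - a) :=
      Real.rpow_le_rpow_of_nonpos ht0 ht_le (by linarith)
    refine le_trans ?_ h3
    rw [Real.mul_rpow (by positivity) hτ0.le]
    have h4 : τ ^ (-1 - a) = τ⁻¹ * τ ^ (-a) := by
      rw [← Real.rpow_neg_one τ, ← Real.rpow_add hτ0]; congr 1
    have h5 : (25 * y ^ 4)⁻¹ ≤ (5 * y ^ 2) ^ (-1 - a) := by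
      have h6 : (25 * y ^ 4)⁻¹ = (5 * y ^ 2) ^ (-2 : ℝ) := by
        rw [Real.rpow_neg (by positivity)]
        norm_num
        ring
      rw [h6]
      apply Real.rpow_le_rpow_of_exponent_le _ (by linarith)
      nlinarith
    rw [h4, mul_inv, mul_assoc]
    gcongr
  -- The tangent bound a(t-τ)t^(-1-a) with t-τ ≥ τ/(4|l|y) and t ≤ 5y²τ. The exponent -1-a ≥ -2
  -- turns 5y² into 25y⁴, and 4·25 is the 100 in the definition of c.
  have hdiff : c * (τ ^ (-a) / (‖vec l‖ * y ^ 5)) ≤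
      radius γ s lam0 lam' τ - radius γ s lam0 lam' t := by
    refine le_trans ?_ hrad
    have h3 : 0 < lam0 - lam' := by linarith
    calc c * (τ ^ (-a) / (‖vec l‖ * y ^ 5))
        = (1 / 4) * (lam0 - lam') * (a * (τ / (4 * ‖vec l‖ * y)) *
          ((25 * y ^ 4 * τ)⁻¹ * τ ^ (-a))) := by
          rw [hc]; field_simp; norm_num
      _ ≤ _ := by gcongr
  have hxs : (‖vec l‖ * τ) ^ s ≤ x ^ s := by
    apply Real.rpow_le_rpow (by positivity) _ hs0.le
    have := norm_le_japPair l (τ • vec l)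
    rw [norm_smul, Real.norm_of_nonneg hτ] at this
    linarith
  set Q := (radius γ s lam0 lam' τ - radius γ s lam0 lam' t) * x ^ s with hQ
  -- The drop is multiplied by ⟨l,lτ⟩^s ≥ (|l|τ)^s; the powers of τ combine to s-a > 0, and `hsa`
  -- rewrites those of |l|.
  have hQge : c * (τ / ‖vec l‖ ^ (1 + γ)) ^ (s - a) / y ^ 5 ≤ Q := by
    calc c * (τ / ‖vec l‖ ^ (1 + γ)) ^ (s - a) / y ^ 5
        = c * (τ ^ (-a) / (‖vec l‖ * y ^ 5)) * (‖vec l‖ * τ) ^ s := by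
          rw [Real.div_rpow hτ0.le (by positivity), ← Real.rpow_mul hl0.le, hsa,
            Real.mul_rpow hl0.le hτ0.le, sub_eq_neg_add s a, Real.rpow_add hτ0,
            Real.rpow_sub hl0, Real.rpow_one]
          field_simp
      _ ≤ _ := by
          rw [hQ]
          gcongr
          exact le_trans (by positivity) hdiff
  -- The power 1/(s-a) of the lower bound for Q is linear in τ, and Q^(1/(s-a)) ≤ C₁ e^Q.
  have hfin : τ ≤ C₁ / c ^ (1 / (s - a)) * ‖vec l‖ ^ (1 + γ) * y ^ (5 / (s - a)) *
      Real.exp Q := by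
    have h3 := hexp Q (le_trans (by positivity) hQge)
    have h4 : (c * (τ / ‖vec l‖ ^ (1 + γ)) ^ (s - a) / y ^ 5) ^ (1 / (s - a)) ≤ Q ^ (1 / (s - a)) :=
      Real.rpow_le_rpow (by positivity) hQge (by positivity)
    have h5 : (c * (τ / ‖vec l‖ ^ (1 + γ)) ^ (s - a) / y ^ 5) ^ (1 / (s - a)) =
        c ^ (1 / (s - a)) * (τ / ‖vec l‖ ^ (1 + γ)) / y ^ (5 / (s - a)) := by
      rw [Real.div_rpow (by positivity) (by positivity), Real.mul_rpow hc0.le (by positivity),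
        ← Real.rpow_mul (by positivity), mul_one_div_cancel hsa0.ne', Real.rpow_one,
        ← Real.rpow_natCast, ← Real.rpow_mul hy0.le]
      congr 2
      push_cast; ring
    rw [h5] at h4
    have h6 := h4.trans h3
    rw [div_le_iff₀ (by positivity)] at h6
    have h7 : c ^ (1 / (s - a)) * (τ / ‖vec l‖ ^ (1 + γ)) =
      τ * (c ^ (1 / (s - a)) / ‖vec l‖ ^ (1 + γ)) := by ring
    rw [h7, ← le_div_iff₀ (by positivity)] at h6
    refine h6.trans (le_of_eq ?_)
    field_simp
  calc ‖vec k‖ * u ≤ 2 * (y * τ) := hku2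
    _ ≤ 2 * (y * (C₁ / c ^ (1 / (s - a)) * ‖vec l‖ ^ (1 + γ) * y ^ (5 / (s - a)) *
      Real.exp Q)) := by gcongr
    _ = 2 * (C₁ / c ^ (1 / (s - a))) * ‖vec l‖ ^ (1 + γ) * y ^ (1 + 5 / (s - a)) *
      Real.exp Q := by
        rw [Real.rpow_add hy0, Real.rpow_one]; ring
    _ ≤ _ := by
        gcongr
        linarith

end Kernel

end LandauDamping

namespace LandauDamping

/-! ### Comparison of Gevrey weights. -/

section Weights

theorem rpow_ratio_le {x y : ℝ} (hx : 0 < x) (hy : 0 < y) (hxy : x ≤ 2 * y) (hyx : y ≤ 2 * x)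
    (p : ℝ) : x ^ p ≤ 2 ^ |p| * y ^ p := by
  rcases le_total 0 p with hp | hp
  · rw [abs_of_nonneg hp, ← Real.mul_rpow (by norm_num) hy.le]
    exact Real.rpow_le_rpow hx.le hxy hp
  · rw [abs_of_nonpos hp]
    have h1 : (2 * x) ^ p ≤ y ^ p := Real.rpow_le_rpow_of_nonpos hy hyx hp
    rw [Real.mul_rpow (by norm_num) hx.le] at h1
    calc x ^ p = 2 ^ (-p) * (2 ^ p * x ^ p) := by
          rw [← mul_assoc, ← Real.rpow_add (by norm_num)]; simp
      _ ≤ _ := by gcongr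

/-- Subadditivity of x ↦ x^s makes the weight vary by a bounded factor over unit distances. The
constant depends on an upper bound for the radius only, hence is uniform in time. -/
theorem weight_le_of_near {lam Λ s p x y : ℝ} (hlam : 0 ≤ lam) (hΛ : lam ≤ Λ) (hs : 0 ≤ s)
    (hs1 : s ≤ 1) (hx : 1 ≤ x) (hy : 1 ≤ y) (hxy : x ≤ y + 1) (hyx : y ≤ x + 1) :
    Real.exp (lam * x ^ s) * x ^ p ≤
      (Real.exp Λ * 2 ^ |p|) * (Real.exp (lam * y ^ s) * y ^ p) := by
  have h1 : x ^ s ≤ y ^ s + 1 := by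
    calc x ^ s ≤ (y + 1) ^ s := Real.rpow_le_rpow (by linarith) hxy hs
      _ ≤ y ^ s + 1 ^ s := Real.rpow_add_le_add_rpow (by linarith) zero_le_one hs hs1
      _ = _ := by simp
  have h2 := rpow_ratio_le (x := x) (y := y) (by linarith) (by linarith) (by linarith)
    (by linarith) p
  calc Real.exp (lam * x ^ s) * x ^ p
      ≤ (Real.exp Λ * Real.exp (lam * y ^ s)) * (2 ^ |p| * y ^ p) := by
        gcongr
        rw [← Real.exp_add, Real.exp_le_exp]
        nlinarith
    _ = _ := by ring

/-- Because s < 1, the power w^s is at most δw plus a constant for every δ > 0; half of μ absorbs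
the Gevrey factor and half the polynomial one. -/
theorem exists_exp_rpow_mul_le {Λ s σ μ : ℝ} (hΛ : 0 ≤ Λ) (hs : 0 ≤ s) (hs1 : s < 1)
    (hμ : 0 < μ) :
    ∃ C : ℝ, 0 < C ∧ ∀ w : ℝ, 0 ≤ w →
      Real.exp (Λ * w ^ s) * (1 + w) ^ σ ≤ C * Real.exp (μ * w) := by
  obtain ⟨C, hC, h⟩ := exists_rpow_le_exp (c := μ / 2) (s := 1) (by positivity) one_pos σ
  set δ := μ / 2 / (Λ + 1) with hδ
  have hδ0 : 0 < δ := by positivity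
  -- The point where w^(s-1) = δ: below it w^s ≤ W^s, beyond it w^s ≤ δw.
  set W := δ ^ (-1 / (1 - s)) with hW
  have hW0 : 0 < W := by positivity
  have hWs : W ^ (s - 1) = δ := by
    rw [hW, ← Real.rpow_mul hδ0.le]
    have : -1 / (1 - s) * (s - 1) = 1 := by
      have : 1 - s ≠ 0 := by linarith
      field_simp; ring
    rw [this, Real.rpow_one]
  have key : ∀ w : ℝ, 0 ≤ w → w ^ s ≤ δ * w + W ^ s := by
    intro w hw
    rcases le_total w W with h1 | h1
    · have := Real.rpow_le_rpow hw h1 hs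
      nlinarith
    · have hw0 : 0 < w := hW0.trans_le h1
      have h2 : w ^ (s - 1) ≤ δ := by
        rw [← hWs]; exact Real.rpow_le_rpow_of_nonpos hW0 h1 (by linarith)
      have h3 : w ^ s = w ^ (s - 1) * w := by
        rw [← Real.rpow_add_one hw0.ne', sub_add_cancel]
      rw [h3]
      have : 0 < W ^ s := by positivity
      nlinarith
  refine ⟨Real.exp (Λ * W ^ s) * (C * Real.exp (μ / 2)), by positivity, fun w hw => ?_⟩
  have h1 : Real.exp (Λ * w ^ s) ≤ Real.exp (Λ * W ^ s) * Real.exp (μ / 2 * w) := by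
    rw [← Real.exp_add, Real.exp_le_exp]
    have h2 : Λ * δ ≤ μ / 2 := by
      rw [hδ, ← mul_div_assoc, div_le_iff₀ (by positivity)]
      nlinarith
    nlinarith [key w hw]
  have h2 := h (1 + w) (by linarith)
  rw [Real.rpow_one] at h2
  calc _ ≤ (Real.exp (Λ * W ^ s) * Real.exp (μ / 2 * w)) *
        (C * Real.exp (μ / 2 * (1 + w))) := by gcongr
    _ = Real.exp (Λ * W ^ s) * (C * Real.exp (μ / 2)) * Real.exp (μ * w) := by
        rw [show μ * w = μ / 2 * w + μ / 2 * w by ring, show μ / 2 * (1 + w) = μ / 2 + μ / 2 * w by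
          ring, Real.exp_add, Real.exp_add]
        ring

end Weights

/-! ### The multiplier A along interactions of modes. -/

section MultA

variable {d : ℕ} {γ s lam0 lam' σ : ℝ}

theorem multA_pos (σ' t : ℝ) (k : Fin d → ℤ) (η : E d) :
    0 < multA γ s lam0 lam' σ σ' t k η :=
  mul_pos (Real.exp_pos _) (Real.rpow_pos_of_pos (japPair_pos _ _) _)

theorem s_pos (hγ : 1 ≤ γ) (hs : 1 / (2 + γ) < s) : 0 < s :=
  lt_trans (by positivity) hs

theorem continuous_multA (σ' : ℝ) (k : Fin d → ℤ) :
    Continuous fun p : ℝ × E d => multA γ s lam0 lam' σ σ' p.1 k p.2 := by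
  have h1 : Continuous fun p : ℝ × E d => japPair k p.2 := (continuous_japPair k).comp continuous_snd
  have h2 : Continuous fun p : ℝ × E d => radius γ s lam0 lam' p.1 :=
    continuous_radius.comp continuous_fst
  have h3 : ∀ p : ℝ, Continuous fun q : ℝ × E d => japPair k q.2 ^ p := fun p =>
    h1.rpow_const (fun q => Or.inl (japPair_pos _ _).ne')
  unfold multA
  exact (Real.continuous_exp.comp (h2.mul (h3 s))).mul (h3 _)

theorem exists_multA_le_of_near (hγ : 1 ≤ γ) (hs : 1 / (2 + γ) < s) (hs1 : s < 1)
    (hlam' : 0 < lam') (hlam : lam' < lam0) (σ' : ℝ) :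
    ∃ C : ℝ, 0 < C ∧ ∀ (t : ℝ) (k : Fin d → ℤ) (η ξ : E d), 0 ≤ t → ‖η - ξ‖ ≤ 1 →
      multA γ s lam0 lam' σ σ' t k η ≤ C * multA γ s lam0 lam' σ σ' t k ξ := by
  refine ⟨Real.exp lam0 * 2 ^ |σ + σ'|, by positivity, fun t k η ξ ht h => ?_⟩
  have h1 := japPair_le_add k k η ξ
  have h2 := japPair_le_add k k ξ η
  rw [sub_self, vec_zero, norm_zero, zero_add] at h1 h2
  rw [norm_sub_rev] at h2
  exact weight_le_of_near (by linarith [lam'_le_radius (γ := γ) (s := s) hlam t])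
    (by linarith [radius_le (γ := γ) (s := s) hγ hs hlam ht]) (s_pos hγ hs).le hs1.le
    (one_le_japPair _ _) (one_le_japPair _ _) (by linarith) (by linarith)

/-- Since ⟨k,kt⟩ ≤ ⟨k,kτ⟩ + |k|(t-τ) and the radius decreases, the growth is only Gevrey in
|k|(t-τ). As μ is arbitrary, it can be chosen below the decay rate of the resolvent of the
linearized equation. -/
theorem exists_multA_shift_le (hγ : 1 ≤ γ) (hs : 1 / (2 + γ) < s) (hs1 : s < 1)
    (hlam' : 0 < lam') (hlam : lam' < lam0) (hσ : 0 ≤ σ) {μ : ℝ} (hμ : 0 < μ) :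
    ∃ C : ℝ, 0 < C ∧ ∀ (k : Fin d → ℤ) (τ t : ℝ), 0 ≤ τ → τ ≤ t →
      multA γ s lam0 lam' σ 0 t k (t • vec k) ≤
        C * Real.exp (μ * (‖vec k‖ * (t - τ))) * multA γ s lam0 lam' σ 0 τ k (τ • vec k) := by
  have hs0 := s_pos hγ hs
  obtain ⟨C, hC, h⟩ := exists_exp_rpow_mul_le (Λ := lam0) (σ := σ) (by linarith) hs0.le hs1 hμ
  refine ⟨C, hC, fun k τ t hτ hτt => ?_⟩
  set w := ‖vec k‖ * (t - τ) with hw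
  have hw0 : 0 ≤ w := mul_nonneg (norm_nonneg _) (by linarith)
  have h1 : japPair k (t • vec k) ≤ japPair k (τ • vec k) + w := by
    have := japPair_le_add k k (t • vec k) (τ • vec k)
    rwa [sub_self, vec_zero, norm_zero, zero_add, ← sub_smul, norm_smul,
      Real.norm_of_nonneg (by linarith), mul_comm] at this
  unfold multA
  set X := japPair k (t • vec k)
  set y := japPair k (τ • vec k)
  have hX : 1 ≤ X := one_le_japPair _ _
  have hy : 1 ≤ y := one_le_japPair _ _
  have h2 : X ^ s ≤ y ^ s + w ^ s :=
    (Real.rpow_le_rpow (by linarith) h1 hs0.le).trans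
      (Real.rpow_add_le_add_rpow (by linarith) hw0 hs0.le hs1.le)
  have h3 : X ^ (σ + 0) ≤ y ^ (σ + 0) * (1 + w) ^ σ := by
    rw [add_zero, ← Real.mul_rpow (by linarith) (by linarith)]
    exact Real.rpow_le_rpow (by linarith) (by nlinarith) hσ
  have h4 := radius_anti (γ := γ) (s := s) hγ hs hlam hτt
  have h5 := lam'_le_radius (γ := γ) (s := s) hlam t
  have h6 := radius_le (γ := γ) (s := s) hγ hs hlam (hτ.trans hτt)
  have h7 : Real.exp (radius γ s lam0 lam' t * X ^ s) ≤
      Real.exp (radius γ s lam0 lam' τ * y ^ s) * Real.exp (lam0 * w ^ s) := by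
    rw [← Real.exp_add, Real.exp_le_exp]
    have h8 : 0 ≤ w ^ s := by positivity
    have h9 : 0 ≤ y ^ s := by positivity
    calc radius γ s lam0 lam' t * X ^ s ≤ radius γ s lam0 lam' t * (y ^ s + w ^ s) := by gcongr; linarith
      _ ≤ _ := by nlinarith
  calc _ ≤ (Real.exp (radius γ s lam0 lam' τ * y ^ s) * Real.exp (lam0 * w ^ s)) *
        (y ^ (σ + 0) * (1 + w) ^ σ) := by gcongr
    _ = (Real.exp (lam0 * w ^ s) * (1 + w) ^ σ) *
        (Real.exp (radius γ s lam0 lam' τ * y ^ s) * y ^ (σ + 0)) := by ring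
    _ ≤ _ := mul_le_mul_of_nonneg_right (h w hw0) (by positivity)

/-- Splitting of the multiplier when the second frequency is the smaller one. -/
theorem exp_mul_rpow_le_of_le {lam σ X x y : ℝ} (hs : 0 < s) (hs1 : s < 1) (hlam : 0 ≤ lam)
    (hσ : 0 ≤ σ) (hX : 0 ≤ X) (hy : 0 < y) (hyx : y ≤ x) (hXxy : X ≤ x + y) :
    Real.exp (lam * X ^ s) * X ^ σ ≤
      2 ^ σ * (Real.exp (lam * x ^ s) * x ^ σ) * Real.exp (s * lam * y ^ s) := by
  have h1 : X ^ s ≤ x ^ s + s * y ^ s :=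
    (Real.rpow_le_rpow hX hXxy hs.le).trans (add_rpow_le_of_le hs hs1 hy hyx)
  have h2 : X ^ σ ≤ 2 ^ σ * x ^ σ := by
    rw [← Real.mul_rpow (by norm_num) (by linarith)]
    exact Real.rpow_le_rpow hX (by linarith) hσ
  calc _ ≤ (Real.exp (lam * x ^ s) * Real.exp (s * lam * y ^ s)) * (2 ^ σ * x ^ σ) := by
        gcongr
        rw [← Real.exp_add, Real.exp_le_exp]
        nlinarith
    _ = _ := by ring

/-- The reaction regime, the density carrying the larger frequency. The echo bound costs
exp((λ(τ)-λ(t)) x^s), which raises λ(t) to λ(τ) in the weight of the density, and |l|^(1+γ), of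
which |l|^(-γ) leaves |l|. The profile needs only the fraction s of its radius, hence the low norm
suffices, with any decay y^(-N) to spare. -/
theorem exists_reaction_bound (hγ : 1 ≤ γ) (hs : 1 / (2 + γ) < s) (hs1 : s < 1)
    (hlam' : 0 < lam') (hlam : lam' < lam0) (hσ : 0 ≤ σ) (β N : ℝ) :
    ∃ C : ℝ, 0 < C ∧ ∀ (k l : Fin d → ℤ) (τ t : ℝ), k ≠ 0 → l ≠ 0 → 0 ≤ τ → τ ≤ t →
      japPair (k - l) (t • vec k - τ • vec l) ≤ japPair l (τ • vec l) →
      multA γ s lam0 lam' σ 0 t k (t • vec k) * (‖vec l‖ ^ (-γ) * (‖vec k‖ * (t - τ))) ≤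
        C * (‖vec l‖ * japPair (k - l) (t • vec k - τ • vec l) ^ (-N)) *
          (multA γ s lam0 lam' σ 0 τ l (τ • vec l) *
            multA γ s lam0 lam' σ (-β) τ (k - l) (t • vec k - τ • vec l)) := by
  have hs0 := s_pos hγ hs
  obtain ⟨C₁, N₁, hC₁, hecho⟩ := exists_echo_bound (d := d) hγ hs hs1 hlam
  obtain ⟨C₂, hC₂, hdec⟩ := exists_rpow_le_exp (c := (1 - s) * lam') (s := s)
    (mul_pos (by linarith) hlam') hs0 (N₁ + N - (σ - β))
  refine ⟨2 ^ σ * C₁ * C₂, by positivity, fun k l τ t hk hl hτ hτt hyx => ?_⟩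
  have h1 := hecho k l τ t hk hl hτ hτt
  have h2 : japPair k (t • vec k) ≤ japPair l (τ • vec l) +
    japPair (k - l) (t • vec k - τ • vec l) := japPair_le_add_japPair _ _ _ _
  have h4 := radius_anti (γ := γ) (s := s) hγ hs hlam hτt
  have h5 := lam'_le_radius (γ := γ) (s := s) hlam t
  have hl1 := one_le_norm_vec hl
  unfold multA
  set X := japPair k (t • vec k)
  set x := japPair l (τ • vec l)
  set y := japPair (k - l) (t • vec k - τ • vec l)
  set r := radius γ s lam0 lam' t
  set r' := radius γ s lam0 lam' τ
  have hX : 1 ≤ X := one_le_japPair _ _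
  have hx : 1 ≤ x := one_le_japPair _ _
  have hy : 1 ≤ y := one_le_japPair _ _
  have hx0 : 0 < x := by linarith
  have hy0 : 0 < y := by linarith
  have h6 := exp_mul_rpow_le_of_le (σ := σ) hs0 hs1 (by linarith : 0 ≤ r) hσ (by linarith)
    hy0 hyx h2
  have h7 := hdec y hy
  have hlγ : ‖vec l‖ ^ (-γ) * ‖vec l‖ ^ (1 + γ) = ‖vec l‖ := by
    rw [← Real.rpow_add (by linarith)]; simp
  -- The reserve (1-s)λ' y^s, available because λ' ≤ λ(t) ≤ λ(τ), pays for the powers of y from the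
  -- echo, for y^(-N), and for the exponent σ-β.
  have h8 : Real.exp (s * r * y ^ s) * y ^ N₁ ≤
      C₂ * y ^ (-N) * (Real.exp (r' * y ^ s) * y ^ (σ + -β)) := by
    have h9 : y ^ N₁ = y ^ (N₁ + N - (σ - β)) * (y ^ (-N) * y ^ (σ + -β)) := by
      rw [← Real.rpow_add hy0, ← Real.rpow_add hy0]; congr 1; ring
    have h10 : Real.exp (s * r * y ^ s) * Real.exp ((1 - s) * lam' * y ^ s) ≤
        Real.exp (r' * y ^ s) := by
      rw [← Real.exp_add, Real.exp_le_exp, ← add_mul]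
      gcongr
      nlinarith
    rw [h9]
    calc _ ≤ Real.exp (s * r * y ^ s) * ((C₂ * Real.exp ((1 - s) * lam' * y ^ s)) *
          (y ^ (-N) * y ^ (σ + -β))) := by gcongr
      _ = C₂ * y ^ (-N) * ((Real.exp (s * r * y ^ s) * Real.exp ((1 - s) * lam' * y ^ s)) *
          y ^ (σ + -β)) := by ring
      _ ≤ _ := by gcongr
  have hexp : Real.exp (r * x ^ s) * Real.exp ((r' - r) * x ^ s) = Real.exp (r' * x ^ s) := by
    rw [← Real.exp_add]; congr 1; ring
  rw [add_zero]
  calc _ ≤ (2 ^ σ * (Real.exp (r * x ^ s) * x ^ σ) * Real.exp (s * r * y ^ s)) *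
        (‖vec l‖ ^ (-γ) * (C₁ * ‖vec l‖ ^ (1 + γ) * y ^ N₁ * Real.exp ((r' - r) * x ^ s))) := by
        gcongr
    _ = 2 ^ σ * C₁ * (‖vec l‖ ^ (-γ) * ‖vec l‖ ^ (1 + γ)) *
        ((Real.exp (r * x ^ s) * Real.exp ((r' - r) * x ^ s)) * x ^ σ) *
        (Real.exp (s * r * y ^ s) * y ^ N₁) := by ring
    _ ≤ 2 ^ σ * C₁ * ‖vec l‖ * (Real.exp (r' * x ^ s) * x ^ σ) *
        (C₂ * y ^ (-N) * (Real.exp (r' * y ^ s) * y ^ (σ + -β))) := by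
        rw [hlγ, hexp]
        gcongr
    _ = _ := by ring

/-- The transport regime, the profile carrying the larger frequency. Here |k|(t-τ) ≤ y(1+τ) ≤ 2xy:
the factor y is the extra derivative in A^(1), while x and the decay x^(-N) come from the reserve
(1-s)λ' x^s of the density. -/
theorem exists_transport_bound (hγ : 1 ≤ γ) (hs : 1 / (2 + γ) < s) (hs1 : s < 1)
    (hlam' : 0 < lam') (hlam : lam' < lam0) (hσ : 0 ≤ σ) (N : ℝ) :
    ∃ C : ℝ, 0 < C ∧ ∀ (k l : Fin d → ℤ) (τ t : ℝ), l ≠ 0 → 0 ≤ τ → τ ≤ t →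
      japPair l (τ • vec l) ≤ japPair (k - l) (t • vec k - τ • vec l) →
      multA γ s lam0 lam' σ 0 t k (t • vec k) * (‖vec l‖ ^ (-γ) * (‖vec k‖ * (t - τ))) ≤
        C * japPair l (τ • vec l) ^ (-N) *
          (multA γ s lam0 lam' σ 0 τ l (τ • vec l) *
            multA γ s lam0 lam' σ 1 τ (k - l) (t • vec k - τ • vec l)) := by
  have hs0 := s_pos hγ hs
  obtain ⟨C₂, hC₂, hdec⟩ := exists_rpow_le_exp (c := (1 - s) * lam') (s := s)
    (mul_pos (by linarith) hlam') hs0 (1 + N - σ)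
  refine ⟨2 ^ σ * 2 * C₂, by positivity, fun k l τ t hl hτ hτt hxy => ?_⟩
  have h1 := norm_mul_sub_le k l hτ hτt
  have h2 : japPair k (t • vec k) ≤ japPair l (τ • vec l) +
    japPair (k - l) (t • vec k - τ • vec l) := japPair_le_add_japPair _ _ _ _
  have h4 := radius_anti (γ := γ) (s := s) hγ hs hlam hτt
  have h5 := lam'_le_radius (γ := γ) (s := s) hlam t
  have hl1 := one_le_norm_vec hl
  -- Time is dominated by the frequency of the density because |lτ| ≥ τ for l ≠ 0.
  have hτx : 1 + τ ≤ 2 * japPair l (τ • vec l) := by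
    have h6 := norm_le_japPair l (τ • vec l)
    rw [norm_smul, Real.norm_of_nonneg hτ] at h6
    have h7 := one_le_japPair l (τ • vec l)
    nlinarith
  unfold multA
  set X := japPair k (t • vec k)
  set x := japPair l (τ • vec l)
  set y := japPair (k - l) (t • vec k - τ • vec l)
  set r := radius γ s lam0 lam' t
  set r' := radius γ s lam0 lam' τ
  have hX : 1 ≤ X := one_le_japPair _ _
  have hx : 1 ≤ x := one_le_japPair _ _
  have hy : 1 ≤ y := one_le_japPair _ _
  have hx0 : 0 < x := by linarith
  have hy0 : 0 < y := by linarith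
  have h6 := exp_mul_rpow_le_of_le (σ := σ) hs0 hs1 (by linarith : 0 ≤ r) hσ (by linarith)
    hx0 hxy (by linarith : X ≤ y + x)
  have h7 := hdec x hx
  have hlγ : ‖vec l‖ ^ (-γ) ≤ 1 := Real.rpow_le_one_of_one_le_of_nonpos hl1 (by linarith)
  have h8 : Real.exp (s * r * x ^ s) * x ≤
      C₂ * x ^ (-N) * (Real.exp (r' * x ^ s) * x ^ σ) := by
    have h9 : x = x ^ (1 + N - σ) * (x ^ (-N) * x ^ σ) := by
      rw [← Real.rpow_add hx0, ← Real.rpow_add hx0]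
      conv_lhs => rw [← Real.rpow_one x]
      congr 1; ring
    have h10 : Real.exp (s * r * x ^ s) * Real.exp ((1 - s) * lam' * x ^ s) ≤
        Real.exp (r' * x ^ s) := by
      rw [← Real.exp_add, Real.exp_le_exp, ← add_mul]
      gcongr
      nlinarith
    calc Real.exp (s * r * x ^ s) * x
        = Real.exp (s * r * x ^ s) * (x ^ (1 + N - σ) * (x ^ (-N) * x ^ σ)) := by
          rw [← h9]
      _ ≤ Real.exp (s * r * x ^ s) * ((C₂ * Real.exp ((1 - s) * lam' * x ^ s)) *
          (x ^ (-N) * x ^ σ)) := by gcongr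
      _ = C₂ * x ^ (-N) * ((Real.exp (s * r * x ^ s) * Real.exp ((1 - s) * lam' * x ^ s)) *
          x ^ σ) := by ring
      _ ≤ _ := by gcongr
  rw [add_zero, Real.rpow_add hy0, Real.rpow_one]
  calc _ ≤ (2 ^ σ * (Real.exp (r * y ^ s) * y ^ σ) * Real.exp (s * r * x ^ s)) *
        (1 * (y * (2 * x))) := by
        have : 0 ≤ ‖vec k‖ * (t - τ) := mul_nonneg (norm_nonneg _) (by linarith)
        have h9 : ‖vec k‖ * (t - τ) ≤ y * (2 * x) := h1.trans (by gcongr)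
        exact mul_le_mul h6 (mul_le_mul hlγ h9 this zero_le_one) (by positivity) (by positivity)
    _ = 2 ^ σ * 2 * (Real.exp (r * y ^ s) * (y ^ σ * y)) * (Real.exp (s * r * x ^ s) * x) := by
        ring
    _ ≤ 2 ^ σ * 2 * (Real.exp (r' * y ^ s) * (y ^ σ * y)) *
        (C₂ * x ^ (-N) * (Real.exp (r' * x ^ s) * x ^ σ)) := by
        gcongr
    _ = _ := by ring

end MultA

end LandauDamping

namespace LandauDamping

/-! ### The Fourier transform on L¹ ∩ L² and Parseval's identity. -/

section Consistency

open SchwartzMap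

open scoped ContDiff in
theorem exists_schwartz_eq {V : Type*} [NormedAddCommGroup V] [InnerProductSpace ℝ V] {g : V → ℝ}
    (hg : ContDiff ℝ ∞ g) (hgs : HasCompactSupport g) :
    ∃ G : 𝓢(V, ℂ), ∀ x, G x = g x := by
  have hg' : HasCompactSupport (Complex.ofReal ∘ g) := hgs.comp_left Complex.ofReal_zero
  exact ⟨hg'.toSchwartzMap (Complex.ofRealCLM.contDiff.comp hg), fun x => rfl⟩

variable {V : Type*} [NormedAddCommGroup V] [InnerProductSpace ℝ V] [FiniteDimensional ℝ V]
  [MeasurableSpace V] [BorelSpace V]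

theorem integral_fourier_mul_eq_of_integrable {f g : V → ℂ} (hf : Integrable f)
    (hg : Integrable g) : ∫ ξ, 𝓕 f ξ * g ξ = ∫ x, f x * 𝓕 g x := by
  have := VectorFourier.integral_fourierIntegral_smul_eq_flip (L := innerₗ V) (μ := volume)
    (ν := volume) Real.continuous_fourierChar continuous_inner hf hg
  rw [flip_innerₗ] at this
  exact this

theorem integral_fourierInv_mul_eq_of_integrable {f g : V → ℂ} (hf : Integrable f)
    (hg : Integrable g) : ∫ ξ, 𝓕⁻ f ξ * g ξ = ∫ x, f x * 𝓕⁻ g x := by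
  have h1 := integral_fourier_mul_eq_of_integrable hf hg.comp_neg
  have h2 : ∀ ξ, 𝓕⁻ f ξ = 𝓕 f (-ξ) := fun ξ => Real.fourierInv_eq_fourier_neg f ξ
  rw [← integral_neg_eq_self]
  simp only [h2, neg_neg]
  rw [h1]
  congr with x
  rw [Real.fourierInv_eq_fourier_comp_neg]

theorem integral_fourier_schwartz_mul (F : Lp (α := V) ℂ 2 volume) (G : 𝓢(V, ℂ)) :
    ∫ x, 𝓕 (G : V → ℂ) x * F x = ∫ x, G x * (𝓕 F : Lp (α := V) ℂ 2 volume) x := by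
  have h3 := congrArg (fun T => T G) (Lp.fourier_toTemperedDistribution_eq F)
  simp only [TemperedDistribution.fourier_apply, Lp.toTemperedDistribution_apply] at h3
  exact h3

theorem integral_fourierInv_schwartz_mul (F : Lp (α := V) ℂ 2 volume) (G : 𝓢(V, ℂ)) :
    ∫ x, 𝓕⁻ (G : V → ℂ) x * F x = ∫ x, G x * (𝓕⁻ F : Lp (α := V) ℂ 2 volume) x := by
  have h3 := congrArg (fun T => T G) (Lp.fourierInv_toTemperedDistribution_eq F)
  simp only [TemperedDistribution.fourierInv_apply, Lp.toTemperedDistribution_apply,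
    SchwartzMap.fourierInv_coe] at h3
  exact h3

/-- The Fourier transform on `L²` is given by the Fourier integral on `L¹ ∩ L²`. -/
theorem coeFn_fourier_toLp {u : V → ℂ} (h1 : Integrable u) (h2 : MemLp u 2 volume) :
    ((𝓕 (h2.toLp u) : Lp (α := V) ℂ 2 volume) : V → ℂ) =ᵐ[volume] 𝓕 u := by
  apply ae_eq_of_integral_contDiff_smul_eq
  · exact (Lp.memLp _).locallyIntegrable (by norm_num)
  · refine Continuous.locallyIntegrable ?_
    exact VectorFourier.fourierIntegral_continuous Real.continuous_fourierChar
      continuous_inner h1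
  intro g hg hgs
  obtain ⟨G, hGx⟩ := exists_schwartz_eq hg hgs
  have h3 := integral_fourier_schwartz_mul (h2.toLp u) G
  have h4 : ∫ x, 𝓕 (G : V → ℂ) x * (h2.toLp u : V → ℂ) x = ∫ x, 𝓕 (G : V → ℂ) x * u x := by
    apply integral_congr_ae
    filter_upwards [h2.coeFn_toLp] with x hx
    rw [hx]
  rw [h4, integral_fourier_mul_eq_of_integrable G.integrable h1] at h3
  simp only [hGx] at h3
  simp only [Complex.real_smul]
  exact h3.symm

theorem coeFn_fourierInv_toLp {u : V → ℂ} (h1 : Integrable u) (h2 : MemLp u 2 volume) :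
    ((𝓕⁻ (h2.toLp u) : Lp (α := V) ℂ 2 volume) : V → ℂ) =ᵐ[volume] 𝓕⁻ u := by
  apply ae_eq_of_integral_contDiff_smul_eq
  · exact (Lp.memLp _).locallyIntegrable (by norm_num)
  · refine Continuous.locallyIntegrable ?_
    have : 𝓕⁻ u = fun x => 𝓕 u (-x) := by
      ext x; exact Real.fourierInv_eq_fourier_neg u x
    rw [this]
    exact (VectorFourier.fourierIntegral_continuous Real.continuous_fourierChar
      continuous_inner h1).comp continuous_neg
  intro g hg hgs
  obtain ⟨G, hGx⟩ := exists_schwartz_eq hg hgs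
  have h3 := integral_fourierInv_schwartz_mul (h2.toLp u) G
  have h4 : ∫ x, 𝓕⁻ (G : V → ℂ) x * (h2.toLp u : V → ℂ) x = ∫ x, 𝓕⁻ (G : V → ℂ) x * u x := by
    apply integral_congr_ae
    filter_upwards [h2.coeFn_toLp] with x hx
    rw [hx]
  rw [h4, integral_fourierInv_mul_eq_of_integrable G.integrable h1] at h3
  simp only [hGx] at h3
  simp only [Complex.real_smul]
  exact h3.symm

theorem fourierInv_toLp_eq {u : V → ℂ} (h1 : Integrable u) (h2 : MemLp u 2 volume) :
    ∃ h3 : MemLp (𝓕⁻ u) 2 volume, h3.toLp (𝓕⁻ u) = 𝓕⁻ (h2.toLp u) := by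
  have h := coeFn_fourierInv_toLp h1 h2
  have h3 : MemLp (𝓕⁻ u) 2 volume := (memLp_congr_ae h).mp (Lp.memLp _)
  refine ⟨h3, ?_⟩
  ext1
  exact h3.coeFn_toLp.trans h.symm

theorem fourier_toLp_eq {u : V → ℂ} (h1 : Integrable u) (h2 : MemLp u 2 volume) :
    ∃ h3 : MemLp (𝓕 u) 2 volume, h3.toLp (𝓕 u) = 𝓕 (h2.toLp u) := by
  have h := coeFn_fourier_toLp h1 h2
  have h3 : MemLp (𝓕 u) 2 volume := (memLp_congr_ae h).mp (Lp.memLp _)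
  refine ⟨h3, ?_⟩
  ext1
  exact h3.coeFn_toLp.trans h.symm

/-- Plancherel's identity on `L¹ ∩ L²`. -/
theorem eLpNorm_fourier_eq {u : V → ℂ} (h1 : Integrable u) (h2 : MemLp u 2 volume) :
    eLpNorm (𝓕 u) 2 volume = eLpNorm u 2 volume := by
  obtain ⟨h3, h4⟩ := fourier_toLp_eq h1 h2
  have h5 := congrArg norm h4
  rw [Lp.norm_fourier_eq, Lp.norm_toLp, Lp.norm_toLp] at h5
  exact (ENNReal.toReal_eq_toReal_iff' h3.2.ne h2.2.ne).mp h5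

/-- Parseval's identity, one of the functions being an inverse Fourier integral. -/
theorem integral_conj_fourierInv_mul {p b : V → ℂ} (hp1 : Integrable p) (hp2 : MemLp p 2 volume)
    (hb : MemLp b 2 volume) :
    ∫ v, (starRingEnd ℂ) (𝓕⁻ p v) * b v =
      ∫ ξ, (starRingEnd ℂ) (p ξ) * (𝓕 (hb.toLp b) : Lp (α := V) ℂ 2 volume) ξ := by
  obtain ⟨h3, h4⟩ := fourierInv_toLp_eq hp1 hp2
  have h5 := Lp.inner_fourier_eq (h3.toLp (𝓕⁻ p)) (hb.toLp b)
  rw [h4, FourierTransform.fourier_fourierInv_eq, ← h4] at h5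
  rw [L2.inner_def, L2.inner_def] at h5
  have e1 : ∫ v, (starRingEnd ℂ) (𝓕⁻ p v) * b v =
      ∫ v, inner ℂ ((h3.toLp (𝓕⁻ p)) v) ((hb.toLp b) v) := by
    apply integral_congr_ae
    filter_upwards [h3.coeFn_toLp, hb.coeFn_toLp] with v hv hv'
    rw [hv, hv', RCLike.inner_apply, mul_comm]
  have e2 : ∫ ξ, (starRingEnd ℂ) (p ξ) * (𝓕 (hb.toLp b) : Lp (α := V) ℂ 2 volume) ξ =
      ∫ v, inner ℂ ((hp2.toLp p) v) ((𝓕 (hb.toLp b) : Lp (α := V) ℂ 2 volume) v) := by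
    apply integral_congr_ae
    filter_upwards [hp2.coeFn_toLp] with v hv
    rw [hv, RCLike.inner_apply, mul_comm]
  rw [e1, e2, h5]

/-- The convolution of a square integrable function with a function in `L¹ ∩ L²` is an inverse
Fourier integral. -/
theorem integral_sub_mul_eq_fourierInv {G h : V → ℂ} (hG1 : Integrable G)
    (hG2 : MemLp G 2 volume) (hh : MemLp h 2 volume) (v : V) :
    ∫ w, G (v - w) * h w =
      𝓕⁻ (fun ξ => 𝓕 G ξ * (𝓕 (hh.toLp h) : Lp (α := V) ℂ 2 volume) ξ) v := by
  -- The convolution at v is the L² inner product of the conjugate of G(v - ·) with h, to which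
  -- Parseval's identity applies.
  set a : V → ℂ := fun w => (starRingEnd ℂ) (G (v - w)) with ha
  have ha1 : Integrable a := by
    have : Integrable (fun w => G (v - w)) := hG1.comp_sub_left v
    exact (LinearIsometryEquiv.integrable_comp_iff Complex.conjLIE).mpr this
  have ha2 : MemLp a 2 volume := by
    have : MemLp (fun w => G (v - w)) 2 volume :=
      hG2.comp_measurePreserving (Measure.measurePreserving_sub_left volume v)
    exact this.star
  have h5 := Lp.inner_fourier_eq (ha2.toLp a) (hh.toLp h)
  obtain ⟨h3, h4⟩ := fourier_toLp_eq ha1 ha2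
  rw [← h4, L2.inner_def, L2.inner_def] at h5
  have hfa : ∀ ξ, 𝓕 a ξ = (starRingEnd ℂ) (𝐞 (inner ℝ v ξ) • 𝓕 G ξ) := by
    intro ξ
    rw [Real.fourier_eq, Real.fourier_eq, Circle.smul_def, smul_eq_mul, map_mul,
      ← integral_conj, ← integral_const_mul]
    rw [← integral_sub_left_eq_self _ volume v]
    congr with w
    simp only [ha, sub_sub_cancel, Circle.smul_def, smul_eq_mul, map_mul]
    rw [← mul_assoc]
    congr 1
    rw [← Circle.coe_inv_eq_conj, ← Circle.coe_inv_eq_conj, ← AddChar.map_neg_eq_inv,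
      ← AddChar.map_neg_eq_inv, ← Circle.coe_mul, ← AddChar.map_add_eq_mul, inner_sub_left]
    congr 2; ring
  have e1 : ∫ w, G (v - w) * h w = ∫ w, inner ℂ ((ha2.toLp a) w) ((hh.toLp h) w) := by
    apply integral_congr_ae
    filter_upwards [ha2.coeFn_toLp, hh.coeFn_toLp] with w hw hw'
    rw [hw, hw', RCLike.inner_apply, mul_comm, ha]
    simp
  rw [e1, ← h5, Real.fourierInv_eq]
  apply integral_congr_ae
  filter_upwards [h3.coeFn_toLp] with ξ hξ
  rw [hξ, RCLike.inner_apply, hfa, Complex.conj_conj, Circle.smul_def, Circle.smul_def, smul_eq_mul,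
    smul_eq_mul, real_inner_comm]
  ring

end Consistency

end LandauDamping

namespace LandauDamping

/-! ### Band-limited Schwartz functions. -/

section BandLimited

open SchwartzMap LineDeriv

variable {d : ℕ}

/-- The Schwartz function `G` has its Fourier transform supported in the ball of radius `r`. -/
def BandLimited (r : ℝ) (G : 𝓢(E d, ℂ)) : Prop := ∀ ξ : E d, r < ‖ξ‖ → 𝓕 (G : E d → ℂ) ξ = 0

/-- Multiplication by a coordinate is differentiation on the Fourier side, and the transform
vanishes on an open set, hence so does its derivative. -/
theorem BandLimited.mul_coord {r : ℝ} {G : 𝓢(E d, ℂ)} (hG : BandLimited r G) (j : Fin d) :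
    ∃ G' : 𝓢(E d, ℂ), BandLimited r G' ∧ ∀ x, G' x = (x j : ℂ) * G x := by
  have htg : (fun x : E d => inner ℝ x (EuclideanSpace.single j (1 : ℝ))).HasTemperateGrowth := by
    fun_prop
  refine ⟨smulLeftCLM ℂ (fun x : E d => inner ℝ x (EuclideanSpace.single j (1 : ℝ))) G, ?_, ?_⟩
  · intro ξ hξ
    have h1 := lineDerivOp_fourier_eq G (EuclideanSpace.single j (1 : ℝ))
    have h2 := congrArg (fun F : 𝓢(E d, ℂ) => F ξ) h1
    have h3 : (∂_{EuclideanSpace.single j (1 : ℝ)} (𝓕 G) : 𝓢(E d, ℂ)) ξ = 0 := by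
      rw [lineDerivOp_apply_eq_fderiv]
      have h4 : (fun x => (𝓕 G) x) =ᶠ[nhds ξ] fun _ => 0 := by
        have : ∀ᶠ x in nhds ξ, r < ‖x‖ := continuous_norm.continuousAt.eventually_const_lt hξ
        filter_upwards [this] with x hx
        exact hG x hx
      rw [Filter.EventuallyEq.fderiv_eq h4]
      simp
    rw [h3] at h2
    have h5 : 𝓕 (-(2 * Real.pi * Complex.I) •
        smulLeftCLM ℂ (fun x : E d => inner ℝ x (EuclideanSpace.single j (1 : ℝ))) G) =
        -(2 * Real.pi * Complex.I) •
        𝓕 (smulLeftCLM ℂ (fun x : E d => inner ℝ x (EuclideanSpace.single j (1 : ℝ))) G) := by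
      rw [FourierTransform.fourier_smul]
    rw [h5] at h2
    have h6 : -(2 * Real.pi * Complex.I) ≠ 0 := by simp [Real.pi_ne_zero]
    have h7 := h2.symm
    rw [smul_apply, smul_eq_zero] at h7
    exact h7.resolve_left h6
  · intro x
    rw [smulLeftCLM_apply_apply htg]
    simp [EuclideanSpace.inner_single_right]

theorem BandLimited.mul_coord_pow {r : ℝ} {G : 𝓢(E d, ℂ)} (hG : BandLimited r G) (j : Fin d)
    (n : ℕ) : ∃ G' : 𝓢(E d, ℂ), BandLimited r G' ∧ ∀ x, G' x = (x j : ℂ) ^ n * G x := by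
  induction n with
  | zero => exact ⟨G, hG, fun x => by simp⟩
  | succ n ih =>
    obtain ⟨G₁, h₁, h₁'⟩ := ih
    obtain ⟨G₂, h₂, h₂'⟩ := h₁.mul_coord j
    exact ⟨G₂, h₂, fun x => by rw [h₂', h₁']; ring⟩

theorem BandLimited.mul_monomial {r : ℝ} {G : 𝓢(E d, ℂ)} (hG : BandLimited r G)
    (α : Fin d → ℕ) :
    ∃ G' : 𝓢(E d, ℂ), BandLimited r G' ∧ ∀ x, G' x = (∏ j, (x j : ℂ) ^ α j) * G x := by
  suffices ∀ S : Finset (Fin d), ∃ G' : 𝓢(E d, ℂ), BandLimited r G' ∧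
      ∀ x, G' x = (∏ j ∈ S, (x j : ℂ) ^ α j) * G x from this Finset.univ
  intro S
  induction S using Finset.induction_on with
  | empty => exact ⟨G, hG, fun x => by simp⟩
  | insert j S hj ih =>
    obtain ⟨G₁, h₁, h₁'⟩ := ih
    obtain ⟨G₂, h₂, h₂'⟩ := h₁.mul_coord_pow j (α j)
    exact ⟨G₂, h₂, fun x => by rw [h₂', h₁', Finset.prod_insert hj]; ring⟩

/-- The inverse transform of a bump function equal to 1 at the origin. The radius 1/8 is small
enough that, in the normalization e^(-iv·η), the support has radius 2π/8 < 1. -/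
theorem exists_bandLimited (d : ℕ) :
    ∃ G : 𝓢(E d, ℂ), BandLimited (1 / 8) G ∧ ∫ x, G x = 1 := by
  let b : ContDiffBump (0 : E d) := ⟨1 / 16, 1 / 8, by norm_num, by norm_num⟩
  obtain ⟨χ, hχ⟩ := exists_schwartz_eq (V := E d) b.contDiff b.hasCompactSupport
  have h1 : 𝓕 (𝓕⁻ χ) = χ := FourierTransform.fourier_fourierInv_eq χ
  have h2 : ∀ ξ, 𝓕 ((𝓕⁻ χ : 𝓢(E d, ℂ)) : E d → ℂ) ξ = b ξ := by
    intro ξ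
    rw [← hχ, ← SchwartzMap.fourier_coe, h1]
  refine ⟨𝓕⁻ χ, ?_, ?_⟩
  · intro ξ hξ
    rw [h2]
    have : b ξ = 0 := b.zero_of_le_dist (by rw [dist_zero_right]; exact hξ.le)
    simp [this]
  · have h3 := h2 0
    rw [Real.fourier_eq] at h3
    have h4 : b 0 = 1 := b.one_of_mem_closedBall (by simp [b])
    simpa [h4] using h3

end BandLimited

/-! ### Decomposition of 1 into monomials times functions with spectrum near the origin. -/

section Partition

variable {d : ℕ}

theorem zero_mem_multiIndices (d M : ℕ) : (0 : Fin d → ℕ) ∈ multiIndices d M := by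
  simp [multiIndices, Fintype.mem_piFinset]

theorem single_mem_multiIndices (M : ℕ) (j : Fin d) : Pi.single j M ∈ multiIndices d M := by
  simp only [multiIndices, Finset.mem_filter, Fintype.mem_piFinset, Finset.mem_range]
  refine ⟨fun i => ?_, ?_⟩
  · by_cases h : i = j
    · subst h; simp
    · simp [Pi.single_eq_of_ne h]
  · rw [Finset.sum_pi_single']
    simp

theorem mem_multiIndices_of_le {M : ℕ} {α p : Fin d → ℕ} (hα : α ∈ multiIndices d M)
    (hp : ∀ j, p j ≤ α j) : p ∈ multiIndices d M := by
  simp only [multiIndices, Finset.mem_filter, Fintype.mem_piFinset, Finset.mem_range] at hα ⊢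
  refine ⟨fun i => lt_of_le_of_lt (hp i) (hα.1 i), ?_⟩
  exact (Finset.sum_le_sum (fun j _ => hp j)).trans hα.2

/-- `P(v) = ∑_{|α| ≤ M} v^{2α}`. -/
noncomputable def momentWeight (d M : ℕ) (v : E d) : ℝ :=
  ∑ α ∈ multiIndices d M, (∏ j, v j ^ α j) ^ 2

theorem one_le_momentWeight (M : ℕ) (v : E d) : 1 ≤ momentWeight d M v := by
  have := Finset.single_le_sum (f := fun α : Fin d → ℕ => (∏ j, v j ^ α j) ^ 2)
    (fun α _ => sq_nonneg _) (zero_mem_multiIndices d M)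
  simpa [momentWeight] using this

theorem continuous_monomial (α : Fin d → ℕ) : Continuous fun v : E d => ∏ j, v j ^ α j := by
  fun_prop

theorem continuous_momentWeight (M : ℕ) : Continuous (momentWeight d M) := by
  unfold momentWeight
  exact continuous_finsetSum _ fun α _ => (continuous_monomial α).pow 2

/-- For the largest coordinate v_j one has |v|² ≤ d v_j², and v_j^(2M) is one of the summands of P.
-/
theorem one_add_norm_pow_le_momentWeight (hd : 1 ≤ d) (M : ℕ) (v : E d) :
    (1 + ‖v‖) ^ (2 * M) ≤ (4 * d : ℝ) ^ M * momentWeight d M v := by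
  have : Nonempty (Fin d) := ⟨⟨0, hd⟩⟩
  obtain ⟨j, -, hj⟩ := Finset.exists_max_image Finset.univ (fun j : Fin d => v j ^ 2)
    Finset.univ_nonempty
  have h1 : ‖v‖ ^ 2 ≤ d * v j ^ 2 := by
    rw [EuclideanSpace.norm_sq_eq]
    calc ∑ i, ‖v i‖ ^ 2 ≤ ∑ _i : Fin d, v j ^ 2 :=
          Finset.sum_le_sum fun i hi => by simpa using hj i hi
      _ = _ := by simp
  have h2 : (v j ^ 2) ^ M ≤ momentWeight d M v := by
    have := Finset.single_le_sum (f := fun α : Fin d → ℕ => (∏ j, v j ^ α j) ^ 2)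
      (fun α _ => sq_nonneg _) (single_mem_multiIndices M j)
    refine le_trans (le_of_eq ?_) this
    have h3 : ∏ i, v i ^ (Pi.single j M : Fin d → ℕ) i = v j ^ M := by
      rw [Finset.prod_eq_single j]
      · simp
      · intro i _ hi; simp [Pi.single_eq_of_ne hi]
      · simp
    simp only [h3]; ring
  have h4 := one_le_momentWeight M v
  have hd' : (1 : ℝ) ≤ d := by exact_mod_cast hd
  rcases le_total ‖v‖ 1 with h | h
  · calc (1 + ‖v‖) ^ (2 * M) ≤ 2 ^ (2 * M) := by
          gcongr; linarith
      _ = 4 ^ M * 1 := by rw [pow_mul]; norm_num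
      _ ≤ (4 * d : ℝ) ^ M * momentWeight d M v := by
          gcongr; linarith
  · calc (1 + ‖v‖) ^ (2 * M) = ((1 + ‖v‖) ^ 2) ^ M := by rw [pow_mul]
      _ ≤ (4 * d * v j ^ 2) ^ M := by
          gcongr
          nlinarith
      _ = (4 * d : ℝ) ^ M * (v j ^ 2) ^ M := by rw [mul_pow]
      _ ≤ _ := by gcongr

theorem integrable_inv_momentWeight (hd : 1 ≤ d) {M : ℕ} (hM : (d : ℝ) / 2 < M) :
    Integrable (fun v : E d => (momentWeight d M v)⁻¹) := by
  have h1 : Integrable (fun v : E d => (1 + ‖v‖) ^ (-(2 * M : ℝ))) :=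
    integrable_one_add_norm (by simp; linarith)
  refine (h1.const_mul ((4 * d : ℝ) ^ M)).mono'
    ((continuous_momentWeight M).inv₀ fun v => by
      linarith [one_le_momentWeight M v]).aestronglyMeasurable ?_
  filter_upwards with v
  have h2 := one_le_momentWeight M v
  have h3 := one_add_norm_pow_le_momentWeight hd M v
  rw [Real.norm_of_nonneg (by positivity), Real.rpow_neg (by positivity),
    inv_eq_one_div, div_le_iff₀ (by positivity), mul_assoc, ← div_eq_inv_mul, mul_div_assoc',
    le_div_iff₀ (by positivity), one_mul]
  have : (1 + ‖v‖) ^ (2 * M : ℝ) = (1 + ‖v‖) ^ (2 * M) := by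
    rw [← Real.rpow_natCast]; norm_cast
  rwa [this]

/-- The square is at most 1/P, which is integrable since P grows like |v|^(2M) and 2M > d. -/
theorem memLp_monomial_div_momentWeight (hd : 1 ≤ d) {M : ℕ} (hM : (d : ℝ) / 2 < M)
    {α : Fin d → ℕ} (hα : α ∈ multiIndices d M) :
    MemLp (fun w : E d => (((∏ j, w j ^ α j) / momentWeight d M w : ℝ) : ℂ)) 2 volume := by
  have hc : Continuous (fun w : E d => (∏ j, w j ^ α j) / momentWeight d M w) :=
    (continuous_monomial α).div (continuous_momentWeight M) fun v => by
      linarith [one_le_momentWeight M v]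
  refine (memLp_two_iff_integrable_sq_norm
    (Complex.continuous_ofReal.comp hc).aestronglyMeasurable).mpr ?_
  refine (integrable_inv_momentWeight hd hM).mono'
    ((Complex.continuous_ofReal.comp hc).norm.pow 2).aestronglyMeasurable ?_
  filter_upwards with w
  have h1 := one_le_momentWeight M w
  have h2 : (∏ j, w j ^ α j) ^ 2 ≤ momentWeight d M w :=
    Finset.single_le_sum (f := fun α : Fin d → ℕ => (∏ j, w j ^ α j) ^ 2)
      (fun α _ => sq_nonneg _) hα
  rw [Real.norm_of_nonneg (by positivity), Function.comp_apply, Complex.norm_real,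
    Real.norm_eq_abs, sq_abs, div_pow,
    div_le_iff₀ (by positivity), inv_eq_one_div, div_mul_eq_mul_div, one_mul,
    le_div_iff₀ (by positivity)]
  nlinarith

/-- The binomial expansion of w = v - (v-w): in a convolution over w the powers of v leave the
integral and the powers of v-w join the kernel. -/
theorem monomial_eq_sum (v w : E d) (α : Fin d → ℕ) :
    ((∏ j, w j ^ α j : ℝ) : ℂ) = ∑ p ∈ Fintype.piFinset (fun j => Finset.range (α j + 1)),
      (∏ j, ((-1 : ℂ) ^ (α j - p j) * (α j).choose (p j))) * ((∏ j, v j ^ p j : ℝ) : ℂ) *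
        ∏ j, ((v - w) j : ℂ) ^ (α j - p j) := by
  have h1 : ∀ j, ((w j : ℂ)) ^ α j = ∑ m ∈ Finset.range (α j + 1),
      ((-1 : ℂ) ^ (α j - m) * (α j).choose m) * (v j : ℂ) ^ m * ((v - w) j : ℂ) ^ (α j - m) := by
    intro j
    have : (w j : ℂ) = (v j : ℂ) + -1 * ((v - w) j : ℂ) := by simp
    conv_lhs => rw [this]
    rw [add_pow]
    refine Finset.sum_congr rfl fun m _ => ?_
    rw [mul_pow]; ring
  push_cast
  rw [Finset.prod_congr rfl fun j _ => h1 j, Finset.prod_univ_sum]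
  refine Finset.sum_congr rfl fun p _ => ?_
  rw [Finset.prod_mul_distrib, Finset.prod_mul_distrib]

/-- A decomposition `1 = ∑ v^p (𝓕⁻ q)(v)` with square integrable `q` supported near the origin;
it is what reduces the bounds on point values of a Fourier transform to local `L²` bounds. -/
theorem exists_partition (hd : 1 ≤ d) {M : ℕ} (hM : (d : ℝ) / 2 < M) :
    ∃ (S : Finset ((Fin d → ℕ) × (Fin d → ℕ))) (q : (Fin d → ℕ) × (Fin d → ℕ) → E d → ℂ),
      (∀ i ∈ S, i.2 ∈ multiIndices d M ∧ MemLp (q i) 2 volume ∧ ∀ ξ, 1 / 8 < ‖ξ‖ → q i ξ = 0) ∧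
      ∀ v : E d, ∑ i ∈ S, ((∏ j, v j ^ i.2 j : ℝ) : ℂ) * 𝓕⁻ (q i) v = 1 := by
  obtain ⟨G, hG, hG1⟩ := exists_bandLimited d
  choose Gm hGm hGm' using fun β => hG.mul_monomial β
  -- These square integrable functions satisfy ∑ w^α h_α(w) = 1, so that 1 = ∑_α ∫ G(v-w) w^α h_α(w)
  -- dw.
  set h : (Fin d → ℕ) → E d → ℂ := fun α w =>
    (((∏ j, w j ^ α j) / momentWeight d M w : ℝ) : ℂ) with hh
  have hmem : ∀ α ∈ multiIndices d M, MemLp (h α) 2 volume := fun α hα =>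
    memLp_monomial_div_momentWeight hd hM hα
  classical
  set c : (Fin d → ℕ) × (Fin d → ℕ) → ℂ := fun i =>
    ∏ j, ((-1 : ℂ) ^ (i.1 j - i.2 j) * (i.1 j).choose (i.2 j)) with hc
  -- For i = (α,p) this is, up to a binomial constant, the transform of the convolution of x^(α-p) G
  -- with h_α: its first factor is bounded and supported near the origin, its second is in L².
  set q : (Fin d → ℕ) × (Fin d → ℕ) → E d → ℂ := fun i ξ =>
    if hi : MemLp (h i.1) 2 volume then
      c i * (𝓕 (Gm (i.1 - i.2) : E d → ℂ) ξ * (𝓕 (hi.toLp (h i.1)) : Lp (α := E d) ℂ 2 volume) ξ)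
    else 0 with hq
  set S : Finset ((Fin d → ℕ) × (Fin d → ℕ)) :=
    ((multiIndices d M).sigma fun α => Fintype.piFinset fun j => Finset.range (α j + 1)).map
      (Equiv.sigmaEquivProd _ _).toEmbedding with hS
  have hmemS : ∀ i ∈ S, i.1 ∈ multiIndices d M ∧ ∀ j, i.2 j ≤ i.1 j := by
    intro i hi
    rw [hS, Finset.mem_map] at hi
    obtain ⟨⟨α, p⟩, hp, rfl⟩ := hi
    simp only [Finset.mem_sigma, Fintype.mem_piFinset, Finset.mem_range] at hp
    exact ⟨hp.1, fun j => Nat.lt_succ_iff.mp (hp.2 j)⟩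
  refine ⟨S, q, fun i hi => ⟨mem_multiIndices_of_le (hmemS i hi).1 (hmemS i hi).2, ?_, ?_⟩, ?_⟩
  · have hi1 := hmem _ (hmemS i hi).1
    simp only [hq, dif_pos hi1]
    refine MemLp.const_mul ?_ _
    have h1 : MemLp (𝓕 (Gm (i.1 - i.2) : E d → ℂ)) ⊤ volume := by
      rw [← SchwartzMap.fourier_coe]
      exact SchwartzMap.memLp _ _ _
    exact (Lp.memLp _).mul h1
  · intro ξ hξ
    simp only [hq]
    split_ifs
    · rw [hGm (i.1 - i.2) ξ hξ]; simp
    · rfl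
  · intro v
    have hconv : ∀ α ∈ multiIndices d M, ∀ β, Integrable (fun w => Gm β (v - w) * h α w) := by
      intro α hα β
      have h1 : MemLp (fun w => Gm β (v - w)) 2 volume :=
        ((Gm β).memLp 2 volume).comp_measurePreserving
          (Measure.measurePreserving_sub_left volume v)
      exact h1.integrable_mul (hmem α hα)
    have hterm : ∀ α ∈ multiIndices d M, ∀ p, 𝓕⁻ (q (α, p)) v =
        c (α, p) * ∫ w, Gm (α - p) (v - w) * h α w := by
      intro α hα p
      rw [integral_sub_mul_eq_fourierInv (Gm (α - p)).integrable ((Gm (α - p)).memLp 2 volume)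
        (hmem α hα) v, Real.fourierInv_eq, Real.fourierInv_eq, ← integral_const_mul]
      congr with ξ
      simp only [hq, dif_pos (hmem α hα), Circle.smul_def, smul_eq_mul]
      ring
    rw [hS, Finset.sum_map, Finset.sum_sigma]
    simp only [Equiv.coe_toEmbedding, Equiv.sigmaEquivProd_apply]
    -- For fixed α the terms in p recombine to the monomial w^α under the integral.
    have hsum : ∀ α ∈ multiIndices d M,
        ∑ p ∈ Fintype.piFinset (fun j => Finset.range (α j + 1)),
          ((∏ j, v j ^ p j : ℝ) : ℂ) * 𝓕⁻ (q (α, p)) v =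
        ∫ w, G (v - w) * (((∏ j, w j ^ α j : ℝ) : ℂ) * h α w) := by
      intro α hα
      rw [Finset.sum_congr rfl fun p _ => by rw [hterm α hα p]]
      simp_rw [← mul_assoc, ← integral_const_mul]
      rw [← integral_finsetSum]
      · congr with w
        rw [monomial_eq_sum v w α, Finset.mul_sum, Finset.sum_mul]
        refine Finset.sum_congr rfl fun p _ => ?_
        rw [hGm']
        simp only [hc, Pi.sub_apply]
        ring
      · intro p _
        exact (hconv α hα _).const_mul _
    rw [Finset.sum_congr rfl hsum, ← integral_finsetSum]
    · rw [← hG1, ← integral_sub_left_eq_self _ volume v]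
      congr with w
      rw [← Finset.mul_sum]
      have : ∀ w, ∑ α ∈ multiIndices d M, (((∏ j, w j ^ α j : ℝ) : ℂ) * h α w) = 1 := by
        intro w
        have hP := one_le_momentWeight M w
        simp only [hh]
        norm_cast
        rw [Finset.sum_congr rfl fun α _ => mul_div_assoc' _ _ _, ← Finset.sum_div,
          div_eq_one_iff_eq (by positivity), momentWeight]
        exact Finset.sum_congr rfl fun α _ => (sq _).symm
      rw [this, mul_one, sub_sub_cancel]
    · intro α hα
      have h1 : ∀ w, G (v - w) * (((∏ j, w j ^ α j : ℝ) : ℂ) * h α w) =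
          ∑ p ∈ Fintype.piFinset (fun j => Finset.range (α j + 1)),
            (c (α, p) * ((∏ j, v j ^ p j : ℝ) : ℂ)) * (Gm (α - p) (v - w) * h α w) := by
        intro w
        rw [monomial_eq_sum v w α, Finset.sum_mul, Finset.mul_sum]
        refine Finset.sum_congr rfl fun p _ => ?_
        rw [hGm']
        simp only [hc, Pi.sub_apply]
        ring
      simp_rw [h1]
      exact integrable_finsetSum _ fun p _ => (hconv α hα _).const_mul _

end Partition

/-! ### Point values of Fourier transforms by local L² norms. -/

section Trace

variable {d : ℕ}

open Classical in
/-- The square of the modulus of the Fourier transform of a square integrable function, `∞` for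
other functions. -/
noncomputable def fourierSq (u : E d → ℂ) (η : E d) : ℝ≥0∞ :=
  if h : MemLp u 2 volume then ‖fourierL2 u h η‖ₑ ^ 2 else ⊤

theorem fourierSq_of_memLp {u : E d → ℂ} (h : MemLp u 2 volume) (η : E d) :
    fourierSq u η = ‖fourierL2 u h η‖ₑ ^ 2 := dif_pos h

theorem measurable_fourierL2 {u : E d → ℂ} (h : MemLp u 2 volume) :
    Measurable (fourierL2 u h) :=
  (Lp.stronglyMeasurable _).measurable.comp (measurable_const_smul _)

theorem measurable_fourierSq (u : E d → ℂ) : Measurable (fourierSq u) := by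
  by_cases h : MemLp u 2 volume
  · have : fourierSq u = fun η => ‖fourierL2 u h η‖ₑ ^ 2 := funext fun η => fourierSq_of_memLp h η
    rw [this]
    exact (measurable_fourierL2 h).enorm.pow_const 2
  · have : fourierSq u = fun _ => ⊤ := funext fun η => dif_neg h
    rw [this]
    exact measurable_const

theorem lintegral_comp_inv_two_pi_smul (g : E d → ℝ≥0∞) :
    ∫⁻ η, g ((2 * Real.pi)⁻¹ • η) = ENNReal.ofReal ((2 * Real.pi) ^ d) * ∫⁻ ξ, g ξ := by
  have h0 : (2 * Real.pi)⁻¹ ≠ 0 := by positivity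
  have h1 : ∫⁻ η, g ((2 * Real.pi)⁻¹ • η) =
      ∫⁻ ξ, g ξ ∂(Measure.map (fun η : E d => (2 * Real.pi)⁻¹ • η) volume) :=
    ((Homeomorph.smulOfNeZero _ h0).toMeasurableEquiv.measurableEmbedding.lintegral_map g).symm
  rw [h1, Measure.map_addHaar_smul _ h0, lintegral_smul_measure]
  congr 1
  congr 1
  rw [finrank_euclideanSpace_fin, abs_of_pos (by positivity), inv_pow, inv_inv]

/-- `|∫ p̄ b|² ≤ ∫ |p|² ∫ |b|²`, the second integral being over a set that carries `p`. -/
theorem enorm_integral_conj_mul_sq_le {V : Type*} [MeasurableSpace V] {μ : Measure V}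
    {p b : V → ℂ} (hp : AEStronglyMeasurable p μ) (hb : AEStronglyMeasurable b μ) {B : Set V}
    (hB : MeasurableSet B) (hpB : ∀ x, x ∉ B → p x = 0) :
    ‖∫ x, (starRingEnd ℂ) (p x) * b x ∂μ‖ₑ ^ 2 ≤
      eLpNorm p 2 μ ^ 2 * ∫⁻ x in B, ‖b x‖ₑ ^ 2 ∂μ := by
  have h1 : ‖∫ x, (starRingEnd ℂ) (p x) * b x ∂μ‖ₑ ≤ ∫⁻ x, ‖p x‖ₑ * B.indicator (‖b ·‖ₑ) x ∂μ := by
    refine (enorm_integral_le_lintegral_enorm _).trans (lintegral_mono fun x => ?_)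
    by_cases hx : x ∈ B
    · simp [Set.indicator_of_mem hx, enorm_mul]
    · simp [hpB x hx]
  have h2 := ENNReal.lintegral_mul_le_Lp_mul_Lq μ Real.HolderConjugate.two_two hp.enorm
    (hb.enorm.indicator hB)
  have h3 := pow_le_pow_left' (h1.trans h2) 2
  refine h3.trans (le_of_eq ?_)
  rw [mul_pow, eLpNorm_eq_lintegral_rpow_enorm_toReal (by norm_num) (by norm_num)]
  congr 1
  rw [← ENNReal.rpow_natCast, ← ENNReal.rpow_mul]
  simp only [ENNReal.rpow_ofNat, Nat.cast_ofNat, one_div, ne_eq, OfNat.ofNat_ne_zero,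
    not_false_eq_true, inv_mul_cancel₀, ENNReal.rpow_one]
  rw [← lintegral_indicator hB]
  congr with x
  by_cases hx : x ∈ B
  · simp [Set.indicator_of_mem hx]
  · simp [Set.indicator_of_notMem hx]

/-- The identity f = ∑ (v^α/P)(v^α f) exhibits f as a sum of products of two square integrable
functions. -/
theorem integrable_of_memLp_moments (hd : 1 ≤ d) {M : ℕ} (hM : (d : ℝ) / 2 < M) {f : E d → ℂ}
    (hf : ∀ α ∈ multiIndices d M, MemLp (fun v => ((∏ j, v j ^ α j : ℝ) : ℂ) * f v) 2 volume) :
    Integrable f := by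
  have h1 : f = fun v => ∑ α ∈ multiIndices d M,
      (((∏ j, v j ^ α j) / momentWeight d M v : ℝ) : ℂ) * (((∏ j, v j ^ α j : ℝ) : ℂ) * f v) := by
    ext v
    have hP := one_le_momentWeight M v
    simp_rw [← mul_assoc]
    rw [← Finset.sum_mul]
    have : ∑ α ∈ multiIndices d M, (((∏ j, v j ^ α j) / momentWeight d M v : ℝ) : ℂ) *
        ((∏ j, v j ^ α j : ℝ) : ℂ) = 1 := by
      norm_cast
      rw [Finset.sum_congr rfl fun α _ => div_mul_eq_mul_div _ _ _, ← Finset.sum_div,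
        div_eq_one_iff_eq (by positivity), momentWeight]
      exact Finset.sum_congr rfl fun α _ => (sq _).symm
    rw [this, one_mul]
  rw [h1]
  exact integrable_finsetSum _ fun α hα =>
    (memLp_monomial_div_momentWeight hd hM hα).integrable_mul (hf α hα)

/-- Point values of a Fourier transform are controlled by the local `L²` norms of its derivatives
of order at most `M > d / 2`. -/
theorem exists_trace_bound (hd : 1 ≤ d) {M : ℕ} (hM : (d : ℝ) / 2 < M) :
    ∃ C : ℝ≥0∞, C ≠ ⊤ ∧ ∀ f : E d → ℂ,
      (∀ α ∈ multiIndices d M, MemLp (fun v => ((∏ j, v j ^ α j : ℝ) : ℂ) * f v) 2 volume) →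
      ∀ η₀ : E d, ‖fourierInt f η₀‖ₑ ^ 2 ≤ C * ∑ α ∈ multiIndices d M,
        ∫⁻ η in Metric.closedBall η₀ 1, fourierSq (fun v => ((∏ j, v j ^ α j : ℝ) : ℂ) * f v) η := by
  obtain ⟨S, q, hq, hsum⟩ := exists_partition hd hM
  refine ⟨(∑ i ∈ S, eLpNorm (q i) 2 volume) ^ 2, ?_, ?_⟩
  · exact ENNReal.pow_ne_top (ENNReal.sum_ne_top.mpr fun i hi => (hq i hi).2.1.2.ne)
  intro f hf η₀
  set b : (Fin d → ℕ) → E d → ℂ := fun α v => ((∏ j, v j ^ α j : ℝ) : ℂ) * f v with hb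
  set ξ₀ : E d := (2 * Real.pi)⁻¹ • η₀ with hξ₀
  set R := ∑ α ∈ multiIndices d M, ∫⁻ η in Metric.closedBall η₀ 1, fourierSq (b α) η with hR
  -- The reflected and conjugated q, now supported around ξ₀ = η₀/2π: modulation by e^(-iη₀·v)
  -- translates the spectrum, and the conjugate prepares Parseval's identity.
  set p : (Fin d → ℕ) × (Fin d → ℕ) → E d → ℂ := fun i ζ => (starRingEnd ℂ) (q i (ξ₀ - ζ)) with hp
  have hp2 : ∀ i ∈ S, MemLp (p i) 2 volume := fun i hi =>
    ((hq i hi).2.1.comp_measurePreserving (Measure.measurePreserving_sub_left volume ξ₀)).star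
  have hpn : ∀ i ∈ S, eLpNorm (p i) 2 volume = eLpNorm (q i) 2 volume := fun i hi => by
    rw [← eLpNorm_comp_measurePreserving (hq i hi).2.1.1
      (Measure.measurePreserving_sub_left volume ξ₀)]
    exact eLpNorm_congr_norm_ae (Filter.Eventually.of_forall fun ζ => by simp [hp])
  have hpB : ∀ i ∈ S, ∀ ζ, ζ ∉ Metric.closedBall ξ₀ (1 / 8) → p i ζ = 0 := by
    intro i hi ζ hζ
    simp only [hp]
    rw [(hq i hi).2.2 _ (by simpa [dist_eq_norm, norm_sub_rev] using hζ)]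
    simp
  have hp1 : ∀ i ∈ S, Integrable (p i) := by
    intro i hi
    have h1 : IntegrableOn (p i) (Metric.closedBall ξ₀ (1 / 8)) := by
      have : IsFiniteMeasure (volume.restrict (Metric.closedBall ξ₀ (1 / 8))) :=
        ⟨by rw [Measure.restrict_apply_univ]; exact measure_closedBall_lt_top⟩
      exact ((hp2 i hi).restrict _).integrable (by norm_num)
    exact (integrableOn_iff_integrable_of_support_subset fun ζ hζ => by
      by_contra h; exact hζ (hpB i hi ζ h)).mp h1
  have hconj : ∀ i v, Complex.exp (-Complex.I * (inner ℝ η₀ v : ℝ)) * 𝓕⁻ (q i) v =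
      (starRingEnd ℂ) (𝓕⁻ (p i) v) := by
    intro i v
    rw [Real.fourierInv_eq, Real.fourierInv_eq, ← integral_conj,
      ← integral_sub_left_eq_self _ volume ξ₀, ← integral_const_mul]
    congr with ζ
    simp only [hp, Circle.smul_def, smul_eq_mul, map_mul, Complex.conj_conj]
    rw [← mul_assoc]
    congr 1
    rw [Real.fourierChar_apply, Real.fourierChar_apply, ← Complex.exp_conj, ← Complex.exp_add]
    congr 1
    simp only [map_mul, Complex.conj_I, Complex.conj_ofReal, inner_sub_left, hξ₀,
      real_inner_smul_left]
    push_cast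
    have : (Real.pi : ℂ) ≠ 0 := by exact_mod_cast Real.pi_ne_zero
    field_simp
    ring
  have hfour : fourierInt f η₀ = ∑ i ∈ S, ∫ v, (starRingEnd ℂ) (𝓕⁻ (p i) v) * b i.2 v := by
    unfold fourierInt
    rw [← integral_finsetSum]
    · congr with v
      rw [← one_mul (f v), ← hsum v, Finset.sum_mul, Finset.mul_sum]
      refine Finset.sum_congr rfl fun i _ => ?_
      rw [← hconj]; simp only [hb]; ring
    · intro i hi
      obtain ⟨h3, -⟩ := fourierInv_toLp_eq (hp1 i hi) (hp2 i hi)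
      exact h3.star.integrable_mul (hf _ (hq i hi).1)
  -- Under η = 2πξ the ball of radius 1/8 becomes one of radius π/4 < 1, and the Jacobian (2π)^d ≥ 1
  -- has the favourable sign.
  have hball : ∀ α (hα : MemLp (b α) 2 volume),
      ∫⁻ ξ in Metric.closedBall ξ₀ (1 / 8), ‖(𝓕 (hα.toLp (b α)) : Lp (α := E d) ℂ 2 volume) ξ‖ₑ ^ 2
        ≤ ∫⁻ η in Metric.closedBall η₀ 1, fourierSq (b α) η := by
    intro α hα
    rw [← lintegral_indicator Metric.isClosed_closedBall.measurableSet,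
      ← lintegral_indicator Metric.isClosed_closedBall.measurableSet]
    set g : E d → ℝ≥0∞ := (Metric.closedBall ξ₀ (1 / 8)).indicator
      fun ξ => ‖(𝓕 (hα.toLp (b α)) : Lp (α := E d) ℂ 2 volume) ξ‖ₑ ^ 2
    have h1 : ∫⁻ ξ, g ξ ≤ ∫⁻ η, g ((2 * Real.pi)⁻¹ • η) := by
      rw [lintegral_comp_inv_two_pi_smul]
      conv_lhs => rw [← one_mul (∫⁻ ξ, g ξ)]
      gcongr
      rw [← ENNReal.ofReal_one]
      apply ENNReal.ofReal_le_ofReal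
      exact one_le_pow₀ (by linarith [Real.pi_gt_three])
    refine h1.trans (lintegral_mono fun η => ?_)
    by_cases h2 : (2 * Real.pi)⁻¹ • η ∈ Metric.closedBall ξ₀ (1 / 8)
    · have h3 : η ∈ Metric.closedBall η₀ 1 := by
        rw [mem_closedBall_iff_norm] at h2 ⊢
        rw [hξ₀, ← smul_sub, norm_smul, Real.norm_of_nonneg (by positivity),
          inv_mul_le_iff₀ (by positivity)] at h2
        linarith [Real.pi_lt_four]
      simp only [g]
      rw [Set.indicator_of_mem h2, Set.indicator_of_mem h3, fourierSq_of_memLp hα]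
      rfl
    · simp only [g]
      rw [Set.indicator_of_notMem h2]
      exact zero_le
  have hterm : ∀ i ∈ S, ‖∫ v, (starRingEnd ℂ) (𝓕⁻ (p i) v) * b i.2 v‖ₑ ≤
      eLpNorm (q i) 2 volume * R ^ (1 / 2 : ℝ) := by
    intro i hi
    have hbi := hf i.2 (hq i hi).1
    rw [integral_conj_fourierInv_mul (hp1 i hi) (hp2 i hi) hbi]
    have h1 := enorm_integral_conj_mul_sq_le (hp2 i hi).1
      (Lp.aestronglyMeasurable (𝓕 (hbi.toLp (b i.2)) : Lp (α := E d) ℂ 2 volume))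
      Metric.isClosed_closedBall.measurableSet (hpB i hi)
    have h2 : ∫⁻ η in Metric.closedBall η₀ 1, fourierSq (b i.2) η ≤ R :=
      Finset.single_le_sum (f := fun α => ∫⁻ η in Metric.closedBall η₀ 1, fourierSq (b α) η)
        (fun _ _ => zero_le) (hq i hi).1
    have h3 := h1.trans (mul_le_mul_right ((hball i.2 hbi).trans h2) _)
    rw [hpn i hi] at h3
    have h4 : eLpNorm (q i) 2 volume ^ 2 * R = (eLpNorm (q i) 2 volume * R ^ (1 / 2 : ℝ)) ^ 2 := by
      rw [mul_pow]
      congr 1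
      rw [← ENNReal.rpow_natCast, ← ENNReal.rpow_mul]
      norm_num
    rw [h4] at h3
    exact (ENNReal.pow_le_pow_left_iff (by norm_num)).mp h3
  rw [hfour]
  calc ‖∑ i ∈ S, ∫ v, (starRingEnd ℂ) (𝓕⁻ (p i) v) * b i.2 v‖ₑ ^ 2
      ≤ (∑ i ∈ S, eLpNorm (q i) 2 volume * R ^ (1 / 2 : ℝ)) ^ 2 := by
        gcongr
        exact (enorm_sum_le _ _).trans (Finset.sum_le_sum hterm)
    _ = _ := by
        rw [← Finset.sum_mul, mul_pow]
        congr 1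
        rw [← ENNReal.rpow_natCast, ← ENNReal.rpow_mul]
        norm_num

end Trace

end LandauDamping

namespace LandauDamping

/-! ### Schur's test and Young's inequality. -/

section Schur

theorem sq_lintegral_mul_le {Y : Type*} [MeasurableSpace Y] {ν : Measure Y} {k g : Y → ℝ≥0∞}
    (hk : AEMeasurable k ν) (hg : AEMeasurable g ν) :
    (∫⁻ y, k y * g y ∂ν) ^ 2 ≤ (∫⁻ y, k y ∂ν) * ∫⁻ y, k y * g y ^ 2 ∂ν := by
  have h1 : ∀ y, k y = k y ^ (1 / 2 : ℝ) * k y ^ (1 / 2 : ℝ) := fun y => by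
    rw [← ENNReal.rpow_add_of_nonneg _ _ (by norm_num) (by norm_num)]; norm_num
  have h2 := ENNReal.lintegral_mul_le_Lp_mul_Lq ν Real.HolderConjugate.two_two
    (hk.pow_const (1 / 2 : ℝ)) ((hk.pow_const (1 / 2 : ℝ)).mul hg)
  have h3 : ∫⁻ y, k y * g y ∂ν =
      ∫⁻ y, ((fun y => k y ^ (1 / 2 : ℝ)) * ((fun y => k y ^ (1 / 2 : ℝ)) * g)) y ∂ν := by
    congr with y
    simp only [Pi.mul_apply]
    rw [← mul_assoc, ← h1]
  rw [h3]
  refine (pow_le_pow_left' h2 2).trans (le_of_eq ?_)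
  have h4 : ∀ a : ℝ≥0∞, (a ^ (1 / 2 : ℝ)) ^ 2 = a := fun a => by
    rw [← ENNReal.rpow_natCast, ← ENNReal.rpow_mul]; norm_num
  rw [mul_pow, h4, h4]
  simp only [Pi.mul_apply, ENNReal.rpow_two, mul_pow, h4]

/-- Schur's test. -/
theorem lintegral_schur {X Y : Type*} [MeasurableSpace X] [MeasurableSpace Y] {μ : Measure X}
    {ν : Measure Y} [SFinite μ] [SFinite ν] {K : X → Y → ℝ≥0∞} {g : Y → ℝ≥0∞}
    (hK : Measurable (Function.uncurry K)) (hg : Measurable g) {A B : ℝ≥0∞}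
    (hA : ∀ x, ∫⁻ y, K x y ∂ν ≤ A) (hB : ∀ y, ∫⁻ x, K x y ∂μ ≤ B) :
    ∫⁻ x, (∫⁻ y, K x y * g y ∂ν) ^ 2 ∂μ ≤ A * B * ∫⁻ y, g y ^ 2 ∂ν := by
  have hKx : ∀ x, Measurable (K x) := fun x => hK.comp measurable_prodMk_left
  have hKy : ∀ y, Measurable fun x => K x y := fun y => hK.comp measurable_prodMk_right
  calc ∫⁻ x, (∫⁻ y, K x y * g y ∂ν) ^ 2 ∂μ
      ≤ ∫⁻ x, A * ∫⁻ y, K x y * g y ^ 2 ∂ν ∂μ := by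
        refine lintegral_mono fun x => ?_
        exact (sq_lintegral_mul_le (hKx x).aemeasurable hg.aemeasurable).trans
          (mul_le_mul_left (hA x) _)
    _ = A * ∫⁻ y, ∫⁻ x, K x y * g y ^ 2 ∂μ ∂ν := by
        have hm : Measurable (Function.uncurry fun x y => K x y * g y ^ 2) :=
          hK.mul ((hg.comp measurable_snd).pow_const 2)
        have hm' : Measurable fun x => ∫⁻ y, K x y * g y ^ 2 ∂ν := hm.lintegral_prod_right'
        rw [lintegral_const_mul _ hm', lintegral_lintegral_swap hm.aemeasurable]
    _ ≤ A * ∫⁻ y, B * g y ^ 2 ∂ν := by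
        gcongr with y
        rw [lintegral_mul_const _ (hKy y)]
        gcongr
        exact hB y
    _ = _ := by
        rw [lintegral_const_mul _ (hg.pow_const 2), mul_assoc]

/-- Young's inequality for the convolution of an integrable and a square integrable function. -/
theorem lintegral_convolution_sq_le {k g : ℝ → ℝ≥0∞} (hk : Measurable k) (hg : Measurable g) :
    ∫⁻ t, (∫⁻ s, k (t - s) * g s) ^ 2 ≤ (∫⁻ t, k t) ^ 2 * ∫⁻ s, g s ^ 2 := by
  rw [sq (∫⁻ t, k t)]
  refine lintegral_schur (K := fun t s => k (t - s)) (hk.comp measurable_sub) hg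
    (fun t => (lintegral_sub_left_eq_self k t).le) (fun s => ?_)
  exact (lintegral_sub_right_eq_self k s).le

end Schur

/-! ### Coercivity of convolution equations by Plancherel. -/

section Coercivity

/-- If the Fourier multiplier of `1 - k ⋆` stays away from `0`, then `1 - k ⋆` is bounded below
in `L²`. -/
theorem mul_eLpNorm_le_of_fourier_ge {k g : ℝ → ℂ} (hk : Integrable k) (hg : Integrable g)
    (hg2 : MemLp g 2 volume) {κ : ℝ} (hκ : 0 < κ) (hκk : ∀ ω, κ ≤ ‖1 - 𝓕 k ω‖) :
    ENNReal.ofReal κ * eLpNorm g 2 volume ≤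
      eLpNorm (fun t => g t - ∫ s, g s * k (t - s)) 2 volume := by
  set c : ℝ → ℂ := fun t => ∫ s, g s * k (t - s) with hc
  have hcconv : c = convolution g k (ContinuousLinearMap.mul ℂ ℂ) volume := rfl
  have hci : Integrable c := by rw [hcconv]; exact hg.integrable_convolution _ hk
  have hi : Integrable (fun t => g t - c t) := hg.sub hci
  -- If the right-hand function is not square integrable the claim is void; otherwise both sides
  -- pass to the Fourier side, where the operator is multiplication by 1 - 𝓕k.
  by_cases hmem : MemLp (fun t => g t - c t) 2 volume
  · rw [← eLpNorm_fourier_eq hg hg2, ← eLpNorm_fourier_eq hi hmem]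
    have hF : ∀ ω, 𝓕 (fun t => g t - c t) ω = (1 - 𝓕 k ω) * 𝓕 g ω := by
      intro ω
      have h1 : 𝓕 c ω = 𝓕 g ω * 𝓕 k ω := by
        rw [hcconv]; exact Real.fourier_mul_convolution_eq hg hk ω
      have h2 : 𝓕 (fun t => g t - c t) ω = 𝓕 g ω - 𝓕 c ω := by
        rw [Real.fourier_eq, Real.fourier_eq, Real.fourier_eq, ← integral_sub]
        · congr with t
          rw [smul_sub]
        · exact (Real.fourierIntegral_convergent_iff ω).mpr hg
        · exact (Real.fourierIntegral_convergent_iff ω).mpr hci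
      rw [h2, h1]; ring
    rw [← Real.enorm_of_nonneg hκ.le, ← eLpNorm_const_smul]
    refine eLpNorm_mono fun ω => ?_
    rw [hF, norm_mul, Pi.smul_apply, norm_smul, Real.norm_of_nonneg hκ.le]
    gcongr
    exact hκk ω
  · have : eLpNorm (fun t => g t - c t) 2 volume = ⊤ := by
      by_contra h
      exact hmem ⟨hi.1, lt_top_iff_ne_top.mpr h⟩
    rw [this]
    exact le_top

end Coercivity

/-! ### Existence of Volterra resolvents. -/

section Volterra

/-- Existence of the resolvent of a Volterra equation with bounded continuous kernel. -/
theorem exists_resolvent {K : ℝ → ℂ} (hK : Continuous K) {C : ℝ} (hC : 0 < C)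
    (hKC : ∀ t, 0 ≤ t → ‖K t‖ ≤ C) :
    ∃ (R : ℝ → ℂ) (B : ℝ), Continuous R ∧ (∀ t, 0 ≤ t → ‖R t‖ ≤ B * Real.exp (2 * C * t)) ∧
      ∀ t, 0 ≤ t → R t = K t + ∫ s in 0..t, R s * K (t - s) := by
  -- The damping e^(-2Ct) gives the kernel mass at most 1/2 on the half line, so the fixed point map
  -- is a contraction; undoing it produces the growth e^(2Ct).
  set k : ℝ → ℂ := fun t => Real.exp (-(2 * C) * t) * K t with hk
  have hkc : Continuous k := by fun_prop
  have hkb : ∀ t, 0 ≤ t → ‖k t‖ ≤ C * Real.exp (-(2 * C) * t) := by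
    intro t ht
    rw [hk, norm_mul, Complex.norm_real, Real.norm_of_nonneg (Real.exp_pos _).le, mul_comm]
    gcongr
    exact hKC t ht
  have hInt : ∀ (S : ℝ → ℂ) (A : ℝ), Continuous S → (∀ t, ‖S t‖ ≤ A) → ∀ t, 0 ≤ t →
      ‖∫ s in 0..t, S s * k (t - s)‖ ≤ A / 2 := by
    intro S A hS hSA t ht
    have hA : 0 ≤ A := (norm_nonneg _).trans (hSA 0)
    have h1 : ‖∫ s in 0..t, S s * k (t - s)‖ ≤
        ∫ s in 0..t, A * (C * Real.exp (-(2 * C) * (t - s))) := by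
      refine intervalIntegral.norm_integral_le_of_norm_le ht ?_ ?_
      · filter_upwards with s hs
        rw [norm_mul]
        gcongr
        · exact hSA s
        · exact hkb _ (by linarith [hs.2])
      · exact Continuous.intervalIntegrable (by fun_prop) _ _
    refine h1.trans ?_
    have h2 : ∀ s ∈ Set.uIcc 0 t, HasDerivAt (fun s => A / 2 * Real.exp (-(2 * C) * (t - s)))
        (A * (C * Real.exp (-(2 * C) * (t - s)))) s := by
      intro s _
      have h3 : HasDerivAt (fun s => -(2 * C) * (t - s)) (2 * C) s := by
        have := ((hasDerivAt_id s).const_sub t).const_mul (-(2 * C))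
        simpa using this
      exact ((h3.exp).const_mul (A / 2)).congr_deriv (by ring)
    rw [intervalIntegral.integral_eq_sub_of_hasDerivAt h2
      (Continuous.intervalIntegrable (by fun_prop) _ _)]
    simp only [sub_self, mul_zero, Real.exp_zero, mul_one]
    have : 0 ≤ A / 2 * Real.exp (-(2 * C) * (t - 0)) := by positivity
    linarith
  have hcont : ∀ S : ℝ → ℂ, Continuous S →
      Continuous fun t => ∫ s in 0..(max t 0), S s * k (max t 0 - s) := by
    intro S hS
    have h1 : Continuous fun t => ∫ s in 0..t, S s * k (t - s) :=
      intervalIntegral.continuous_parametric_intervalIntegral_of_continuous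
        (f := fun t s => S s * k (t - s)) (by fun_prop) continuous_id
    exact h1.comp (continuous_id.max continuous_const)
  -- Freezing time at `max t 0` extends everything to the whole line, so that the map acts on
  -- bounded continuous functions.
  let Φ : BoundedContinuousFunction ℝ ℂ → BoundedContinuousFunction ℝ ℂ := fun S =>
    BoundedContinuousFunction.ofNormedAddCommGroup
      (fun t => k (max t 0) + ∫ s in 0..(max t 0), S s * k (max t 0 - s))
      ((hkc.comp (continuous_id.max continuous_const)).add (hcont S S.continuous))
      (C + ‖S‖ / 2) (fun t => by
        refine (norm_add_le _ _).trans (add_le_add ?_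
          (hInt S ‖S‖ S.continuous S.norm_coe_le_norm _ (le_max_right _ _)))
        refine (hkb _ (le_max_right _ _)).trans ?_
        have : Real.exp (-(2 * C) * max t 0) ≤ 1 := by
          rw [Real.exp_le_one_iff]
          nlinarith [le_max_right t 0]
        nlinarith)
  have hΦ : ContractingWith (1 / 2) Φ := by
    refine ⟨by norm_num, LipschitzWith.of_dist_le_mul fun S S' => ?_⟩
    rw [BoundedContinuousFunction.dist_le (by positivity)]
    intro t
    have h1 : Φ S t - Φ S' t = ∫ s in 0..(max t 0), (S - S') s * k (max t 0 - s) := by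
      change (k (max t 0) + ∫ s in 0..(max t 0), S s * k (max t 0 - s)) -
        (k (max t 0) + ∫ s in 0..(max t 0), S' s * k (max t 0 - s)) = _
      rw [add_sub_add_left_eq_sub, ← intervalIntegral.integral_sub]
      · congr with s
        simp [sub_mul]
      · exact Continuous.intervalIntegrable (S.continuous.mul (by fun_prop)) _ _
      · exact Continuous.intervalIntegrable (S'.continuous.mul (by fun_prop)) _ _
    rw [dist_eq_norm, h1, dist_eq_norm]
    refine (hInt (S - S') ‖S - S'‖ (S - S').continuous (S - S').norm_coe_le_norm _
      (le_max_right _ _)).trans (le_of_eq ?_)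
    simp; ring
  set S := hΦ.fixedPoint with hSdef
  have hS : Φ S = S := hΦ.fixedPoint_isFixedPt
  have hSt : ∀ t, 0 ≤ t → S t = k t + ∫ s in 0..t, S s * k (t - s) := by
    intro t ht
    have h1 : Φ S t = S t := by rw [hS]
    have h2 : Φ S t = k (max t 0) + ∫ s in 0..(max t 0), S s * k (max t 0 - s) := rfl
    rw [← h1, h2, max_eq_left ht]
  refine ⟨fun t => Real.exp (2 * C * t) * S t, ‖S‖, ?_, ?_, ?_⟩
  · have := S.continuous
    fun_prop
  · intro t _
    rw [norm_mul, Complex.norm_real, Real.norm_of_nonneg (Real.exp_pos _).le, mul_comm]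
    gcongr
    exact S.norm_coe_le_norm t
  · intro t ht
    simp only
    rw [hSt t ht, mul_add, ← intervalIntegral.integral_const_mul]
    congr 1
    · rw [hk]
      simp only
      rw [← mul_assoc, ← Complex.ofReal_mul, ← Real.exp_add]
      simp
    · congr with s
      rw [hk]
      simp only
      have : Real.exp (2 * C * t) * Real.exp (-(2 * C) * (t - s)) = Real.exp (2 * C * s) := by
        rw [← Real.exp_add]; congr 1; ring
      rw [← this]
      push_cast
      ring

end Volterra

end LandauDamping

namespace LandauDamping

/-! ### Raising the exponential weight of a resolvent. -/

section Step

theorem abs_exp_sub_exp_le (a b : ℝ) :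
    |Real.exp a - Real.exp b| ≤ Real.exp b * (Real.exp |a - b| - 1) := by
  have h1 : Real.exp a = Real.exp b * Real.exp (a - b) := by rw [← Real.exp_add]; congr 1; ring
  have h2 : Real.exp (a - b) ≤ Real.exp |a - b| := Real.exp_le_exp.mpr (le_abs_self _)
  have h3 : 2 ≤ Real.exp (a - b) + Real.exp |a - b| := by
    have h4 : 1 + (a - b) ≤ Real.exp (a - b) := by linarith [Real.add_one_le_exp (a - b)]
    have h5 := Real.add_one_le_exp |a - b|
    linarith [neg_abs_le (a - b)]
  rw [h1, ← mul_sub_one, abs_mul, abs_of_pos (Real.exp_pos b)]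
  gcongr
  rw [abs_le]
  constructor <;> linarith

theorem eLpNorm_two_eq {X : Type*} [MeasurableSpace X] {μ : Measure X} (f : X → ℂ) :
    eLpNorm f 2 μ = (∫⁻ x, ‖f x‖ₑ ^ 2 ∂μ) ^ (1 / 2 : ℝ) := by
  rw [eLpNorm_eq_lintegral_rpow_enorm_toReal (by norm_num) (by norm_num)]
  simp

theorem lintegral_indicator_exp_neg {a : ℝ} (ha : 0 < a) :
    ∫⁻ t, (Set.Ici (0 : ℝ)).indicator (fun t => ENNReal.ofReal (Real.exp (-a * t))) t =
      ENNReal.ofReal a⁻¹ := by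
  rw [lintegral_indicator measurableSet_Ici, setLIntegral_congr Ioi_ae_eq_Ici.symm,
    ← ofReal_integral_eq_lintegral_ofReal]
  · rw [integral_exp_mul_Ioi (by linarith)]
    simp
  · exact integrableOn_exp_mul_Ioi (by linarith) 0
  · exact Filter.Eventually.of_forall fun t => (Real.exp_pos _).le

theorem memLp_two_of_le_exp {f : ℝ → ℂ} (hf : Measurable f) {C a : ℝ} (ha : 0 < a)
    (hneg : ∀ t, t < 0 → f t = 0) (hle : ∀ t, 0 ≤ t → ‖f t‖ ≤ C * Real.exp (-a * t)) :
    MemLp f 2 volume ∧ Integrable f ∧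
      ∫⁻ t, ‖f t‖ₑ ^ 2 ≤ ENNReal.ofReal (C ^ 2 * (2 * a)⁻¹) := by
  have hC : 0 ≤ C := by
    have := (norm_nonneg _).trans (hle 0 le_rfl)
    simpa using this
  have h1 : ∫⁻ t, ‖f t‖ₑ ^ 2 ≤ ENNReal.ofReal (C ^ 2 * (2 * a)⁻¹) := by
    calc ∫⁻ t, ‖f t‖ₑ ^ 2 ≤ ∫⁻ t, ENNReal.ofReal (C ^ 2) * (Set.Ici (0 : ℝ)).indicator
          (fun t => ENNReal.ofReal (Real.exp (-(2 * a) * t))) t := by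
          refine lintegral_mono fun t => ?_
          rcases lt_or_ge t 0 with ht | ht
          · simp [hneg t ht]
          · rw [Set.indicator_of_mem (Set.mem_Ici.mpr ht), ← ENNReal.ofReal_mul (by positivity),
              ← ofReal_norm, ← ENNReal.ofReal_pow (norm_nonneg _)]
            apply ENNReal.ofReal_le_ofReal
            calc ‖f t‖ ^ 2 ≤ (C * Real.exp (-a * t)) ^ 2 := by gcongr; exact hle t ht
              _ = _ := by rw [mul_pow, ← Real.exp_nat_mul]; congr 2; push_cast; ring
      _ = _ := by
          rw [lintegral_const_mul', lintegral_indicator_exp_neg (by positivity),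
            ENNReal.ofReal_mul (by positivity)]
          exact ENNReal.ofReal_ne_top
  refine ⟨⟨hf.aestronglyMeasurable, ?_⟩, ⟨hf.aestronglyMeasurable, ?_⟩, h1⟩
  · rw [eLpNorm_two_eq]
    exact ENNReal.rpow_lt_top_of_nonneg (by norm_num) (h1.trans_lt ENNReal.ofReal_lt_top).ne
  · calc ∫⁻ t, ‖f t‖ₑ ≤ ∫⁻ t, ENNReal.ofReal C * (Set.Ici (0 : ℝ)).indicator
          (fun t => ENNReal.ofReal (Real.exp (-a * t))) t := by
          refine lintegral_mono fun t => ?_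
          rcases lt_or_ge t 0 with ht | ht
          · simp [hneg t ht]
          · rw [Set.indicator_of_mem (Set.mem_Ici.mpr ht), ← ENNReal.ofReal_mul hC, ← ofReal_norm]
            exact ENNReal.ofReal_le_ofReal (hle t ht)
      _ = ENNReal.ofReal C * ENNReal.ofReal a⁻¹ := by
          rw [lintegral_const_mul', lintegral_indicator_exp_neg ha]
          exact ENNReal.ofReal_ne_top
      _ < ⊤ := ENNReal.mul_lt_top ENNReal.ofReal_lt_top ENNReal.ofReal_lt_top

/-- A causal kernel `K` with exponential decay, and its resolvent `R = K + R ⋆ K`. -/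
structure IsResolvent (K R : ℝ → ℂ) (C ν κ : ℝ) : Prop where
  measurable_kernel : Measurable K
  measurable_resolvent : Measurable R
  kernel_neg : ∀ t, t < 0 → K t = 0
  resolvent_neg : ∀ t, t < 0 → R t = 0
  kernel_le : ∀ t, 0 ≤ t → ‖K t‖ ≤ C * Real.exp (-ν * t)
  integrable_conv : ∀ t, Integrable fun s => R s * K (t - s)
  eq : ∀ t, R t = K t + ∫ s, R s * K (t - s)
  stable : ∀ ζ : ℂ, ζ.re < ν → κ ≤ ‖1 - ∫ t : ℝ, Complex.exp (ζ * t) * K t‖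

variable {K R : ℝ → ℂ} {C ν κ : ℝ}

/-- The extra weight e^(m(t)), m(t) = δ min(t, 2n-t), is bounded, so the left side is finite
beforehand. It is also δ-Lipschitz in the exponent, so commuting it with the convolution by K
produces an operator of norm at most κ/2 on L². Half of the coercivity constant κ on the line Re ζ =
μ survives. -/
theorem IsResolvent.truncated_bound (h : IsResolvent K R C ν κ) (hC : 0 < C) (hν : 0 < ν)
    (hκ : 0 < κ) {μ δ : ℝ} (hμ : μ ≤ ν / 2) (hδ : 0 < δ) (hδν : δ ≤ ν / 8)
    (hsmall : C * δ * 32 / ν ^ 2 ≤ κ / 2)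
    (hR2 : MemLp (fun t => (Real.exp (μ * t) : ℂ) * R t) 2 volume) (n : ℝ) :
    ENNReal.ofReal (κ / 2) * eLpNorm (fun t =>
        (Real.exp (μ * t + δ * min t (2 * n - t)) : ℂ) * R t) 2 volume ≤
      eLpNorm (fun t => (Real.exp ((μ + δ) * t) : ℂ) * K t) 2 volume := by
  set m : ℝ → ℝ := fun t => δ * min t (2 * n - t) with hm
  set g : ℝ → ℂ := fun t => (Real.exp (μ * t + m t) : ℂ) * R t with hg
  set k : ℝ → ℂ := fun t => (Real.exp (μ * t) : ℂ) * K t with hk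
  have hmc : Continuous m := by simp only [hm]; fun_prop
  have hmle : ∀ t s, |m t - m s| ≤ δ * |t - s| := by
    intro t s
    simp only [hm]
    rw [← mul_sub, abs_mul, abs_of_pos hδ]
    refine mul_le_mul_of_nonneg_left ?_ hδ.le
    refine (abs_min_sub_min_le_max t (2 * n - t) s (2 * n - s)).trans (max_le le_rfl ?_)
    rw [show 2 * n - t - (2 * n - s) = -(t - s) by ring, abs_neg]
  have hk1 : Integrable k := by
    refine (memLp_two_of_le_exp (C := C) (a := ν / 2) ?_ (by positivity) ?_ ?_).2.1
    · have := h.measurable_kernel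
      simp only [hk]; fun_prop
    · intro t ht; simp [hk, h.kernel_neg t ht]
    · intro t ht
      rw [hk, norm_mul, Complex.norm_real, Real.norm_of_nonneg (Real.exp_pos _).le]
      calc Real.exp (μ * t) * ‖K t‖ ≤ Real.exp (ν / 2 * t) * (C * Real.exp (-ν * t)) := by
            gcongr
            exact h.kernel_le t ht
        _ = C * Real.exp (-(ν / 2) * t) := by
            rw [mul_left_comm, ← Real.exp_add]; congr 2; ring
  have hgm : Measurable g := by
    have := h.measurable_resolvent
    have := hmc.measurable
    simp only [hg]; fun_prop
  have hgeq : ∀ t, g t = (Real.exp (m t) : ℂ) * ((Real.exp (μ * t) : ℂ) * R t) := by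
    intro t
    simp only [hg]
    rw [← mul_assoc, ← Complex.ofReal_mul, ← Real.exp_add, add_comm]
  have hg2 : MemLp g 2 volume := by
    refine MemLp.of_le_mul (c := Real.exp (δ * n)) hR2 hgm.aestronglyMeasurable ?_
    filter_upwards with t
    rw [hgeq, norm_mul, Complex.norm_real, Real.norm_of_nonneg (Real.exp_pos _).le]
    gcongr
    simp only [hm]
    gcongr
    rcases le_total t n with h1 | h1
    · exact (min_le_left _ _).trans h1
    · exact (min_le_right _ _).trans (by linarith)
  -- On t ≥ 0 the factor e^(m(t)) ≤ e^(2δn-δt) is square integrable. Integrability of g is required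
  -- by the convolution theorem behind the coercivity bound.
  have hg1 : Integrable g := by
    have h1 : MemLp ((Set.Ici (0 : ℝ)).indicator fun t => (Real.exp (m t) : ℂ)) 2 volume := by
      refine (memLp_two_of_le_exp (C := Real.exp (2 * δ * n)) (a := δ) ?_ hδ ?_ ?_).1
      · have := hmc.measurable
        exact Measurable.indicator (by fun_prop) measurableSet_Ici
      · intro t ht; simp [ht]
      · intro t ht
        rw [Set.indicator_of_mem (Set.mem_Ici.mpr ht), Complex.norm_real,
          Real.norm_of_nonneg (Real.exp_pos _).le, ← Real.exp_add, Real.exp_le_exp]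
        simp only [hm]
        have := min_le_right t (2 * n - t)
        nlinarith
    refine (h1.integrable_mul hR2).congr (Filter.Eventually.of_forall fun t => ?_)
    rcases lt_or_ge t 0 with ht | ht
    · simp [hg, h.resolvent_neg t ht]
    · simp only [Pi.mul_apply]
      rw [Set.indicator_of_mem (Set.mem_Ici.mpr ht), hgeq]
  -- The Fourier transform of e^(μt)K is the Laplace transform of K on the line Re ζ = μ, inside the
  -- stable half plane.
  have hfour : ∀ ω, κ ≤ ‖1 - 𝓕 k ω‖ := by
    intro ω
    have h1 := h.stable (μ - 2 * Real.pi * ω * Complex.I) (by simp; linarith)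
    convert h1 using 3
    rw [Real.fourier_real_eq_integral_exp_smul]
    congr with t
    simp only [hk]
    rw [smul_eq_mul, Complex.ofReal_exp, ← mul_assoc, ← Complex.exp_add]
    congr 2
    push_cast
    ring
  have hcoer := mul_eLpNorm_le_of_fourier_ge hk1 hg1 hg2 hκ hfour
  -- Majorant of the commutator kernel, from |e^(m(t)) - e^(m(s))| ≤ e^(m(s)) (e^(δ|t-s|) - 1). Its
  -- mass is at most 32Cδ/ν² ≤ κ/2.
  set kt : ℝ → ℝ≥0∞ := fun u =>
    ENNReal.ofReal (Real.exp (μ * u) * (Real.exp (δ * |u|) - 1) * ‖K u‖) with hkt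
  have hktm : Measurable kt := by
    have := h.measurable_kernel
    simp only [hkt]; fun_prop
  have hktint : ∫⁻ u, kt u ≤ ENNReal.ofReal (κ / 2) := by
    calc ∫⁻ u, kt u ≤ ∫⁻ u, ENNReal.ofReal (C * δ * 8 / ν) * (Set.Ici (0 : ℝ)).indicator
          (fun t => ENNReal.ofReal (Real.exp (-(ν / 4) * t))) u := by
          refine lintegral_mono fun u => ?_
          rcases lt_or_ge u 0 with hu | hu
          · simp [hkt, h.kernel_neg u hu]
          · rw [Set.indicator_of_mem (Set.mem_Ici.mpr hu), ← ENNReal.ofReal_mul (by positivity)]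
            apply ENNReal.ofReal_le_ofReal
            rw [abs_of_nonneg hu]
            have h1 : Real.exp (δ * u) - 1 ≤ δ * u * Real.exp (δ * u) := by
              have h2 := Real.add_one_le_exp (-(δ * u))
              rw [Real.exp_neg] at h2
              have h3 := Real.exp_pos (δ * u)
              have h4 : (-(δ * u) + 1) * Real.exp (δ * u) ≤ 1 := by
                calc _ ≤ (Real.exp (δ * u))⁻¹ * Real.exp (δ * u) := by gcongr
                  _ = 1 := inv_mul_cancel₀ h3.ne'
              linarith
            have h2 : u ≤ 8 / ν * Real.exp (ν / 8 * u) := by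
              have h3 := Real.add_one_le_exp (ν / 8 * u)
              rw [div_mul_eq_mul_div, le_div_iff₀ hν]
              nlinarith
            have h0 : 0 ≤ Real.exp (δ * u) - 1 := by
              linarith [Real.one_le_exp (by positivity : 0 ≤ δ * u)]
            calc Real.exp (μ * u) * (Real.exp (δ * u) - 1) * ‖K u‖
                ≤ Real.exp (ν / 2 * u) * (δ * (8 / ν * Real.exp (ν / 8 * u)) *
                  Real.exp (ν / 8 * u)) * (C * Real.exp (-ν * u)) := by
                  gcongr
                  · exact h1.trans (by gcongr)
                  · exact h.kernel_le u hu
              _ = C * δ * 8 / ν * (Real.exp (ν / 2 * u) * Real.exp (ν / 8 * u) *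
                  Real.exp (ν / 8 * u) * Real.exp (-ν * u)) := by ring
              _ = C * δ * 8 / ν * Real.exp (-(ν / 4) * u) := by
                  rw [← Real.exp_add, ← Real.exp_add, ← Real.exp_add]; congr 2; ring
      _ = ENNReal.ofReal (C * δ * 8 / ν) * ENNReal.ofReal (ν / 4)⁻¹ := by
          rw [lintegral_const_mul', lintegral_indicator_exp_neg (by positivity)]
          exact ENNReal.ofReal_ne_top
      _ ≤ _ := by
          rw [← ENNReal.ofReal_mul (by positivity)]
          apply ENNReal.ofReal_le_ofReal
          refine le_trans (le_of_eq ?_) hsmall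
          field_simp
          norm_num
  have hpt : ∀ t, ‖g t - ∫ s, g s * k (t - s)‖ₑ ≤
      ‖(Real.exp ((μ + δ) * t) : ℂ) * K t‖ₑ + ∫⁻ s, kt (t - s) * ‖g s‖ₑ := by
    intro t
    have hgk : ∀ s, g s * k (t - s) =
        (Real.exp (μ * t + m s) : ℂ) * (R s * K (t - s)) := by
      intro s
      simp only [hg, hk]
      have : Real.exp (μ * t + m s) = Real.exp (μ * s + m s) * Real.exp (μ * (t - s)) := by
        rw [← Real.exp_add]; congr 1; ring
      rw [this]; push_cast; ring
    have hbd : ∀ s, ‖(Real.exp (μ * t + m t) : ℂ) * (R s * K (t - s)) - g s * k (t - s)‖ₑ ≤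
        kt (t - s) * ‖g s‖ₑ := by
      intro s
      rw [hgk, ← sub_mul, ← Complex.ofReal_sub, ← ofReal_norm, ← ofReal_norm (g s), hkt,
        ← ENNReal.ofReal_mul']
      · apply ENNReal.ofReal_le_ofReal
        rw [norm_mul, norm_mul, Complex.norm_real, Real.norm_eq_abs]
        have h1 := abs_exp_sub_exp_le (μ * t + m t) (μ * t + m s)
        rw [add_sub_add_left_eq_sub] at h1
        have h2 : Real.exp |m t - m s| ≤ Real.exp (δ * |t - s|) := Real.exp_le_exp.mpr (hmle t s)
        have h3 : ‖g s‖ = Real.exp (μ * s + m s) * ‖R s‖ := by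
          simp only [hg]
          rw [norm_mul, Complex.norm_real, Real.norm_of_nonneg (Real.exp_pos _).le]
        rw [h3]
        calc _ ≤ Real.exp (μ * t + m s) * (Real.exp (δ * |t - s|) - 1) * (‖R s‖ * ‖K (t - s)‖) := by
              refine mul_le_mul_of_nonneg_right (h1.trans ?_) (by positivity)
              gcongr
          _ = (Real.exp (μ * (t - s)) * Real.exp (μ * s + m s)) * (Real.exp (δ * |t - s|) - 1) *
              (‖R s‖ * ‖K (t - s)‖) := by
              rw [← Real.exp_add]; congr 3; ring
          _ = _ := by ring
      · exact norm_nonneg _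
    have hbase := h.integrable_conv t
    have hint2 : Integrable fun s => g s * k (t - s) := by
      have h1 : Integrable fun s => (Real.exp (μ * t + δ * |n|) : ℂ) * (R s * K (t - s)) :=
        hbase.const_mul _
      refine h1.mono ?_ ?_
      · have := h.measurable_kernel
        have := hgm
        refine Measurable.aestronglyMeasurable ?_
        simp only [hk]; fun_prop
      · filter_upwards with s
        rw [hgk, norm_mul, norm_mul _ (R s * K (t - s)), Complex.norm_real, Complex.norm_real,
          Real.norm_of_nonneg (Real.exp_pos _).le, Real.norm_of_nonneg (Real.exp_pos _).le]
        gcongr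
        simp only [hm]
        gcongr
        rcases le_total s n with h1 | h1
        · exact (min_le_left _ _).trans (h1.trans (le_abs_self n))
        · exact (min_le_right _ _).trans ((by linarith : 2 * n - s ≤ n).trans (le_abs_self n))
    -- The weighted resolvent equation: only the weighted source and the commutator remain.
    have hsplit : g t - ∫ s, g s * k (t - s) = (Real.exp (μ * t + m t) : ℂ) * K t +
        ∫ s, ((Real.exp (μ * t + m t) : ℂ) * (R s * K (t - s)) - g s * k (t - s)) := by
      rw [integral_sub (hbase.const_mul _) hint2, integral_const_mul]
      have : g t = (Real.exp (μ * t + m t) : ℂ) * (K t + ∫ s, R s * K (t - s)) := by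
        rw [← h.eq t]
      rw [this]; ring
    rw [hsplit]
    refine (enorm_add_le _ _).trans (add_le_add ?_ ?_)
    · rw [enorm_mul, enorm_mul]
      gcongr
      rw [← ofReal_norm, ← ofReal_norm, Complex.norm_real, Complex.norm_real,
        Real.norm_of_nonneg (Real.exp_pos _).le, Real.norm_of_nonneg (Real.exp_pos _).le]
      apply ENNReal.ofReal_le_ofReal
      rw [Real.exp_le_exp]
      simp only [hm]
      have := min_le_left t (2 * n - t)
      nlinarith
    · exact (enorm_integral_le_lintegral_enorm _).trans (lintegral_mono hbd)
  have hbm : Measurable fun t => ∫⁻ s, kt (t - s) * ‖g s‖ₑ := by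
    refine Measurable.lintegral_prod_right' (f := fun p : ℝ × ℝ => kt (p.1 - p.2) * ‖g p.2‖ₑ) ?_
    fun_prop
  have hKm : Measurable fun t => ‖(Real.exp ((μ + δ) * t) : ℂ) * K t‖ₑ := by
    have := h.measurable_kernel
    fun_prop
  have hnorm : eLpNorm (fun t => g t - ∫ s, g s * k (t - s)) 2 volume ≤
      eLpNorm (fun t => (Real.exp ((μ + δ) * t) : ℂ) * K t) 2 volume +
        ENNReal.ofReal (κ / 2) * eLpNorm g 2 volume := by
    rw [eLpNorm_two_eq, eLpNorm_two_eq, eLpNorm_two_eq]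
    calc (∫⁻ t, ‖g t - ∫ s, g s * k (t - s)‖ₑ ^ 2) ^ (1 / 2 : ℝ)
        ≤ (∫⁻ t, (((fun t => ‖(Real.exp ((μ + δ) * t) : ℂ) * K t‖ₑ) +
          (fun t => ∫⁻ s, kt (t - s) * ‖g s‖ₑ)) t) ^ (2 : ℝ)) ^ (1 / 2 : ℝ) := by
          gcongr with t
          rw [ENNReal.rpow_two]
          gcongr
          exact hpt t
      _ ≤ (∫⁻ t, ‖(Real.exp ((μ + δ) * t) : ℂ) * K t‖ₑ ^ (2 : ℝ)) ^ (1 / 2 : ℝ) +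
          (∫⁻ t, (∫⁻ s, kt (t - s) * ‖g s‖ₑ) ^ (2 : ℝ)) ^ (1 / 2 : ℝ) :=
          ENNReal.lintegral_Lp_add_le hKm.aemeasurable hbm.aemeasurable (by norm_num)
      _ ≤ _ := by
          simp only [ENNReal.rpow_two]
          gcongr
          refine (ENNReal.rpow_le_rpow (lintegral_convolution_sq_le hktm hgm.enorm)
            (by norm_num)).trans ?_
          rw [ENNReal.mul_rpow_of_nonneg _ _ (by norm_num), ← ENNReal.rpow_natCast,
            ← ENNReal.rpow_mul]
          norm_num
          gcongr
  have hfin := hcoer.trans hnorm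
  -- The commutator is absorbed in the left side; the subtraction is legitimate because g has finite
  -- norm.
  have h1 : ENNReal.ofReal κ = ENNReal.ofReal (κ / 2) + ENNReal.ofReal (κ / 2) := by
    rw [← ENNReal.ofReal_add (by positivity) (by positivity)]; congr 1; ring
  rw [h1, add_mul] at hfin
  exact (ENNReal.add_le_add_iff_right
    (ENNReal.mul_ne_top ENNReal.ofReal_ne_top hg2.2.ne)).mp hfin

/-- The truncated bound does not depend on n, and the truncation disappears as n → ∞ by Fatou's
lemma. -/
theorem IsResolvent.step (h : IsResolvent K R C ν κ) (hC : 0 < C) (hν : 0 < ν)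
    (hκ : 0 < κ) {μ δ : ℝ} (hμ : μ ≤ ν / 2) (hδ : 0 < δ) (hδν : δ ≤ ν / 8)
    (hsmall : C * δ * 32 / ν ^ 2 ≤ κ / 2)
    (hR2 : MemLp (fun t => (Real.exp (μ * t) : ℂ) * R t) 2 volume) :
    ENNReal.ofReal (κ / 2) * eLpNorm (fun t => (Real.exp ((μ + δ) * t) : ℂ) * R t) 2 volume ≤
      eLpNorm (fun t => (Real.exp ((μ + δ) * t) : ℂ) * K t) 2 volume := by
  set F : ℕ → ℝ → ℂ := fun n t => (Real.exp (μ * t + δ * min t (2 * n - t)) : ℂ) * R t with hF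
  have hm := h.measurable_resolvent
  have h1 : eLpNorm (fun t => (Real.exp ((μ + δ) * t) : ℂ) * R t) 2 volume ≤
      Filter.liminf (fun n => eLpNorm (F n) 2 volume) Filter.atTop := by
    apply Lp.eLpNorm_lim_le_liminf_eLpNorm
    · intro n
      refine Measurable.aestronglyMeasurable ?_
      simp only [hF]; fun_prop
    · filter_upwards with t
      apply tendsto_const_nhds.congr'
      obtain ⟨N, hN⟩ := exists_nat_ge t
      filter_upwards [Filter.eventually_ge_atTop N] with n hn
      have : (N : ℝ) ≤ n := by exact_mod_cast hn
      simp only [hF]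
      rw [min_eq_left (by linarith)]
      congr 3; ring
  have h2 : Filter.liminf (fun n => eLpNorm (F n) 2 volume) Filter.atTop ≤
      (ENNReal.ofReal (κ / 2))⁻¹ *
        eLpNorm (fun t => (Real.exp ((μ + δ) * t) : ℂ) * K t) 2 volume := by
    refine Filter.liminf_le_of_le (by isBoundedDefault) fun b hb => ?_
    obtain ⟨n, hn⟩ := hb.exists
    refine hn.trans ?_
    rw [← ENNReal.div_eq_inv_mul, ENNReal.le_div_iff_mul_le (Or.inl (by simpa using hκ))
      (Or.inl ENNReal.ofReal_ne_top), mul_comm]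
    exact h.truncated_bound hC hν hκ hμ hδ hδν hsmall hR2 n
  have h3 := h1.trans h2
  rwa [← ENNReal.div_eq_inv_mul, ENNReal.le_div_iff_mul_le (Or.inl (by simpa using hκ))
      (Or.inl ENNReal.ofReal_ne_top), mul_comm] at h3

end Step

end LandauDamping

namespace LandauDamping

/-! ### Integrated exponential decay of resolvents. -/

section ResolventBound

variable {K R : ℝ → ℂ} {C ν κ : ℝ}

/-- The growth bound puts R in L² with weight e^(-(c+1)t). Since δ is fixed, finitely many
applications of `IsResolvent.step` bring the weight above e^(νt/4). The estimate kept is that of the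
last application alone, so its constant knows neither B nor c. Cauchy–Schwarz against e^(-νt/8) then
turns L² into L¹. -/
theorem IsResolvent.lintegral_le (h : IsResolvent K R C ν κ) (hC : 0 < C) (hν : 0 < ν)
    (hκ : 0 < κ) {B c : ℝ} (hR : ∀ t, 0 ≤ t → ‖R t‖ ≤ B * Real.exp (c * t)) (hc : 0 < c) :
    ∫⁻ t, ENNReal.ofReal (Real.exp (ν / 8 * t)) * ‖R t‖ₑ ≤ ENNReal.ofReal (4 * C / (κ * ν)) := by
  have hm := h.measurable_resolvent
  have hmK := h.measurable_kernel
  set δ := min (ν / 8) (κ * ν ^ 2 / (64 * C)) with hδdef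
  have hδ : 0 < δ := lt_min (by positivity) (by positivity)
  have hδν : δ ≤ ν / 8 := min_le_left _ _
  have hsmall : C * δ * 32 / ν ^ 2 ≤ κ / 2 := by
    have h1 : δ ≤ κ * ν ^ 2 / (64 * C) := min_le_right _ _
    rw [le_div_iff₀ (by positivity)] at h1
    rw [div_le_iff₀ (by positivity)]
    linarith
  have hexpK : ∀ μ, μ ≤ 3 * ν / 8 →
      MemLp (fun t => (Real.exp (μ * t) : ℂ) * K t) 2 volume ∧
      ∫⁻ t, ‖(Real.exp (μ * t) : ℂ) * K t‖ₑ ^ 2 ≤ ENNReal.ofReal (C ^ 2 * (2 * (ν / 2))⁻¹) := by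
    intro μ hμ
    have h1 := memLp_two_of_le_exp (f := fun t => (Real.exp (μ * t) : ℂ) * K t) (C := C)
      (a := ν / 2) (by fun_prop) (by positivity) (fun t ht => by simp [h.kernel_neg t ht]) ?_
    · exact ⟨h1.1, h1.2.2⟩
    · intro t ht
      rw [norm_mul, Complex.norm_real, Real.norm_of_nonneg (Real.exp_pos _).le]
      calc Real.exp (μ * t) * ‖K t‖ ≤ Real.exp (ν / 2 * t) * (C * Real.exp (-ν * t)) := by
            gcongr
            · linarith
            · exact h.kernel_le t ht
        _ = C * Real.exp (-(ν / 2) * t) := by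
            rw [mul_left_comm, ← Real.exp_add]; congr 2; ring
  set μ₀ := -(c + 1) with hμ₀
  have hall : ∀ n : ℕ, μ₀ + n * δ ≤ 3 * ν / 8 →
      MemLp (fun t => (Real.exp ((μ₀ + n * δ) * t) : ℂ) * R t) 2 volume := by
    intro n
    induction n with
    | zero =>
      intro _
      refine (memLp_two_of_le_exp (C := B) (a := 1) (by fun_prop) one_pos
        (fun t ht => by simp [h.resolvent_neg t ht]) ?_).1
      intro t ht
      rw [norm_mul, Complex.norm_real, Real.norm_of_nonneg (Real.exp_pos _).le]
      calc _ ≤ Real.exp ((μ₀ + (0 : ℕ) * δ) * t) * (B * Real.exp (c * t)) := by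
            gcongr
            exact hR t ht
        _ = B * Real.exp (-1 * t) := by
            rw [mul_left_comm, ← Real.exp_add]; congr 2; rw [hμ₀]; push_cast; ring
    | succ n ih =>
      intro hn
      have e : ((n + 1 : ℕ) : ℝ) = n + 1 := by push_cast; ring
      rw [e] at hn ⊢
      have h1 := h.step hC hν hκ (μ := μ₀ + n * δ) (δ := δ) (by linarith) hδ hδν hsmall
        (ih (by linarith))
      have h2 : μ₀ + n * δ + δ = μ₀ + (n + 1) * δ := by ring
      rw [h2] at h1
      refine ⟨(by fun_prop : Measurable _).aestronglyMeasurable, ?_⟩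
      by_contra h3
      rw [not_lt, top_le_iff] at h3
      rw [h3, ENNReal.mul_top (by simpa using hκ), top_le_iff] at h1
      exact (hexpK _ hn).1.2.ne h1
  -- The last step ends between ν/4 and ν/4 + ν/8 = 3ν/8, a range in which the weighted kernel is
  -- still square integrable.
  obtain ⟨n, hn1, hn2⟩ : ∃ n : ℕ, μ₀ + n * δ ≤ ν / 4 ∧ ν / 4 ≤ μ₀ + n * δ + δ := by
    refine ⟨⌊(ν / 4 - μ₀) / δ⌋₊, ?_, ?_⟩
    · have h0 : 0 ≤ (ν / 4 - μ₀) / δ := div_nonneg (by rw [hμ₀]; linarith) hδ.le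
      have := Nat.floor_le h0
      rw [le_div_iff₀ hδ] at this
      linarith
    · have := (Nat.lt_floor_add_one ((ν / 4 - μ₀) / δ)).le
      rw [div_le_iff₀ hδ] at this
      linarith
  have hstep := h.step hC hν hκ (μ := μ₀ + n * δ) (δ := δ) (by linarith) hδ hδν hsmall
    (hall n (by linarith))
  set μ := μ₀ + n * δ + δ with hμ
  have hK2 := (hexpK μ (by linarith)).2
  set Q := eLpNorm (fun t => (Real.exp (μ * t) : ℂ) * R t) 2 volume with hQ
  have hQle : ENNReal.ofReal (κ / 2) * Q ≤ ENNReal.ofReal (C ^ 2 * (2 * (ν / 2))⁻¹) ^ (1 / 2 : ℝ) := by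
    refine hstep.trans ?_
    rw [eLpNorm_two_eq]
    gcongr
  set e : ℝ → ℝ≥0∞ := (Set.Ici (0 : ℝ)).indicator
    (fun t => ENNReal.ofReal (Real.exp (-(ν / 8) * t))) with he
  have hem : Measurable e := Measurable.indicator (by fun_prop) measurableSet_Ici
  have hCS : ∫⁻ t, ENNReal.ofReal (Real.exp (ν / 8 * t)) * ‖R t‖ₑ ≤
      ENNReal.ofReal (2 * (ν / 8))⁻¹ ^ (1 / 2 : ℝ) * Q := by
    calc ∫⁻ t, ENNReal.ofReal (Real.exp (ν / 8 * t)) * ‖R t‖ₑ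
        ≤ ∫⁻ t, (e * fun t => ‖(Real.exp (μ * t) : ℂ) * R t‖ₑ) t := by
          refine lintegral_mono fun t => ?_
          rcases lt_or_ge t 0 with ht | ht
          · simp [h.resolvent_neg t ht]
          · simp only [Pi.mul_apply, he]
            rw [Set.indicator_of_mem (Set.mem_Ici.mpr ht), enorm_mul, ← mul_assoc]
            gcongr
            rw [← ofReal_norm, Complex.norm_real, Real.norm_of_nonneg (Real.exp_pos _).le,
              ← ENNReal.ofReal_mul (Real.exp_pos _).le, ← Real.exp_add]
            apply ENNReal.ofReal_le_ofReal
            rw [Real.exp_le_exp]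
            nlinarith
      _ ≤ (∫⁻ t, e t ^ (2 : ℝ)) ^ (1 / 2 : ℝ) *
          (∫⁻ t, ‖(Real.exp (μ * t) : ℂ) * R t‖ₑ ^ (2 : ℝ)) ^ (1 / 2 : ℝ) :=
          ENNReal.lintegral_mul_le_Lp_mul_Lq _ Real.HolderConjugate.two_two hem.aemeasurable
            (by fun_prop)
      _ = _ := by
          rw [hQ, eLpNorm_two_eq]
          simp only [ENNReal.rpow_two]
          congr 2
          rw [← lintegral_indicator_exp_neg (by positivity)]
          congr with t
          simp only [he]
          rcases lt_or_ge t 0 with ht | ht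
          · simp [ht]
          · rw [Set.indicator_of_mem (Set.mem_Ici.mpr ht), Set.indicator_of_mem (Set.mem_Ici.mpr ht),
              ← ENNReal.ofReal_pow (Real.exp_pos _).le, ← Real.exp_nat_mul]
            congr 2; push_cast; ring
  have hQ2 : Q ≤ (ENNReal.ofReal (κ / 2))⁻¹ *
      ENNReal.ofReal (C ^ 2 * (2 * (ν / 2))⁻¹) ^ (1 / 2 : ℝ) := by
    rwa [← ENNReal.div_eq_inv_mul, ENNReal.le_div_iff_mul_le (Or.inl (by simpa using hκ))
      (Or.inl ENNReal.ofReal_ne_top), mul_comm]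
  refine (hCS.trans (mul_le_mul_right hQ2 _)).trans (le_of_eq ?_)
  rw [← ENNReal.ofReal_inv_of_pos (by positivity), ENNReal.ofReal_rpow_of_nonneg (by positivity)
    (by norm_num), ENNReal.ofReal_rpow_of_nonneg (by positivity) (by norm_num),
    ← ENNReal.ofReal_mul (by positivity), ← ENNReal.ofReal_mul (by positivity)]
  congr 1
  rw [mul_left_comm, ← Real.mul_rpow (by positivity) (by positivity), ← Real.sqrt_eq_rpow]
  have : (2 * (ν / 8))⁻¹ * (C ^ 2 * (2 * (ν / 2))⁻¹) = (2 * C / ν) ^ 2 := by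
    field_simp; norm_num
  rw [this, Real.sqrt_sq (by positivity)]
  field_simp
  norm_num

theorem integral_indicator_conv (F G : ℝ → ℂ) {t : ℝ} (ht : 0 ≤ t) :
    ∫ s, (Set.Ici (0 : ℝ)).indicator F s * (Set.Ici (0 : ℝ)).indicator G (t - s) =
      ∫ s in 0..t, F s * G (t - s) := by
  rw [intervalIntegral.integral_of_le ht, ← integral_Icc_eq_integral_Ioc,
    ← integral_indicator measurableSet_Icc]
  congr with s
  by_cases h1 : 0 ≤ s
  · by_cases h2 : s ≤ t
    · rw [Set.indicator_of_mem (Set.mem_Ici.mpr h1), Set.indicator_of_mem (Set.mem_Ici.mpr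
        (by linarith)), Set.indicator_of_mem (Set.mem_Icc.mpr ⟨h1, h2⟩)]
    · rw [Set.indicator_of_notMem (s := Set.Ici (0 : ℝ)) (a := t - s) (by simp; linarith),
        Set.indicator_of_notMem (s := Set.Icc 0 t) (fun h => h2 h.2)]
      simp
  · rw [Set.indicator_of_notMem (s := Set.Ici (0 : ℝ)) (a := s) (by simpa using h1),
      Set.indicator_of_notMem (s := Set.Icc 0 t) (fun h => h1 h.1)]
    simp

theorem integrable_indicator_conv {F G : ℝ → ℂ} (hF : Continuous F) (hG : Continuous G) (t : ℝ) :
    Integrable fun s => (Set.Ici (0 : ℝ)).indicator F s * (Set.Ici (0 : ℝ)).indicator G (t - s) := by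
  have h1 : IntegrableOn (fun s => F s * G (t - s)) (Set.Icc 0 t) :=
    (Continuous.continuousOn (by fun_prop)).integrableOn_compact isCompact_Icc
  refine (h1.integrable_indicator measurableSet_Icc).congr
    (Filter.Eventually.of_forall fun s => ?_)
  by_cases h1 : 0 ≤ s
  · by_cases h2 : s ≤ t
    · simp only
      rw [Set.indicator_of_mem (Set.mem_Ici.mpr h1), Set.indicator_of_mem (Set.mem_Ici.mpr
        (by linarith)), Set.indicator_of_mem (Set.mem_Icc.mpr ⟨h1, h2⟩)]
    · simp only
      rw [Set.indicator_of_notMem (s := Set.Ici (0 : ℝ)) (a := t - s) (by simp; linarith),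
        Set.indicator_of_notMem (s := Set.Icc 0 t) (fun h => h2 h.2)]
      simp
  · simp only
    rw [Set.indicator_of_notMem (s := Set.Ici (0 : ℝ)) (a := s) (by simpa using h1),
      Set.indicator_of_notMem (s := Set.Icc 0 t) (fun h => h1 h.1)]
    simp

/-- Exponential decay, in an integrated sense, of the resolvent of a stable Volterra kernel. -/
theorem exists_resolvent_bound {K : ℝ → ℂ} (hK : Continuous K) (hC : 0 < C) (hν : 0 < ν)
    (hκ : 0 < κ) (hKC : ∀ t, 0 ≤ t → ‖K t‖ ≤ C * Real.exp (-ν * t))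
    (hst : ∀ ζ : ℂ, ζ.re < ν → κ ≤ ‖1 - ∫ t in Set.Ioi (0 : ℝ), Complex.exp (ζ * t) * K t‖) :
    ∃ R : ℝ → ℂ, Measurable R ∧ (∀ t, t < 0 → R t = 0) ∧
      (∀ t, R t = (Set.Ici (0 : ℝ)).indicator K t +
        ∫ s, R s * (Set.Ici (0 : ℝ)).indicator K (t - s)) ∧
      ∫⁻ t, ENNReal.ofReal (Real.exp (ν / 8 * t)) * ‖R t‖ₑ ≤ ENNReal.ofReal (4 * C / (κ * ν)) := by
  obtain ⟨R, B, hRc, hRB, hReq⟩ := exists_resolvent hK hC (fun t ht => (hKC t ht).trans (by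
    have : Real.exp (-ν * t) ≤ 1 := by rw [Real.exp_le_one_iff]; nlinarith
    nlinarith))
  have heq : ∀ t, (Set.Ici (0 : ℝ)).indicator R t = (Set.Ici (0 : ℝ)).indicator K t +
      ∫ s, (Set.Ici (0 : ℝ)).indicator R s * (Set.Ici (0 : ℝ)).indicator K (t - s) := by
    intro t
    rcases lt_or_ge t 0 with ht | ht
    · rw [Set.indicator_of_notMem (by simpa using ht), Set.indicator_of_notMem (by simpa using ht),
        zero_add]
      symm
      apply integral_eq_zero_of_ae
      filter_upwards with s
      rcases lt_or_ge s 0 with hs | hs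
      · simp [hs]
      · rw [Set.indicator_of_notMem (s := Set.Ici (0 : ℝ)) (a := t - s) (by simp; linarith)]
        simp
    · rw [integral_indicator_conv R K ht, Set.indicator_of_mem (Set.mem_Ici.mpr ht),
        Set.indicator_of_mem (Set.mem_Ici.mpr ht), hReq t ht]
  have hres : IsResolvent ((Set.Ici (0 : ℝ)).indicator K) ((Set.Ici (0 : ℝ)).indicator R) C ν κ :=
    { measurable_kernel := hK.measurable.indicator measurableSet_Ici
      measurable_resolvent := hRc.measurable.indicator measurableSet_Ici
      kernel_neg := fun t ht => by simp [ht]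
      resolvent_neg := fun t ht => by simp [ht]
      kernel_le := fun t ht => by
        rw [Set.indicator_of_mem (Set.mem_Ici.mpr ht)]; exact hKC t ht
      integrable_conv := integrable_indicator_conv hRc hK
      eq := heq
      stable := fun ζ hζ => by
        have h1 : ∫ t : ℝ, Complex.exp (ζ * t) * (Set.Ici (0 : ℝ)).indicator K t =
            ∫ t in Set.Ioi (0 : ℝ), Complex.exp (ζ * t) * K t := by
          rw [← integral_Ici_eq_integral_Ioi, ← integral_indicator measurableSet_Ici]
          congr with t
          rw [Set.indicator_mul_right]
        rw [h1]
        exact hst ζ hζ }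
  refine ⟨(Set.Ici (0 : ℝ)).indicator R, hRc.measurable.indicator measurableSet_Ici,
    fun t ht => by simp [ht], heq, ?_⟩
  refine hres.lintegral_le hC hν hκ (B := B) (c := 2 * C) (fun t ht => ?_) (by positivity)
  rw [Set.indicator_of_mem (Set.mem_Ici.mpr ht)]
  exact hRB t ht

/-- The time-rescaled version of `exists_resolvent_bound`. -/
theorem exists_resolvent_bound_scaled {K : ℝ → ℂ} (hK : Continuous K) (hC : 0 < C) (hν : 0 < ν)
    (hκ : 0 < κ) {b : ℝ} (hb : 0 < b)
    (hKC : ∀ t, 0 ≤ t → ‖K t‖ ≤ C * b * Real.exp (-ν * (b * t)))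
    (hst : ∀ ζ : ℂ, ζ.re < ν →
      κ ≤ ‖1 - ∫ t in Set.Ioi (0 : ℝ), Complex.exp (ζ * b * t) * K t‖) :
    ∃ R : ℝ → ℂ, Measurable R ∧ (∀ t, t < 0 → R t = 0) ∧
      (∀ t, R t = (Set.Ici (0 : ℝ)).indicator K t +
        ∫ s, R s * (Set.Ici (0 : ℝ)).indicator K (t - s)) ∧
      ∫⁻ t, ENNReal.ofReal (Real.exp (ν / 8 * (b * t))) * ‖R t‖ₑ ≤
        ENNReal.ofReal (4 * C / (κ * ν)) := by
  have hb' : (b : ℂ) ≠ 0 := by exact_mod_cast hb.ne'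
  have hind : ∀ t, (Set.Ici (0 : ℝ)).indicator (fun t => (b : ℂ)⁻¹ * K (b⁻¹ * t)) (b * t) =
      (b : ℂ)⁻¹ * (Set.Ici (0 : ℝ)).indicator K t := by
    intro t
    rcases lt_or_ge t 0 with ht | ht
    · rw [Set.indicator_of_notMem (a := t) (by simpa using ht),
        Set.indicator_of_notMem (a := b * t) (by
          rw [Set.mem_Ici, not_le]; exact mul_neg_of_pos_of_neg hb ht), mul_zero]
    · rw [Set.indicator_of_mem (a := t) (Set.mem_Ici.mpr ht), Set.indicator_of_mem (Set.mem_Ici.mpr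
        (by positivity)), inv_mul_cancel_left₀ hb.ne']
  have hb1 : ∀ t, 0 ≤ t → ‖(b : ℂ)⁻¹ * K (b⁻¹ * t)‖ ≤ C * Real.exp (-ν * t) := by
    intro t ht
    rw [norm_mul, norm_inv, Complex.norm_real, Real.norm_of_nonneg hb.le]
    have h1 := hKC (b⁻¹ * t) (by positivity)
    rw [mul_inv_cancel_left₀ hb.ne'] at h1
    rw [inv_mul_le_iff₀ hb]
    linarith
  have hb2 : ∀ ζ : ℂ, ζ.re < ν → κ ≤ ‖1 - ∫ t in Set.Ioi (0 : ℝ),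
      Complex.exp (ζ * t) * ((b : ℂ)⁻¹ * K (b⁻¹ * t))‖ := by
    intro ζ hζ
    have h1 := hst ζ hζ
    have h2 := integral_comp_mul_left_Ioi
      (fun t : ℝ => Complex.exp (ζ * t) * ((b : ℂ)⁻¹ * K (b⁻¹ * t))) 0 hb
    rw [mul_zero] at h2
    have h3 : ∫ t in Set.Ioi (0 : ℝ), Complex.exp (ζ * t) * ((b : ℂ)⁻¹ * K (b⁻¹ * t)) =
        ∫ t in Set.Ioi (0 : ℝ), Complex.exp (ζ * b * t) * K t := by
      have h4 : ∫ t in Set.Ioi (0 : ℝ), Complex.exp (ζ * t) * ((b : ℂ)⁻¹ * K (b⁻¹ * t)) =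
          b * ∫ t in Set.Ioi (0 : ℝ), Complex.exp (ζ * (b * t : ℝ)) *
            ((b : ℂ)⁻¹ * K (b⁻¹ * (b * t))) := by
        rw [h2, Complex.real_smul, ← mul_assoc]
        push_cast
        rw [mul_inv_cancel₀ hb', one_mul]
      rw [h4, ← integral_const_mul]
      congr with t
      rw [inv_mul_cancel_left₀ hb.ne']
      push_cast
      field_simp
    rw [h3]
    exact h1
  -- The rescaled kernel t ↦ b⁻¹K(t/b) has decay rate ν and stability constant κ whatever b is, and
  -- the integral of the resolvent is invariant under the scaling.
  obtain ⟨R, hRm, hRneg, hReq, hRint⟩ := exists_resolvent_bound (C := C) (ν := ν) (κ := κ)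
    (K := fun t => (b : ℂ)⁻¹ * K (b⁻¹ * t)) (by fun_prop) hC hν hκ hb1 hb2
  refine ⟨fun t => b * R (b * t), by fun_prop, fun t ht => by
    change (b : ℂ) * R (b * t) = 0
    rw [hRneg _ (mul_neg_of_pos_of_neg hb ht), mul_zero], fun t => ?_, ?_⟩
  · simp only
    rw [hReq, hind, mul_add, mul_inv_cancel_left₀ hb']
    congr 1
    have h1 := Measure.integral_comp_mul_left (fun s => R s *
      (Set.Ici (0 : ℝ)).indicator (fun t => (b : ℂ)⁻¹ * K (b⁻¹ * t)) (b * t - s)) b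
    rw [abs_of_pos (by positivity)] at h1
    have h2 : ∫ s, R s * (Set.Ici (0 : ℝ)).indicator (fun t => (b : ℂ)⁻¹ * K (b⁻¹ * t))
        (b * t - s) = b * ∫ x, R (b * x) *
        (Set.Ici (0 : ℝ)).indicator (fun t => (b : ℂ)⁻¹ * K (b⁻¹ * t)) (b * t - b * x) := by
      rw [h1, Complex.real_smul, ← mul_assoc]
      push_cast
      rw [mul_inv_cancel₀ hb', one_mul]
    rw [h2, ← integral_const_mul, ← integral_const_mul]
    congr with s
    rw [← mul_sub, hind]
    field_simp
  · refine le_trans (le_of_eq ?_) hRint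
    have hmm : Measurable fun t : ℝ => ENNReal.ofReal (Real.exp (ν / 8 * t)) * ‖R t‖ₑ := by
      fun_prop
    have h1 : ∫⁻ t, ENNReal.ofReal (Real.exp (ν / 8 * t)) * ‖R t‖ₑ =
        ENNReal.ofReal b * ∫⁻ t, ENNReal.ofReal (Real.exp (ν / 8 * (b * t))) * ‖R (b * t)‖ₑ := by
      have h2 := lintegral_map (μ := volume) hmm (measurable_const_mul b)
      rw [Real.map_volume_mul_left hb.ne', lintegral_smul_measure] at h2
      rw [← h2, smul_eq_mul, ← mul_assoc, ← ENNReal.ofReal_mul hb.le, abs_of_pos (by positivity),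
        mul_inv_cancel₀ hb.ne']
      simp
    rw [h1, ← lintegral_const_mul' _ _ ENNReal.ofReal_ne_top]
    congr with t
    rw [enorm_mul, ← ofReal_norm (b : ℂ), Complex.norm_real, Real.norm_of_nonneg hb.le]
    ring

end ResolventBound

end LandauDamping

namespace LandauDamping

/-! ### Weighted L² bounds for Volterra equations. -/

section Volterra

variable {K R φ H : ℝ → ℂ} {T CK Cφ : ℝ}

/-- The solution of a Volterra equation in terms of its resolvent. -/
theorem volterra_eq (hK : Continuous K) (hKb : ∀ t, 0 ≤ t → ‖K t‖ ≤ CK)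
    (hR : Integrable R)
    (hReq : ∀ t, R t = (Set.Ici (0 : ℝ)).indicator K t +
      ∫ s, R s * (Set.Ici (0 : ℝ)).indicator K (t - s))
    (hφ : Integrable φ) (hφb : ∀ t, ‖φ t‖ ≤ Cφ) (t : ℝ)
    (hH : ∀ t, H t = φ t - ∫ u, φ u * (Set.Ici (0 : ℝ)).indicator K (t - u)) :
    φ t = H t + ∫ s, R (t - s) * H s := by
  set K' := (Set.Ici (0 : ℝ)).indicator K with hK'
  have hCK : 0 ≤ CK := (norm_nonneg _).trans (hKb 0 le_rfl)
  have hK'm : Measurable K' := hK.measurable.indicator measurableSet_Ici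
  have hK'b : ∀ t, ‖K' t‖ ≤ CK := fun t => by
    rcases lt_or_ge t 0 with ht | ht
    · rw [hK', Set.indicator_of_notMem (by simpa using ht)]; simpa using hCK
    · rw [hK', Set.indicator_of_mem (Set.mem_Ici.mpr ht)]; exact hKb t ht
  have hRt : Integrable fun s => R (t - s) := hR.comp_sub_left t
  have hprod : Integrable (fun p : ℝ × ℝ => R (t - p.1) * (φ p.2 * K' (p.1 - p.2)))
      (volume.prod volume) := by
    have h1 : Integrable (fun p : ℝ × ℝ => R (t - p.1) * φ p.2) (volume.prod volume) :=
      hRt.mul_prod hφ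
    have h2 := h1.mul_bdd (g := fun p : ℝ × ℝ => K' (p.1 - p.2)) (c := CK)
      (hK'm.comp (measurable_fst.sub measurable_snd)).aestronglyMeasurable
      (Filter.Eventually.of_forall fun p => hK'b _)
    simpa only [mul_assoc] using h2
  have hRφ : Integrable fun s => R (t - s) * φ s :=
    hRt.mul_bdd (c := Cφ) hφ.aestronglyMeasurable (Filter.Eventually.of_forall hφb)
  have hφK : Integrable fun u => φ u * K' (t - u) :=
    hφ.mul_bdd (c := CK) (hK'm.comp (measurable_const.sub measurable_id)).aestronglyMeasurable
      (Filter.Eventually.of_forall fun u => hK'b _)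
  -- Fubini's theorem and the resolvent equation in the form R ⋆ K = R - K.
  have hswap : ∫ s, R (t - s) * ∫ u, φ u * K' (s - u) =
      ∫ u, φ u * (R (t - u) - K' (t - u)) := by
    simp_rw [← integral_const_mul]
    rw [integral_integral_swap hprod]
    congr with u
    have h1 : R (t - u) - K' (t - u) = ∫ s, R s * K' (t - u - s) := by
      rw [hReq (t - u)]; ring
    rw [h1, ← integral_const_mul]
    rw [← integral_sub_left_eq_self _ volume t]
    congr with s
    rw [show t - s - u = t - u - s by ring, sub_sub_cancel]
    ring
  have hH' : ∀ s, R (t - s) * H s = R (t - s) * φ s - R (t - s) * ∫ u, φ u * K' (s - u) := by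
    intro s; rw [hH s]; ring
  have h3 : Integrable fun s => R (t - s) * ∫ u, φ u * K' (s - u) := by
    simpa only [integral_const_mul] using hprod.integral_prod_left
  simp_rw [hH']
  rw [integral_sub hRφ h3, hswap]
  have h4 : ∫ u, φ u * (R (t - u) - K' (t - u)) =
      (∫ s, R (t - s) * φ s) - ∫ u, φ u * K' (t - u) := by
    rw [← integral_sub hRφ hφK]
    congr with u
    ring
  rw [h4, hH t]
  ring

/-- In the representation φ = H + R ⋆ H the weight passes under the convolution at the price
e^(μ(t-s)), against which R is integrable; Young's inequality L¹ ⋆ L² ⊂ L² concludes. -/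
theorem volterra_bound {w : ℝ → ℝ} {μ Cs B : ℝ}
    (hK : Continuous K) (hKb : ∀ t, 0 ≤ t → ‖K t‖ ≤ CK)
    (hRm : Measurable R) (hR0 : ∀ t, t < 0 → R t = 0)
    (hReq : ∀ t, R t = (Set.Ici (0 : ℝ)).indicator K t +
      ∫ s, R s * (Set.Ici (0 : ℝ)).indicator K (t - s))
    (hμ : 0 ≤ μ) (hB : 0 ≤ B)
    (hRB : ∫⁻ t, ENNReal.ofReal (Real.exp (μ * t)) * ‖R t‖ₑ ≤ ENNReal.ofReal B)
    (hφm : Measurable φ) (hφb : ∀ t ∈ Set.Icc 0 T, ‖φ t‖ ≤ Cφ)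
    (heq : ∀ t ∈ Set.Icc 0 T, φ t = H t + ∫ s in 0..t, φ s * K (t - s))
    (hw : Measurable w) (hw0 : ∀ t, 0 ≤ w t) (hCs : 0 ≤ Cs)
    (hws : ∀ τ t, 0 ≤ τ → τ ≤ t → w t ≤ Cs * Real.exp (μ * (t - τ)) * w τ) :
    ∫⁻ t in Set.Icc 0 T, ENNReal.ofReal (w t ^ 2) * ‖φ t‖ₑ ^ 2 ≤
      ENNReal.ofReal (2 * (1 + (Cs * B) ^ 2)) *
        ∫⁻ t in Set.Icc 0 T, ENNReal.ofReal (w t ^ 2) * ‖H t‖ₑ ^ 2 := by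
  rcases lt_or_ge T 0 with hT | hT
  · simp [hT]
  have hCφ : 0 ≤ Cφ := (norm_nonneg _).trans (hφb 0 ⟨le_rfl, hT⟩)
  set K' := (Set.Ici (0 : ℝ)).indicator K with hK'
  set φ' := (Set.Icc (0 : ℝ) T).indicator φ with hφ'
  have hK'm : Measurable K' := hK.measurable.indicator measurableSet_Ici
  have hφ'm : Measurable φ' := hφm.indicator measurableSet_Icc
  have hφ'b : ∀ t, ‖φ' t‖ ≤ Cφ := fun t => by
    by_cases ht : t ∈ Set.Icc 0 T
    · rw [hφ', Set.indicator_of_mem ht]; exact hφb t ht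
    · rw [hφ', Set.indicator_of_notMem ht]; simpa using hCφ
  have hφ'i : Integrable φ' := by
    rw [hφ', integrable_indicator_iff measurableSet_Icc]
    refine Measure.integrableOn_of_bounded (M := Cφ) (by simp) hφm.aestronglyMeasurable ?_
    exact (ae_restrict_iff' measurableSet_Icc).mpr (Filter.Eventually.of_forall hφb)
  have hRi : Integrable R := by
    refine ⟨hRm.aestronglyMeasurable, lt_of_le_of_lt ?_ (ENNReal.ofReal_lt_top (r := B))⟩
    refine le_trans (lintegral_mono fun t => ?_) hRB
    rcases lt_or_ge t 0 with ht | ht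
    · simp [hR0 t ht]
    · refine le_mul_of_one_le_left zero_le ?_
      rw [ENNReal.one_le_ofReal, Real.one_le_exp_iff]
      positivity
  -- The forcing that belongs to the truncated solution on the whole line. It equals H on [0,T] and
  -- vanishes before 0; its values after T do not matter because R is causal.
  set H' : ℝ → ℂ := fun t => φ' t - ∫ u, φ' u * K' (t - u) with hH'
  have hH'm : Measurable H' := by
    refine hφ'm.sub ?_
    have h1 : StronglyMeasurable (Function.uncurry fun t u : ℝ => φ' u * K' (t - u)) :=
      ((hφ'm.comp measurable_snd).mul
        (hK'm.comp (measurable_fst.sub measurable_snd))).stronglyMeasurable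
    exact h1.integral_prod_right.measurable
  have hrep := fun t => volterra_eq (t := t) (H := H') hK hKb hRi hReq hφ'i hφ'b (fun _ => rfl)
  have hH'eq : ∀ t ∈ Set.Icc 0 T, H' t = H t := by
    intro t ht
    have h1 : ∫ u, φ' u * K' (t - u) = ∫ s in 0..t, φ s * K (t - s) := by
      rw [intervalIntegral.integral_of_le ht.1, ← integral_Icc_eq_integral_Ioc,
        ← integral_indicator measurableSet_Icc]
      congr with s
      by_cases h1 : 0 ≤ s
      · by_cases h2 : s ≤ t
        · rw [hφ', hK', Set.indicator_of_mem (Set.mem_Icc.mpr ⟨h1, h2.trans ht.2⟩),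
            Set.indicator_of_mem (Set.mem_Ici.mpr (by linarith)),
            Set.indicator_of_mem (Set.mem_Icc.mpr ⟨h1, h2⟩)]
        · rw [hK', Set.indicator_of_notMem (s := Set.Ici (0 : ℝ)) (by simp; linarith),
            Set.indicator_of_notMem (s := Set.Icc 0 t) (fun h => h2 h.2), mul_zero]
      · rw [hφ', Set.indicator_of_notMem (s := Set.Icc 0 T) (fun h => h1 h.1),
          Set.indicator_of_notMem (s := Set.Icc 0 t) (fun h => h1 h.1), zero_mul]
    simp only [hH']
    rw [h1, hφ', Set.indicator_of_mem ht, heq t ht]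
    ring
  have hH'neg : ∀ t, t < 0 → H' t = 0 := by
    intro t ht
    have h1 : ∫ u, φ' u * K' (t - u) = 0 := by
      apply integral_eq_zero_of_ae
      filter_upwards with u
      rcases lt_or_ge u 0 with hu | hu
      · rw [hφ', Set.indicator_of_notMem (fun h => not_le.mpr hu h.1), zero_mul]; rfl
      · rw [hK', Set.indicator_of_notMem (s := Set.Ici (0 : ℝ)) (by simp; linarith), mul_zero]; rfl
    simp only [hH']
    rw [h1, hφ', Set.indicator_of_notMem (fun h => not_le.mpr ht h.1), sub_zero]
  set g : ℝ → ℝ≥0∞ := (Set.Icc (0 : ℝ) T).indicator (fun t => ENNReal.ofReal (w t) * ‖H' t‖ₑ) with hg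
  have hgm : Measurable g := Measurable.indicator (by fun_prop) measurableSet_Icc
  set k : ℝ → ℝ≥0∞ := fun t => ENNReal.ofReal Cs * (ENNReal.ofReal (Real.exp (μ * t)) * ‖R t‖ₑ)
    with hk
  have hkm : Measurable k := by fun_prop
  have hk1 : ∫⁻ t, k t ≤ ENNReal.ofReal (Cs * B) := by
    rw [hk, lintegral_const_mul' _ _ ENNReal.ofReal_ne_top, ENNReal.ofReal_mul hCs]
    gcongr
  have hpt : ∀ t ∈ Set.Icc 0 T, ENNReal.ofReal (w t) * ‖φ t‖ₑ ≤ g t + ∫⁻ s, k (t - s) * g s := by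
    intro t ht
    have h1 : φ t = H' t + ∫ s, R (t - s) * H' s := by
      rw [← hrep t, hφ', Set.indicator_of_mem ht]
    rw [h1]
    refine (mul_le_mul_right (enorm_add_le _ _) _).trans ?_
    rw [mul_add]
    refine add_le_add ?_ ?_
    · rw [hg, Set.indicator_of_mem ht]
    · refine (mul_le_mul_right (enorm_integral_le_lintegral_enorm _) _).trans ?_
      rw [← lintegral_const_mul' _ _ ENNReal.ofReal_ne_top]
      refine lintegral_mono fun s => ?_
      rw [enorm_mul]
      rcases lt_or_ge s 0 with hs | hs
      · simp [hH'neg s hs]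
      rcases lt_or_ge (t - s) 0 with hts | hts
      · simp [hR0 _ hts]
      rw [hg, Set.indicator_of_mem (Set.mem_Icc.mpr ⟨hs, by linarith [ht.2]⟩)]
      have h2 : ENNReal.ofReal (w t) ≤
          ENNReal.ofReal Cs * ENNReal.ofReal (Real.exp (μ * (t - s))) * ENNReal.ofReal (w s) := by
        rw [← ENNReal.ofReal_mul hCs, ← ENNReal.ofReal_mul (by positivity)]
        exact ENNReal.ofReal_le_ofReal (hws s t hs (by linarith))
      calc _ ≤ (ENNReal.ofReal Cs * ENNReal.ofReal (Real.exp (μ * (t - s))) *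
            ENNReal.ofReal (w s)) * (‖R (t - s)‖ₑ * ‖H' s‖ₑ) := by gcongr
        _ = _ := by simp only [hk]; ring
  have hgint : ∫⁻ t, g t ^ 2 = ∫⁻ t in Set.Icc 0 T, ENNReal.ofReal (w t ^ 2) * ‖H t‖ₑ ^ 2 := by
    rw [← lintegral_indicator measurableSet_Icc]
    congr with t
    by_cases ht : t ∈ Set.Icc 0 T
    · rw [hg, Set.indicator_of_mem ht, Set.indicator_of_mem ht, hH'eq t ht, mul_pow,
        ENNReal.ofReal_pow (hw0 t)]
    · rw [hg, Set.indicator_of_notMem ht, Set.indicator_of_notMem ht]; simp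
  have hadd : ∀ a b : ℝ≥0∞, (a + b) ^ 2 ≤ 2 * a ^ 2 + 2 * b ^ 2 := by
    intro a b
    have := ENNReal.rpow_add_le_mul_rpow_add_rpow a b (p := 2) (by norm_num)
    norm_num at this
    rw [← mul_add]
    exact this
  calc ∫⁻ t in Set.Icc 0 T, ENNReal.ofReal (w t ^ 2) * ‖φ t‖ₑ ^ 2
      ≤ ∫⁻ t in Set.Icc 0 T, (2 * g t ^ 2 + 2 * (∫⁻ s, k (t - s) * g s) ^ 2) := by
        refine setLIntegral_mono' measurableSet_Icc fun t ht => ?_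
        rw [ENNReal.ofReal_pow (hw0 t), ← mul_pow]
        refine (pow_le_pow_left₀ zero_le (hpt t ht) 2).trans (hadd _ _)
    _ ≤ ∫⁻ t, (2 * g t ^ 2 + 2 * (∫⁻ s, k (t - s) * g s) ^ 2) := setLIntegral_le_lintegral _ _
    _ = 2 * (∫⁻ t, g t ^ 2) + 2 * ∫⁻ t, (∫⁻ s, k (t - s) * g s) ^ 2 := by
        rw [lintegral_add_left (by fun_prop), lintegral_const_mul' _ _ (by norm_num),
          lintegral_const_mul' _ _ (by norm_num)]
    _ ≤ 2 * (∫⁻ t, g t ^ 2) + 2 * (ENNReal.ofReal (Cs * B) ^ 2 * ∫⁻ t, g t ^ 2) := by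
        gcongr
        refine (lintegral_convolution_sq_le hkm hgm).trans ?_
        gcongr
    _ = _ := by
        rw [← hgint, ENNReal.ofReal_mul (p := 2) (by norm_num), ENNReal.ofReal_add (by norm_num)
          (by positivity), ENNReal.ofReal_pow (by positivity)]
        norm_num
        ring

end Volterra

end LandauDamping

namespace LandauDamping

/-! ### The torus as a quotient of ℝ^d. -/

section Torus

variable {d : ℕ}

/-- Functions on the torus `ℝ^d / (2πℤ)^d`. -/
def TorusPeriodic {F : Type*} (u : E d → F) : Prop :=
  ∀ (k : Fin d → ℤ) (z : E d), u (z + (2 * Real.pi) • vec k) = u z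

/-- A half-open cube of side `2π`. -/
def cellAt (c : E d) : Set (E d) := {z | ∀ j, z j ∈ Set.Ioc (c j) (c j + 2 * Real.pi)}

theorem cell_eq_cellAt : cell d = cellAt 0 := by
  ext z; simp [cell, cellAt]

theorem measurableSet_cellAt (c : E d) : MeasurableSet (cellAt c) := by
  have : cellAt c = ⋂ j, (fun z : E d => z j) ⁻¹' Set.Ioc (c j) (c j + 2 * Real.pi) := by
    ext z; simp [cellAt]
  rw [this]
  exact MeasurableSet.iInter fun j => (by fun_prop : Measurable fun z : E d => z j) measurableSet_Ioc

theorem measurableSet_cell : MeasurableSet (cell d) := by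
  rw [cell_eq_cellAt]; exact measurableSet_cellAt 0

theorem volume_cell : volume (cell d) = ENNReal.ofReal ((2 * Real.pi) ^ d) := by
  have h1 : cell d = (WithLp.ofLp : E d → _) ⁻¹' (Set.univ.pi fun _ => Set.Ioc 0 (2 * Real.pi)) := by
    ext z; simp [cell]
  rw [h1, (PiLp.volume_preserving_ofLp (Fin d)).measure_preimage
    (MeasurableSet.univ_pi fun _ => measurableSet_Ioc).nullMeasurableSet, volume_pi, Measure.pi_pi]
  simp [ENNReal.ofReal_pow Real.two_pi_pos.le]

theorem volume_cell_lt_top : volume (cell d) < ⊤ := by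
  rw [volume_cell]; exact ENNReal.ofReal_lt_top

instance isFiniteMeasure_restrict_cell : IsFiniteMeasure (volume.restrict (cell d)) :=
  ⟨by rw [Measure.restrict_apply_univ]; exact volume_cell_lt_top⟩

theorem norm_le_of_mem_cell {z : E d} (hz : z ∈ cell d) : ‖z‖ ≤ Real.sqrt d * (2 * Real.pi) := by
  have h1 : ∑ j, ‖z j‖ ^ 2 ≤ ∑ _j : Fin d, (2 * Real.pi) ^ 2 := by
    refine Finset.sum_le_sum fun j _ => ?_
    have := hz j
    rw [Real.norm_of_nonneg this.1.le]
    exact pow_le_pow_left₀ this.1.le this.2 2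
  rw [EuclideanSpace.norm_eq]
  refine (Real.sqrt_le_sqrt h1).trans (le_of_eq ?_)
  rw [Finset.sum_const, Finset.card_univ, Fintype.card_fin, nsmul_eq_mul,
    Real.sqrt_mul (Nat.cast_nonneg d), Real.sqrt_sq Real.two_pi_pos.le]

/-- The lattice `(2πℤ)^d`. -/
noncomputable def periodLattice (d : ℕ) : AddSubgroup (E d) where
  carrier := Set.range fun k : Fin d → ℤ => (2 * Real.pi) • vec k
  zero_mem' := ⟨0, by simp [vec_zero]⟩
  add_mem' := by
    rintro _ _ ⟨k, rfl⟩ ⟨l, rfl⟩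
    exact ⟨k + l, by simp [vec_add, smul_add]⟩
  neg_mem' := by
    rintro _ ⟨k, rfl⟩
    exact ⟨-k, by simp [vec_neg]⟩

instance countable_periodLattice : Countable (periodLattice d) :=
  (Set.countable_range fun k : Fin d → ℤ => (2 * Real.pi) • vec k).to_subtype

/-- Coordinatewise, every real number has exactly one translate by 2πℤ in a half-open interval of
length 2π. -/
theorem isAddFundamentalDomain_cellAt (c : E d) :
    IsAddFundamentalDomain (periodLattice d) (cellAt c) (volume : Measure (E d)) := by
  refine IsAddFundamentalDomain.mk' (measurableSet_cellAt c).nullMeasurableSet fun x => ?_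
  have h1 : ∀ j, ∃! m : ℤ, x j + m • (2 * Real.pi) ∈ Set.Ioc (c j) (c j + 2 * Real.pi) :=
    fun j => existsUnique_add_zsmul_mem_Ioc Real.two_pi_pos (x j) (c j)
  choose k hk hk' using h1
  refine ⟨⟨(2 * Real.pi) • vec k, k, rfl⟩, fun j => ?_, ?_⟩
  · have := hk j
    simp only [AddSubgroup.vadd_def, vadd_eq_add, PiLp.add_apply, PiLp.smul_apply, vec_apply,
      smul_eq_mul, zsmul_eq_mul] at this ⊢
    convert this using 1; ring
  · rintro ⟨_, l, rfl⟩ hl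
    have : l = k := by
      ext j
      refine hk' j (l j) ?_
      have := hl j
      simp only [AddSubgroup.vadd_def, vadd_eq_add, PiLp.add_apply, PiLp.smul_apply, vec_apply,
        smul_eq_mul, zsmul_eq_mul] at this ⊢
      convert this using 1; ring
    simp [this]

/-- The cell and its translate are two fundamental domains of the same lattice. -/
theorem TorusPeriodic.integral_cell_add {F : Type*} [NormedAddCommGroup F] [NormedSpace ℝ F]
    {u : E d → F} (hu : TorusPeriodic u) (a : E d) :
    ∫ z in cell d, u (z + a) = ∫ z in cell d, u z := by
  have h1 : ∫ z in cell d, u (z + a) = ∫ z in cellAt a, u z := by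
    have h2 : cell d = (fun z => z + a) ⁻¹' cellAt a := by
      ext z
      simp only [cell, cellAt, Set.mem_ofPred_eq, Set.mem_preimage, PiLp.add_apply, Set.mem_Ioc]
      refine forall_congr' fun j => ?_
      constructor <;> rintro ⟨h1, h2⟩ <;> constructor <;> linarith
    rw [h2]
    exact (measurePreserving_add_right volume a).setIntegral_preimage_emb
      (measurableEmbedding_addRight a) u (cellAt a)
  rw [h1, cell_eq_cellAt]
  refine (isAddFundamentalDomain_cellAt a).setIntegral_eq (isAddFundamentalDomain_cellAt 0) ?_
  rintro ⟨_, k, rfl⟩ x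
  rw [AddSubgroup.vadd_def, vadd_eq_add, add_comm]
  exact hu k x

theorem TorusPeriodic.lintegral_cell_add {u : E d → ℝ≥0∞} (hu : TorusPeriodic u) (a : E d) :
    ∫⁻ z in cell d, u (z + a) = ∫⁻ z in cell d, u z := by
  have h1 : ∫⁻ z in cell d, u (z + a) = ∫⁻ z in cellAt a, u z := by
    have h2 : cell d = (fun z => z + a) ⁻¹' cellAt a := by
      ext z
      simp only [cell, cellAt, Set.mem_ofPred_eq, Set.mem_preimage, PiLp.add_apply, Set.mem_Ioc]
      refine forall_congr' fun j => ?_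
      constructor <;> rintro ⟨h1, h2⟩ <;> constructor <;> linarith
    rw [h2]
    exact (measurePreserving_add_right volume a).setLIntegral_comp_preimage_emb
      (measurableEmbedding_addRight a) u (cellAt a)
  rw [h1, cell_eq_cellAt]
  refine (isAddFundamentalDomain_cellAt a).setLIntegral_eq (isAddFundamentalDomain_cellAt 0) _ ?_
  rintro ⟨_, k, rfl⟩ x
  rw [AddSubgroup.vadd_def, vadd_eq_add, add_comm]
  exact hu k x

theorem norm_exp_I_mul (x : ℝ) : ‖Complex.exp (Complex.I * x)‖ = 1 := by
  rw [mul_comm]; exact Complex.norm_exp_ofReal_mul_I x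

theorem norm_exp_neg_I_mul (x : ℝ) : ‖Complex.exp (-Complex.I * x)‖ = 1 := by
  have := norm_exp_I_mul (-x)
  rwa [Complex.ofReal_neg, mul_neg, ← neg_mul] at this

theorem inner_vec (k : Fin d → ℤ) (x : E d) : inner ℝ (vec k) x = ∑ j, (k j : ℝ) * x j := by
  rw [PiLp.inner_apply]
  refine Finset.sum_congr rfl fun j _ => ?_
  simp [vec_apply, mul_comm]

theorem exp_inner_add_period (k l : Fin d → ℤ) (x : E d) :
    Complex.exp (Complex.I * (inner ℝ (vec k) (x + (2 * Real.pi) • vec l) : ℝ)) =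
      Complex.exp (Complex.I * (inner ℝ (vec k) x : ℝ)) := by
  rw [Complex.exp_eq_exp_iff_exists_int]
  refine ⟨∑ j, k j * l j, ?_⟩
  rw [inner_add_right, real_inner_smul_right, inner_vec k (vec l)]
  simp only [vec_apply]
  push_cast
  ring

theorem exp_neg_inner_eq (k : Fin d → ℤ) (x : E d) :
    Complex.exp (-Complex.I * (inner ℝ (vec k) x : ℝ)) =
      Complex.exp (Complex.I * (inner ℝ (vec (-k)) x : ℝ)) := by
  rw [vec_neg, inner_neg_left]; push_cast; congr 1; ring

theorem torusPeriodic_exp_neg (k : Fin d → ℤ) :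
    TorusPeriodic fun x : E d => Complex.exp (-Complex.I * (inner ℝ (vec k) x : ℝ)) := by
  intro l x
  simp only [exp_neg_inner_eq, exp_inner_add_period]

theorem TorusPeriodic.mul {u w : E d → ℂ} (hu : TorusPeriodic u) (hw : TorusPeriodic w) :
    TorusPeriodic fun x => u x * w x := fun k x => by simp only [hu k x, hw k x]

/-- If k_j ≠ 0, translation by π/k_j along the j-th axis changes the sign of the exponential but not
its integral. -/
theorem torusCoeff_const (c : ℂ) (k : Fin d → ℤ) :
    torusCoeff (fun _ : E d => c) k = if k = 0 then c else 0 := by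
  unfold torusCoeff
  have hpi : (((2 * Real.pi) ^ d : ℝ) : ℂ) ≠ 0 := by
    exact_mod_cast (pow_pos Real.two_pi_pos d).ne'
  split_ifs with hk
  · subst hk
    simp only [vec_zero, inner_zero_left, Complex.ofReal_zero, mul_zero, Complex.exp_zero, one_mul]
    rw [setIntegral_const, measureReal_def, volume_cell,
      ENNReal.toReal_ofReal (pow_pos Real.two_pi_pos d).le, Complex.real_smul,
      inv_mul_cancel_left₀ hpi]
  · obtain ⟨j, hj⟩ : ∃ j, k j ≠ 0 := by
      by_contra! h; exact hk (funext h)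
    have hj' : (k j : ℝ) ≠ 0 := by exact_mod_cast hj
    have h1 := (torusPeriodic_exp_neg k).integral_cell_add
      (EuclideanSpace.single j (Real.pi / k j))
    have h2 : ∀ x : E d, Complex.exp (-Complex.I *
        (inner ℝ (vec k) (x + EuclideanSpace.single j (Real.pi / k j)) : ℝ)) =
        -Complex.exp (-Complex.I * (inner ℝ (vec k) x : ℝ)) := by
      intro x
      rw [inner_add_right, EuclideanSpace.inner_single_right]
      simp only [vec_apply, conj_trivial]
      rw [div_mul_cancel₀ _ hj']
      push_cast
      rw [mul_add, Complex.exp_add, neg_mul Complex.I (Real.pi : ℂ), mul_comm Complex.I (Real.pi : ℂ), Complex.exp_neg,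
        Complex.exp_pi_mul_I]
      norm_num
    simp only [h2] at h1
    rw [integral_neg] at h1
    have h3 : ∫ x in cell d, Complex.exp (-Complex.I * (inner ℝ (vec k) x : ℝ)) = 0 := by
      have := self_eq_neg.mp h1.symm
      exact this
    rw [integral_mul_const, h3]
    simp

end Torus

end LandauDamping

namespace LandauDamping

open scoped Pointwise

/-! ### Fourier inversion on the torus. -/

section FourierSeries

variable {d : ℕ}

theorem mFourier_coe (n : Fin d → ℤ) (x : Fin d → ℝ) :
    UnitAddTorus.mFourier n (fun i => (x i : UnitAddCircle)) =
      Complex.exp (Complex.I * (inner ℝ (vec n) ((2 * Real.pi) • WithLp.toLp 2 x : E d) : ℝ)) := by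
  simp only [UnitAddTorus.mFourier, ContinuousMap.coe_mk, fourier_coe_apply]
  rw [← Complex.exp_sum, inner_vec]
  congr 1
  simp only [PiLp.smul_apply, smul_eq_mul]
  push_cast
  rw [Finset.mul_sum]
  refine Finset.sum_congr rfl fun j _ => ?_
  ring

/-- A product of open quotient maps ℝ → ℝ/ℤ is again a quotient map, so continuity descends to the
torus. -/
theorem exists_lift_torus {u : E d → ℂ} (hu : Continuous u) (hp : TorusPeriodic u) :
    ∃ f : C(UnitAddTorus (Fin d), ℂ), ∀ x : Fin d → ℝ,
      f (fun i => (x i : UnitAddCircle)) = u ((2 * Real.pi) • WithLp.toLp 2 x) := by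
  have hq0 : IsOpenQuotientMap
      (Pi.map fun _ : Fin d => (QuotientAddGroup.mk : ℝ → UnitAddCircle)) :=
    IsOpenQuotientMap.piMap fun _ => QuotientAddGroup.isOpenQuotientMap_mk
  let q : C(Fin d → ℝ, UnitAddTorus (Fin d)) := ⟨_, hq0.continuous⟩
  have hq : Topology.IsQuotientMap q := hq0.isQuotientMap
  let g : C(Fin d → ℝ, ℂ) := ⟨fun x => u ((2 * Real.pi) • WithLp.toLp 2 x), by fun_prop⟩
  have hg : Function.FactorsThrough g q := by
    intro x y hxy
    have h1 : ∀ j, ∃ m : ℤ, x j = y j + m := by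
      intro j
      have h2 : (x j : UnitAddCircle) = (y j : UnitAddCircle) := congrFun hxy j
      rw [← sub_eq_zero, ← AddCircle.coe_sub, AddCircle.coe_eq_zero_iff] at h2
      obtain ⟨n, hn⟩ := h2
      refine ⟨n, ?_⟩
      rw [zsmul_eq_mul, mul_one] at hn
      linarith
    choose m hm using h1
    have h3 : (2 * Real.pi) • (WithLp.toLp 2 x : E d) =
        (2 * Real.pi) • (WithLp.toLp 2 y : E d) + (2 * Real.pi) • vec m := by
      ext j
      simp [vec_apply, hm j, mul_add]
    simp only [g, ContinuousMap.coe_mk]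
    rw [h3]
    exact hp m _
  refine ⟨hq.lift g hg, fun x => ?_⟩
  exact congrFun (congrArg DFunLike.coe (hq.lift_comp g hg)) x

theorem torusCoeff_eq_integral (u : E d → ℂ) (k : Fin d → ℤ) :
    torusCoeff u k = ∫ x in {x : Fin d → ℝ | ∀ i, x i ∈ Set.Ioc ((0 : Fin d → ℝ) i) ((0 : Fin d → ℝ) i + 1)},
      Complex.exp (-Complex.I * (inner ℝ (vec k) ((2 * Real.pi) • WithLp.toLp 2 x : E d) : ℝ)) *
        u ((2 * Real.pi) • WithLp.toLp 2 x) := by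
  set F : E d → ℂ := fun x => Complex.exp (-Complex.I * (inner ℝ (vec k) x : ℝ)) * u x with hF
  have h1 : ∫ x in {x : Fin d → ℝ | ∀ i, x i ∈ Set.Ioc ((0 : Fin d → ℝ) i) ((0 : Fin d → ℝ) i + 1)},
      F ((2 * Real.pi) • WithLp.toLp 2 x) =
      ∫ x in {x : E d | ∀ i, x i ∈ Set.Ioc (0 : ℝ) 1}, F ((2 * Real.pi) • x) := by
    have := (PiLp.volume_preserving_ofLp (Fin d)).setIntegral_preimage_emb
      (MeasurableEquiv.toLp 2 (Fin d → ℝ)).symm.measurableEmbedding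
      (fun x => F ((2 * Real.pi) • WithLp.toLp 2 x))
      {x : Fin d → ℝ | ∀ i, x i ∈ Set.Ioc ((0 : Fin d → ℝ) i) ((0 : Fin d → ℝ) i + 1)}
    rw [← this]
    congr 2
    ext x
    simp
  change _ = ∫ x in _, F ((2 * Real.pi) • WithLp.toLp 2 x)
  rw [h1, Measure.setIntegral_comp_smul_of_pos _ _ _ Real.two_pi_pos]
  have h2 : (2 * Real.pi) • {x : E d | ∀ i, x i ∈ Set.Ioc (0 : ℝ) 1} = cell d := by
    ext x
    rw [Set.mem_smul_set_iff_inv_smul_mem₀ Real.two_pi_pos.ne']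
    simp only [Set.mem_ofPred_eq, cell, PiLp.smul_apply, smul_eq_mul, Set.mem_Ioc]
    refine forall_congr' fun j => ?_
    rw [inv_mul_le_iff₀ Real.two_pi_pos, mul_one,
      mul_pos_iff_of_pos_left (inv_pos.mpr Real.two_pi_pos)]
  rw [h2, finrank_euclideanSpace, Fintype.card_fin, Complex.real_smul, torusCoeff]
  push_cast
  rfl

/-- Fourier inversion for continuous functions on the torus with summable coefficients. -/
theorem hasSum_torusCoeff {u : E d → ℂ} (hu : Continuous u) (hp : TorusPeriodic u)
    (hs : Summable (torusCoeff u)) (x : E d) :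
    HasSum (fun k => torusCoeff u k * Complex.exp (Complex.I * (inner ℝ (vec k) x : ℝ))) (u x) := by
  obtain ⟨f, hf⟩ := exists_lift_torus hu hp
  have hcoeff : UnitAddTorus.mFourierCoeff f = torusCoeff u := by
    ext k
    rw [UnitAddTorus.mFourierCoeff_eq_integral f k 0, torusCoeff_eq_integral]
    congr with y
    rw [mFourier_coe, hf, exp_neg_inner_eq, smul_eq_mul]
  have h1 := UnitAddTorus.hasSum_mFourier_series_apply_of_summable (f := f) (by rwa [hcoeff])
    (fun i => (((2 * Real.pi)⁻¹ * x i : ℝ) : UnitAddCircle))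
  have h2 : (2 * Real.pi) • (WithLp.toLp 2 fun i => (2 * Real.pi)⁻¹ * x i : E d) = x := by
    ext j
    simp only [PiLp.smul_apply, smul_eq_mul]
    rw [mul_inv_cancel_left₀ Real.two_pi_pos.ne']
  rw [hf, hcoeff] at h1
  simp only [mFourier_coe, h2, smul_eq_mul] at h1
  exact h1

end FourierSeries

end LandauDamping

namespace LandauDamping

open scoped Pointwise

/-! ### Fourier modes and the energy density. -/

section Modes

variable {d : ℕ}

/-- Comparison with the integral of (1+|x|)^(-r): each term is dominated by the integral over a cell
of the lattice (2πℤ)^d. -/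
theorem summable_jap_vec {r : ℝ} (hr : (d : ℝ) < r) :
    Summable fun k : Fin d → ℤ => jap ‖vec k‖ ^ (-r) := by
  have hr0 : -r ≤ 0 := by have : (0 : ℝ) ≤ d := Nat.cast_nonneg d; linarith
  -- On the cell translated by 2πk one has 1+|x| ≤ D⟨k⟩, the last summand bounding the norm of
  -- points of the cell.
  set D := 1 + 2 * Real.pi + Real.sqrt d * (2 * Real.pi) with hD
  have hD0 : 0 < D := by positivity
  have hInt : ∫⁻ x : E d, ENNReal.ofReal ((1 + ‖x‖) ^ (-r)) < ⊤ :=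
    (integrable_one_add_norm (μ := volume) (by simpa using hr)).lintegral_lt_top
  rw [(isAddFundamentalDomain_cellAt (0 : E d)).lintegral_eq_tsum] at hInt
  have hinj : Function.Injective
      fun k : Fin d → ℤ => (⟨(2 * Real.pi) • vec k, k, rfl⟩ : periodLattice d) := by
    intro k l hkl
    have h2 : (2 * Real.pi) • vec k = (2 * Real.pi) • vec l := congrArg Subtype.val hkl
    have h3 := smul_right_injective (E d) Real.two_pi_pos.ne' h2
    ext j
    have := congrArg (fun x : E d => x j) h3
    simp only [vec_apply] at this
    exact_mod_cast this
  have h1 := (ENNReal.tsum_comp_le_tsum_of_injective hinj _).trans_lt hInt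
  have h2 : ∑' k : Fin d → ℤ, ENNReal.ofReal ((D * jap ‖vec k‖) ^ (-r)) * volume (cell d) < ⊤ := by
    refine (ENNReal.tsum_le_tsum fun k => ?_).trans_lt h1
    set g : periodLattice d := ⟨(2 * Real.pi) • vec k, k, rfl⟩ with hg
    have hvol : volume (cell d) = volume (g +ᵥ cellAt (0 : E d)) := by
      rw [measure_vadd, cell_eq_cellAt]
    rw [hvol, ← setLIntegral_const]
    refine setLIntegral_mono' ((measurableSet_cellAt 0).const_vadd g) fun x hx => ?_
    obtain ⟨z, hz, rfl⟩ := hx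
    refine ENNReal.ofReal_le_ofReal (Real.rpow_le_rpow_of_nonpos (by positivity) ?_ hr0)
    have h3 : ‖z‖ ≤ Real.sqrt d * (2 * Real.pi) := norm_le_of_mem_cell (by rwa [cell_eq_cellAt])
    have h4 : ‖g +ᵥ z‖ ≤ 2 * Real.pi * ‖vec k‖ + ‖z‖ := by
      rw [AddSubgroup.vadd_def, vadd_eq_add]
      refine (norm_add_le _ _).trans ?_
      rw [hg, norm_smul, Real.norm_of_nonneg Real.two_pi_pos.le]
    have h5 := one_le_jap ‖vec k‖
    have h6 : ‖vec k‖ ≤ jap ‖vec k‖ := (le_abs_self _).trans (abs_le_jap _)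
    have h7 : 0 ≤ Real.sqrt d * (2 * Real.pi) := by positivity
    change 1 + ‖g +ᵥ z‖ ≤ _
    rw [hD]
    nlinarith [Real.two_pi_pos]
  have h3 : Summable fun k : Fin d → ℤ => (D * jap ‖vec k‖) ^ (-r) := by
    rw [ENNReal.tsum_mul_right] at h2
    have hv : volume (cell d) ≠ 0 := by
      rw [volume_cell]; simp [Real.pi_pos]
    have h4 : ∑' k : Fin d → ℤ, ENNReal.ofReal ((D * jap ‖vec k‖) ^ (-r)) ≠ ⊤ := by
      intro h
      rw [h, ENNReal.top_mul hv] at h2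
      exact lt_irrefl _ h2
    refine (ENNReal.summable_toReal h4).congr fun k => ?_
    exact ENNReal.toReal_ofReal (Real.rpow_nonneg (mul_nonneg hD0.le (jap_pos _).le) _)
  have h5 := h3.mul_left (D ^ r)
  refine h5.congr fun k => ?_
  rw [Real.mul_rpow hD0.le (jap_pos _).le, ← mul_assoc, ← Real.rpow_add hD0]
  simp

theorem integrable_jap_norm {r : ℝ} (hr : (d : ℝ) < r) :
    Integrable fun η : E d => jap ‖η‖ ^ (-r) := by
  have h1 := integrable_rpow_neg_one_add_norm_sq (E := E d) (μ := volume) (r := r) (by simpa using hr)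
  refine h1.congr (Filter.Eventually.of_forall fun η => ?_)
  simp only [jap]
  rw [Real.sqrt_eq_rpow, ← Real.rpow_mul (by positivity)]
  congr 1; ring

theorem zMode_moment (α : Fin d → ℕ) (g : E d → E d → ℂ) (k : Fin d → ℤ) (v : E d) :
    zMode (moment α g) k v = ((∏ j, v j ^ α j : ℝ) : ℂ) * zMode g k v := by
  unfold zMode torusCoeff moment
  have h : ∀ x : E d, Complex.exp (-Complex.I * (inner ℝ (vec k) x : ℝ)) *
      (((∏ j, v j ^ α j : ℝ) : ℂ) * g x v) =
      ((∏ j, v j ^ α j : ℝ) : ℂ) * (Complex.exp (-Complex.I * (inner ℝ (vec k) x : ℝ)) * g x v) :=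
    fun x => by ring
  simp only [h]
  rw [integral_const_mul]
  ring

theorem lintegral_fourierSq {u : E d → ℂ} (hu : MemLp u 2 volume) :
    ∫⁻ η, fourierSq u η = ENNReal.ofReal ((2 * Real.pi) ^ d) * ∫⁻ v, ‖u v‖ₑ ^ 2 := by
  simp_rw [fourierSq_of_memLp hu, fourierL2]
  rw [lintegral_comp_inv_two_pi_smul (fun ξ =>
    ‖(𝓕 (hu.toLp u) : Lp (α := E d) ℂ 2 volume) ξ‖ₑ ^ 2)]
  congr 1
  have h1 : ∀ f : Lp (α := E d) ℂ 2 volume, ∫⁻ ξ, ‖f ξ‖ₑ ^ 2 = ‖f‖ₑ ^ 2 := by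
    intro f
    rw [Lp.enorm_def, eLpNorm_two_eq, ← ENNReal.rpow_natCast, ← ENNReal.rpow_mul]
    norm_num
  rw [h1]
  have h2 : ‖(𝓕 (hu.toLp u) : Lp (α := E d) ℂ 2 volume)‖ₑ = ‖hu.toLp u‖ₑ := by
    rw [← ofReal_norm, ← ofReal_norm, Lp.norm_fourier_eq]
  rw [h2, ← h1]
  refine lintegral_congr_ae ?_
  filter_upwards [hu.coeFn_toLp] with v hv
  rw [hv]

/-- The energy density `∑_{|α| ≤ M} |m_k(η)|² |D^α ĝ_k(η)|²`. -/
noncomputable def spectralDensity (M : ℕ) (m : (Fin d → ℤ) → E d → ℝ) (g : E d → E d → ℂ)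
    (k : Fin d → ℤ) (η : E d) : ℝ≥0∞ :=
  ENNReal.ofReal (m k η ^ 2) * ∑ α ∈ multiIndices d M,
    fourierSq (fun v => ((∏ j, v j ^ α j : ℝ) : ℂ) * zMode g k v) η

theorem measurable_spectralDensity {M : ℕ} {m : (Fin d → ℤ) → E d → ℝ} (hm : ∀ k, Measurable (m k))
    (g : E d → E d → ℂ) (k : Fin d → ℤ) : Measurable (spectralDensity M m g k) := by
  unfold spectralDensity
  have := hm k
  have h2 : Measurable fun η => ∑ α ∈ multiIndices d M,
      fourierSq (fun v => ((∏ j, v j ^ α j : ℝ) : ℂ) * zMode g k v) η :=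
    Finset.measurable_fun_sum _ fun α _ => measurable_fourierSq _
  fun_prop

theorem memLp_of_multiplierNormSq_ne_top {m : (Fin d → ℤ) → E d → ℝ} {g : E d → E d → ℂ}
    (h : multiplierNormSq m g ≠ ⊤) :
    MemLp (fun p : E d × E d => g p.1 p.2) 2 ((volume.restrict (cell d)).prod volume) ∧
      ∀ k, MemLp (zMode g k) 2 volume := by
  by_contra h1
  exact h (by rw [multiplierNormSq, dif_neg h1])

theorem multiplierNormSq_eq {m : (Fin d → ℤ) → E d → ℝ} {g : E d → E d → ℂ}
    (h : multiplierNormSq m g ≠ ⊤) :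
    multiplierNormSq m g = ∑' k, ∫⁻ η, ENNReal.ofReal (m k η ^ 2) * fourierSq (zMode g k) η := by
  have h1 := memLp_of_multiplierNormSq_ne_top h
  rw [multiplierNormSq, dif_pos h1]
  simp_rw [fun k => fourierSq_of_memLp (h1.2 k)]

theorem memLp_moment_zMode {M : ℕ} {m : (Fin d → ℤ) → E d → ℝ} {g : E d → E d → ℂ}
    (h : ∑ α ∈ multiIndices d M, multiplierNormSq m (moment α g) ≠ ⊤) {α : Fin d → ℕ}
    (hα : α ∈ multiIndices d M) (k : Fin d → ℤ) :
    MemLp (fun v => ((∏ j, v j ^ α j : ℝ) : ℂ) * zMode g k v) 2 volume := by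
  have h1 := (memLp_of_multiplierNormSq_ne_top (ENNReal.sum_ne_top.mp h α hα)).2 k
  simpa only [funext (zMode_moment α g k)] using h1

theorem tsum_lintegral_spectralDensity {M : ℕ} {m : (Fin d → ℤ) → E d → ℝ}
    (hm : ∀ k, Measurable (m k)) {g : E d → E d → ℂ}
    (h : ∑ α ∈ multiIndices d M, multiplierNormSq m (moment α g) ≠ ⊤) :
    ∑' k, ∫⁻ η, spectralDensity M m g k η =
      ∑ α ∈ multiIndices d M, multiplierNormSq m (moment α g) := by
  have h1 : ∀ k, ∫⁻ η, spectralDensity M m g k η = ∑ α ∈ multiIndices d M,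
      ∫⁻ η, ENNReal.ofReal (m k η ^ 2) * fourierSq (zMode (moment α g) k) η := by
    intro k
    simp only [spectralDensity, Finset.mul_sum]
    rw [lintegral_finsetSum]
    · simp_rw [funext (zMode_moment _ g k)]
    · intro α _
      have := hm k
      have := measurable_fourierSq (fun v : E d => ((∏ j, v j ^ α j : ℝ) : ℂ) * zMode g k v)
      fun_prop
  simp_rw [h1]
  rw [Summable.tsum_finsetSum fun α _ => ENNReal.summable]
  exact Finset.sum_congr rfl fun α hα =>
    (multiplierNormSq_eq (ENNReal.sum_ne_top.mp h α hα)).symm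

/-- `ĝ_k(η)` as an absolutely convergent integral. -/
noncomputable def modeHat (g : E d → E d → ℂ) (k : Fin d → ℤ) (η : E d) : ℂ :=
  fourierInt (zMode g k) η

theorem integrable_zMode (hd : 1 ≤ d) {M : ℕ} (hM : (d : ℝ) / 2 < M) {m : (Fin d → ℤ) → E d → ℝ}
    {g : E d → E d → ℂ} (h : ∑ α ∈ multiIndices d M, multiplierNormSq m (moment α g) ≠ ⊤)
    (k : Fin d → ℤ) : Integrable (zMode g k) :=
  integrable_of_memLp_moments hd hM fun _ hα => memLp_moment_zMode h hα k

/-- Local control of the Fourier transform by the energy density. -/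
theorem exists_modeHat_sq_le (hd : 1 ≤ d) {M : ℕ} (hM : (d : ℝ) / 2 < M) (c : ℝ) (hc : 0 < c) :
    ∃ C : ℝ, 0 < C ∧ ∀ (m : (Fin d → ℤ) → E d → ℝ) (_ : ∀ k η, 0 < m k η)
      (_ : ∀ k η ξ, ‖η - ξ‖ ≤ 1 → m k η ≤ c * m k ξ)
      (g : E d → E d → ℂ), ∑ α ∈ multiIndices d M, multiplierNormSq m (moment α g) ≠ ⊤ →
      ∀ k η, ENNReal.ofReal (m k η ^ 2) * ‖modeHat g k η‖ₑ ^ 2 ≤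
        ENNReal.ofReal C * ∫⁻ ξ in Metric.closedBall η 1, spectralDensity M m g k ξ := by
  obtain ⟨C, hC, htr⟩ := exists_trace_bound hd hM
  refine ⟨c ^ 2 * (C.toReal + 1), by positivity, fun m hm0 hm g h k η => ?_⟩
  have h1 := htr (zMode g k) (fun α hα => memLp_moment_zMode h hα k) η
  have h2 : C ≤ ENNReal.ofReal (C.toReal + 1) := by
    rw [ENNReal.ofReal_add ENNReal.toReal_nonneg zero_le_one, ENNReal.ofReal_toReal hC]
    exact le_self_add
  calc ENNReal.ofReal (m k η ^ 2) * ‖modeHat g k η‖ₑ ^ 2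
      ≤ ENNReal.ofReal (m k η ^ 2) * (C * ∑ α ∈ multiIndices d M,
        ∫⁻ ξ in Metric.closedBall η 1,
          fourierSq (fun v => ((∏ j, v j ^ α j : ℝ) : ℂ) * zMode g k v) ξ) := by
        gcongr; exact h1
    _ = C * ∫⁻ ξ in Metric.closedBall η 1, ENNReal.ofReal (m k η ^ 2) * ∑ α ∈ multiIndices d M,
          fourierSq (fun v => ((∏ j, v j ^ α j : ℝ) : ℂ) * zMode g k v) ξ := by
        rw [lintegral_const_mul' _ _ ENNReal.ofReal_ne_top,
          lintegral_finsetSum _ fun α _ => measurable_fourierSq _]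
        ring
    _ ≤ C * ∫⁻ ξ in Metric.closedBall η 1, ENNReal.ofReal (c ^ 2) * spectralDensity M m g k ξ := by
        gcongr 1
        refine setLIntegral_mono' Metric.isClosed_closedBall.measurableSet fun ξ hξ => ?_
        rw [spectralDensity, ← mul_assoc, ← ENNReal.ofReal_mul (by positivity), ← mul_pow]
        gcongr
        · exact (hm0 k η).le
        · refine hm k η ξ ?_
          rw [← dist_eq_norm, dist_comm]
          exact hξ
    _ ≤ _ := by
        rw [lintegral_const_mul' _ _ ENNReal.ofReal_ne_top, ← mul_assoc,
          ENNReal.ofReal_mul (by positivity), mul_comm C]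
        gcongr

end Modes

end LandauDamping

namespace LandauDamping

/-! ### Traces of Fourier transforms along lines. -/

section Traces

variable {d : ℕ}

theorem volume_line_inter_ball_le (w v : E d) (hv : 1 ≤ ‖v‖) :
    volume {t : ℝ | w ∈ Metric.closedBall (t • v) 1} ≤ 2 := by
  refine (Real.volume_le_diam _).trans (Metric.ediam_le fun t ht t' ht' => ?_)
  have h1 : dist (t • v) (t' • v) ≤ 2 := by
    have h2 := dist_triangle_left (t • v) (t' • v) w
    have h3 : dist w (t • v) ≤ 1 := ht
    have h4 : dist w (t' • v) ≤ 1 := ht'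
    linarith
  rw [dist_eq_norm, ← sub_smul, norm_smul] at h1
  rw [edist_dist, dist_eq_norm]
  have h5 : ‖t - t'‖ ≤ 2 := by nlinarith [norm_nonneg (t - t')]
  calc ENNReal.ofReal ‖t - t'‖ ≤ ENNReal.ofReal 2 := ENNReal.ofReal_le_ofReal h5
    _ = 2 := by norm_num

/-- By Tonelli's theorem: the unit ball moving with speed |v| ≥ 1 covers a given ξ during a time at
most 2. -/
theorem lintegral_line_ball_le {Q : E d → ℝ≥0∞} (hQ : Measurable Q) (a v : E d) (hv : 1 ≤ ‖v‖) :
    ∫⁻ t : ℝ, ∫⁻ ξ in Metric.closedBall (t • v - a) 1, Q ξ ≤ 2 * ∫⁻ ξ, Q ξ := by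
  have hS : MeasurableSet {p : ℝ × E d | dist p.2 (p.1 • v - a) ≤ 1} :=
    measurableSet_le (by fun_prop) measurable_const
  have h1 : ∀ t : ℝ, ∫⁻ ξ in Metric.closedBall (t • v - a) 1, Q ξ =
      ∫⁻ ξ, {p : ℝ × E d | dist p.2 (p.1 • v - a) ≤ 1}.indicator (fun p => Q p.2) (t, ξ) := by
    intro t
    rw [← lintegral_indicator Metric.isClosed_closedBall.measurableSet]
    congr with ξ
  simp_rw [h1]
  have hm : Measurable ({p : ℝ × E d | dist p.2 (p.1 • v - a) ≤ 1}.indicator fun p => Q p.2) :=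
    Measurable.indicator (hQ.comp measurable_snd) hS
  rw [lintegral_lintegral_swap (f := fun t ξ => {p : ℝ × E d | dist p.2 (p.1 • v - a) ≤ 1}.indicator
    (fun p => Q p.2) (t, ξ)) hm.aemeasurable,
    ← lintegral_const_mul _ hQ]
  refine lintegral_mono fun ξ => ?_
  calc ∫⁻ t : ℝ, {p : ℝ × E d | dist p.2 (p.1 • v - a) ≤ 1}.indicator (fun p => Q p.2) (t, ξ)
      = ∫⁻ t : ℝ, {t : ℝ | ξ + a ∈ Metric.closedBall (t • v) 1}.indicator (fun _ => Q ξ) t := by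
        congr with t
        have : (t, ξ) ∈ {p : ℝ × E d | dist p.2 (p.1 • v - a) ≤ 1} ↔
            t ∈ {t : ℝ | ξ + a ∈ Metric.closedBall (t • v) 1} := by
          simp only [Set.mem_ofPred_eq, Metric.mem_closedBall, dist_eq_norm]
          rw [sub_sub_eq_add_sub]
        by_cases ht : (t, ξ) ∈ {p : ℝ × E d | dist p.2 (p.1 • v - a) ≤ 1}
        · rw [Set.indicator_of_mem ht, Set.indicator_of_mem (this.mp ht)]
        · rw [Set.indicator_of_notMem ht, Set.indicator_of_notMem (mt this.mpr ht)]
    _ ≤ Q ξ * volume {t : ℝ | ξ + a ∈ Metric.closedBall (t • v) 1} := lintegral_indicator_const_le _ _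
    _ ≤ 2 * Q ξ := by
        rw [mul_comm]; gcongr; exact volume_line_inter_ball_le _ _ hv

variable {M : ℕ}

/-- The `L²` trace of the Fourier transform along the lines `t ↦ k t - a`. -/
theorem exists_line_trace (hd : 1 ≤ d) (hM : (d : ℝ) / 2 < M) (c : ℝ) (hc : 0 < c) :
    ∃ C : ℝ, 0 < C ∧ ∀ (m : (Fin d → ℤ) → E d → ℝ) (_ : ∀ k, Measurable (m k))
      (_ : ∀ k η, 0 < m k η) (_ : ∀ k η ξ, ‖η - ξ‖ ≤ 1 → m k η ≤ c * m k ξ)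
      (g : E d → E d → ℂ), ∑ α ∈ multiIndices d M, multiplierNormSq m (moment α g) ≠ ⊤ →
      (∀ k η, ENNReal.ofReal (m k η ^ 2) * ‖modeHat g k η‖ₑ ^ 2 ≤
        ENNReal.ofReal C * ∑ α ∈ multiIndices d M, multiplierNormSq m (moment α g)) ∧
      ∀ (l : Fin d → ℤ) (a : E d), ∑' k : Fin d → ℤ, (if k = 0 then 0 else
        ∫⁻ t : ℝ, ENNReal.ofReal (m (k - l) (t • vec k - a) ^ 2) *
          ‖modeHat g (k - l) (t • vec k - a)‖ₑ ^ 2) ≤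
        ENNReal.ofReal C * ∑ α ∈ multiIndices d M, multiplierNormSq m (moment α g) := by
  obtain ⟨C, hC, h⟩ := exists_modeHat_sq_le hd hM c hc
  refine ⟨2 * C, by positivity, fun m hmm hm0 hm g hg => ⟨fun k η => ?_, fun l a => ?_⟩⟩
  · refine (h m hm0 hm g hg k η).trans ?_
    rw [← tsum_lintegral_spectralDensity hmm hg]
    gcongr
    · linarith
    · exact (setLIntegral_le_lintegral _ _).trans
        (ENNReal.le_tsum (f := fun k => ∫⁻ η, spectralDensity M m g k η) k)
  · calc _ ≤ ∑' k : Fin d → ℤ, ENNReal.ofReal (2 * C) * ∫⁻ ξ, spectralDensity M m g (k - l) ξ := by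
          refine ENNReal.tsum_le_tsum fun k => ?_
          split_ifs with hk
          · exact zero_le
          · refine (lintegral_mono fun t => h m hm0 hm g hg (k - l) _).trans ?_
            rw [lintegral_const_mul' _ _ ENNReal.ofReal_ne_top, mul_comm 2 C,
              ENNReal.ofReal_mul hC.le, mul_assoc]
            gcongr
            refine (lintegral_line_ball_le (measurable_spectralDensity hmm g (k - l)) a _
              (one_le_norm_vec hk)).trans ?_
            norm_num
      _ = _ := by
          rw [ENNReal.tsum_mul_left, ← tsum_lintegral_spectralDensity hmm hg]
          congr 1
          exact (Equiv.subRight l).tsum_eq (fun k => ∫⁻ ξ, spectralDensity M m g k ξ)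

/-- `‖u‖_{L¹}` is controlled by the `L²` norms of `v^α u`, `|α| ≤ M`, for `M > d / 2`. -/
theorem exists_lintegral_enorm_sq_le (hd : 1 ≤ d) (hM : (d : ℝ) / 2 < M) :
    ∃ C : ℝ, 0 < C ∧ ∀ u : E d → ℂ, AEMeasurable u volume → (∫⁻ v, ‖u v‖ₑ) ^ 2 ≤
      ENNReal.ofReal C * ∑ α ∈ multiIndices d M,
        ∫⁻ v, ‖((∏ j, v j ^ α j : ℝ) : ℂ) * u v‖ₑ ^ 2 := by
  have hInt := integrable_inv_momentWeight hd hM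
  have hP : ∀ v : E d, 0 < momentWeight d M v := fun v => by linarith [one_le_momentWeight M v]
  refine ⟨(∫ v : E d, (momentWeight d M v)⁻¹) + 1,
    add_pos_of_nonneg_of_pos (integral_nonneg fun v => (inv_pos.mpr (hP v)).le) one_pos,
    fun u hu => ?_⟩
  have hmP : Measurable (momentWeight d M) := (continuous_momentWeight M).measurable
  -- Cauchy–Schwarz with respect to the finite density 1/P; the remaining integrand P|u|² is the sum
  -- of the |v^α u|².
  have h1 : ∀ v : E d, ‖u v‖ₑ = ENNReal.ofReal (momentWeight d M v)⁻¹ *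
      (ENNReal.ofReal (momentWeight d M v) * ‖u v‖ₑ) := by
    intro v
    rw [← mul_assoc, ← ENNReal.ofReal_mul (inv_pos.mpr (hP v)).le, inv_mul_cancel₀ (hP v).ne']
    simp
  rw [lintegral_congr h1]
  refine (sq_lintegral_mul_le (by fun_prop) (by fun_prop)).trans ?_
  rw [← ofReal_integral_eq_lintegral_ofReal hInt
    (Filter.Eventually.of_forall fun v => (inv_pos.mpr (hP v)).le)]
  refine mul_le_mul' (ENNReal.ofReal_le_ofReal (by linarith)) (le_of_eq ?_)
  rw [← lintegral_finsetSum']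
  · congr with v
    have h2 : ∀ α : Fin d → ℕ, ‖((∏ j, v j ^ α j : ℝ) : ℂ) * u v‖ₑ ^ 2 =
        ENNReal.ofReal ((∏ j, v j ^ α j) ^ 2) * ‖u v‖ₑ ^ 2 := by
      intro α
      rw [enorm_mul, mul_pow, ← ofReal_norm, Complex.norm_real, ← ENNReal.ofReal_pow (norm_nonneg _),
        Real.norm_eq_abs, sq_abs]
    simp_rw [h2]
    rw [← Finset.sum_mul, ← ENNReal.ofReal_sum_of_nonneg (fun α _ => sq_nonneg _)]
    change _ = ENNReal.ofReal (momentWeight d M v) * _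
    rw [mul_pow, sq, ← mul_assoc, ← mul_assoc, ← ENNReal.ofReal_mul (inv_pos.mpr (hP v)).le,
      inv_mul_cancel₀ (hP v).ne', ENNReal.ofReal_one, one_mul]
  · intro α _
    have := (continuous_monomial (d := d) α).measurable
    fun_prop

end Traces

end LandauDamping

namespace LandauDamping

/-! ### Decay of Fourier modes of Gevrey functions. -/

section Decay

variable {d M : ℕ} {c s : ℝ}

theorem gevreyWeight_le_of_near (hc : 0 ≤ c) (hs : 0 ≤ s) (hs1 : s ≤ 1) (k : Fin d → ℤ)
    {η ξ : E d} (h : ‖η - ξ‖ ≤ 1) :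
    Real.exp (c * japPair k η ^ s) ≤ Real.exp c * Real.exp (c * japPair k ξ ^ s) := by
  have h1 := japPair_le_add k k η ξ
  have h2 := japPair_le_add k k ξ η
  rw [sub_self, vec_zero, norm_zero, zero_add] at h1 h2
  rw [norm_sub_rev] at h2
  have h3 := weight_le_of_near (lam := c) (Λ := c) (p := 0) hc le_rfl hs hs1 (one_le_japPair k η)
    (one_le_japPair k ξ) (by linarith) (by linarith)
  simpa using h3

theorem measurable_gevreyWeight (c s : ℝ) (k : Fin d → ℤ) :
    Measurable fun η : E d => Real.exp (c * japPair k η ^ s) := by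
  have := (continuous_japPair (d := d) k).measurable
  fun_prop

theorem jap_norm_vec_le_japPair (k : Fin d → ℤ) (η : E d) : jap ‖vec k‖ ≤ japPair k η :=
  jap_le_jap (norm_nonneg _) (by linarith [norm_nonneg η])

theorem jap_norm_le_japPair (k : Fin d → ℤ) (η : E d) : jap ‖η‖ ≤ japPair k η :=
  jap_le_jap (norm_nonneg _) (by linarith [norm_nonneg (vec k)])

/-- Fourier decay of functions of finite Gevrey norm. -/
theorem exists_gevrey_bounds (hd : 1 ≤ d) (hM : (d : ℝ) / 2 < M) (hc : 0 < c) (hs : 0 < s)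
    (hs1 : s ≤ 1) :
    ∃ C : ℝ, 0 < C ∧ ∀ (g : E d → E d → ℂ) (N : ℝ), 0 ≤ N →
      ∑ α ∈ multiIndices d M, gevreyNormSq c s (moment α g) ≤ ENNReal.ofReal N →
      (∀ k η, ‖modeHat g k η‖ ≤ C * Real.sqrt N * Real.exp (-(c * japPair k η ^ s))) ∧
      ∀ k, ∫⁻ v, ‖zMode g k v‖ₑ ≤
        ENNReal.ofReal (C * Real.sqrt N * Real.exp (-(c * jap ‖vec k‖ ^ s))) := by
  obtain ⟨C, hC, h⟩ := exists_line_trace (M := M) hd hM (Real.exp c) (Real.exp_pos c)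
  obtain ⟨C', hC', h'⟩ := exists_lintegral_enorm_sq_le (M := M) hd hM
  refine ⟨Real.sqrt C + Real.sqrt C', by positivity, fun g N hN hg => ?_⟩
  have hg' : ∑ α ∈ multiIndices d M, gevreyNormSq c s (moment α g) ≠ ⊤ :=
    (hg.trans_lt ENNReal.ofReal_lt_top).ne
  have h1 := (h (fun k η => Real.exp (c * japPair k η ^ s)) (measurable_gevreyWeight c s)
    (fun _ _ => Real.exp_pos _) (fun k η ξ => gevreyWeight_le_of_near hc.le hs.le hs1 k) g hg').1
  constructor
  · intro k η
    have h2 := (h1 k η).trans (mul_le_mul_right hg _)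
    rw [← ofReal_norm, ← ENNReal.ofReal_pow (norm_nonneg _), ← ENNReal.ofReal_mul (by positivity),
      ← ENNReal.ofReal_mul hC.le, ENNReal.ofReal_le_ofReal_iff (by positivity), ← mul_pow] at h2
    have h3 : Real.exp (c * japPair k η ^ s) * ‖modeHat g k η‖ ≤ Real.sqrt C * Real.sqrt N := by
      rw [← Real.sqrt_mul hC.le]
      exact Real.le_sqrt_of_sq_le h2
    rw [Real.exp_neg, ← div_eq_mul_inv, le_div_iff₀ (Real.exp_pos _), mul_comm]
    refine h3.trans ?_
    gcongr
    linarith [Real.sqrt_nonneg C']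
  · intro k
    have h2 := h' (zMode g k) (integrable_zMode hd hM hg' k).aemeasurable
    have h3 : ∑ α ∈ multiIndices d M, ∫⁻ v, ‖((∏ j, v j ^ α j : ℝ) : ℂ) * zMode g k v‖ₑ ^ 2 ≤
        ENNReal.ofReal (Real.exp (-(c * jap ‖vec k‖ ^ s)) ^ 2 * N) := by
      calc _ ≤ ∑ α ∈ multiIndices d M,
            ∫⁻ η, fourierSq (fun v => ((∏ j, v j ^ α j : ℝ) : ℂ) * zMode g k v) η := by
            refine Finset.sum_le_sum fun α hα => ?_
            rw [lintegral_fourierSq (memLp_moment_zMode hg' hα k)]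
            refine le_mul_of_one_le_left zero_le ?_
            rw [ENNReal.one_le_ofReal]
            exact one_le_pow₀ (by linarith [Real.two_le_pi])
        _ = ∫⁻ η, ∑ α ∈ multiIndices d M,
            fourierSq (fun v => ((∏ j, v j ^ α j : ℝ) : ℂ) * zMode g k v) η := by
            rw [lintegral_finsetSum _ fun α _ => measurable_fourierSq _]
        _ ≤ ∫⁻ η, ENNReal.ofReal (Real.exp (-(c * jap ‖vec k‖ ^ s)) ^ 2) *
            spectralDensity M (fun k η => Real.exp (c * japPair k η ^ s)) g k η := by
            refine lintegral_mono fun η => ?_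
            rw [spectralDensity, ← mul_assoc, ← ENNReal.ofReal_mul (by positivity)]
            refine le_mul_of_one_le_left zero_le ?_
            rw [ENNReal.one_le_ofReal, ← mul_pow, ← Real.exp_add]
            refine one_le_pow₀ (Real.one_le_exp ?_)
            have : jap ‖vec k‖ ^ s ≤ japPair k η ^ s :=
              Real.rpow_le_rpow (jap_pos _).le (jap_norm_vec_le_japPair k η) hs.le
            nlinarith
        _ ≤ ENNReal.ofReal (Real.exp (-(c * jap ‖vec k‖ ^ s)) ^ 2) * ENNReal.ofReal N := by
            rw [lintegral_const_mul' _ _ ENNReal.ofReal_ne_top]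
            gcongr
            refine le_trans ?_ hg
            refine le_trans ?_ (tsum_lintegral_spectralDensity
              (measurable_gevreyWeight c s) hg').le
            exact ENNReal.le_tsum (f := fun k => ∫⁻ η, spectralDensity M
              (fun k η => Real.exp (c * japPair k η ^ s)) g k η) k
        _ = _ := by rw [ENNReal.ofReal_mul (by positivity)]
    have h4 := h2.trans (mul_le_mul_right h3 _)
    have h5 : ENNReal.ofReal C' * ENNReal.ofReal (Real.exp (-(c * jap ‖vec k‖ ^ s)) ^ 2 * N) =
        ENNReal.ofReal (Real.sqrt C' * Real.sqrt N * Real.exp (-(c * jap ‖vec k‖ ^ s))) ^ 2 := by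
      rw [← ENNReal.ofReal_mul hC'.le, ← ENNReal.ofReal_pow (by positivity), mul_pow, mul_pow,
        Real.sq_sqrt hC'.le, Real.sq_sqrt hN]
      congr 1; ring
    rw [h5] at h4
    refine ((ENNReal.pow_le_pow_left_iff two_ne_zero).mp h4).trans (ENNReal.ofReal_le_ofReal ?_)
    gcongr
    linarith [Real.sqrt_nonneg C]

/-- A function on `𝕋^d × ℝ^d` with polynomially decaying Fourier transform. -/
structure ModeDecay (g : E d → E d → ℂ) (B : ℝ) : Prop where
  continuous : Continuous fun p : E d × E d => g p.1 p.2
  periodic : ∀ v, TorusPeriodic fun z => g z v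
  hat_le : ∀ k η, ‖modeHat g k η‖ ≤ B * (jap ‖vec k‖ ^ (-(d + 2) : ℝ) * jap ‖η‖ ^ (-(d + 2) : ℝ))
  lintegral_le : ∀ k, ∫⁻ v, ‖zMode g k v‖ₑ ≤ ENNReal.ofReal (B * jap ‖vec k‖ ^ (-(d + 2) : ℝ))

theorem exists_modeDecay (hd : 1 ≤ d) (hM : (d : ℝ) / 2 < M) (hc : 0 < c) (hs : 0 < s)
    (hs1 : s ≤ 1) :
    ∃ C : ℝ, 0 < C ∧ ∀ (g : E d → E d → ℂ) (N : ℝ), 0 ≤ N →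
      (Continuous fun p : E d × E d => g p.1 p.2) → (∀ v, TorusPeriodic fun z => g z v) →
      ∑ α ∈ multiIndices d M, gevreyNormSq c s (moment α g) ≤ ENNReal.ofReal N →
      ModeDecay g (C * Real.sqrt N) := by
  obtain ⟨C, hC, h⟩ := exists_gevrey_bounds (M := M) hd hM hc hs hs1
  -- Twice the exponent d+2, so that one half of the decay can be read in k and the other half in η.
  obtain ⟨C', hC', h'⟩ := exists_rpow_le_exp hc hs (2 * (d + 2))
  have key : ∀ y, 1 ≤ y → Real.exp (-(c * y ^ s)) ≤ C' * y ^ (-(2 * (d + 2)) : ℝ) := by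
    intro y hy
    have h1 := h' y hy
    rw [Real.exp_neg, Real.rpow_neg (by linarith), ← div_eq_mul_inv,
      le_div_iff₀ (Real.rpow_pos_of_pos (by linarith) _), inv_mul_le_iff₀ (Real.exp_pos _)]
    linarith
  have hp : (-(d + 2) : ℝ) ≤ 0 := by have : (0 : ℝ) ≤ d := Nat.cast_nonneg d; linarith
  have hsplit : ∀ y : ℝ, 1 ≤ y → y ^ (-(2 * (d + 2)) : ℝ) = y ^ (-(d + 2) : ℝ) * y ^ (-(d + 2) : ℝ) := by
    intro y hy
    rw [← Real.rpow_add (by linarith)]; congr 1; ring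
  refine ⟨C * C', by positivity, fun g N hN hcont hper hg => ?_⟩
  obtain ⟨h1, h2⟩ := h g N hN hg
  refine ⟨hcont, hper, fun k η => (h1 k η).trans ?_, fun k => (h2 k).trans ?_⟩
  · have h3 := key _ (one_le_japPair k η)
    rw [hsplit _ (one_le_japPair k η)] at h3
    have h4 := Real.rpow_le_rpow_of_nonpos (jap_pos _) (jap_norm_vec_le_japPair k η) hp
    have h5 := Real.rpow_le_rpow_of_nonpos (jap_pos _) (jap_norm_le_japPair k η) hp
    have h6 : 0 < japPair k η ^ (-(d + 2) : ℝ) := Real.rpow_pos_of_pos (japPair_pos k η) _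
    have h7 : 0 < jap ‖vec k‖ ^ (-(d + 2) : ℝ) := Real.rpow_pos_of_pos (jap_pos _) _
    calc C * Real.sqrt N * Real.exp (-(c * japPair k η ^ s))
        ≤ C * Real.sqrt N * (C' * (jap ‖vec k‖ ^ (-(d + 2) : ℝ) * jap ‖η‖ ^ (-(d + 2) : ℝ))) := by
          gcongr
          exact h3.trans (by gcongr)
      _ = _ := by ring
  · refine ENNReal.ofReal_le_ofReal ?_
    have h3 := key _ (one_le_jap ‖vec k‖)
    rw [hsplit _ (one_le_jap _)] at h3
    have h7 : 0 < jap ‖vec k‖ ^ (-(d + 2) : ℝ) := Real.rpow_pos_of_pos (jap_pos _) _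
    have h8 : jap ‖vec k‖ ^ (-(d + 2) : ℝ) ≤ 1 :=
      Real.rpow_le_one_of_one_le_of_nonpos (one_le_jap _) hp
    calc C * Real.sqrt N * Real.exp (-(c * jap ‖vec k‖ ^ s))
        ≤ C * Real.sqrt N * (C' * (jap ‖vec k‖ ^ (-(d + 2) : ℝ) * 1)) := by
          gcongr
          exact h3.trans (by gcongr)
      _ = _ := by ring

end Decay

end LandauDamping

namespace LandauDamping

/-! ### Boundedness and Lipschitz regularity from decay of the modes. -/

section ModeDecay

variable {d : ℕ} {g : E d → E d → ℂ} {B : ℝ}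

theorem norm_exp_I_mul_sub_le (a b : ℝ) :
    ‖Complex.exp (Complex.I * a) - Complex.exp (Complex.I * b)‖ ≤ |a - b| := by
  have h1 : Complex.exp (Complex.I * a) - Complex.exp (Complex.I * b) =
      Complex.exp (Complex.I * b) * (Complex.exp (Complex.I * ((a - b : ℝ) : ℂ)) - 1) := by
    rw [mul_sub, ← Complex.exp_add, mul_one]
    congr 2
    push_cast; ring
  rw [h1, norm_mul, norm_exp_I_mul, one_mul]
  exact Real.norm_exp_I_mul_ofReal_sub_one_le

/-- Integrals over the cell of continuous functions depend continuously on parameters. -/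
theorem continuous_integral_cell {X : Type*} [TopologicalSpace X] [LocallyCompactSpace X]
    [FirstCountableTopology X] {u : E d × X → ℂ} (hu : Continuous u) :
    Continuous fun x => ∫ z in cell d, u (z, x) := by
  rw [continuous_iff_continuousAt]
  intro x
  obtain ⟨S, hS, hxS⟩ := exists_compact_mem_nhds x
  obtain ⟨C, hC⟩ := ((isCompact_closedBall (0 : E d) (Real.sqrt d * (2 * Real.pi))).prod
    hS).exists_bound_of_continuousOn hu.continuousOn
  refine continuousAt_of_dominated (bound := fun _ => C) ?_ ?_ (integrable_const C) ?_
  · exact Filter.Eventually.of_forall fun y =>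
      (hu.comp (Continuous.prodMk_left y)).aestronglyMeasurable
  · filter_upwards [hxS] with y hy
    refine (ae_restrict_iff' measurableSet_cell).mpr (Filter.Eventually.of_forall fun z hz => ?_)
    exact hC (z, y) ⟨by simpa using norm_le_of_mem_cell hz, hy⟩
  · exact Filter.Eventually.of_forall fun z => (hu.comp (Continuous.prodMk_right z)).continuousAt

theorem continuous_zMode (hg : Continuous fun p : E d × E d => g p.1 p.2) (k : Fin d → ℤ) :
    Continuous (zMode g k) := by
  unfold zMode torusCoeff
  refine continuous_const.mul (continuous_integral_cell (u := fun p : E d × E d =>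
    Complex.exp (-Complex.I * (inner ℝ (vec k) p.1 : ℝ)) * g p.1 p.2) ?_)
  fun_prop

theorem continuous_exp_inner (η : E d) :
    Continuous fun v : E d => Complex.exp (-Complex.I * (inner ℝ η v : ℝ)) := by
  fun_prop

theorem fourier_eq_fourierInt (u : E d → ℂ) (w : E d) :
    𝓕 u w = fourierInt u ((2 * Real.pi) • w) := by
  rw [Real.fourier_eq', fourierInt]
  congr with v
  rw [smul_eq_mul, real_inner_smul_left, real_inner_comm]
  congr 2
  push_cast; ring

namespace ModeDecay

theorem nonneg (h : ModeDecay g B) : 0 ≤ B := by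
  have h1 := (norm_nonneg _).trans (h.hat_le 0 0)
  by_contra hB
  have h2 : 0 < jap ‖vec (0 : Fin d → ℤ)‖ ^ (-(d + 2) : ℝ) * jap ‖(0 : E d)‖ ^ (-(d + 2) : ℝ) :=
    mul_pos (Real.rpow_pos_of_pos (jap_pos _) _) (Real.rpow_pos_of_pos (jap_pos _) _)
  nlinarith

theorem integrable_zMode (h : ModeDecay g B) (k : Fin d → ℤ) : Integrable (zMode g k) :=
  ⟨(continuous_zMode h.continuous k).aestronglyMeasurable,
    (h.lintegral_le k).trans_lt ENNReal.ofReal_lt_top⟩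

theorem continuous_modeHat (h : ModeDecay g B) (k : Fin d → ℤ) : Continuous (modeHat g k) := by
  unfold modeHat fourierInt
  refine continuous_of_dominated (bound := fun v => ‖zMode g k v‖) (fun η => ?_) (fun η => ?_)
    (h.integrable_zMode k).norm ?_
  · exact ((continuous_exp_inner η).mul (continuous_zMode h.continuous k)).aestronglyMeasurable
  · exact Filter.Eventually.of_forall fun v => by rw [norm_mul, norm_exp_neg_I_mul, one_mul]
  · exact Filter.Eventually.of_forall fun v => by fun_prop

/-- `modeHat g k (2πw)` is bounded by an integrable weight, with one power of `w` to spare. -/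
theorem norm_modeHat_two_pi_le (h : ModeDecay g B) (k : Fin d → ℤ) (w : E d) :
    jap ‖w‖ * ‖modeHat g k ((2 * Real.pi) • w)‖ ≤
      B * jap ‖vec k‖ ^ (-(d + 2) : ℝ) * jap ‖w‖ ^ (-(d + 1) : ℝ) := by
  have h1 := h.hat_le k ((2 * Real.pi) • w)
  have hB := h.nonneg
  have hp : (-(d + 2) : ℝ) ≤ 0 := by have : (0 : ℝ) ≤ d := Nat.cast_nonneg d; linarith
  have h2 : jap ‖(2 * Real.pi) • w‖ ^ (-(d + 2) : ℝ) ≤ jap ‖w‖ ^ (-(d + 2) : ℝ) := by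
    refine Real.rpow_le_rpow_of_nonpos (jap_pos _) (jap_le_jap (norm_nonneg _) ?_) hp
    rw [norm_smul, Real.norm_of_nonneg Real.two_pi_pos.le]
    nlinarith [norm_nonneg w, Real.two_le_pi]
  have h3 : jap ‖w‖ ^ (-(d + 1) : ℝ) = jap ‖w‖ * jap ‖w‖ ^ (-(d + 2) : ℝ) := by
    rw [show (-(d + 1) : ℝ) = 1 + -(d + 2) by ring, Real.rpow_add (jap_pos _), Real.rpow_one]
  have h4 : 0 < jap ‖vec k‖ ^ (-(d + 2) : ℝ) := Real.rpow_pos_of_pos (jap_pos _) _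
  have h5 := jap_pos ‖w‖
  rw [h3]
  calc jap ‖w‖ * ‖modeHat g k ((2 * Real.pi) • w)‖
      ≤ jap ‖w‖ * (B * (jap ‖vec k‖ ^ (-(d + 2) : ℝ) * jap ‖w‖ ^ (-(d + 2) : ℝ))) := by
        gcongr; exact h1.trans (by gcongr)
    _ = _ := by ring

theorem norm_modeHat_two_pi_le' (h : ModeDecay g B) (k : Fin d → ℤ) (w : E d) :
    ‖modeHat g k ((2 * Real.pi) • w)‖ ≤
      B * jap ‖vec k‖ ^ (-(d + 2) : ℝ) * jap ‖w‖ ^ (-(d + 1) : ℝ) :=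
  (le_mul_of_one_le_left (norm_nonneg _) (one_le_jap _)).trans (h.norm_modeHat_two_pi_le k w)

theorem integrable_modeHat (h : ModeDecay g B) (k : Fin d → ℤ) :
    Integrable fun w => modeHat g k ((2 * Real.pi) • w) := by
  have hc := h.continuous_modeHat k
  refine ((integrable_jap_norm (d := d) (r := d + 1) (by linarith)).const_mul
    (B * jap ‖vec k‖ ^ (-(d + 2) : ℝ))).mono' (by fun_prop)
    (Filter.Eventually.of_forall fun w => h.norm_modeHat_two_pi_le' k w)

theorem zMode_eq_integral (h : ModeDecay g B) (k : Fin d → ℤ) (v : E d) :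
    zMode g k v = ∫ w, Complex.exp (Complex.I * (2 * Real.pi * inner ℝ w v : ℝ)) *
      modeHat g k ((2 * Real.pi) • w) := by
  have h1 : 𝓕 (zMode g k) = fun w => modeHat g k ((2 * Real.pi) • w) :=
    funext fun w => fourier_eq_fourierInt _ _
  have h2 := (continuous_zMode h.continuous k).fourierInv_fourier_eq (h.integrable_zMode k)
    (by rw [h1]; exact h.integrable_modeHat k)
  rw [← congrFun h2 v, h1, Real.fourierInv_eq']
  congr with w
  rw [smul_eq_mul]
  congr 2
  rw [mul_comm]

theorem norm_zMode_le (h : ModeDecay g B) (k : Fin d → ℤ) (v : E d) :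
    ‖zMode g k v‖ ≤ B * jap ‖vec k‖ ^ (-(d + 2) : ℝ) * ∫ w : E d, jap ‖w‖ ^ (-(d + 1) : ℝ) := by
  rw [h.zMode_eq_integral, ← integral_const_mul]
  refine norm_integral_le_of_norm_le ((integrable_jap_norm (d := d) (r := d + 1)
    (by linarith)).const_mul _) (Filter.Eventually.of_forall fun w => ?_)
  rw [norm_mul, norm_exp_I_mul, one_mul]
  exact h.norm_modeHat_two_pi_le' k w

/-- Decay of order d+2 in η leaves one power beyond integrability, which pays for the derivative of
e^(iw·v) in v. -/
theorem norm_zMode_sub_le (h : ModeDecay g B) (k : Fin d → ℤ) (v v' : E d) :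
    ‖zMode g k v - zMode g k v'‖ ≤ 2 * Real.pi * ‖v - v'‖ *
      (B * jap ‖vec k‖ ^ (-(d + 2) : ℝ) * ∫ w : E d, jap ‖w‖ ^ (-(d + 1) : ℝ)) := by
  have hInt : ∀ v : E d, Integrable fun w => Complex.exp (Complex.I * (2 * Real.pi * inner ℝ w v : ℝ)) *
      modeHat g k ((2 * Real.pi) • w) := fun v =>
    (h.integrable_modeHat k).bdd_mul (c := 1) (by fun_prop)
      (Filter.Eventually.of_forall fun w => (norm_exp_I_mul _).le)
  rw [h.zMode_eq_integral, h.zMode_eq_integral, ← integral_sub (hInt v) (hInt v'),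
    ← integral_const_mul, ← integral_const_mul]
  refine norm_integral_le_of_norm_le (((integrable_jap_norm (d := d) (r := d + 1)
    (by linarith)).const_mul _).const_mul _) (Filter.Eventually.of_forall fun w => ?_)
  rw [← sub_mul, norm_mul]
  have h1 := norm_exp_I_mul_sub_le (2 * Real.pi * inner ℝ w v) (2 * Real.pi * inner ℝ w v')
  rw [← mul_sub, ← inner_sub_right, abs_mul, abs_of_pos Real.two_pi_pos] at h1
  have h2 := abs_real_inner_le_norm w (v - v')
  have h3 : ‖w‖ ≤ jap ‖w‖ := (le_abs_self _).trans (abs_le_jap _)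
  have h4 := h.norm_modeHat_two_pi_le k w
  calc _ ≤ (2 * Real.pi * (‖w‖ * ‖v - v'‖)) * ‖modeHat g k ((2 * Real.pi) • w)‖ := by
        gcongr
        exact h1.trans (by gcongr)
    _ ≤ (2 * Real.pi * (jap ‖w‖ * ‖v - v'‖)) * ‖modeHat g k ((2 * Real.pi) • w)‖ := by gcongr
    _ = 2 * Real.pi * ‖v - v'‖ * (jap ‖w‖ * ‖modeHat g k ((2 * Real.pi) • w)‖) := by ring
    _ ≤ _ := by gcongr

end ModeDecay

theorem ModeDecay.hasSum (h : ModeDecay g B) (z v : E d) :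
    HasSum (fun k => zMode g k v * Complex.exp (Complex.I * (inner ℝ (vec k) z : ℝ))) (g z v) := by
  have h1 : Summable (torusCoeff fun z => g z v) := by
    refine Summable.of_norm_bounded (((summable_jap_vec (d := d) (r := d + 2)
      (by linarith)).mul_left B).mul_right (∫ w : E d, jap ‖w‖ ^ (-(d + 1) : ℝ))) fun k => ?_
    exact h.norm_zMode_le k v
  exact hasSum_torusCoeff (h.continuous.comp (Continuous.prodMk_left v)) (h.periodic v) h1 z

theorem jap_rpow_le (k : Fin d → ℤ) :
    jap ‖vec k‖ ^ (-(d + 2) : ℝ) ≤ jap ‖vec k‖ ^ (-(d + 1) : ℝ) :=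
  Real.rpow_le_rpow_of_exponent_le (one_le_jap _) (by linarith)

theorem norm_vec_mul_jap_rpow_le (k : Fin d → ℤ) :
    ‖vec k‖ * jap ‖vec k‖ ^ (-(d + 2) : ℝ) ≤ jap ‖vec k‖ ^ (-(d + 1) : ℝ) := by
  rw [show (-(d + 1) : ℝ) = 1 + -(d + 2) by ring, Real.rpow_add (jap_pos _), Real.rpow_one]
  gcongr
  · exact Real.rpow_nonneg (jap_pos _).le _
  · exact (le_abs_self _).trans (abs_le_jap _)

/-- One power of |k| is spent on the derivative in z; what remains, of order d+1, is still summable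
over the lattice. -/
theorem ModeDecay.norm_term_sub_le (h : ModeDecay g B) (k : Fin d → ℤ) (z v z' v' : E d) :
    ‖zMode g k v * Complex.exp (Complex.I * (inner ℝ (vec k) z : ℝ))
        - zMode g k v' * Complex.exp (Complex.I * (inner ℝ (vec k) z' : ℝ))‖ ≤
      (1 + 2 * Real.pi) * (‖z - z'‖ + ‖v - v'‖) *
        (B * jap ‖vec k‖ ^ (-(d + 1) : ℝ) * ∫ w : E d, jap ‖w‖ ^ (-(d + 1) : ℝ)) := by
  have hB := h.nonneg
  have hz := h.norm_zMode_le k v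
  have hz' := h.norm_zMode_sub_le k v v'
  have hJ0 : 0 ≤ ∫ w : E d, jap ‖w‖ ^ (-(d + 1) : ℝ) :=
    integral_nonneg fun w => Real.rpow_nonneg (jap_pos _).le _
  generalize (∫ w : E d, jap ‖w‖ ^ (-(d + 1) : ℝ)) = J at *
  have e1 : zMode g k v * Complex.exp (Complex.I * (inner ℝ (vec k) z : ℝ))
      - zMode g k v' * Complex.exp (Complex.I * (inner ℝ (vec k) z' : ℝ)) =
      zMode g k v * (Complex.exp (Complex.I * (inner ℝ (vec k) z : ℝ)) -
        Complex.exp (Complex.I * (inner ℝ (vec k) z' : ℝ))) +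
      (zMode g k v - zMode g k v') * Complex.exp (Complex.I * (inner ℝ (vec k) z' : ℝ)) := by ring
  have e2 := norm_exp_I_mul_sub_le (inner ℝ (vec k) z) (inner ℝ (vec k) z')
  rw [← inner_sub_right] at e2
  have e3 := e2.trans (abs_real_inner_le_norm (vec k) (z - z'))
  have e4 := norm_vec_mul_jap_rpow_le k
  have e5 := jap_rpow_le k
  have e6 : 0 ≤ jap ‖vec k‖ ^ (-(d + 2) : ℝ) := Real.rpow_nonneg (jap_pos _).le _
  have e7 : 0 ≤ jap ‖vec k‖ ^ (-(d + 1) : ℝ) := Real.rpow_nonneg (jap_pos _).le _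
  rw [e1]
  refine (norm_add_le _ _).trans ?_
  rw [norm_mul, norm_mul, norm_exp_I_mul, mul_one]
  calc _ ≤ (B * jap ‖vec k‖ ^ (-(d + 2) : ℝ) * J) * (‖vec k‖ * ‖z - z'‖) +
        2 * Real.pi * ‖v - v'‖ * (B * jap ‖vec k‖ ^ (-(d + 2) : ℝ) * J) :=
        add_le_add (mul_le_mul hz e3 (norm_nonneg _) (by positivity))
          hz'
    _ = B * J * ‖z - z'‖ * (‖vec k‖ * jap ‖vec k‖ ^ (-(d + 2) : ℝ)) +
        2 * Real.pi * ‖v - v'‖ * (B * J) * jap ‖vec k‖ ^ (-(d + 2) : ℝ) := by ring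
    _ ≤ B * J * ‖z - z'‖ * jap ‖vec k‖ ^ (-(d + 1) : ℝ) +
        2 * Real.pi * ‖v - v'‖ * (B * J) * jap ‖vec k‖ ^ (-(d + 1) : ℝ) := by gcongr
    _ = (‖z - z'‖ + 2 * Real.pi * ‖v - v'‖) * (B * jap ‖vec k‖ ^ (-(d + 1) : ℝ) * J) := by ring
    _ ≤ _ := by
        gcongr ?_ * _
        nlinarith [norm_nonneg (v - v'), mul_nonneg Real.two_pi_pos.le (norm_nonneg (z - z'))]

/-- Functions with decaying modes are bounded, Lipschitz and integrable, uniformly. -/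
theorem exists_modeDecay_bounds (d : ℕ) :
    ∃ C : ℝ, 0 < C ∧ ∀ (g : E d → E d → ℂ) (B : ℝ), ModeDecay g B →
      (∀ z v, ‖g z v‖ ≤ C * B) ∧
      (∀ z v z' v', ‖g z v - g z' v'‖ ≤ C * B * (‖z - z'‖ + ‖v - v'‖)) ∧
      Integrable (fun p : E d × E d => g p.1 p.2) ((volume.restrict (cell d)).prod volume) ∧
      ∫⁻ p : E d × E d, ‖g p.1 p.2‖ₑ ∂((volume.restrict (cell d)).prod volume) ≤
        ENNReal.ofReal (C * B) := by
  set J := ∫ w : E d, jap ‖w‖ ^ (-(d + 1) : ℝ) with hJ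
  have hJ0 : 0 ≤ J := integral_nonneg fun w => Real.rpow_nonneg (jap_pos _).le _
  set S := ∑' k : Fin d → ℤ, jap ‖vec k‖ ^ (-(d + 1) : ℝ) with hS
  have hsum : Summable fun k : Fin d → ℤ => jap ‖vec k‖ ^ (-(d + 1) : ℝ) :=
    summable_jap_vec (by linarith)
  have hS0 : 0 ≤ S := tsum_nonneg fun k => Real.rpow_nonneg (jap_pos _).le _
  have hpi := Real.two_pi_pos
  refine ⟨(1 + 2 * Real.pi) * J * S + (2 * Real.pi) ^ d * S + 1, by positivity, fun g B h => ?_⟩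
  have hB := h.nonneg
  have hlint : ∫⁻ p : E d × E d, ‖g p.1 p.2‖ₑ ∂((volume.restrict (cell d)).prod volume) ≤
      ENNReal.ofReal (((1 + 2 * Real.pi) * J * S + (2 * Real.pi) ^ d * S + 1) * B) := by
    rw [lintegral_prod _ h.continuous.enorm.measurable.aemeasurable]
    calc ∫⁻ z in cell d, ∫⁻ v, ‖g z v‖ₑ
        ≤ ∫⁻ _ in cell d, ENNReal.ofReal (B * S) := by
          refine lintegral_mono fun z => ?_
          calc ∫⁻ v, ‖g z v‖ₑ ≤ ∫⁻ v, ∑' k, ‖zMode g k v‖ₑ := by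
                refine lintegral_mono fun v => ?_
                rw [← (h.hasSum z v).tsum_eq]
                refine enorm_tsum_le_tsum_enorm.trans (ENNReal.tsum_le_tsum fun k => ?_)
                rw [enorm_mul, ← ofReal_norm (Complex.exp _), norm_exp_I_mul]
                simp
            _ = ∑' k, ∫⁻ v, ‖zMode g k v‖ₑ :=
                lintegral_tsum fun k => (continuous_zMode h.continuous k).enorm.measurable.aemeasurable
            _ ≤ ∑' k : Fin d → ℤ, ENNReal.ofReal (B * jap ‖vec k‖ ^ (-(d + 1) : ℝ)) :=
                ENNReal.tsum_le_tsum fun k => (h.lintegral_le k).trans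
                  (ENNReal.ofReal_le_ofReal (by gcongr B * ?_; exact jap_rpow_le k))
            _ = ENNReal.ofReal (B * S) := by
                rw [hS, ← tsum_mul_left, ENNReal.ofReal_tsum_of_nonneg _ (hsum.mul_left B)]
                exact fun k => mul_nonneg hB (Real.rpow_nonneg (jap_pos _).le _)
      _ = ENNReal.ofReal ((2 * Real.pi) ^ d * S * B) := by
          rw [lintegral_const, Measure.restrict_apply_univ, volume_cell,
            ← ENNReal.ofReal_mul (by positivity)]
          congr 1; ring
      _ ≤ _ := by
          apply ENNReal.ofReal_le_ofReal
          gcongr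
          have : 0 ≤ (1 + 2 * Real.pi) * J * S := by positivity
          linarith
  refine ⟨fun z v => ?_, fun z v z' v' => ?_, ⟨h.continuous.aestronglyMeasurable,
    hlint.trans_lt ENNReal.ofReal_lt_top⟩, hlint⟩
  · have hbd : ∀ k, ‖zMode g k v * Complex.exp (Complex.I * (inner ℝ (vec k) z : ℝ))‖ ≤
        B * jap ‖vec k‖ ^ (-(d + 1) : ℝ) * J := by
      intro k
      rw [norm_mul, norm_exp_I_mul, mul_one]
      refine (h.norm_zMode_le k v).trans ?_
      gcongr B * ?_ * J
      exact jap_rpow_le k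
    have h1 := tsum_of_norm_bounded (((hsum.mul_left B).mul_right J).hasSum) hbd
    rw [(h.hasSum z v).tsum_eq, tsum_mul_right, tsum_mul_left] at h1
    refine h1.trans ?_
    have h2 : 0 ≤ 2 * Real.pi * J * S + (2 * Real.pi) ^ d * S + 1 := by positivity
    nlinarith [mul_nonneg h2 hB]
  · have h0 : g z v - g z' v' = ∑' k, (zMode g k v * Complex.exp (Complex.I * (inner ℝ (vec k) z : ℝ))
        - zMode g k v' * Complex.exp (Complex.I * (inner ℝ (vec k) z' : ℝ))) :=
      ((h.hasSum z v).sub (h.hasSum z' v')).tsum_eq.symm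
    have hbd : ∀ k, ‖zMode g k v * Complex.exp (Complex.I * (inner ℝ (vec k) z : ℝ))
        - zMode g k v' * Complex.exp (Complex.I * (inner ℝ (vec k) z' : ℝ))‖ ≤
        (1 + 2 * Real.pi) * (‖z - z'‖ + ‖v - v'‖) * (B * jap ‖vec k‖ ^ (-(d + 1) : ℝ) * J) := by
      intro k
      exact h.norm_term_sub_le k z v z' v'
    have h1 := tsum_of_norm_bounded ((((hsum.mul_left B).mul_right J).mul_left
      ((1 + 2 * Real.pi) * (‖z - z'‖ + ‖v - v'‖))).hasSum) hbd
    rw [← h0, tsum_mul_left, tsum_mul_right, tsum_mul_left] at h1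
    refine h1.trans ?_
    have h2 : 0 ≤ (2 * Real.pi) ^ d * S + 1 := by positivity
    have h3 : 0 ≤ B * (‖z - z'‖ + ‖v - v'‖) := by positivity
    nlinarith [mul_nonneg h2 h3]

end ModeDecay

end LandauDamping

namespace LandauDamping

/-! ### Integration by parts on phase space. -/

section PhaseSpace

variable {d : ℕ}

/-- Lebesgue measure on a fundamental domain of the phase space `𝕋^d × ℝ^d`. -/
noncomputable abbrev phase (d : ℕ) : Measure (E d × E d) :=
  (volume.restrict (cell d)).prod volume

theorem ae_phase_mem_cell : ∀ᵐ p ∂phase d, p.1 ∈ cell d :=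
  Measure.quasiMeasurePreserving_fst.ae (ae_restrict_mem measurableSet_cell)

theorem integrable_indicator_closedBall (C R : ℝ) :
    Integrable (fun p : E d × E d => (Metric.closedBall (0 : E d) R).indicator (fun _ => C) p.2)
      (phase d) := by
  have h1 : Integrable ((Metric.closedBall (0 : E d) R).indicator fun _ => C) volume :=
    (integrable_indicator_iff Metric.isClosed_closedBall.measurableSet).mpr
      (integrableOn_const measure_closedBall_lt_top.ne)
  have h2 := Integrable.mul_prod (integrable_const (μ := volume.restrict (cell d)) (1 : ℝ)) h1
  simpa using h2

/-- Continuous functions whose support is bounded in velocity are dominated by an integrable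
function, locally uniformly with respect to translations. -/
theorem exists_bound_of_support {F : Type*} [NormedAddCommGroup F] {u : E d × E d → F}
    (hu : Continuous u) {R : ℝ} (hsupp : ∀ p, R < ‖p.2‖ → u p = 0) (r : ℝ) :
    ∃ C : ℝ, 0 ≤ C ∧ ∀ p q : E d × E d, p.1 ∈ cell d → ‖q‖ ≤ r →
      ‖u (p + q)‖ ≤ (Metric.closedBall (0 : E d) (R + r)).indicator (fun _ => C) p.2 := by
  obtain ⟨C, hC⟩ := ((isCompact_closedBall (0 : E d) (Real.sqrt d * (2 * Real.pi) + r)).prod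
    (isCompact_closedBall (0 : E d) (R + r + r))).exists_bound_of_continuousOn hu.continuousOn
  refine ⟨max C 0, le_max_right _ _, fun p q hp hq => ?_⟩
  have hq1 : ‖q.1‖ ≤ r := (norm_fst_le q).trans hq
  have hq2 : ‖q.2‖ ≤ r := (norm_snd_le q).trans hq
  by_cases hv : p.2 ∈ Metric.closedBall (0 : E d) (R + r)
  · rw [Set.indicator_of_mem hv]
    rw [mem_closedBall_zero_iff] at hv
    refine (hC _ ⟨?_, ?_⟩).trans (le_max_left _ _)
    · rw [mem_closedBall_zero_iff]
      exact (norm_add_le _ _).trans (add_le_add (norm_le_of_mem_cell hp) hq1)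
    · rw [mem_closedBall_zero_iff]
      exact (norm_add_le _ _).trans (add_le_add hv hq2)
  · rw [Set.indicator_of_notMem hv, hsupp, norm_zero]
    rw [mem_closedBall_zero_iff, not_le] at hv
    have h1 : ‖p.2‖ ≤ ‖(p + q).2‖ + ‖q.2‖ := by
      have := norm_sub_le (p + q).2 q.2
      simpa using this
    linarith

theorem integrable_of_support {F : Type*} [NormedAddCommGroup F] {u : E d × E d → F}
    (hu : Continuous u) {R : ℝ}
    (hsupp : ∀ p, R < ‖p.2‖ → u p = 0) : Integrable u (phase d) := by
  obtain ⟨C, -, hC⟩ := exists_bound_of_support hu hsupp 0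
  refine (integrable_indicator_closedBall C (R + 0)).mono' hu.aestronglyMeasurable ?_
  filter_upwards [ae_phase_mem_cell] with p hp
  simpa using hC p 0 hp (by simp)

theorem integral_phase_translate {u : E d × E d → ℂ} (hu : Continuous u)
    (hper : ∀ v, TorusPeriodic fun z => u (z, v)) {R : ℝ} (hsupp : ∀ p, R < ‖p.2‖ → u p = 0)
    (w : E d × E d) : ∫ p, u (p + w) ∂phase d = ∫ p, u p ∂phase d := by
  have h1 : Integrable (fun p => u (p + w)) (phase d) := by
    refine integrable_of_support (R := R + ‖w.2‖) (by fun_prop) fun p hp => hsupp _ ?_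
    have := norm_sub_le (p + w).2 w.2
    simp only [Prod.snd_add, add_sub_cancel_right] at this
    simp only [Prod.snd_add]
    linarith
  rw [integral_prod_symm _ h1, integral_prod_symm _ (integrable_of_support hu hsupp)]
  have h2 : ∀ v, ∫ z in cell d, u ((z, v) + w) = ∫ z in cell d, u (z, v + w.2) := fun v =>
    (hper (v + w.2)).integral_cell_add w.1
  simp_rw [h2]
  exact integral_add_right_eq_self (fun v => ∫ z in cell d, u (z, v)) w.2

/-- Integration by parts on `𝕋^d × ℝ^d`. -/
theorem integral_phase_fderiv_eq_zero {u : E d × E d → ℂ} (hu : ContDiff ℝ 1 u)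
    (hper : ∀ v, TorusPeriodic fun z => u (z, v)) {R : ℝ} (hsupp : ∀ p, R < ‖p.2‖ → u p = 0)
    (w : E d × E d) : ∫ p, fderiv ℝ u p w ∂phase d = 0 := by
  have hd : Differentiable ℝ u := hu.differentiable one_ne_zero
  have hc' : Continuous fun p => fderiv ℝ u p w := (hu.continuous_fderiv one_ne_zero).clm_apply
    continuous_const
  have hsupp' : ∀ p, R < ‖p.2‖ → fderiv ℝ u p w = 0 := by
    intro p hp
    have h1 : u =ᶠ[nhds p] fun _ => 0 := by
      filter_upwards [(isOpen_lt continuous_const (by fun_prop :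
        Continuous fun p : E d × E d => ‖p.2‖)).mem_nhds hp] with q hq
      exact hsupp q hq
    rw [h1.fderiv_eq]
    simp
  obtain ⟨C, -, hC⟩ := exists_bound_of_support hc' hsupp' ‖w‖
  -- The integral of u(p+εw) does not depend on ε; differentiating it under the integral sign at ε =
  -- 0 gives the claim.
  have h1 := hasDerivAt_integral_of_dominated_loc_of_deriv_le (μ := phase d) (𝕜 := ℝ)
    (F := fun ε p => u (p + ε • w)) (F' := fun ε p => fderiv ℝ u (p + ε • w) w) (x₀ := 0)
    (s := Metric.ball 0 1)
    (bound := fun p => (Metric.closedBall (0 : E d) (R + ‖w‖)).indicator (fun _ => C) p.2)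
    (Metric.ball_mem_nhds 0 one_pos)
    (Filter.Eventually.of_forall fun ε =>
      (hd.continuous.comp (by fun_prop)).aestronglyMeasurable)
    (by simpa using integrable_of_support hd.continuous hsupp)
    (hc'.comp (by fun_prop : Continuous fun p : E d × E d => p + (0 : ℝ) • w)).aestronglyMeasurable
    (by
      filter_upwards [ae_phase_mem_cell] with p hp ε hε
      refine hC p (ε • w) hp ?_
      rw [norm_smul]
      rw [mem_ball_zero_iff] at hε
      nlinarith [norm_nonneg w])
    (integrable_indicator_closedBall C _)
    (by
      filter_upwards with p ε _
      have h2 : HasDerivAt (fun ε : ℝ => p + ε • w) w ε := by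
        simpa using ((hasDerivAt_id ε).smul_const w).const_add p
      exact (hd (p + ε • w)).hasFDerivAt.comp_hasDerivAt ε h2)
  have h2 := h1.2
  simp only [integral_phase_translate hd.continuous hper hsupp, zero_smul, add_zero] at h2
  exact h2.unique (hasDerivAt_const _ _)

end PhaseSpace

/-! ### Plane waves and Fourier coefficients of the density. -/

section Density

variable {d : ℕ} {g : E d → E d → ℂ} {B : ℝ}

/-- The plane wave `e^{-i m·z - i ξ·v}`. -/
noncomputable def planeWave (m : Fin d → ℤ) (ξ : E d) (p : E d × E d) : ℂ :=
  Complex.exp (-Complex.I * (inner ℝ (vec m) p.1 : ℝ)) *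
    Complex.exp (-Complex.I * (inner ℝ ξ p.2 : ℝ))

theorem norm_planeWave (m : Fin d → ℤ) (ξ : E d) (p : E d × E d) : ‖planeWave m ξ p‖ = 1 := by
  rw [planeWave, norm_mul, norm_exp_neg_I_mul, norm_exp_neg_I_mul, one_mul]

theorem continuous_planeWave (m : Fin d → ℤ) (ξ : E d) : Continuous (planeWave m ξ) := by
  unfold planeWave
  fun_prop

theorem torusPeriodic_planeWave (m : Fin d → ℤ) (ξ v : E d) :
    TorusPeriodic fun z => planeWave m ξ (z, v) := by
  intro l z
  simp only [planeWave]
  congr 1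
  exact torusPeriodic_exp_neg m l z

theorem integral_planeWave_mul (hg : Integrable (fun p : E d × E d => g p.1 p.2) (phase d))
    (m : Fin d → ℤ) (ξ : E d) :
    ∫ p, planeWave m ξ p * g p.1 p.2 ∂phase d = (((2 * Real.pi) ^ d : ℝ) : ℂ) * modeHat g m ξ := by
  have h1 : Integrable (fun p => planeWave m ξ p * g p.1 p.2) (phase d) :=
    hg.bdd_mul (c := 1) (continuous_planeWave m ξ).aestronglyMeasurable
      (Filter.Eventually.of_forall fun p => (norm_planeWave m ξ p).le)
  have hpi : (((2 * Real.pi) ^ d : ℝ) : ℂ) ≠ 0 := by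
    exact_mod_cast (pow_pos Real.two_pi_pos d).ne'
  rw [integral_prod_symm _ h1, modeHat, fourierInt, ← integral_const_mul]
  congr with v
  rw [zMode, torusCoeff, ← mul_assoc, ← mul_assoc, mul_right_comm _ _ (_)⁻¹, mul_inv_cancel₀ hpi, one_mul,
    ← integral_const_mul]
  congr with z
  simp only [planeWave]
  ring

theorem integrable_shear (hc : Continuous fun p : E d × E d => g p.1 p.2)
    (hp : ∀ v, TorusPeriodic fun z => g z v)
    (hg : Integrable (fun p : E d × E d => g p.1 p.2) (phase d)) (t : ℝ) :
    Integrable (fun p : E d × E d => g (p.1 - t • p.2) p.2) (phase d) := by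
  have hc' : Continuous fun p : E d × E d => g (p.1 - t • p.2) p.2 :=
    hc.comp (by fun_prop : Continuous fun p : E d × E d => (p.1 - t • p.2, p.2))
  refine ⟨hc'.aestronglyMeasurable, ?_⟩
  have h1 := hg.2
  rw [hasFiniteIntegral_iff_enorm] at h1 ⊢
  rw [lintegral_prod_symm _ hc.enorm.measurable.aemeasurable] at h1
  rw [lintegral_prod_symm _ hc'.enorm.measurable.aemeasurable]
  refine lt_of_le_of_lt (le_of_eq ?_) h1
  congr with v
  have h2 : TorusPeriodic fun z => ‖g z v‖ₑ := fun k z => by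
    have := hp v k z
    simp only at this ⊢
    rw [this]
  simpa only [sub_eq_add_neg] using h2.lintegral_cell_add (-(t • v))

/-- The shear x = z + tv turns e^(-ik·x) into e^(-ik·z - itk·v), so the k-th coefficient samples f̂
at (k,kt). For fixed v the shear is a translation of the torus. -/
theorem torusCoeff_density (hc : Continuous fun p : E d × E d => g p.1 p.2)
    (hp : ∀ v, TorusPeriodic fun z => g z v)
    (hg : Integrable (fun p : E d × E d => g p.1 p.2) (phase d)) (t : ℝ) (k : Fin d → ℤ) :
    torusCoeff (fun x => ∫ v, g (x - t • v) v) k = modeHat g k (t • vec k) := by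
  have h1 : Integrable (fun p : E d × E d =>
      Complex.exp (-Complex.I * (inner ℝ (vec k) p.1 : ℝ)) * g (p.1 - t • p.2) p.2) (phase d) :=
    (integrable_shear hc hp hg t).bdd_mul (c := 1) (by fun_prop)
      (Filter.Eventually.of_forall fun p => (norm_exp_neg_I_mul _).le)
  rw [torusCoeff, modeHat, fourierInt]
  have h0 : ∀ x : E d, Complex.exp (-Complex.I * (inner ℝ (vec k) x : ℝ)) * ∫ v, g (x - t • v) v =
      ∫ v, Complex.exp (-Complex.I * (inner ℝ (vec k) x : ℝ)) * g (x - t • v) v :=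
    fun x => (integral_const_mul _ _).symm
  simp only [h0]
  have h2 := integral_integral_swap (f := fun x v =>
    Complex.exp (-Complex.I * (inner ℝ (vec k) x : ℝ)) * g (x - t • v) v) h1
  rw [h2, ← integral_const_mul]
  congr with v
  rw [zMode, torusCoeff, mul_left_comm]
  congr 1
  rw [← integral_const_mul]
  have h3 : TorusPeriodic fun z =>
      Complex.exp (-Complex.I * (inner ℝ (t • vec k) v : ℝ)) *
        (Complex.exp (-Complex.I * (inner ℝ (vec k) z : ℝ)) * g z v) := by
    have := (torusPeriodic_exp_neg k).mul (hp v)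
    intro l z
    have h4 := this l z
    simp only at h4 ⊢
    rw [h4]
  rw [← h3.integral_cell_add (-(t • v))]
  congr with z
  rw [← mul_assoc, ← Complex.exp_add, ← sub_eq_add_neg]
  congr 2
  rw [inner_sub_right, real_inner_smul_left, real_inner_smul_right]
  push_cast
  ring

end Density

end LandauDamping

namespace LandauDamping

/-! ### Decaying solutions and their force field. -/

section Solution

variable {d : ℕ} {What : (Fin d → ℤ) → ℂ} {f0 : E d → ℂ} {hin : E d → E d → ℂ} {T CW B : ℝ}
  {f : ℝ → E d → E d → ℂ}

/-- A solution of the Vlasov equation whose Fourier transform decays uniformly in time. -/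
structure DecayingSolution (What : (Fin d → ℤ) → ℂ) (f0 : E d → ℂ) (hin : E d → E d → ℂ) (T : ℝ)
    (f : ℝ → E d → E d → ℂ) (CW B : ℝ) : Prop extends IsVlasovSolution What f0 hin T f where
  decay : ∀ t ∈ Set.Ico 0 T, ModeDecay (f t) B
  potential : ∀ k, ‖vec k‖ * ‖What k‖ ≤ CW
  background : ContDiff ℝ 1 f0
  integrable_background : Integrable f0

/-- The Fourier coefficients of the force field. -/
noncomputable def forceCoeff (What : (Fin d → ℤ) → ℂ) (f : ℝ → E d → E d → ℂ) (t : ℝ) (j : Fin d)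
    (l : Fin d → ℤ) : ℂ :=
  -(Complex.I * (l j : ℂ) * What l * densityHat f t l)

/-- The total distribution `f + f⁰`. -/
def total (f0 : E d → ℂ) (f : ℝ → E d → E d → ℂ) (t : ℝ) (p : E d × E d) : ℂ :=
  f t p.1 p.2 + f0 p.2

/-- The direction of the derivative `∂_{v_j} - t ∂_{z_j}`. -/
noncomputable def drift (t : ℝ) (j : Fin d) : E d × E d :=
  (-(t • EuclideanSpace.single j 1), EuclideanSpace.single j 1)

theorem norm_intCast_le_norm_vec (l : Fin d → ℤ) (j : Fin d) : ‖(l j : ℂ)‖ ≤ ‖vec l‖ := by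
  have h1 := PiLp.norm_apply_le (vec l) j
  rw [vec_apply] at h1
  rwa [← Complex.norm_real, Complex.ofReal_intCast] at h1

/-- The force is evaluated at z+τv, so its l-th mode moves the frequency (k,η) to (k-l, η-τl). -/
theorem planeWave_mul_exp (k l : Fin d → ℤ) (η : E d) (τ : ℝ) (p : E d × E d) :
    planeWave k η p * Complex.exp (Complex.I * (inner ℝ (vec l) (p.1 + τ • p.2) : ℝ)) =
      planeWave (k - l) (η - τ • vec l) p := by
  simp only [planeWave]
  rw [← Complex.exp_add, ← Complex.exp_add, ← Complex.exp_add]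
  congr 1
  rw [inner_add_right, real_inner_smul_right, vec_sub, inner_sub_left, inner_sub_left,
    real_inner_smul_left]
  push_cast
  ring

theorem contDiff_planeWave (m : Fin d → ℤ) (ξ : E d) {n : WithTop ℕ∞} :
    ContDiff ℝ n (planeWave m ξ) := by
  unfold planeWave
  have h1 : ContDiff ℝ n fun p : E d × E d => ((inner ℝ (vec m) p.1 : ℝ) : ℂ) :=
    Complex.ofRealCLM.contDiff.comp (contDiff_const.inner ℝ contDiff_fst)
  have h2 : ContDiff ℝ n fun p : E d × E d => ((inner ℝ ξ p.2 : ℝ) : ℂ) :=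
    Complex.ofRealCLM.contDiff.comp (contDiff_const.inner ℝ contDiff_snd)
  exact (contDiff_const.mul h1).cexp.mul (contDiff_const.mul h2).cexp

theorem hasDerivAt_planeWave_line (m : Fin d → ℤ) (ξ : E d) (p w : E d × E d) :
    HasDerivAt (fun ε : ℝ => planeWave m ξ (p + ε • w))
      (-Complex.I * ((inner ℝ (vec m) w.1 + inner ℝ ξ w.2 : ℝ) : ℂ) * planeWave m ξ p) 0 := by
  have h1 : (fun ε : ℝ => planeWave m ξ (p + ε • w)) = fun ε : ℝ =>
      planeWave m ξ p *
        Complex.exp ((ε : ℂ) * (-Complex.I * ((inner ℝ (vec m) w.1 + inner ℝ ξ w.2 : ℝ) : ℂ))) := by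
    ext ε
    simp only [planeWave, Prod.fst_add, Prod.snd_add, Prod.smul_fst, Prod.smul_snd]
    rw [← Complex.exp_add, ← Complex.exp_add, ← Complex.exp_add]
    congr 1
    simp only [inner_add_right, real_inner_smul_right]
    push_cast
    ring
  rw [h1]
  have h2 : HasDerivAt (fun ε : ℝ => (ε : ℂ) * (-Complex.I *
      ((inner ℝ (vec m) w.1 + inner ℝ ξ w.2 : ℝ) : ℂ)))
      (-Complex.I * ((inner ℝ (vec m) w.1 + inner ℝ ξ w.2 : ℝ) : ℂ)) 0 := by
    simpa using (Complex.ofRealCLM.hasDerivAt (x := (0 : ℝ))).mul_const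
      (-Complex.I * ((inner ℝ (vec m) w.1 + inner ℝ ξ w.2 : ℝ) : ℂ))
  have h3 := (h2.cexp).const_mul (planeWave m ξ p)
  have h4 : planeWave m ξ p * (Complex.exp (((0 : ℝ) : ℂ) *
      (-Complex.I * ((inner ℝ (vec m) w.1 + inner ℝ ξ w.2 : ℝ) : ℂ))) *
      (-Complex.I * ((inner ℝ (vec m) w.1 + inner ℝ ξ w.2 : ℝ) : ℂ))) =
      -Complex.I * ((inner ℝ (vec m) w.1 + inner ℝ ξ w.2 : ℝ) : ℂ) * planeWave m ξ p := by
    rw [Complex.ofReal_zero, zero_mul, Complex.exp_zero]; ring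
  rwa [h4] at h3

/-- Functions of z+τv are annihilated by ∂_v - τ∂_z, so the shift by l leaves no trace in the factor
produced by the integration by parts. -/
theorem inner_drift (k l : Fin d → ℤ) (η : E d) (τ : ℝ) (j : Fin d) :
    inner ℝ (vec (k - l)) (drift τ j).1 + inner ℝ (η - τ • vec l) (drift τ j).2 =
      η j - τ * k j := by
  simp only [drift, inner_neg_right, real_inner_smul_right, EuclideanSpace.inner_single_right,
    conj_trivial, one_mul, PiLp.sub_apply, PiLp.smul_apply, vec_apply, smul_eq_mul, Pi.sub_apply]
  push_cast
  ring

namespace DecayingSolution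

theorem integrable_solution (h : DecayingSolution What f0 hin T f CW B) {t : ℝ}
    (ht : t ∈ Set.Ico 0 T) : Integrable (fun p : E d × E d => f t p.1 p.2) (phase d) := by
  obtain ⟨C, -, hC⟩ := exists_modeDecay_bounds d
  exact (hC _ _ (h.decay t ht)).2.2.1

theorem densityHat_eq (h : DecayingSolution What f0 hin T f CW B) {t : ℝ}
    (ht : t ∈ Set.Ico 0 T) (k : Fin d → ℤ) : densityHat f t k = modeHat (f t) k (t • vec k) :=
  torusCoeff_density (h.decay t ht).continuous (h.decay t ht).periodic (h.integrable_solution ht) t k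

theorem norm_densityHat_le (h : DecayingSolution What f0 hin T f CW B) {t : ℝ}
    (ht : t ∈ Set.Ico 0 T) (k : Fin d → ℤ) :
    ‖densityHat f t k‖ ≤ B * jap ‖vec k‖ ^ (-(d + 2) : ℝ) := by
  rw [h.densityHat_eq ht]
  refine ((h.decay t ht).hat_le k _).trans ?_
  have hB := (h.decay t ht).nonneg
  have h1 : jap ‖t • vec k‖ ^ (-(d + 2) : ℝ) ≤ 1 :=
    Real.rpow_le_one_of_one_le_of_nonpos (one_le_jap _)
      (by have : (0 : ℝ) ≤ d := Nat.cast_nonneg d; linarith)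
  have h2 : 0 ≤ jap ‖vec k‖ ^ (-(d + 2) : ℝ) := Real.rpow_nonneg (jap_pos _).le _
  calc _ ≤ B * (jap ‖vec k‖ ^ (-(d + 2) : ℝ) * 1) := by gcongr
    _ = _ := by ring

theorem norm_forceCoeff_le (h : DecayingSolution What f0 hin T f CW B) {t : ℝ}
    (ht : t ∈ Set.Ico 0 T) (j : Fin d) (l : Fin d → ℤ) :
    ‖forceCoeff What f t j l‖ ≤ CW * (B * jap ‖vec l‖ ^ (-(d + 2) : ℝ)) := by
  rw [forceCoeff, norm_neg, norm_mul, norm_mul, norm_mul, Complex.norm_I, one_mul]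
  have h1 : ‖(l j : ℂ)‖ * ‖What l‖ ≤ CW :=
    (mul_le_mul_of_nonneg_right (norm_intCast_le_norm_vec l j) (norm_nonneg _)).trans (h.potential l)
  exact mul_le_mul h1 (h.norm_densityHat_le ht l) (norm_nonneg _)
    ((mul_nonneg (norm_nonneg _) (norm_nonneg _)).trans h1)

theorem summable_forceCoeff (h : DecayingSolution What f0 hin T f CW B) {t : ℝ}
    (ht : t ∈ Set.Ico 0 T) (j : Fin d) : Summable fun l => ‖forceCoeff What f t j l‖ :=
  Summable.of_nonneg_of_le (fun _ => norm_nonneg _) (h.norm_forceCoeff_le ht j)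
    (((summable_jap_vec (d := d) (r := d + 2) (by linarith)).mul_left B).mul_left CW)

/-- A uniform bound for the force field. -/
theorem norm_force_le (h : DecayingSolution What f0 hin T f CW B) {t : ℝ}
    (ht : t ∈ Set.Ico 0 T) (j : Fin d) (x : E d) :
    ‖force What f t j x‖ ≤ CW * (B * ∑' l : Fin d → ℤ, jap ‖vec l‖ ^ (-(d + 2) : ℝ)) := by
  have h1 := tsum_of_norm_bounded (f := forceMode What f t j x) (((summable_jap_vec (d := d)
    (r := d + 2) (by linarith)).mul_left B).mul_left CW).hasSum fun l => by
      have : forceMode What f t j x l =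
          forceCoeff What f t j l * Complex.exp (Complex.I * (inner ℝ (vec l) x : ℝ)) := by
        simp only [forceMode, forceCoeff]; ring
      rw [this, norm_mul, norm_exp_I_mul, mul_one]
      exact h.norm_forceCoeff_le ht j l
  rwa [tsum_mul_left, tsum_mul_left] at h1

theorem contDiff_total (h : DecayingSolution What f0 hin T f CW B) {t : ℝ}
    (ht : t ∈ Set.Ico 0 T) : ContDiff ℝ 1 (total f0 f t) :=
  (h.smooth t ht).add (h.background.comp contDiff_snd)

theorem fderiv_total (h : DecayingSolution What f0 hin T f CW B) {t : ℝ}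
    (ht : t ∈ Set.Ico 0 T) (j : Fin d) (z v : E d) :
    fderiv ℝ (total f0 f t) (z, v) (drift t j) =
      (partialD j (fun w => f t z w) v - (t : ℂ) * partialD j (fun y => f t y v) z)
        + partialD j f0 v := by
  have hd : DifferentiableAt ℝ (fun p : E d × E d => f t p.1 p.2) (z, v) :=
    (h.smooth t ht).differentiable one_ne_zero _
  have hd0 : DifferentiableAt ℝ f0 v := h.background.differentiable one_ne_zero _
  set D := fderiv ℝ (fun p : E d × E d => f t p.1 p.2) (z, v) with hD
  have h1 : HasFDerivAt (total f0 f t)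
      (D + (fderiv ℝ f0 v).comp (ContinuousLinearMap.snd ℝ (E d) (E d))) (z, v) :=
    hd.hasFDerivAt.add (HasFDerivAt.comp (z, v) (g := f0) (f := Prod.snd) hd0.hasFDerivAt
      hasFDerivAt_snd)
  have h2 : HasFDerivAt (fun w => f t z w) (D.comp (ContinuousLinearMap.inr ℝ (E d) (E d))) v :=
    HasFDerivAt.comp (f := fun w => (z, w)) v hd.hasFDerivAt (hasFDerivAt_prodMk_right z v)
  have h3 : HasFDerivAt (fun y => f t y v) (D.comp (ContinuousLinearMap.inl ℝ (E d) (E d))) z :=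
    HasFDerivAt.comp (f := fun y => (y, v)) z hd.hasFDerivAt (hasFDerivAt_prodMk_left z v)
  rw [partialD, partialD, partialD, h1.fderiv, h2.fderiv, h3.fderiv]
  simp only [add_apply, ContinuousLinearMap.comp_apply,
    ContinuousLinearMap.coe_snd', ContinuousLinearMap.inr_apply, ContinuousLinearMap.inl_apply,
    drift]
  have h4 : ((-(t • EuclideanSpace.single j 1), EuclideanSpace.single j 1) : E d × E d) =
      (0, EuclideanSpace.single j 1) - t • (EuclideanSpace.single j 1, 0) := by
    ext <;> simp
  rw [h4, map_sub, map_smul, Complex.real_smul]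

theorem hasDerivAt (h : DecayingSolution What f0 hin T f CW B) {t : ℝ}
    (ht : t ∈ Set.Ioo 0 T) (z v : E d) :
    HasDerivAt (fun τ => f τ z v)
      (-∑ j, force What f t j (z + t • v) * fderiv ℝ (total f0 f t) (z, v) (drift t j)) t := by
  have ht' : t ∈ Set.Ico 0 T := ⟨ht.1.le, ht.2⟩
  have h1 := (h.equation t ht' z v).hasDerivAt (Ico_mem_nhds ht.1 ht.2)
  rw [← Finset.sum_add_distrib] at h1
  simp only [h.fderiv_total ht', mul_add]
  exact h1

end DecayingSolution

end Solution

end LandauDamping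

namespace LandauDamping

/-! ### Evolution of the modes with a velocity cutoff. -/

section Cutoff

variable {d : ℕ} {What : (Fin d → ℤ) → ℂ} {f0 : E d → ℂ} {hin : E d → E d → ℂ} {T CW B : ℝ}
  {f : ℝ → E d → E d → ℂ}

/-- The Fourier transform of `χ(v) f(t,z,v)`. -/
noncomputable def cutoffMode (χ : E d → ℂ) (f : ℝ → E d → E d → ℂ) (k : Fin d → ℤ) (η : E d)
    (t : ℝ) : ℂ :=
  ∫ p, planeWave k η p * (χ p.2 * f t p.1 p.2) ∂phase d

/-- The interaction of the modes `l` and `k - l` in the evolution of `cutoffMode`. -/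
noncomputable def cutoffFlux (χ : E d → ℂ) (f0 : E d → ℂ) (f : ℝ → E d → E d → ℂ) (k : Fin d → ℤ)
    (η : E d) (t : ℝ) (j : Fin d) (l : Fin d → ℤ) : ℂ :=
  ∫ p, planeWave (k - l) (η - t • vec l) p *
    ((-Complex.I * ((η j - t * k j : ℝ) : ℂ) * χ p.2 + partialD j χ p.2) * total f0 f t p) ∂phase d

theorem continuous_partialD {χ : E d → ℂ} (hχ : ContDiff ℝ 1 χ) (j : Fin d) :
    Continuous (partialD j χ) :=
  (hχ.continuous_fderiv one_ne_zero).clm_apply continuous_const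

theorem partialD_eq_zero {χ : E d → ℂ} {R : ℝ} (hR : ∀ v, R < ‖v‖ → χ v = 0) (j : Fin d) {v : E d}
    (hv : R < ‖v‖) : partialD j χ v = 0 := by
  have h1 : χ =ᶠ[nhds v] fun _ => 0 := by
    filter_upwards [(isOpen_lt continuous_const continuous_norm).mem_nhds hv] with w hw
    exact hR w hw
  rw [partialD, h1.fderiv_eq]
  simp

namespace DecayingSolution

theorem continuous_total (h : DecayingSolution What f0 hin T f CW B) {t : ℝ}
    (ht : t ∈ Set.Ico 0 T) : Continuous (total f0 f t) := (h.contDiff_total ht).continuous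

theorem total_periodic (h : DecayingSolution What f0 hin T f CW B) {t : ℝ}
    (ht : t ∈ Set.Ico 0 T) (v : E d) : TorusPeriodic fun z => total f0 f t (z, v) := fun k z => by
  simp only [total]
  rw [h.periodic t ht k z v]

/-- The cutoff gives the product bounded support in v, whence the integration by parts has no
boundary term; the derivative falls on the plane wave and on χ. -/
theorem integral_ibp (h : DecayingSolution What f0 hin T f CW B) {τ : ℝ}
    (hτ : τ ∈ Set.Ico 0 T) {χ : E d → ℂ} (hχ : ContDiff ℝ 1 χ) {R : ℝ}
    (hR : ∀ v, R < ‖v‖ → χ v = 0) (k : Fin d → ℤ) (η : E d) (j : Fin d) (l : Fin d → ℤ) :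
    ∫ p, planeWave (k - l) (η - τ • vec l) p *
      (χ p.2 * fderiv ℝ (total f0 f τ) p (drift τ j)) ∂phase d = -cutoffFlux χ f0 f k η τ j l := by
  set m := k - l with hm
  set ξ := η - τ • vec l with hξ
  set G := total f0 f τ with hG
  have hGc : ContDiff ℝ 1 G := h.contDiff_total hτ
  have hχ' : ContDiff ℝ 1 fun p : E d × E d => χ p.2 := hχ.comp contDiff_snd
  set u : E d × E d → ℂ := fun p => planeWave m ξ p * (χ p.2 * G p) with hu
  have huc : ContDiff ℝ 1 u := (contDiff_planeWave m ξ).mul (hχ'.mul hGc)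
  have hline : ∀ p w : E d × E d, HasDerivAt (fun ε : ℝ => p + ε • w) w 0 := fun p w => by
    simpa using ((hasDerivAt_id (0 : ℝ)).smul_const w).const_add p
  have hder : ∀ {F : E d × E d → ℂ}, ContDiff ℝ 1 F → ∀ p w,
      HasDerivAt (fun ε : ℝ => F (p + ε • w)) (fderiv ℝ F p w) 0 := by
    intro F hF p w
    have h1 := (hF.differentiable one_ne_zero (p + (0 : ℝ) • w)).hasFDerivAt.comp_hasDerivAt 0
      (hline p w)
    rw [zero_smul, add_zero] at h1
    exact h1
  have hderχ : ∀ p : E d × E d, fderiv ℝ (fun p : E d × E d => χ p.2) p (drift τ j) =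
      partialD j χ p.2 := by
    intro p
    have h1 : HasFDerivAt (fun p : E d × E d => χ p.2)
        ((fderiv ℝ χ p.2).comp (ContinuousLinearMap.snd ℝ (E d) (E d))) p :=
      HasFDerivAt.comp p (g := χ) (f := Prod.snd)
        (hχ.differentiable one_ne_zero _).hasFDerivAt hasFDerivAt_snd
    rw [h1.fderiv]
    rfl
  have hfd : ∀ p, fderiv ℝ u p (drift τ j) =
      planeWave m ξ p * ((-Complex.I * ((η j - τ * k j : ℝ) : ℂ) * χ p.2 + partialD j χ p.2) * G p) +
      planeWave m ξ p * (χ p.2 * fderiv ℝ G p (drift τ j)) := by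
    intro p
    have h1 := hder huc p (drift τ j)
    have h2 := (hasDerivAt_planeWave_line m ξ p (drift τ j)).mul
      ((hder hχ' p (drift τ j)).mul (hder hGc p (drift τ j)))
    rw [h1.unique h2, hderχ, hm, hξ, inner_drift]
    simp only [zero_smul, add_zero, Pi.mul_apply]
    ring
  have hzero := integral_phase_fderiv_eq_zero huc (fun v => ?_) (R := R) (fun p hp => by
    simp only [hu, hR _ hp, zero_mul, mul_zero]) (drift τ j)
  · have hcG := hGc.continuous
    have hcχ := hχ.continuous
    have hcχ' := continuous_partialD hχ j
    have hcp := continuous_planeWave m ξ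
    have hcG' : Continuous fun p => fderiv ℝ G p (drift τ j) :=
      (hGc.continuous_fderiv one_ne_zero).clm_apply continuous_const
    simp_rw [hfd] at hzero
    rw [integral_add (integrable_of_support (R := R) (by fun_prop) fun p hp => by
        rw [hR _ hp, partialD_eq_zero hR j hp]; simp)
      (integrable_of_support (R := R) (by fun_prop) fun p hp => by rw [hR _ hp]; simp)] at hzero
    rw [eq_neg_iff_add_eq_zero, add_comm]
    exact hzero
  · have h1 := (torusPeriodic_planeWave m ξ v).mul (h.total_periodic hτ v)
    intro n z
    have h2 := h1 n z
    simp only [hu, hG] at h2 ⊢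
    rw [mul_left_comm, h2, mul_left_comm]

theorem continuous_force (h : DecayingSolution What f0 hin T f CW B) {t : ℝ}
    (ht : t ∈ Set.Ico 0 T) (j : Fin d) : Continuous (force What f t j) := by
  unfold force
  refine continuous_tsum (fun l => ?_) (h.summable_forceCoeff ht j) fun l x => ?_
  · unfold forceMode
    fun_prop
  · have : forceMode What f t j x l =
        forceCoeff What f t j l * Complex.exp (Complex.I * (inner ℝ (vec l) x : ℝ)) := by
      simp only [forceMode, forceCoeff]; ring
    rw [this, norm_mul, norm_exp_I_mul, mul_one]

/-- The force term in Fourier variables. -/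
theorem hasSum_force (h : DecayingSolution What f0 hin T f CW B) {τ : ℝ}
    (hτ : τ ∈ Set.Ico 0 T) {χ : E d → ℂ} (hχ : ContDiff ℝ 1 χ) {R : ℝ}
    (hR : ∀ v, R < ‖v‖ → χ v = 0) (k : Fin d → ℤ) (η : E d) (j : Fin d) :
    HasSum (fun l => -(forceCoeff What f τ j l * cutoffFlux χ f0 f k η τ j l))
      (∫ p, planeWave k η p * (χ p.2 * (force What f τ j (p.1 + τ • p.2) *
        fderiv ℝ (total f0 f τ) p (drift τ j))) ∂phase d) := by
  have hGc := h.contDiff_total hτ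
  have hcG' : Continuous fun p => fderiv ℝ (total f0 f τ) p (drift τ j) :=
    (hGc.continuous_fderiv one_ne_zero).clm_apply continuous_const
  have hcχ := hχ.continuous
  set F : (Fin d → ℤ) → E d × E d → ℂ := fun l p => forceCoeff What f τ j l *
    (planeWave (k - l) (η - τ • vec l) p * (χ p.2 * fderiv ℝ (total f0 f τ) p (drift τ j))) with hF
  have hInt : Integrable (fun p : E d × E d => χ p.2 * fderiv ℝ (total f0 f τ) p (drift τ j))
      (phase d) :=
    integrable_of_support (R := R) (by fun_prop) fun p hp => by rw [hR _ hp, zero_mul]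
  have hFint : ∀ l, Integrable (F l) (phase d) := fun l =>
    (hInt.bdd_mul (c := 1) (continuous_planeWave _ _).aestronglyMeasurable
      (Filter.Eventually.of_forall fun p => (norm_planeWave _ _ p).le)).const_mul _
  have hnorm : ∀ l p, ‖F l p‖ = ‖forceCoeff What f τ j l‖ *
      ‖χ p.2 * fderiv ℝ (total f0 f τ) p (drift τ j)‖ := by
    intro l p
    simp only [hF]
    rw [norm_mul, norm_mul, norm_planeWave, one_mul]
  have h1 := hasSum_integral_of_summable_integral_norm hFint (by
    simp_rw [hnorm, integral_const_mul]
    exact (h.summable_forceCoeff hτ j).mul_right _)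
  have h2 : ∀ l, ∫ p, F l p ∂phase d = -(forceCoeff What f τ j l * cutoffFlux χ f0 f k η τ j l) := by
    intro l
    simp only [hF]
    rw [integral_const_mul, h.integral_ibp hτ hχ hR, mul_neg]
  have h3 : ∀ p, ∑' l, F l p = planeWave k η p * (χ p.2 * (force What f τ j (p.1 + τ • p.2) *
      fderiv ℝ (total f0 f τ) p (drift τ j))) := by
    intro p
    rw [force, ← tsum_mul_right, ← tsum_mul_left, ← tsum_mul_left]
    refine tsum_congr fun l => ?_
    simp only [hF, ← planeWave_mul_exp, forceMode, forceCoeff]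
    ring
  simpa only [h2, h3] using h1

/-- A classical solution is C¹ without any uniformity in time; the uniform bound comes from the
Lipschitz estimate for decaying modes. -/
theorem norm_fderiv_solution_le (h : DecayingSolution What f0 hin T f CW B) {C : ℝ} (hC0 : 0 < C)
    (hC : ∀ (g : E d → E d → ℂ) (B : ℝ), ModeDecay g B →
      ∀ z v z' v', ‖g z v - g z' v'‖ ≤ C * B * (‖z - z'‖ + ‖v - v'‖)) {t : ℝ}
    (ht : t ∈ Set.Ico 0 T) (p : E d × E d) :
    ‖fderiv ℝ (fun p : E d × E d => f t p.1 p.2) p‖ ≤ 2 * (C * B) := by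
  have hB := (h.decay t ht).nonneg
  refine norm_fderiv_le_of_lip' ℝ (by positivity) (Filter.Eventually.of_forall fun q => ?_)
  refine (hC _ _ (h.decay t ht) q.1 q.2 p.1 p.2).trans ?_
  have h1 : ‖q.1 - p.1‖ ≤ ‖q - p‖ := norm_fst_le (q - p)
  have h2 : ‖q.2 - p.2‖ ≤ ‖q - p‖ := norm_snd_le (q - p)
  have h3 : 0 ≤ C * B := by positivity
  nlinarith

theorem norm_drift_le (t : ℝ) (j : Fin d) : ‖drift t j‖ ≤ 1 + |t| := by
  rw [drift, Prod.norm_def]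
  refine max_le ?_ ?_
  · simp [norm_smul]
  · simp

theorem norm_fderiv_total_le (h : DecayingSolution What f0 hin T f CW B) {C : ℝ} (hC0 : 0 < C)
    (hC : ∀ (g : E d → E d → ℂ) (B : ℝ), ModeDecay g B →
      ∀ z v z' v', ‖g z v - g z' v'‖ ≤ C * B * (‖z - z'‖ + ‖v - v'‖)) {t : ℝ}
    (ht : t ∈ Set.Ico 0 T) (j : Fin d) (p : E d × E d) :
    ‖fderiv ℝ (total f0 f t) p (drift t j)‖ ≤ (2 * (C * B) + ‖fderiv ℝ f0 p.2‖) * (1 + T) := by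
  have hd : DifferentiableAt ℝ (fun p : E d × E d => f t p.1 p.2) p :=
    (h.smooth t ht).differentiable one_ne_zero _
  have hd0 : DifferentiableAt ℝ f0 p.2 := h.background.differentiable one_ne_zero _
  have h1 : HasFDerivAt (total f0 f t) (fderiv ℝ (fun p : E d × E d => f t p.1 p.2) p +
      (fderiv ℝ f0 p.2).comp (ContinuousLinearMap.snd ℝ (E d) (E d))) p :=
    hd.hasFDerivAt.add (HasFDerivAt.comp p (g := f0) (f := Prod.snd) hd0.hasFDerivAt
      hasFDerivAt_snd)
  have hdr : ‖drift t j‖ ≤ 1 + T := (norm_drift_le t j).trans (by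
    rw [abs_of_nonneg ht.1]; linarith [ht.2])
  rw [h1.fderiv]
  refine (ContinuousLinearMap.le_opNorm _ _).trans ?_
  have hB := (h.decay t ht).nonneg
  gcongr
  refine (norm_add_le _ _).trans (add_le_add (h.norm_fderiv_solution_le hC0 hC ht p) ?_)
  refine (ContinuousLinearMap.opNorm_comp_le _ _).trans ?_
  exact mul_le_of_le_one_right (norm_nonneg _) (ContinuousLinearMap.norm_snd_le ℝ _ _)

/-- Differentiation under the integral: force and derivatives of f are bounded uniformly in time,
and the cutoff makes the majorant integrable. -/
theorem hasDerivAt_cutoffMode (h : DecayingSolution What f0 hin T f CW B) {τ : ℝ}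
    (hτ : τ ∈ Set.Ioo 0 T) {χ : E d → ℂ} (hχ : ContDiff ℝ 1 χ) {R : ℝ}
    (hR : ∀ v, R < ‖v‖ → χ v = 0) (k : Fin d → ℤ) (η : E d) :
    HasDerivAt (cutoffMode χ f k η)
      (∑ j, ∑' l, forceCoeff What f τ j l * cutoffFlux χ f0 f k η τ j l) τ := by
  obtain ⟨C, hC0, hC⟩ := exists_modeDecay_bounds d
  have hC' : ∀ (g : E d → E d → ℂ) (B : ℝ), ModeDecay g B →
      ∀ z v z' v', ‖g z v - g z' v'‖ ≤ C * B * (‖z - z'‖ + ‖v - v'‖) :=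
    fun g B hg => (hC g B hg).2.1
  have hmem : ∀ {t}, t ∈ Set.Ioo 0 T → t ∈ Set.Ico 0 T := fun ht => ⟨ht.1.le, ht.2⟩
  set S := CW * (B * ∑' l : Fin d → ℤ, jap ‖vec l‖ ^ (-(d + 2) : ℝ)) with hS
  have hcχ := hχ.continuous
  have hcf0 : Continuous fun p : E d × E d => ‖fderiv ℝ f0 p.2‖ :=
    ((h.background.continuous_fderiv one_ne_zero).comp continuous_snd).norm
  have hfc : ∀ t ∈ Set.Ico 0 T, Continuous fun p : E d × E d => f t p.1 p.2 :=
    fun t ht => (h.smooth t ht).continuous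
  have hpc := continuous_planeWave k η
  have hcG : ∀ j, Continuous fun p => fderiv ℝ (total f0 f τ) p (drift τ j) := fun j =>
    ((h.contDiff_total (hmem hτ)).continuous_fderiv one_ne_zero).clm_apply continuous_const
  have h1 := hasDerivAt_integral_of_dominated_loc_of_deriv_le (μ := phase d) (𝕜 := ℝ)
    (F := fun t p => planeWave k η p * (χ p.2 * f t p.1 p.2))
    (F' := fun t p => planeWave k η p * (χ p.2 * (-∑ j, force What f t j (p.1 + t • p.2) *
      fderiv ℝ (total f0 f t) p (drift t j)))) (x₀ := τ) (s := Set.Ioo 0 T)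
    (bound := fun p => ‖χ p.2‖ * ∑ _j : Fin d, S * ((2 * (C * B) + ‖fderiv ℝ f0 p.2‖) * (1 + T)))
    (Ioo_mem_nhds hτ.1 hτ.2)
    (by
      filter_upwards [Ioo_mem_nhds hτ.1 hτ.2] with t ht
      have := hfc t (hmem ht)
      exact Continuous.aestronglyMeasurable (by fun_prop))
    (by
      have := hfc τ (hmem hτ)
      exact integrable_of_support (R := R) (by fun_prop) fun p hp => by rw [hR _ hp]; simp)
    ?_
    (by
      filter_upwards with p t ht
      rw [norm_mul, norm_planeWave, one_mul, norm_mul, norm_neg]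
      gcongr
      refine (norm_sum_le _ _).trans (Finset.sum_le_sum fun j _ => ?_)
      rw [norm_mul]
      have e1 := h.norm_force_le (hmem ht) j (p.1 + t • p.2)
      exact mul_le_mul e1 (h.norm_fderiv_total_le hC0 hC' (hmem ht) j p) (norm_nonneg _)
        ((norm_nonneg _).trans e1))
    (integrable_of_support (R := R) (by fun_prop) fun p hp => by rw [hR _ hp]; simp)
    (by
      filter_upwards with p t ht
      exact ((h.hasDerivAt ht p.1 p.2).const_mul _).const_mul _)
  · have h2 := h1.2
    have h3 : ∫ p, planeWave k η p * (χ p.2 * (-∑ j, force What f τ j (p.1 + τ • p.2) *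
        fderiv ℝ (total f0 f τ) p (drift τ j))) ∂phase d =
        ∑ j, ∑' l, forceCoeff What f τ j l * cutoffFlux χ f0 f k η τ j l := by
      have h4 : ∀ p : E d × E d, planeWave k η p * (χ p.2 * (-∑ j, force What f τ j (p.1 + τ • p.2) *
          fderiv ℝ (total f0 f τ) p (drift τ j))) = -∑ j, planeWave k η p * (χ p.2 *
          (force What f τ j (p.1 + τ • p.2) * fderiv ℝ (total f0 f τ) p (drift τ j))) := by
        intro p
        rw [mul_neg, mul_neg, Finset.mul_sum, Finset.mul_sum]
      simp_rw [h4]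
      rw [integral_neg, integral_finsetSum]
      · rw [← Finset.sum_neg_distrib]
        refine Finset.sum_congr rfl fun j _ => ?_
        have := (h.hasSum_force (hmem hτ) hχ hR k η j).neg.tsum_eq
        simp only [neg_neg] at this
        exact this.symm
      · intro j _
        have := hcG j
        have := h.continuous_force (hmem hτ) j
        exact integrable_of_support (R := R) (by fun_prop) fun p hp => by rw [hR _ hp]; simp
    rw [← h3]
    exact h2
  · have := hcG
    have := fun j => h.continuous_force (hmem hτ) j
    exact Continuous.aestronglyMeasurable (by fun_prop)

end DecayingSolution

end Cutoff

end LandauDamping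

namespace LandauDamping

open Filter Topology

/-! ### Removal of the velocity cutoff. -/

section Duhamel

variable {d : ℕ} {What : (Fin d → ℤ) → ℂ} {f0 : E d → ℂ} {hin : E d → E d → ℂ} {T CW B : ℝ}
  {f : ℝ → E d → E d → ℂ}

/-- Smooth cutoffs exhausting velocity space. -/
theorem exists_cutoffs (d : ℕ) :
    ∃ (χ : ℕ → E d → ℂ) (C : ℝ), 0 ≤ C ∧ (∀ n, ContDiff ℝ 1 (χ n) ∧
      (∃ R, ∀ v, R < ‖v‖ → χ n v = 0) ∧ (∀ v, ‖χ n v‖ ≤ 1) ∧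
      ∀ j v, ‖partialD j (χ n) v‖ ≤ C * ((n : ℝ) + 1)⁻¹) ∧
      ∀ v, Tendsto (fun n => χ n v) atTop (𝓝 1) := by
  let φ : ContDiffBump (0 : E d) := ⟨1, 2, one_pos, by norm_num⟩
  set ψ : E d → ℂ := fun v => (φ v : ℂ) with hψ
  have hψc : ContDiff ℝ 1 ψ := Complex.ofRealCLM.contDiff.comp φ.contDiff
  have hψs : ∀ v, 2 ≤ ‖v‖ → ψ v = 0 := fun v hv => by
    simp only [hψ]
    rw [φ.zero_of_le_dist (by simpa using hv), Complex.ofReal_zero]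
  have hfs : HasCompactSupport (fderiv ℝ ψ) := by
    refine HasCompactSupport.fderiv (𝕜 := ℝ) (HasCompactSupport.intro (isCompact_closedBall 0 2) fun v hv => hψs v ?_)
    rw [mem_closedBall_zero_iff, not_le] at hv
    exact hv.le
  obtain ⟨C, hC⟩ := hfs.exists_bound_of_continuous (hψc.continuous_fderiv one_ne_zero)
  have hC0 : 0 ≤ C := (norm_nonneg _).trans (hC 0)
  refine ⟨fun n v => ψ (((n : ℝ) + 1)⁻¹ • v), C, hC0, fun n => ?_, fun v => ?_⟩
  · have hn : (0 : ℝ) < (n : ℝ) + 1 := by positivity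
    refine ⟨hψc.comp (contDiff_const_smul _), ⟨2 * ((n : ℝ) + 1), fun v hv => hψs _ ?_⟩,
      fun v => ?_, fun j v => ?_⟩
    · rw [norm_smul, Real.norm_of_nonneg (inv_pos.mpr hn).le, ← div_eq_inv_mul, le_div_iff₀ hn]
      exact hv.le
    · simp only [hψ]
      rw [Complex.norm_real, Real.norm_of_nonneg φ.nonneg]
      exact φ.le_one
    · have h1 : HasFDerivAt (fun v => ψ (((n : ℝ) + 1)⁻¹ • v))
          ((fderiv ℝ ψ (((n : ℝ) + 1)⁻¹ • v)).comp
            (((n : ℝ) + 1)⁻¹ • ContinuousLinearMap.id ℝ (E d))) v :=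
        HasFDerivAt.comp (g := ψ) (f := fun v => ((n : ℝ) + 1)⁻¹ • v) v
          (hψc.differentiable one_ne_zero _).hasFDerivAt
          (((n : ℝ) + 1)⁻¹ • ContinuousLinearMap.id ℝ (E d)).hasFDerivAt
      rw [partialD, h1.fderiv]
      simp only [ContinuousLinearMap.comp_apply, smul_apply,
        ContinuousLinearMap.id_apply, map_smul]
      rw [norm_smul, Real.norm_of_nonneg (inv_pos.mpr hn).le, mul_comm]
      gcongr
      refine (ContinuousLinearMap.le_opNorm _ _).trans ?_
      have h2 := hC (((n : ℝ) + 1)⁻¹ • v)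
      simpa using h2
  · have h1 : Tendsto (fun n : ℕ => ((n : ℝ) + 1)⁻¹ • v) atTop (𝓝 0) := by
      have h2 := (tendsto_one_div_add_atTop_nhds_zero_nat (𝕜 := ℝ)).smul_const v
      simpa using h2
    have h2 := (hψc.continuous.tendsto 0).comp h1
    have h3 : ψ 0 = 1 := by
      simp only [hψ]
      rw [φ.one_of_mem_closedBall (by simp [φ])]
      simp
    rw [h3] at h2
    exact h2

/-- The Fourier transform of the total distribution `f + f⁰`. -/
noncomputable def totalHat (f0 : E d → ℂ) (f : ℝ → E d → E d → ℂ) (t : ℝ) (m : Fin d → ℤ)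
    (ξ : E d) : ℂ :=
  modeHat (f t) m ξ + if m = 0 then fourierInt f0 ξ else 0

theorem integrable_phase_of_velocity (h0 : Integrable f0) :
    Integrable (fun p : E d × E d => f0 p.2) (phase d) := by
  have := Integrable.mul_prod (integrable_const (μ := volume.restrict (cell d)) (1 : ℂ)) h0
  simpa using this

theorem modeHat_velocity (f0 : E d → ℂ) (m : Fin d → ℤ) (ξ : E d) :
    modeHat (fun _ v => f0 v) m ξ = if m = 0 then fourierInt f0 ξ else 0 := by
  have h1 : zMode (fun _ v => f0 v) m = fun v => if m = 0 then f0 v else 0 :=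
    funext fun v => torusCoeff_const (f0 v) m
  rw [modeHat, h1]
  split_ifs <;> simp [fourierInt]

namespace DecayingSolution

theorem integrable_total (h : DecayingSolution What f0 hin T f CW B) {t : ℝ}
    (ht : t ∈ Set.Ico 0 T) : Integrable (total f0 f t) (phase d) :=
  (h.integrable_solution ht).add (integrable_phase_of_velocity h.integrable_background)

theorem integral_planeWave_total (h : DecayingSolution What f0 hin T f CW B) {t : ℝ}
    (ht : t ∈ Set.Ico 0 T) (m : Fin d → ℤ) (ξ : E d) :
    ∫ p, planeWave m ξ p * total f0 f t p ∂phase d =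
      (((2 * Real.pi) ^ d : ℝ) : ℂ) * totalHat f0 f t m ξ := by
  have hb : ∀ {g : E d × E d → ℂ}, Integrable g (phase d) →
      Integrable (fun p => planeWave m ξ p * g p) (phase d) := fun hg =>
    hg.bdd_mul (c := 1) (continuous_planeWave m ξ).aestronglyMeasurable
      (Eventually.of_forall fun p => (norm_planeWave m ξ p).le)
  have h0 := integrable_phase_of_velocity h.integrable_background
  simp only [total, mul_add]
  rw [integral_add (hb (h.integrable_solution ht)) (hb h0),
    integral_planeWave_mul (h.integrable_solution ht), totalHat, mul_add,
    ← modeHat_velocity, ← integral_planeWave_mul (g := fun _ v => f0 v) h0]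

/-- A uniform `L¹` bound for the total distribution. -/
theorem exists_integral_norm_total_le (h : DecayingSolution What f0 hin T f CW B) :
    ∃ G : ℝ, 0 ≤ G ∧ ∀ t ∈ Set.Ico 0 T, ∫ p, ‖total f0 f t p‖ ∂phase d ≤ G := by
  obtain ⟨C, hC0, hC⟩ := exists_modeDecay_bounds d
  have h0 := integrable_phase_of_velocity h.integrable_background
  have hI : 0 ≤ ∫ p : E d × E d, ‖f0 p.2‖ ∂phase d := integral_nonneg fun p => norm_nonneg _
  refine ⟨max (C * B) 0 + ∫ p : E d × E d, ‖f0 p.2‖ ∂phase d, by positivity, fun t ht => ?_⟩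
  have h1 := (hC _ _ (h.decay t ht)).2.2.2
  have hB := (h.decay t ht).nonneg
  have h2 : ∫ p : E d × E d, ‖f t p.1 p.2‖ ∂phase d ≤ C * B := by
    rw [integral_norm_eq_lintegral_enorm (h.integrable_solution ht).aestronglyMeasurable]
    exact ENNReal.toReal_le_of_le_ofReal (by positivity) h1
  calc ∫ p, ‖total f0 f t p‖ ∂phase d
      ≤ ∫ p : E d × E d, (‖f t p.1 p.2‖ + ‖f0 p.2‖) ∂phase d :=
        integral_mono (h.integrable_total ht).norm
          ((h.integrable_solution ht).norm.add h0.norm) fun p => norm_add_le _ _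
    _ = _ := integral_add (h.integrable_solution ht).norm h0.norm
    _ ≤ _ := by
        gcongr
        exact h2.trans (le_max_left _ _)

/-- The bound is independent of time, of l and of the cutoff up to C. It is the majorant for both
the sum over l and the integral over time. -/
theorem norm_cutoffFlux_le (h : DecayingSolution What f0 hin T f CW B) {G : ℝ}
    (hG : ∀ t ∈ Set.Ico 0 T, ∫ p, ‖total f0 f t p‖ ∂phase d ≤ G)
    {t : ℝ} (ht : t ∈ Set.Ico 0 T) {χ : E d → ℂ} {C : ℝ} (hC0 : 0 ≤ C) (hχ : ∀ v, ‖χ v‖ ≤ 1)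
    (hχ' : ∀ j v, ‖partialD j χ v‖ ≤ C) (k : Fin d → ℤ) (η : E d) (j : Fin d) (l : Fin d → ℤ) :
    ‖cutoffFlux χ f0 f k η t j l‖ ≤ (‖η‖ + T * ‖vec k‖ + C) * G := by
  have hT : 0 ≤ T := ht.1.trans ht.2.le
  have hcoef : |η j - t * k j| ≤ ‖η‖ + T * ‖vec k‖ := by
    have h1 := PiLp.norm_apply_le η j
    have h2 := PiLp.norm_apply_le (vec k) j
    rw [vec_apply] at h2
    rw [Real.norm_eq_abs] at h1 h2
    refine (abs_sub _ _).trans ?_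
    rw [abs_mul, abs_of_nonneg ht.1]
    have := ht.2.le
    gcongr
  rw [cutoffFlux]
  have h1 : ‖∫ p, planeWave (k - l) (η - t • vec l) p * ((-Complex.I * ((η j - t * k j : ℝ) : ℂ) *
      χ p.2 + partialD j χ p.2) * total f0 f t p) ∂phase d‖ ≤
      ∫ p, (‖η‖ + T * ‖vec k‖ + C) * ‖total f0 f t p‖ ∂phase d := by
    refine norm_integral_le_of_norm_le ((h.integrable_total ht).norm.const_mul _)
      (Eventually.of_forall fun p => ?_)
    rw [norm_mul, norm_planeWave, one_mul, norm_mul]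
    gcongr
    refine (norm_add_le _ _).trans (add_le_add ?_ (hχ' j p.2))
    rw [norm_mul, norm_mul, norm_neg, Complex.norm_I, one_mul, Complex.norm_real, Real.norm_eq_abs]
    exact (mul_le_of_le_one_right (abs_nonneg _) (hχ _)).trans hcoef
  rw [integral_const_mul] at h1
  refine h1.trans ?_
  gcongr
  exact hG t ht

/-- Dominated convergence: the cutoffs tend to 1 while their gradients are O(1/n), so only the
derivative of the plane wave survives. -/
theorem tendsto_cutoffFlux (h : DecayingSolution What f0 hin T f CW B) {t : ℝ}
    (ht : t ∈ Set.Ico 0 T) {χ : ℕ → E d → ℂ} {C : ℝ} (hC0 : 0 ≤ C)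
    (hχc : ∀ n, ContDiff ℝ 1 (χ n)) (hχ : ∀ n v, ‖χ n v‖ ≤ 1)
    (hχ' : ∀ n j v, ‖partialD j (χ n) v‖ ≤ C * ((n : ℝ) + 1)⁻¹)
    (hlim : ∀ v, Tendsto (fun n => χ n v) atTop (𝓝 1))
    (k : Fin d → ℤ) (η : E d) (j : Fin d) (l : Fin d → ℤ) :
    Tendsto (fun n => cutoffFlux (χ n) f0 f k η t j l) atTop
      (𝓝 (-Complex.I * ((η j - t * k j : ℝ) : ℂ) * ((((2 * Real.pi) ^ d : ℝ) : ℂ) *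
        totalHat f0 f t (k - l) (η - t • vec l)))) := by
  rw [← h.integral_planeWave_total ht, ← integral_const_mul]
  have hct := h.continuous_total ht
  refine tendsto_integral_of_dominated_convergence
    (fun p => (|η j - t * k j| + C) * ‖total f0 f t p‖) (fun n => ?_)
    ((h.integrable_total ht).norm.const_mul _) (fun n => Eventually.of_forall fun p => ?_)
    (Eventually.of_forall fun p => ?_)
  · have := (hχc n).continuous
    have := continuous_partialD (hχc n) j
    have := continuous_planeWave (k - l) (η - t • vec l)
    exact Continuous.aestronglyMeasurable (by fun_prop)
  · rw [norm_mul, norm_planeWave, one_mul, norm_mul]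
    gcongr
    refine (norm_add_le _ _).trans (add_le_add ?_ ((hχ' n j p.2).trans ?_))
    · rw [norm_mul, norm_mul, norm_neg, Complex.norm_I, one_mul, Complex.norm_real, Real.norm_eq_abs]
      exact mul_le_of_le_one_right (abs_nonneg _) (hχ _ _)
    · refine mul_le_of_le_one_right hC0 (inv_le_one_of_one_le₀ ?_)
      have : (0 : ℝ) ≤ n := Nat.cast_nonneg n
      linarith
  · have h1 : Tendsto (fun n => partialD j (χ n) p.2) atTop (𝓝 0) := by
      refine squeeze_zero_norm (fun n => hχ' n j p.2) ?_
      have h2 := (tendsto_one_div_add_atTop_nhds_zero_nat (𝕜 := ℝ)).const_mul C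
      simpa using h2
    have h2 := ((((hlim p.2).const_mul (-Complex.I * ((η j - t * k j : ℝ) : ℂ))).add h1).mul_const
      (total f0 f t p)).const_mul (planeWave (k - l) (η - t • vec l) p)
    convert h2 using 2
    ring

theorem tendsto_cutoffMode (h : DecayingSolution What f0 hin T f CW B) {t : ℝ}
    (ht : t ∈ Set.Ico 0 T) {χ : ℕ → E d → ℂ}
    (hχc : ∀ n, ContDiff ℝ 1 (χ n)) (hχ : ∀ n v, ‖χ n v‖ ≤ 1)
    (hlim : ∀ v, Tendsto (fun n => χ n v) atTop (𝓝 1)) (k : Fin d → ℤ) (η : E d) :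
    Tendsto (fun n => cutoffMode (χ n) f k η t) atTop
      (𝓝 ((((2 * Real.pi) ^ d : ℝ) : ℂ) * modeHat (f t) k η)) := by
  rw [← integral_planeWave_mul (h.integrable_solution ht)]
  have hcf := (h.smooth t ht).continuous
  refine tendsto_integral_of_dominated_convergence (fun p => ‖f t p.1 p.2‖) (fun n => ?_)
    (h.integrable_solution ht).norm (fun n => Eventually.of_forall fun p => ?_)
    (Eventually.of_forall fun p => ?_)
  · have := (hχc n).continuous
    have := continuous_planeWave k η
    exact Continuous.aestronglyMeasurable (by fun_prop)
  · rw [norm_mul, norm_planeWave, one_mul, norm_mul]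
    exact mul_le_of_le_one_left (norm_nonneg _) (hχ _ _)
  · have h2 := ((hlim p.2).mul_const (f t p.1 p.2)).const_mul (planeWave k η p)
    simpa using h2

theorem continuousOn_cutoffMode (h : DecayingSolution What f0 hin T f CW B) {χ : E d → ℂ}
    (hχc : ContDiff ℝ 1 χ) {R : ℝ} (hR : ∀ v, R < ‖v‖ → χ v = 0) (k : Fin d → ℤ) (η : E d) :
    ContinuousOn (cutoffMode χ f k η) (Set.Ico 0 T) := by
  obtain ⟨C, hC0, hC⟩ := exists_modeDecay_bounds d
  have hcχ := hχc.continuous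
  have hcp := continuous_planeWave k η
  intro t ht
  refine continuousWithinAt_of_dominated (bound := fun p => ‖χ p.2‖ * (C * B)) ?_ ?_ ?_ ?_
  · filter_upwards [self_mem_nhdsWithin] with τ hτ
    have := (h.smooth τ hτ).continuous
    exact Continuous.aestronglyMeasurable (by fun_prop)
  · filter_upwards [self_mem_nhdsWithin] with τ hτ
    refine Eventually.of_forall fun p => ?_
    rw [norm_mul, norm_planeWave, one_mul, norm_mul]
    gcongr
    exact (hC _ _ (h.decay τ hτ)).1 _ _
  · exact integrable_of_support (R := R) (by fun_prop) fun p hp => by rw [hR _ hp]; simp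
  · exact Eventually.of_forall fun p =>
      (((h.equation t ht p.1 p.2).continuousWithinAt.const_mul _).const_mul _)

end DecayingSolution

end Duhamel

end LandauDamping

namespace LandauDamping

open Filter Topology

/-! ### Duhamel's formula. -/

section DuhamelFormula

variable {d : ℕ} {What : (Fin d → ℤ) → ℂ} {f0 : E d → ℂ} {hin : E d → E d → ℂ} {T CW B : ℝ}
  {f : ℝ → E d → E d → ℂ}

/-- The interaction of the modes `l` and `k - l`. -/
noncomputable def interaction (What : (Fin d → ℤ) → ℂ) (f0 : E d → ℂ) (f : ℝ → E d → E d → ℂ)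
    (k : Fin d → ℤ) (η : E d) (τ : ℝ) (l : Fin d → ℤ) : ℂ :=
  What l * densityHat f τ l * ((inner ℝ (vec l) (η - τ • vec k) : ℝ) : ℂ) *
    totalHat f0 f τ (k - l) (η - τ • vec l)

theorem sum_forceCoeff_mul (k : Fin d → ℤ) (η : E d) (τ : ℝ) (l : Fin d → ℤ) (c : ℂ) :
    ∑ j, forceCoeff What f τ j l * (-Complex.I * ((η j - τ * k j : ℝ) : ℂ) *
      (c * totalHat f0 f τ (k - l) (η - τ • vec l))) = -(c * interaction What f0 f k η τ l) := by
  have h1 : ∀ j, forceCoeff What f τ j l * (-Complex.I * ((η j - τ * k j : ℝ) : ℂ) *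
      (c * totalHat f0 f τ (k - l) (η - τ • vec l))) =
      -(c * (What l * densityHat f τ l * totalHat f0 f τ (k - l) (η - τ • vec l))) *
        (((l j : ℝ) * (η j - τ * k j) : ℝ) : ℂ) := by
    intro j
    have hI : Complex.I * Complex.I = -1 := Complex.I_mul_I
    simp only [forceCoeff]
    push_cast
    linear_combination (l j : ℂ) * What l * densityHat f τ l * (η j - τ * k j) *
      (c * totalHat f0 f τ (k - l) (η - τ • vec l)) * hI
  simp_rw [h1]
  rw [← Finset.mul_sum, interaction, inner_vec]
  simp only [PiLp.sub_apply, PiLp.smul_apply, vec_apply, smul_eq_mul]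
  push_cast
  ring

namespace DecayingSolution

theorem summable_forceCoeff_mul (h : DecayingSolution What f0 hin T f CW B) {t : ℝ}
    (ht : t ∈ Set.Ico 0 T) (j : Fin d) {b : (Fin d → ℤ) → ℂ} {D : ℝ} (hb : ∀ l, ‖b l‖ ≤ D) :
    Summable fun l => forceCoeff What f t j l * b l := by
  refine Summable.of_norm_bounded ((h.summable_forceCoeff ht j).mul_right D) fun l => ?_
  rw [norm_mul]
  gcongr
  exact hb l

theorem norm_tsum_forceCoeff_mul_le (h : DecayingSolution What f0 hin T f CW B) {t : ℝ}
    (ht : t ∈ Set.Ico 0 T) (j : Fin d) {b : (Fin d → ℤ) → ℂ} {D : ℝ} (hb : ∀ l, ‖b l‖ ≤ D) :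
    ‖∑' l, forceCoeff What f t j l * b l‖ ≤
      CW * (B * ∑' l : Fin d → ℤ, jap ‖vec l‖ ^ (-(d + 2) : ℝ)) * D := by
  have h1 := tsum_of_norm_bounded (f := fun l => forceCoeff What f t j l * b l)
    ((((summable_jap_vec (d := d) (r := d + 2) (by linarith)).mul_left B).mul_left CW).mul_right
      D).hasSum fun l => by
        rw [norm_mul]
        exact mul_le_mul (h.norm_forceCoeff_le ht j l) (hb l) (norm_nonneg _)
          ((norm_nonneg _).trans (h.norm_forceCoeff_le ht j l))
  rwa [tsum_mul_right, tsum_mul_left, tsum_mul_left] at h1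

/-- Duhamel's formula for the Fourier transform of the solution. -/
theorem duhamel (h : DecayingSolution What f0 hin T f CW B) {t : ℝ}
    (ht : t ∈ Set.Ico 0 T) (k : Fin d → ℤ) (η : E d) :
    IntervalIntegrable (fun τ => ∑' l, interaction What f0 f k η τ l) volume 0 t ∧
      modeHat (f t) k η = modeHat hin k η - ∫ τ in 0..t, ∑' l, interaction What f0 f k η τ l := by
  obtain ⟨χ, C, hC0, hχall, hlim⟩ := exists_cutoffs d
  choose hχc hχR hχ1 hχ' using hχall
  choose R hR using hχR
  obtain ⟨G, hG0, hG⟩ := h.exists_integral_norm_total_le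
  have hχ'' : ∀ n j v, ‖partialD j (χ n) v‖ ≤ C := fun n j v => (hχ' n j v).trans (by
    refine mul_le_of_le_one_right hC0 (inv_le_one_of_one_le₀ ?_)
    have : (0 : ℝ) ≤ n := Nat.cast_nonneg n
    linarith)
  set c : ℂ := (((2 * Real.pi) ^ d : ℝ) : ℂ) with hc
  have hc0 : c ≠ 0 := by
    rw [hc]; exact_mod_cast (pow_pos Real.two_pi_pos d).ne'
  set D := (‖η‖ + T * ‖vec k‖ + C) * G with hD
  set Ψ : ℕ → ℝ → ℂ := fun n τ =>
    ∑ j, ∑' l, forceCoeff What f τ j l * cutoffFlux (χ n) f0 f k η τ j l with hΨ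
  have hflux : ∀ n, ∀ τ ∈ Set.Ico 0 T, ∀ j l, ‖cutoffFlux (χ n) f0 f k η τ j l‖ ≤ D :=
    fun n τ hτ j l => h.norm_cutoffFlux_le hG hτ hC0 (hχ1 n) (hχ'' n) k η j l
  have hder : ∀ n, ∀ τ ∈ Set.Ioo 0 T, HasDerivAt (cutoffMode (χ n) f k η) (Ψ n τ) τ :=
    fun n τ hτ => h.hasDerivAt_cutoffMode hτ (hχc n) (hR n) k η
  set D' := ∑ _j : Fin d, CW * (B * ∑' l : Fin d → ℤ, jap ‖vec l‖ ^ (-(d + 2) : ℝ)) * D with hD'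
  have hΨb : ∀ n, ∀ τ ∈ Set.Ico 0 T, ‖Ψ n τ‖ ≤ D' := fun n τ hτ =>
    (norm_sum_le _ _).trans (Finset.sum_le_sum fun j _ =>
      h.norm_tsum_forceCoeff_mul_le hτ j (hflux n τ hτ j))
  have hmem : ∀ {τ}, τ ∈ Set.uIoc 0 t → τ ∈ Set.Ioo 0 T := fun {τ} hτ => by
    rw [Set.uIoc_of_le ht.1] at hτ
    exact ⟨hτ.1, hτ.2.trans_lt ht.2⟩
  have hmem' : ∀ {τ}, τ ∈ Set.uIoc 0 t → τ ∈ Set.Ico 0 T := fun hτ => ⟨(hmem hτ).1.le, (hmem hτ).2⟩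
  -- Measurability in time is inherited from being a derivative; measurability of the modes
  -- themselves will only follow from this theorem.
  have hmeas : ∀ n, AEStronglyMeasurable (Ψ n) (volume.restrict (Set.uIoc 0 t)) := by
    intro n
    refine ((measurable_deriv (cutoffMode (χ n) f k η)).aestronglyMeasurable).congr ?_
    refine (ae_restrict_iff' measurableSet_uIoc).mpr (Eventually.of_forall fun τ hτ => ?_)
    exact (hder n τ (hmem hτ)).deriv
  have hInt : ∀ n, IntervalIntegrable (Ψ n) volume 0 t := by
    intro n
    refine (intervalIntegrable_const (c := D')).mono_fun' (hmeas n) ?_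
    exact (ae_restrict_iff' measurableSet_uIoc).mpr
      (Eventually.of_forall fun τ hτ => hΨb n τ (hmem' hτ))
  have hftc : ∀ n, ∫ τ in 0..t, Ψ n τ =
      cutoffMode (χ n) f k η t - cutoffMode (χ n) f k η 0 := by
    intro n
    refine intervalIntegral.integral_eq_sub_of_hasDerivAt_of_le ht.1 ?_ (fun τ hτ => ?_) (hInt n)
    · exact (h.continuousOn_cutoffMode (hχc n) (hR n) k η).mono fun τ hτ =>
        ⟨hτ.1, hτ.2.trans_lt ht.2⟩
    · exact hder n τ ⟨hτ.1, hτ.2.trans ht.2⟩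
  have hlimΨ : ∀ τ ∈ Set.uIoc 0 t, Tendsto (fun n => Ψ n τ) atTop
      (𝓝 (-(c * ∑' l, interaction What f0 f k η τ l))) := by
    intro τ hτ
    have hτ' := hmem' hτ
    set b : Fin d → (Fin d → ℤ) → ℂ := fun j l => -Complex.I * ((η j - τ * k j : ℝ) : ℂ) *
      (c * totalHat f0 f τ (k - l) (η - τ • vec l)) with hb
    have hfl : ∀ j l, Tendsto (fun n => cutoffFlux (χ n) f0 f k η τ j l) atTop (𝓝 (b j l)) :=
      fun j l => h.tendsto_cutoffFlux hτ' hC0 hχc hχ1 hχ' hlim k η j l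
    have hbD : ∀ j l, ‖b j l‖ ≤ D := fun j l =>
      le_of_tendsto (hfl j l).norm (Eventually.of_forall fun n => hflux n τ hτ' j l)
    have h1 : Tendsto (fun n => Ψ n τ) atTop (𝓝 (∑ j, ∑' l, forceCoeff What f τ j l * b j l)) := by
      refine tendsto_finsetSum _ fun j _ => ?_
      refine tendsto_tsum_of_dominated_convergence ((h.summable_forceCoeff hτ' j).mul_right D)
        (fun l => (hfl j l).const_mul _) (Eventually.of_forall fun n l => ?_)
      rw [norm_mul]
      gcongr
      exact hflux n τ hτ' j l
    have h2 : ∑ j, ∑' l, forceCoeff What f τ j l * b j l =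
        -(c * ∑' l, interaction What f0 f k η τ l) := by
      rw [← Summable.tsum_finsetSum fun j _ => h.summable_forceCoeff_mul hτ' j (hbD j)]
      simp only [hb, sum_forceCoeff_mul]
      rw [tsum_neg, tsum_mul_left]
    rwa [h2] at h1
  -- The fundamental theorem of calculus holds for each cutoff, and both of its sides converge as
  -- the cutoffs exhaust velocity space.
  have hlimint := intervalIntegral.tendsto_integral_filter_of_dominated_convergence
    (μ := volume) (a := 0) (b := t) (F := Ψ) (l := atTop) (fun _ => D')
    (Eventually.of_forall hmeas)
    (Eventually.of_forall fun n => Eventually.of_forall fun τ hτ => hΨb n τ (hmem' hτ))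
    intervalIntegrable_const (Eventually.of_forall hlimΨ)
  have hII : IntervalIntegrable (fun τ => -(c * ∑' l, interaction What f0 f k η τ l)) volume 0 t := by
    have hm : AEStronglyMeasurable (fun τ => -(c * ∑' l, interaction What f0 f k η τ l))
        (volume.restrict (Set.uIoc 0 t)) :=
      aestronglyMeasurable_of_tendsto_ae atTop hmeas
        ((ae_restrict_iff' measurableSet_uIoc).mpr (Eventually.of_forall hlimΨ))
    refine (intervalIntegrable_const (c := D')).mono_fun' hm ?_
    refine (ae_restrict_iff' measurableSet_uIoc).mpr (Eventually.of_forall fun τ hτ => ?_)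
    exact le_of_tendsto (hlimΨ τ hτ).norm (Eventually.of_forall fun n => hΨb n τ (hmem' hτ))
  have hT : (0 : ℝ) ∈ Set.Ico 0 T := ⟨le_rfl, ht.1.trans_lt ht.2⟩
  have hlim2 := (h.tendsto_cutoffMode ht hχc hχ1 hlim k η).sub
    (h.tendsto_cutoffMode hT hχc hχ1 hlim k η)
  simp_rw [← hftc] at hlim2
  have heq := tendsto_nhds_unique hlimint hlim2
  constructor
  · have h1 := hII.const_mul (-c⁻¹)
    refine IntervalIntegrable.congr (fun τ _ => ?_) h1
    field_simp
  · rw [intervalIntegral.integral_neg, intervalIntegral.integral_const_mul, h.initial, ← mul_sub,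
      ← mul_neg] at heq
    have h2 := mul_left_cancel₀ hc0 heq
    rw [sub_eq_add_neg, h2]
    ring

end DecayingSolution

end DuhamelFormula

end LandauDamping

namespace LandauDamping

/-! ### Schur estimates in frequency and time. -/

section Schur

variable {d : ℕ}

theorem sq_lintegral_mul_le_mul {Y : Type*} [MeasurableSpace Y] {ν : Measure Y} {u g : Y → ℝ≥0∞}
    (hu : AEMeasurable u ν) (hg : AEMeasurable g ν) :
    (∫⁻ y, u y * g y ∂ν) ^ 2 ≤ (∫⁻ y, u y ^ 2 ∂ν) * ∫⁻ y, g y ^ 2 ∂ν := by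
  have h1 := ENNReal.lintegral_mul_le_Lp_mul_Lq ν Real.HolderConjugate.two_two hu hg
  have h2 := pow_le_pow_left' h1 2
  refine h2.trans (le_of_eq ?_)
  rw [mul_pow, ← ENNReal.rpow_natCast, ← ENNReal.rpow_natCast, ← ENNReal.rpow_mul,
    ← ENNReal.rpow_mul]
  norm_num

theorem lintegral_inv_one_add_sq : ∫⁻ x : ℝ, ENNReal.ofReal (1 + x ^ 2)⁻¹ = ENNReal.ofReal Real.pi := by
  rw [← ofReal_integral_eq_lintegral_ofReal integrable_inv_one_add_sq
    (Filter.Eventually.of_forall fun x => by positivity), integral_univ_inv_one_add_sq]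

/-- Only the component of a-τv along v matters; it equals |v|(τ₀-τ), and the factor |v| is the
Jacobian that turns the integral into that of 1/(1+x²). -/
theorem lintegral_line_le (a v : E d) (hv : 0 < ‖v‖) :
    ∫⁻ τ : ℝ, ENNReal.ofReal (‖v‖ * (1 + ‖a - τ • v‖ ^ 2)⁻¹) ≤ ENNReal.ofReal Real.pi := by
  set τ₀ := inner ℝ a v / ‖v‖ ^ 2 with hτ₀
  have h1 : ∀ τ : ℝ, (‖v‖ * (τ - τ₀)) ^ 2 ≤ ‖a - τ • v‖ ^ 2 := by
    intro τ
    have h2 := abs_real_inner_le_norm (a - τ • v) v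
    have h3 : inner ℝ (a - τ • v) v = ‖v‖ ^ 2 * (τ₀ - τ) := by
      rw [inner_sub_left, real_inner_smul_left, real_inner_self_eq_norm_sq, hτ₀]
      field_simp
    rw [h3, abs_mul, abs_of_pos (by positivity), sq, mul_assoc, mul_comm ‖a - τ • v‖] at h2
    have h4 : ‖v‖ * |τ₀ - τ| ≤ ‖a - τ • v‖ := le_of_mul_le_mul_left h2 hv
    rw [mul_pow, ← sq_abs (τ - τ₀), abs_sub_comm, ← mul_pow]
    exact pow_le_pow_left₀ (by positivity) h4 2
  have hmm : Measurable fun x : ℝ => ENNReal.ofReal (1 + x ^ 2)⁻¹ := by fun_prop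
  calc ∫⁻ τ : ℝ, ENNReal.ofReal (‖v‖ * (1 + ‖a - τ • v‖ ^ 2)⁻¹)
      ≤ ∫⁻ τ : ℝ, ENNReal.ofReal ‖v‖ * ENNReal.ofReal (1 + (‖v‖ * (τ - τ₀)) ^ 2)⁻¹ := by
        refine lintegral_mono fun τ => ?_
        rw [← ENNReal.ofReal_mul hv.le]
        apply ENNReal.ofReal_le_ofReal
        gcongr ?_ * (1 + ?_)⁻¹
        exact h1 τ
    _ = ENNReal.ofReal ‖v‖ * ∫⁻ τ : ℝ, ENNReal.ofReal (1 + (‖v‖ * τ) ^ 2)⁻¹ := by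
        rw [lintegral_const_mul' _ _ ENNReal.ofReal_ne_top,
          lintegral_sub_right_eq_self (fun τ => ENNReal.ofReal (1 + (‖v‖ * τ) ^ 2)⁻¹) τ₀]
    _ = ∫⁻ x : ℝ, ENNReal.ofReal (1 + x ^ 2)⁻¹ := by
        have h2 := lintegral_map (μ := volume) hmm (measurable_const_mul ‖v‖)
        rw [Real.map_volume_mul_left hv.ne', lintegral_smul_measure] at h2
        rw [← h2, smul_eq_mul, ← mul_assoc, ← ENNReal.ofReal_mul hv.le, abs_of_pos (by positivity),
          mul_inv_cancel₀ hv.ne']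
        simp
    _ = _ := lintegral_inv_one_add_sq

/-- Two powers are kept for integration along a line and d+2 for summation over modes, one more than
summation needs. -/
theorem japPair_rpow_neg_le (m : Fin d → ℤ) (ξ : E d) :
    japPair m ξ ^ (-(d + 4) : ℝ) ≤ jap ‖vec m‖ ^ (-(d + 2) : ℝ) * (1 + ‖ξ‖ ^ 2)⁻¹ := by
  have hd : (0 : ℝ) ≤ d := Nat.cast_nonneg d
  have h1 : japPair m ξ ^ (-(d + 4) : ℝ) = japPair m ξ ^ (-(d + 2) : ℝ) * japPair m ξ ^ (-2 : ℝ) := by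
    rw [← Real.rpow_add (japPair_pos m ξ)]; congr 1; ring
  have h2 : (1 + ‖ξ‖ ^ 2)⁻¹ = jap ‖ξ‖ ^ (-2 : ℝ) := by
    rw [← jap_sq, Real.rpow_neg (jap_pos _).le, Real.rpow_two]
  rw [h1, h2]
  exact mul_le_mul (Real.rpow_le_rpow_of_nonpos (jap_pos _) (jap_norm_vec_le_japPair m ξ) (by linarith))
    (Real.rpow_le_rpow_of_nonpos (jap_pos _) (jap_norm_le_japPair m ξ) (by norm_num))
    (Real.rpow_nonneg (japPair_pos m ξ).le _) (Real.rpow_nonneg (jap_pos _).le _)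

/-- Counting measure in frequency times Lebesgue measure on the time interval `[0, T]`. -/
noncomputable abbrev modeTime (d : ℕ) (T : ℝ) : Measure ((Fin d → ℤ) × ℝ) :=
  Measure.count.prod (volume.restrict (Set.Icc 0 T))

theorem lintegral_modeTime {T : ℝ} {F : (Fin d → ℤ) × ℝ → ℝ≥0∞} (hF : Measurable F) :
    ∫⁻ q, F q ∂modeTime d T = ∑' k, ∫⁻ t in Set.Icc 0 T, F (k, t) := by
  rw [lintegral_prod _ hF.aemeasurable, lintegral_count]

open Classical in
/-- The kernel of the reaction term. -/
noncomputable def reactionKernel (q r : (Fin d → ℤ) × ℝ) : ℝ≥0∞ :=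
  if q.1 = 0 ∨ r.1 = 0 then 0 else
    ENNReal.ofReal (‖vec r.1‖ * japPair (q.1 - r.1) (q.2 • vec q.1 - r.2 • vec r.1) ^ (-(d + 4) : ℝ))

theorem measurable_of_modes {α β : Type*} [MeasurableSpace α] [MeasurableSpace β]
    {F : (Fin d → ℤ) × α → β} (h : ∀ k, Measurable fun x => F (k, x)) : Measurable F :=
  measurable_from_prod_countable_right h

theorem measurable_reactionKernel : Measurable (Function.uncurry (reactionKernel (d := d))) := by
  have h1 : Measurable fun x : (Fin d → ℤ) × ((Fin d → ℤ) × (ℝ × ℝ)) =>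
      reactionKernel (x.1, x.2.2.1) (x.2.1, x.2.2.2) := by
    refine measurable_of_modes fun k => measurable_of_modes fun l => ?_
    simp only [reactionKernel]
    split_ifs
    · exact measurable_const
    · have := (continuous_japPair (k - l)).measurable
      fun_prop
  exact h1.comp (g := fun x : (Fin d → ℤ) × ((Fin d → ℤ) × (ℝ × ℝ)) =>
      reactionKernel (x.1, x.2.2.1) (x.2.1, x.2.2.2))
    (f := fun p : ((Fin d → ℤ) × ℝ) × ((Fin d → ℤ) × ℝ) => (p.1.1, (p.2.1, (p.1.2, p.2.2))))
    (by fun_prop)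

theorem norm_vec_le_mul_jap {k l : Fin d → ℤ} (hk : k ≠ 0) :
    ‖vec l‖ ≤ 2 * ‖vec k‖ * jap ‖vec (k - l)‖ := by
  have h1 := one_le_norm_vec hk
  have h2 : ‖vec l‖ ≤ ‖vec k‖ + ‖vec (k - l)‖ := by
    have := norm_sub_le (vec k) (vec (k - l))
    rw [vec_sub, sub_sub_cancel] at this
    rwa [vec_sub]
  have h3 : ‖vec (k - l)‖ ≤ jap ‖vec (k - l)‖ := (le_abs_self _).trans (abs_le_jap _)
  have h4 := one_le_jap ‖vec (k - l)‖
  nlinarith [norm_nonneg (vec (k - l))]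

/-- For rows the integral in τ has the Jacobian |l| of the kernel. For columns the integral in t
wants |k|, and |l| ≤ 2|k|⟨k-l⟩ uses up the spare power of ⟨k-l⟩. -/
theorem exists_reaction_schur (d : ℕ) :
    ∃ C : ℝ, 0 < C ∧ ∀ (T : ℝ) (a : (Fin d → ℤ) × ℝ → ℝ≥0∞), Measurable a →
      ∫⁻ q, (∫⁻ r, reactionKernel q r * a r ∂modeTime d T) ^ 2 ∂modeTime d T ≤
        ENNReal.ofReal C * ∫⁻ r, a r ^ 2 ∂modeTime d T := by
  set S := ∑' k : Fin d → ℤ, jap ‖vec k‖ ^ (-(d + 1) : ℝ) with hS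
  have hsum : Summable fun k : Fin d → ℤ => jap ‖vec k‖ ^ (-(d + 1) : ℝ) :=
    summable_jap_vec (by linarith)
  have hS0 : 0 ≤ S := tsum_nonneg fun k => Real.rpow_nonneg (jap_pos _).le _
  have hSe : ∑' k : Fin d → ℤ, ENNReal.ofReal (2 * jap ‖vec k‖ ^ (-(d + 1) : ℝ)) * ENNReal.ofReal Real.pi =
      ENNReal.ofReal (2 * S * Real.pi) := by
    rw [ENNReal.tsum_mul_right, ← ENNReal.ofReal_tsum_of_nonneg
      (fun k => by have := Real.rpow_nonneg (jap_pos ‖vec k‖).le (-(d + 1) : ℝ); positivity)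
      (hsum.mul_left 2), tsum_mul_left, ENNReal.ofReal_mul (p := 2 * S) (by positivity)]
  refine ⟨(2 * S * Real.pi) ^ 2 + 1, by positivity, fun T a ha => ?_⟩
  have hmq : ∀ q, Measurable (reactionKernel (d := d) q) := fun q =>
    measurable_reactionKernel.comp measurable_prodMk_left
  have hmr : ∀ r, Measurable fun q => reactionKernel (d := d) q r := fun r =>
    measurable_reactionKernel.comp measurable_prodMk_right
  have hrow : ∀ q, ∫⁻ r, reactionKernel q r ∂modeTime d T ≤ ENNReal.ofReal (2 * S * Real.pi) := by
    rintro ⟨k, t⟩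
    rw [lintegral_modeTime (hmq _), ← hSe]
    rw [← (Equiv.subLeft k).tsum_eq (fun m => ENNReal.ofReal (2 * jap ‖vec m‖ ^ (-(d + 1) : ℝ)) *
      ENNReal.ofReal Real.pi)]
    refine ENNReal.tsum_le_tsum fun l => ?_
    refine (setLIntegral_le_lintegral _ _).trans ?_
    simp only [reactionKernel, Equiv.subLeft_apply]
    split_ifs with h0
    · simp
    · push Not at h0
      have hl := one_le_norm_vec h0.2
      have hj := jap_rpow_le (k - l)
      have hj0 : 0 ≤ jap ‖vec (k - l)‖ ^ (-(d + 1) : ℝ) := Real.rpow_nonneg (jap_pos _).le _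
      calc ∫⁻ τ : ℝ, ENNReal.ofReal (‖vec l‖ * japPair (k - l) (t • vec k - τ • vec l) ^ (-(d + 4) : ℝ))
          ≤ ∫⁻ τ : ℝ, ENNReal.ofReal (2 * jap ‖vec (k - l)‖ ^ (-(d + 1) : ℝ)) *
              ENNReal.ofReal (‖vec l‖ * (1 + ‖t • vec k - τ • vec l‖ ^ 2)⁻¹) := by
            refine lintegral_mono fun τ => ?_
            rw [← ENNReal.ofReal_mul (by positivity)]
            apply ENNReal.ofReal_le_ofReal
            have h1 := japPair_rpow_neg_le (k - l) (t • vec k - τ • vec l)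
            have h2 : (0 : ℝ) ≤ (1 + ‖t • vec k - τ • vec l‖ ^ 2)⁻¹ := by positivity
            calc ‖vec l‖ * japPair (k - l) (t • vec k - τ • vec l) ^ (-(d + 4) : ℝ)
                ≤ ‖vec l‖ * (jap ‖vec (k - l)‖ ^ (-(d + 1) : ℝ) *
                  (1 + ‖t • vec k - τ • vec l‖ ^ 2)⁻¹) := by
                  gcongr
                  exact h1.trans (by gcongr)
              _ ≤ _ := by
                  have : 0 ≤ jap ‖vec (k - l)‖ ^ (-(d + 1) : ℝ) *
                    (‖vec l‖ * (1 + ‖t • vec k - τ • vec l‖ ^ 2)⁻¹) := by positivity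
                  linarith
        _ ≤ _ := by
            rw [lintegral_const_mul' _ _ ENNReal.ofReal_ne_top]
            exact mul_le_mul_right (lintegral_line_le (t • vec k) (vec l) (by linarith)) _
  have hcol : ∀ r, ∫⁻ q, reactionKernel q r ∂modeTime d T ≤ ENNReal.ofReal (2 * S * Real.pi) := by
    rintro ⟨l, τ⟩
    rw [lintegral_modeTime (hmr _), ← hSe]
    rw [← (Equiv.subRight l).tsum_eq (fun m => ENNReal.ofReal (2 * jap ‖vec m‖ ^ (-(d + 1) : ℝ)) *
      ENNReal.ofReal Real.pi)]
    refine ENNReal.tsum_le_tsum fun k => ?_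
    refine (setLIntegral_le_lintegral _ _).trans ?_
    simp only [reactionKernel, Equiv.subRight_apply]
    split_ifs with h0
    · simp
    · push Not at h0
      have hk := one_le_norm_vec h0.1
      have hj0 : 0 ≤ jap ‖vec (k - l)‖ ^ (-(d + 2) : ℝ) := Real.rpow_nonneg (jap_pos _).le _
      have hj : jap ‖vec (k - l)‖ * jap ‖vec (k - l)‖ ^ (-(d + 2) : ℝ) =
          jap ‖vec (k - l)‖ ^ (-(d + 1) : ℝ) := by
        rw [← Real.rpow_one_add' (jap_pos _).le (by intro h; linarith [(Nat.cast_nonneg d : (0:ℝ) ≤ d)])]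
        congr 1; ring
      have hj1 : 0 ≤ jap ‖vec (k - l)‖ ^ (-(d + 1) : ℝ) := Real.rpow_nonneg (jap_pos _).le _
      calc ∫⁻ t : ℝ, ENNReal.ofReal (‖vec l‖ * japPair (k - l) (t • vec k - τ • vec l) ^ (-(d + 4) : ℝ))
          ≤ ∫⁻ t : ℝ, ENNReal.ofReal (2 * jap ‖vec (k - l)‖ ^ (-(d + 1) : ℝ)) *
              ENNReal.ofReal (‖vec k‖ * (1 + ‖τ • vec l - t • vec k‖ ^ 2)⁻¹) := by
            refine lintegral_mono fun t => ?_
            rw [← ENNReal.ofReal_mul (by positivity)]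
            apply ENNReal.ofReal_le_ofReal
            have h1 := japPair_rpow_neg_le (k - l) (t • vec k - τ • vec l)
            rw [norm_sub_rev] at h1
            calc ‖vec l‖ * japPair (k - l) (t • vec k - τ • vec l) ^ (-(d + 4) : ℝ)
                ≤ (2 * ‖vec k‖ * jap ‖vec (k - l)‖) * (jap ‖vec (k - l)‖ ^ (-(d + 2) : ℝ) *
                  (1 + ‖τ • vec l - t • vec k‖ ^ 2)⁻¹) :=
                  mul_le_mul (norm_vec_le_mul_jap h0.1) h1
                    (Real.rpow_nonneg (japPair_pos _ _).le _)
                    (by have := jap_pos ‖vec (k - l)‖; positivity)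
              _ = _ := by rw [← hj]; ring
        _ ≤ _ := by
            rw [lintegral_const_mul' _ _ ENNReal.ofReal_ne_top]
            exact mul_le_mul_right (lintegral_line_le (τ • vec l) (vec k) (by linarith)) _
  refine (lintegral_schur measurable_reactionKernel ha hrow hcol).trans ?_
  gcongr
  rw [← ENNReal.ofReal_mul (by positivity)]
  apply ENNReal.ofReal_le_ofReal
  nlinarith

open Classical in
/-- The factor gained on the low frequency in the transport term. -/
noncomputable def transportWeight (r : (Fin d → ℤ) × ℝ) : ℝ≥0∞ :=
  if r.1 = 0 then 0 else ENNReal.ofReal (japPair r.1 (r.2 • vec r.1) ^ (-((d + 11) / 2) : ℝ))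

theorem measurable_transportWeight : Measurable (transportWeight (d := d)) := by
  refine measurable_of_modes fun l => ?_
  simp only [transportWeight]
  split_ifs
  · exact measurable_const
  · have := (continuous_japPair l).measurable
    fun_prop

/-- Exponents: the squared weight has order -(d+11), and ⟨τ⟩^7 ≤ ⟨l,lτ⟩^7 because l ≠ 0. There
remains -(d+4), summable in l and integrable in τ. -/
theorem transportWeight_sq_mul_le (l : Fin d → ℤ) (τ : ℝ) {D : ℝ} (hD : 0 ≤ D) :
    transportWeight (l, τ) ^ 2 * ENNReal.ofReal (D * jap τ ^ 7) ≤
      ENNReal.ofReal (D * jap ‖vec l‖ ^ (-(d + 2) : ℝ)) * ENNReal.ofReal (1 + τ ^ 2)⁻¹ := by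
  simp only [transportWeight]
  split_ifs with hl
  · simp
  have hl1 := one_le_norm_vec hl
  have hx := japPair_pos l (τ • vec l)
  have h7 : jap τ ≤ japPair l (τ • vec l) := by
    refine le_trans ?_ (jap_norm_le_japPair l _)
    rw [norm_smul, Real.norm_eq_abs, jap, ← sq_abs τ, ← jap]
    exact jap_le_jap (abs_nonneg _) (le_mul_of_one_le_right (abs_nonneg _) hl1)
  rw [← ENNReal.ofReal_pow (Real.rpow_nonneg hx.le _), ← ENNReal.ofReal_mul (by positivity),
    ← ENNReal.ofReal_mul (mul_nonneg hD (Real.rpow_nonneg (jap_pos _).le _))]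
  apply ENNReal.ofReal_le_ofReal
  have h1 : (japPair l (τ • vec l) ^ (-((d + 11) / 2) : ℝ)) ^ 2 * japPair l (τ • vec l) ^ 7 =
      japPair l (τ • vec l) ^ (-(d + 4) : ℝ) := by
    rw [← Real.rpow_natCast, ← Real.rpow_mul hx.le, ← Real.rpow_natCast _ 7, ← Real.rpow_add hx]
    congr 1; push_cast; ring
  have h2 := japPair_rpow_neg_le l (τ • vec l)
  have h3 : (1 + ‖τ • vec l‖ ^ 2)⁻¹ ≤ (1 + τ ^ 2)⁻¹ := by
    rw [norm_smul, mul_pow, Real.norm_eq_abs, sq_abs]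
    gcongr (1 + ?_)⁻¹
    exact le_mul_of_one_le_right (sq_nonneg _) (one_le_pow₀ hl1)
  have hj0 : 0 ≤ jap ‖vec l‖ ^ (-(d + 2) : ℝ) := Real.rpow_nonneg (jap_pos _).le _
  have hw := Real.rpow_nonneg hx.le (-((d + 11) / 2) : ℝ)
  have hjt := (jap_pos τ).le
  calc (japPair l (τ • vec l) ^ (-((d + 11) / 2) : ℝ)) ^ 2 * (D * jap τ ^ 7)
      ≤ (japPair l (τ • vec l) ^ (-((d + 11) / 2) : ℝ)) ^ 2 * (D * japPair l (τ • vec l) ^ 7) := by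
        gcongr
    _ = D * japPair l (τ • vec l) ^ (-(d + 4) : ℝ) := by rw [← h1]; ring
    _ ≤ D * (jap ‖vec l‖ ^ (-(d + 2) : ℝ) * (1 + τ ^ 2)⁻¹) := by
        gcongr
        exact h2.trans (by gcongr)
    _ = _ := by ring

/-- Cauchy–Schwarz in the inner variable isolates the full norm of a. In the other factor the outer
variable is integrated before the inner one, so only the line traces of b are needed. -/
theorem exists_transport_schur (d : ℕ) :
    ∃ C : ℝ, 0 < C ∧ ∀ (T D : ℝ) (a : (Fin d → ℤ) × ℝ → ℝ≥0∞)
      (b : (Fin d → ℤ) × ℝ → (Fin d → ℤ) × ℝ → ℝ≥0∞), 0 ≤ D → Measurable a →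
      Measurable (Function.uncurry b) →
      (∀ l, ∀ τ ∈ Set.Icc 0 T, ∫⁻ q, b q (l, τ) ^ 2 ∂modeTime d T ≤ ENNReal.ofReal (D * jap τ ^ 7)) →
      ∫⁻ q, (∫⁻ r, transportWeight r * (a r * b q r) ∂modeTime d T) ^ 2 ∂modeTime d T ≤
        ENNReal.ofReal (C * D) * ∫⁻ r, a r ^ 2 ∂modeTime d T := by
  set S := ∑' k : Fin d → ℤ, jap ‖vec k‖ ^ (-(d + 2) : ℝ) with hS
  have hsum : Summable fun k : Fin d → ℤ => jap ‖vec k‖ ^ (-(d + 2) : ℝ) :=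
    summable_jap_vec (by linarith)
  have hj0 : ∀ k : Fin d → ℤ, 0 ≤ jap ‖vec k‖ ^ (-(d + 2) : ℝ) :=
    fun k => Real.rpow_nonneg (jap_pos _).le _
  have hS0 : 0 ≤ S := tsum_nonneg hj0
  refine ⟨S * Real.pi + 1, by positivity, fun T D a b hD ha hb hline => ?_⟩
  have hθ := measurable_transportWeight (d := d)
  have hbq : ∀ q, Measurable (b q) := fun q => hb.comp measurable_prodMk_left
  have hbr : ∀ r, Measurable fun q => b q r := fun r => hb.comp measurable_prodMk_right
  have hθb : ∫⁻ r, transportWeight r ^ 2 * ∫⁻ q, b q r ^ 2 ∂modeTime d T ∂modeTime d T ≤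
      ENNReal.ofReal (S * Real.pi * D) := by
    have hm : Measurable fun r => transportWeight r ^ 2 * ∫⁻ q, b q r ^ 2 ∂modeTime d T := by
      refine (hθ.pow_const 2).mul ?_
      exact Measurable.lintegral_prod_left' (f := fun p => b p.1 p.2 ^ 2) (hb.pow_const 2)
    rw [lintegral_modeTime hm]
    calc ∑' l, ∫⁻ τ in Set.Icc 0 T, transportWeight (l, τ) ^ 2 * ∫⁻ q, b q (l, τ) ^ 2 ∂modeTime d T
        ≤ ∑' l : Fin d → ℤ, ENNReal.ofReal (D * jap ‖vec l‖ ^ (-(d + 2) : ℝ)) *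
            ENNReal.ofReal Real.pi := by
          refine ENNReal.tsum_le_tsum fun l => ?_
          calc ∫⁻ τ in Set.Icc 0 T, transportWeight (l, τ) ^ 2 * ∫⁻ q, b q (l, τ) ^ 2 ∂modeTime d T
              ≤ ∫⁻ τ in Set.Icc 0 T, ENNReal.ofReal (D * jap ‖vec l‖ ^ (-(d + 2) : ℝ)) *
                  ENNReal.ofReal (1 + τ ^ 2)⁻¹ := by
                refine setLIntegral_mono' measurableSet_Icc fun τ hτ => ?_
                exact (mul_le_mul_right (hline l τ hτ) _).trans (transportWeight_sq_mul_le l τ hD)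
            _ ≤ ∫⁻ τ : ℝ, ENNReal.ofReal (D * jap ‖vec l‖ ^ (-(d + 2) : ℝ)) *
                  ENNReal.ofReal (1 + τ ^ 2)⁻¹ := setLIntegral_le_lintegral _ _
            _ = _ := by
                rw [lintegral_const_mul' _ _ ENNReal.ofReal_ne_top, lintegral_inv_one_add_sq]
      _ = _ := by
          rw [ENNReal.tsum_mul_right, ← ENNReal.ofReal_tsum_of_nonneg
            (fun k => mul_nonneg hD (hj0 k)) (hsum.mul_left D), tsum_mul_left,
            ← ENNReal.ofReal_mul (by positivity)]
          congr 1; ring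
  calc ∫⁻ q, (∫⁻ r, transportWeight r * (a r * b q r) ∂modeTime d T) ^ 2 ∂modeTime d T
      ≤ ∫⁻ q, (∫⁻ r, a r ^ 2 ∂modeTime d T) *
          ∫⁻ r, transportWeight r ^ 2 * b q r ^ 2 ∂modeTime d T ∂modeTime d T := by
        refine lintegral_mono fun q => ?_
        have := sq_lintegral_mul_le_mul (ν := modeTime d T) ha.aemeasurable
          (hθ.mul (hbq q)).aemeasurable
        simp only [Pi.mul_apply, mul_pow] at this
        refine le_trans (le_of_eq ?_) this
        congr 1
        refine lintegral_congr fun r => ?_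
        ring
    _ = (∫⁻ r, a r ^ 2 ∂modeTime d T) *
          ∫⁻ r, transportWeight r ^ 2 * ∫⁻ q, b q r ^ 2 ∂modeTime d T ∂modeTime d T := by
        have hm : Measurable (Function.uncurry fun q r => transportWeight r ^ 2 * b q r ^ 2) :=
          ((hθ.comp measurable_snd).pow_const 2).mul (hb.pow_const 2)
        rw [lintegral_const_mul _ (hm.lintegral_prod_right (ν := modeTime d T)),
          lintegral_lintegral_swap hm.aemeasurable]
        congr 1
        refine lintegral_congr fun r => ?_
        rw [lintegral_const_mul _ ((hbr r).pow_const 2)]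
    _ ≤ _ := by
        rw [mul_comm]
        gcongr
        refine hθb.trans (ENNReal.ofReal_le_ofReal ?_)
        nlinarith

end Schur

end LandauDamping

namespace LandauDamping

/-! ### The Volterra equation for the density. -/

section VolterraForm

variable {d : ℕ} {What : (Fin d → ℤ) → ℂ} {f0 : E d → ℂ} {hin : E d → E d → ℂ} {T CW B : ℝ}
  {f : ℝ → E d → E d → ℂ}

/-- The retraction of the line onto `[0, T]`. -/
def clamp (T τ : ℝ) : ℝ := max 0 (min τ T)

theorem clamp_mem {T : ℝ} (hT : 0 ≤ T) (τ : ℝ) : clamp T τ ∈ Set.Icc 0 T :=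
  ⟨le_max_left _ _, max_le hT (min_le_right _ _)⟩

theorem clamp_of_mem {T τ : ℝ} (h : τ ∈ Set.Icc 0 T) : clamp T τ = τ := by
  rw [clamp, min_eq_left h.2, max_eq_right h.1]

theorem continuous_clamp (T : ℝ) : Continuous (clamp T) := by
  unfold clamp; fun_prop

/-- The part of the interaction that is quadratic in `f`. -/
noncomputable def nonlinearTerm (What : (Fin d → ℤ) → ℂ) (f : ℝ → E d → E d → ℂ)
    (k : Fin d → ℤ) (t τ : ℝ) (l : Fin d → ℤ) : ℂ :=
  What l * densityHat f τ l * ((inner ℝ (vec l) (t • vec k - τ • vec k) : ℝ) : ℂ) *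
    modeHat (f τ) (k - l) (t • vec k - τ • vec l)

/-- The kernel of the linearized density equation. -/
noncomputable def linearKernel (What : (Fin d → ℤ) → ℂ) (f0 : E d → ℂ) (k : Fin d → ℤ) (t : ℝ) : ℂ :=
  -(fourierInt f0 (t • vec k) * What k * (‖vec k‖ : ℂ) ^ 2 * t)

theorem continuous_fourierInt (h0 : Integrable f0) : Continuous (fourierInt f0) := by
  unfold fourierInt
  refine continuous_of_dominated (bound := fun v => ‖f0 v‖) (fun η => ?_) (fun η => ?_) h0.norm ?_
  · exact (continuous_exp_inner η).aestronglyMeasurable.mul h0.aestronglyMeasurable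
  · exact Filter.Eventually.of_forall fun v => by rw [norm_mul, norm_exp_neg_I_mul, one_mul]
  · exact Filter.Eventually.of_forall fun v => by fun_prop

theorem continuous_linearKernel (h0 : Integrable f0) (k : Fin d → ℤ) :
    Continuous (linearKernel What f0 k) := by
  have := continuous_fourierInt h0
  unfold linearKernel
  fun_prop

/-- The background has only the mode 0 in z, so it meets the density in the single interaction l =
k. -/
theorem interaction_eq (k : Fin d → ℤ) (t τ : ℝ) (l : Fin d → ℤ) :
    interaction What f0 f k (t • vec k) τ l = nonlinearTerm What f k t τ l -
      if l = k then densityHat f τ k * linearKernel What f0 k (t - τ) else 0 := by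
  simp only [interaction, totalHat, nonlinearTerm, sub_eq_zero]
  by_cases hl : l = k
  · subst hl
    rw [if_pos rfl, if_pos rfl, linearKernel, ← sub_smul, real_inner_smul_right,
      real_inner_self_eq_norm_sq]
    push_cast
    ring
  · rw [if_neg hl, if_neg (Ne.symm hl)]
    ring

namespace DecayingSolution

theorem norm_modeHat_le (h : DecayingSolution What f0 hin T f CW B) {t : ℝ}
    (ht : t ∈ Set.Ico 0 T) (k : Fin d → ℤ) (η : E d) : ‖modeHat (f t) k η‖ ≤ B := by
  have hB := (h.decay t ht).nonneg
  have hp : (-(d + 2) : ℝ) ≤ 0 := by have : (0 : ℝ) ≤ d := Nat.cast_nonneg d; linarith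
  have h1 := fun x => Real.rpow_le_one_of_one_le_of_nonpos (one_le_jap x) hp
  have h0 := fun x => Real.rpow_nonneg (jap_pos x).le (-(d + 2) : ℝ)
  exact ((h.decay t ht).hat_le k η).trans
    (mul_le_of_le_one_right hB (mul_le_one₀ (h1 _) (h0 _) (h1 _)))

/-- By Duhamel's formula the modes are primitives in time, hence continuous in time; with
measurability in η this gives joint measurability. The clamp keeps times in [0,S], where the
solution is controlled. -/
theorem measurable_modeHat (h : DecayingSolution What f0 hin T f CW B) {S : ℝ}
    (hS : S ∈ Set.Ico 0 T) (k : Fin d → ℤ) :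
    Measurable fun p : ℝ × E d => modeHat (f (clamp S p.1)) k p.2 := by
  have hmem : ∀ τ, clamp S τ ∈ Set.Ico 0 T := fun τ =>
    ⟨(clamp_mem hS.1 τ).1, (clamp_mem hS.1 τ).2.trans_lt hS.2⟩
  refine measurable_uncurry_of_continuous_of_measurable
    (u := fun τ η => modeHat (f (clamp S τ)) k η) (fun η => ?_)
    (fun τ => ((h.decay _ (hmem τ)).continuous_modeHat k).measurable)
  have h1 : ContinuousOn (fun t => modeHat (f t) k η) (Set.Icc 0 S) := by
    have h2 := intervalIntegral.continuousOn_primitive_interval' (h.duhamel hS k η).1 Set.left_mem_uIcc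
    rw [Set.uIcc_of_le hS.1] at h2
    refine ((continuousOn_const (c := modeHat hin k η)).sub h2).congr fun t ht => ?_
    exact (h.duhamel ⟨ht.1, ht.2.trans_lt hS.2⟩ k η).2
  exact h1.comp_continuous (continuous_clamp S) (clamp_mem hS.1)

theorem measurable_densityHat (h : DecayingSolution What f0 hin T f CW B) {S : ℝ}
    (hS : S ∈ Set.Ico 0 T) (k : Fin d → ℤ) :
    Measurable fun τ => densityHat f (clamp S τ) k := by
  have h1 : (fun τ => densityHat f (clamp S τ) k) =
      (fun p : ℝ × E d => modeHat (f (clamp S p.1)) k p.2) ∘ fun τ => (τ, clamp S τ • vec k) := by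
    funext τ
    exact h.densityHat_eq ⟨(clamp_mem hS.1 τ).1, (clamp_mem hS.1 τ).2.trans_lt hS.2⟩ k
  rw [h1]
  have := (continuous_clamp S).measurable
  exact (h.measurable_modeHat hS k).comp (by fun_prop)

theorem summable_nonlinearTerm (h : DecayingSolution What f0 hin T f CW B) {τ : ℝ}
    (hτ : τ ∈ Set.Ico 0 T) (k : Fin d → ℤ) (t : ℝ) : Summable (nonlinearTerm What f k t τ) := by
  have hB := (h.decay τ hτ).nonneg
  have hs := (((summable_jap_vec (d := d) (r := d + 2) (by linarith)).mul_left B).mul_left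
    CW).mul_right (‖t • vec k - τ • vec k‖ * B)
  refine Summable.of_norm_bounded hs fun l => ?_
  have h1 : ‖((inner ℝ (vec l) (t • vec k - τ • vec k) : ℝ) : ℂ)‖ ≤
      ‖vec l‖ * ‖t • vec k - τ • vec k‖ := by
    rw [Complex.norm_real]; exact norm_inner_le_norm _ _
  have h2 := h.norm_densityHat_le hτ l
  have h3 := h.norm_modeHat_le hτ (k - l) (t • vec k - τ • vec l)
  rw [nonlinearTerm, norm_mul, norm_mul, norm_mul]
  calc _ ≤ ‖What l‖ * (B * jap ‖vec l‖ ^ (-(d + 2) : ℝ)) * (‖vec l‖ * ‖t • vec k - τ • vec k‖) * B := by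
        have := (norm_nonneg _).trans h2
        gcongr
    _ = (‖vec l‖ * ‖What l‖) * (B * jap ‖vec l‖ ^ (-(d + 2) : ℝ)) *
          (‖t • vec k - τ • vec k‖ * B) := by ring
    _ ≤ _ := by
        gcongr
        · exact (norm_nonneg _).trans h2
        · exact h.potential l

/-- The density solves a linear Volterra equation, up to a quadratic error. -/
theorem densityHat_volterra (h : DecayingSolution What f0 hin T f CW B) {t : ℝ}
    (ht : t ∈ Set.Ico 0 T) (k : Fin d → ℤ) :
    densityHat f t k = (modeHat hin k (t • vec k) - ∫ τ in 0..t, ∑' l, nonlinearTerm What f k t τ l) +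
      ∫ τ in 0..t, densityHat f τ k * linearKernel What f0 k (t - τ) := by
  obtain ⟨hInt, hduh⟩ := h.duhamel ht k (t • vec k)
  have hmem : ∀ τ ∈ Set.uIoc 0 t, τ ∈ Set.Ico 0 T := by
    intro τ hτ
    rw [Set.uIoc_of_le ht.1] at hτ
    exact ⟨hτ.1.le, hτ.2.trans_lt ht.2⟩
  have hlin : IntervalIntegrable (fun τ => densityHat f τ k * linearKernel What f0 k (t - τ))
      volume 0 t := by
    have hK : Continuous fun τ => linearKernel What f0 k (t - τ) :=
      (continuous_linearKernel h.integrable_background k).comp (continuous_const.sub continuous_id)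
    refine IntervalIntegrable.mul_continuousOn ?_ hK.continuousOn
    rw [intervalIntegrable_iff_integrableOn_Ioc_of_le ht.1]
    have hb : IntegrableOn (fun τ => densityHat f (clamp t τ) k) (Set.Ioc 0 t) := by
      refine Measure.integrableOn_of_bounded (M := B * jap ‖vec k‖ ^ (-(d + 2) : ℝ)) (by simp)
        (h.measurable_densityHat ht k).aestronglyMeasurable ?_
      refine Filter.Eventually.of_forall fun τ => h.norm_densityHat_le ?_ k
      exact ⟨(clamp_mem ht.1 τ).1, (clamp_mem ht.1 τ).2.trans_lt ht.2⟩
    exact hb.congr_fun (fun τ hτ => by simp only [clamp_of_mem ⟨hτ.1.le, hτ.2⟩]) measurableSet_Ioc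
  have hsplit : ∀ τ ∈ Set.uIoc 0 t, ∑' l, interaction What f0 f k (t • vec k) τ l =
      ∑' l, nonlinearTerm What f k t τ l - densityHat f τ k * linearKernel What f0 k (t - τ) := by
    intro τ hτ
    simp_rw [interaction_eq]
    rw [(h.summable_nonlinearTerm (hmem τ hτ) k t).tsum_sub (hasSum_ite_eq k _).summable, tsum_ite_eq]
  have hnl : IntervalIntegrable (fun τ => ∑' l, nonlinearTerm What f k t τ l) volume 0 t := by
    refine (hInt.add hlin).congr fun τ hτ => ?_
    simp only [hsplit τ hτ, sub_add_cancel]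
  rw [h.densityHat_eq ht, hduh, intervalIntegral.integral_congr_ae (Filter.Eventually.of_forall hsplit),
    intervalIntegral.integral_sub hnl hlin]
  ring

/-- The total mass is conserved. -/
theorem densityHat_zero (h : DecayingSolution What f0 hin T f CW B) {t : ℝ}
    (ht : t ∈ Set.Ico 0 T) : densityHat f t 0 = modeHat hin 0 0 := by
  rw [h.densityHat_eq ht, vec_zero, smul_zero, (h.duhamel ht 0 0).2]
  simp [interaction, vec_zero]

end DecayingSolution

end VolterraForm

end LandauDamping

namespace LandauDamping

/-! ### Linear stability in the weighted norm. -/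

section LinearEstimate

variable {d M : ℕ} {What : (Fin d → ℤ) → ℂ} {f0 : E d → ℂ} {hin : E d → E d → ℂ} {T CW B : ℝ}
  {f : ℝ → E d → E d → ℂ} {γ C_W C₀ lamBar κ s lam0 lam' σ : ℝ}

/-- This is where γ ≥ 1 is used: it makes Ŵ(k)|k|² bounded. -/
theorem norm_potential_mul_sq_le (hγ : 1 ≤ γ) (hC_W : 0 < C_W) {k : Fin d → ℤ} (hk : k ≠ 0)
    (hW : ‖What k‖ ≤ C_W * ‖vec k‖ ^ (-1 - γ)) : ‖What k‖ * ‖vec k‖ ^ 2 ≤ C_W := by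
  have h1 := one_le_norm_vec hk
  have h0 : 0 < ‖vec k‖ := by linarith
  have h2 : ‖vec k‖ ^ (-1 - γ) ≤ (‖vec k‖ ^ 2)⁻¹ := by
    rw [← Real.rpow_natCast, ← Real.rpow_neg h0.le]
    exact Real.rpow_le_rpow_of_exponent_le h1 (by push_cast; linarith)
  calc ‖What k‖ * ‖vec k‖ ^ 2 ≤ C_W * (‖vec k‖ ^ 2)⁻¹ * ‖vec k‖ ^ 2 := by
        gcongr
        exact hW.trans (by gcongr)
    _ = C_W := by field_simp

/-- Half of the exponential decay of f̂⁰(kt) is spent on the factor t. The prefactor |k| is the one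
compatible with rescaling time by |k|. -/
theorem exists_linearKernel_le (hd : 1 ≤ d) (hM : (d : ℝ) / 2 < M) (hγ : 1 ≤ γ) (hC_W : 0 < C_W)
    (hC₀ : 0 < C₀) (hlamBar : 0 < lamBar) :
    ∃ C : ℝ, 0 < C ∧ ∀ (What : (Fin d → ℤ) → ℂ) (f0 : E d → ℂ),
      (∀ k : Fin d → ℤ, k ≠ 0 → ‖What k‖ ≤ C_W * ‖vec k‖ ^ (-1 - γ)) →
      ∑ α ∈ multiIndices d M, gevreyNormSq lamBar 1 (moment α (fun _ v => f0 v)) ≤ ENNReal.ofReal C₀ →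
      ∀ k : Fin d → ℤ, k ≠ 0 → ∀ t, 0 ≤ t →
        ‖linearKernel What f0 k t‖ ≤ C * ‖vec k‖ * Real.exp (-(lamBar / 2) * (‖vec k‖ * t)) := by
  obtain ⟨C, hC, h⟩ := exists_gevrey_bounds (M := M) hd hM hlamBar one_pos le_rfl
  have hsq := Real.sqrt_pos.mpr hC₀
  refine ⟨C * Real.sqrt C₀ * C_W * (2 / lamBar), by positivity, fun What f0 hW hf0 k hk t ht => ?_⟩
  have h1 := (h _ _ hC₀.le hf0).1 0 (t • vec k)
  rw [modeHat_velocity, if_pos rfl, Real.rpow_one] at h1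
  have hb := one_le_norm_vec hk
  set b := ‖vec k‖ with hbd
  have h2 : b * t ≤ japPair 0 (t • vec k) := by
    have := norm_le_japPair 0 (t • vec k)
    rwa [norm_smul, Real.norm_eq_abs, abs_of_nonneg ht, mul_comm] at this
  have h3 := norm_potential_mul_sq_le hγ hC_W hk (hW k hk)
  rw [linearKernel, norm_neg, norm_mul, norm_mul, norm_mul, norm_pow, Complex.norm_real,
    Complex.norm_real, norm_norm, Real.norm_eq_abs, abs_of_nonneg ht]
  have h4 : ‖fourierInt f0 (t • vec k)‖ ≤ C * Real.sqrt C₀ * Real.exp (-(lamBar * (b * t))) := by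
    refine h1.trans ?_
    gcongr
  have hx : t ≤ b * (b * t) := (le_mul_of_one_le_left ht hb).trans
    (le_mul_of_one_le_left (by positivity) hb)
  have h5 : b * t * Real.exp (-(lamBar * (b * t))) ≤
      2 / lamBar * Real.exp (-(lamBar / 2) * (b * t)) := by
    have h6 := Real.add_one_le_exp (lamBar / 2 * (b * t))
    have h7 : b * t ≤ 2 / lamBar * Real.exp (lamBar / 2 * (b * t)) := by
      rw [div_mul_eq_mul_div, le_div_iff₀ hlamBar]
      nlinarith
    have h8 : Real.exp (-(lamBar / 2) * (b * t)) =
        Real.exp (lamBar / 2 * (b * t)) * Real.exp (-(lamBar * (b * t))) := by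
      rw [← Real.exp_add]; congr 1; ring
    rw [h8]
    exact (mul_le_mul_of_nonneg_right h7 (Real.exp_pos _).le).trans_eq (mul_assoc _ _ _)
  calc ‖fourierInt f0 (t • vec k)‖ * ‖What k‖ * b ^ 2 * t
      = ‖fourierInt f0 (t • vec k)‖ * (‖What k‖ * b ^ 2) * t := by ring
    _ ≤ C * Real.sqrt C₀ * Real.exp (-(lamBar * (b * t))) * C_W * (b * (b * t)) := by gcongr
    _ = C * Real.sqrt C₀ * C_W * b * (b * t * Real.exp (-(lamBar * (b * t)))) := by ring
    _ ≤ C * Real.sqrt C₀ * C_W * b * (2 / lamBar * Real.exp (-(lamBar / 2) * (b * t))) := by gcongr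
    _ = _ := by ring

/-- The conjugation in `laplaceSymbol` is undone by evaluating the symbol at the conjugate of ζ,
which has the same real part. -/
theorem StabilityL.le_norm_one_sub (h : StabilityL What f0 C₀ lamBar κ M) (k : Fin d → ℤ) {ζ : ℂ}
    (hζ : ζ.re < lamBar) :
    κ ≤ ‖1 - ∫ t in Set.Ioi (0 : ℝ), Complex.exp (ζ * ‖vec k‖ * t) * linearKernel What f0 k t‖ := by
  have h1 := h.stable ((starRingEnd ℂ) ζ) (by simpa using hζ) k
  rw [norm_sub_rev] at h1
  have h2 : ∫ t in Set.Ioi (0 : ℝ), Complex.exp (ζ * ‖vec k‖ * t) * linearKernel What f0 k t =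
      laplaceSymbol What f0 ((starRingEnd ℂ) ζ) k := by
    rw [laplaceSymbol, ← integral_neg]
    refine integral_congr_ae (Filter.Eventually.of_forall fun t => ?_)
    simp only [linearKernel, Complex.conj_conj]
    ring
  rwa [h2]

/-- The linearized density equation is stable, uniformly in the mode. -/
theorem exists_linear_estimate (hd : 1 ≤ d) (hM : (d : ℝ) / 2 < M) (hγ : 1 ≤ γ) (hC_W : 0 < C_W)
    (hC₀ : 0 < C₀) (hlamBar : 0 < lamBar) (hκ : 0 < κ) (hs : 1 / (2 + γ) < s) (hs1 : s < 1)
    (hlam' : 0 < lam') (hlam : lam' < lam0) (hσ : 0 ≤ σ) :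
    ∃ C : ℝ, 0 < C ∧ ∀ (What : (Fin d → ℤ) → ℂ) (f0 : E d → ℂ) (hin : E d → E d → ℂ) (T CW B : ℝ)
      (f : ℝ → E d → E d → ℂ),
      (∀ k : Fin d → ℤ, k ≠ 0 → ‖What k‖ ≤ C_W * ‖vec k‖ ^ (-1 - γ)) →
      StabilityL What f0 C₀ lamBar κ M → DecayingSolution What f0 hin T f CW B →
      ∀ S ∈ Set.Ico 0 T, ∀ k : Fin d → ℤ, k ≠ 0 →
        ∫⁻ t in Set.Icc 0 S, ENNReal.ofReal (multA γ s lam0 lam' σ 0 t k (t • vec k) ^ 2) *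
            ‖densityHat f t k‖ₑ ^ 2 ≤
          ENNReal.ofReal C * ∫⁻ t in Set.Icc 0 S,
            ENNReal.ofReal (multA γ s lam0 lam' σ 0 t k (t • vec k) ^ 2) *
              ‖modeHat hin k (t • vec k) - ∫ τ in 0..t, ∑' l, nonlinearTerm What f k t τ l‖ₑ ^ 2 := by
  obtain ⟨C, hC, hker⟩ := exists_linearKernel_le (M := M) hd hM hγ hC_W hC₀ hlamBar
  -- The rate is one eighth of λ̄/2, exactly the exponential weight with which the resolvent is
  -- integrable when ν = λ̄/2.
  obtain ⟨Cs, hCs, hshift⟩ := exists_multA_shift_le (d := d) (σ := σ) hγ hs hs1 hlam' hlam hσ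
    (μ := lamBar / 2 / 8) (by positivity)
  refine ⟨2 * (1 + (Cs * (4 * C / (κ * (lamBar / 2)))) ^ 2), by positivity,
    fun What f0 hin T CW B f hW hL h S hS k hk => ?_⟩
  have hb : 0 < ‖vec k‖ := lt_of_lt_of_le one_pos (one_le_norm_vec hk)
  have hK := continuous_linearKernel (What := What) h.integrable_background k
  have hKC := hker What f0 hW hL.localized k hk
  obtain ⟨R, hRm, hR0, hReq, hRB⟩ := exists_resolvent_bound_scaled hK hC
    (half_pos hlamBar) hκ hb hKC (fun ζ hζ => hL.le_norm_one_sub k (hζ.trans (half_lt_self hlamBar)))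
  have hKb : ∀ t, 0 ≤ t → ‖linearKernel What f0 k t‖ ≤ C * ‖vec k‖ := fun t ht =>
    (hKC t ht).trans (mul_le_of_le_one_right (by positivity) (Real.exp_le_one_iff.mpr (by
      have : 0 ≤ lamBar / 2 * (‖vec k‖ * t) := by positivity
      linarith)))
  have hRB' : ∫⁻ t, ENNReal.ofReal (Real.exp (lamBar / 2 / 8 * ‖vec k‖ * t)) * ‖R t‖ₑ ≤
      ENNReal.ofReal (4 * C / (κ * (lamBar / 2))) := by
    simpa only [mul_assoc] using hRB
  have hSmem : ∀ t ∈ Set.Icc 0 S, t ∈ Set.Ico 0 T := fun t ht => ⟨ht.1, ht.2.trans_lt hS.2⟩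
  have hw : Measurable fun t : ℝ => multA γ s lam0 lam' σ 0 t k (t • vec k) :=
    ((continuous_multA 0 k).comp (f := fun t : ℝ => (t, t • vec k)) (by fun_prop)).measurable
  have key := volterra_bound (φ := fun t => densityHat f (clamp S t) k)
    (H := fun t => modeHat hin k (t • vec k) - ∫ τ in 0..t, ∑' l, nonlinearTerm What f k t τ l)
    (T := S) (Cφ := B * jap ‖vec k‖ ^ (-(d + 2) : ℝ))
    (w := fun t => multA γ s lam0 lam' σ 0 t k (t • vec k)) (μ := lamBar / 2 / 8 * ‖vec k‖) (Cs := Cs)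
    hK hKb hRm hR0 hReq (by positivity) (by positivity) hRB' (h.measurable_densityHat hS k)
    (fun t ht => by rw [clamp_of_mem ht]; exact h.norm_densityHat_le (hSmem t ht) k)
    (fun t ht => by
      rw [clamp_of_mem ht, h.densityHat_volterra (hSmem t ht) k]
      congr 1
      refine intervalIntegral.integral_congr fun τ hτ => ?_
      rw [Set.uIcc_of_le ht.1] at hτ
      simp only [clamp_of_mem (⟨hτ.1, hτ.2.trans ht.2⟩ : τ ∈ Set.Icc 0 S)])
    hw (fun t => (multA_pos _ _ _ _).le) hCs.le (fun τ t hτ hτt => by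
      simpa only [mul_assoc] using hshift k τ t hτ hτt)
  refine le_trans (le_of_eq ?_) key
  refine setLIntegral_congr_fun measurableSet_Icc fun t ht => ?_
  simp only [clamp_of_mem ht]

end LinearEstimate

end LandauDamping

namespace LandauDamping

/-! ### Reaction and transport terms. -/

section NonlinearEstimate

variable {d M : ℕ} {What : (Fin d → ℤ) → ℂ} {f0 : E d → ℂ} {hin : E d → E d → ℂ} {T CW B : ℝ}
  {f : ℝ → E d → E d → ℂ} {γ C_W s lam0 lam' σ β : ℝ}

theorem add_sq_le_four_mul (x y : ℝ≥0∞) : (x + y) ^ 2 ≤ 4 * x ^ 2 + 4 * y ^ 2 := by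
  rcases le_total x y with h | h
  · calc (x + y) ^ 2 ≤ (y + y) ^ 2 := by gcongr
      _ = 4 * y ^ 2 := by ring
      _ ≤ _ := le_add_self
  · calc (x + y) ^ 2 ≤ (x + x) ^ 2 := by gcongr
      _ = 4 * x ^ 2 := by ring
      _ ≤ _ := le_self_add

/-- One power of |l| from the gradient of the potential turns |l|^(-1-γ) into |l|^(-γ); the rest is
the growth factor |k|(t-τ). -/
theorem norm_nonlinearTerm_le (hC_W : 0 < C_W)
    (hW : ∀ k : Fin d → ℤ, k ≠ 0 → ‖What k‖ ≤ C_W * ‖vec k‖ ^ (-1 - γ)) (k : Fin d → ℤ)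
    {l : Fin d → ℤ} (hl : l ≠ 0) {t τ : ℝ} (hτt : τ ≤ t) :
    ‖nonlinearTerm What f k t τ l‖ ≤ C_W * (‖vec l‖ ^ (-γ) * (‖vec k‖ * (t - τ))) *
      (‖densityHat f τ l‖ * ‖modeHat (f τ) (k - l) (t • vec k - τ • vec l)‖) := by
  have hl0 : 0 < ‖vec l‖ := lt_of_lt_of_le one_pos (one_le_norm_vec hl)
  have h1 : ‖((inner ℝ (vec l) (t • vec k - τ • vec k) : ℝ) : ℂ)‖ ≤ ‖vec l‖ * (‖vec k‖ * (t - τ)) := by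
    rw [Complex.norm_real]
    refine (norm_inner_le_norm _ _).trans (le_of_eq ?_)
    rw [← sub_smul, norm_smul, Real.norm_eq_abs, abs_of_nonneg (by linarith)]
    ring
  have h2 : ‖vec l‖ ^ (-γ) = ‖vec l‖ ^ (-1 - γ) * ‖vec l‖ := by
    rw [← Real.rpow_add_one hl0.ne']; congr 1; ring
  rw [nonlinearTerm, norm_mul, norm_mul, norm_mul]
  calc _ ≤ (C_W * ‖vec l‖ ^ (-1 - γ)) * ‖densityHat f τ l‖ * (‖vec l‖ * (‖vec k‖ * (t - τ))) *
          ‖modeHat (f τ) (k - l) (t • vec k - τ • vec l)‖ := by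
        gcongr
        exact hW l hl
    _ = _ := by rw [h2]; ring

/-- The weighted density. -/
noncomputable def densityAmplitude (γ s lam0 lam' σ : ℝ) (f : ℝ → E d → E d → ℂ) (S : ℝ)
    (r : (Fin d → ℤ) × ℝ) : ℝ≥0∞ :=
  ENNReal.ofReal (multA γ s lam0 lam' σ 0 r.2 r.1 (r.2 • vec r.1)) *
    ‖densityHat f (clamp S r.2) r.1‖ₑ

/-- The weighted profile along the free trajectories. -/
noncomputable def profileAmplitude (γ s lam0 lam' σ : ℝ) (f : ℝ → E d → E d → ℂ) (S : ℝ)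
    (q r : (Fin d → ℤ) × ℝ) : ℝ≥0∞ :=
  if q.1 = 0 then 0 else
    ENNReal.ofReal (multA γ s lam0 lam' σ 1 r.2 (q.1 - r.1) (q.2 • vec q.1 - r.2 • vec r.1)) *
      ‖modeHat (f (clamp S r.2)) (q.1 - r.1) (q.2 • vec q.1 - r.2 • vec r.1)‖ₑ

theorem DecayingSolution.measurable_densityAmplitude (h : DecayingSolution What f0 hin T f CW B)
    {S : ℝ} (hS : S ∈ Set.Ico 0 T) : Measurable (densityAmplitude γ s lam0 lam' σ f S) := by
  refine measurable_of_modes fun l => ?_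
  have hw : Measurable fun t : ℝ => multA γ s lam0 lam' σ 0 t l (t • vec l) :=
    ((continuous_multA 0 l).comp (f := fun t : ℝ => (t, t • vec l)) (by fun_prop)).measurable
  exact hw.ennreal_ofReal.mul (h.measurable_densityHat hS l).enorm

theorem DecayingSolution.measurable_profileAmplitude (h : DecayingSolution What f0 hin T f CW B)
    {S : ℝ} (hS : S ∈ Set.Ico 0 T) :
    Measurable (Function.uncurry (profileAmplitude γ s lam0 lam' σ f S)) := by
  have h1 : Measurable fun x : (Fin d → ℤ) × ((Fin d → ℤ) × (ℝ × ℝ)) =>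
      profileAmplitude γ s lam0 lam' σ f S (x.1, x.2.2.1) (x.2.1, x.2.2.2) := by
    refine measurable_of_modes fun k => measurable_of_modes fun l => ?_
    simp only [profileAmplitude]
    split_ifs
    · exact measurable_const
    · have hm : Measurable fun x : ℝ × ℝ => (x.2, x.1 • vec k - x.2 • vec l) := by fun_prop
      exact ((continuous_multA 1 (k - l)).measurable.comp hm).ennreal_ofReal.mul
        ((h.measurable_modeHat hS (k - l)).comp hm).enorm
  exact h1.comp (g := fun x : (Fin d → ℤ) × ((Fin d → ℤ) × (ℝ × ℝ)) =>
      profileAmplitude γ s lam0 lam' σ f S (x.1, x.2.2.1) (x.2.1, x.2.2.2))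
    (f := fun p : ((Fin d → ℤ) × ℝ) × ((Fin d → ℤ) × ℝ) => (p.1.1, (p.2.1, (p.1.2, p.2.2))))
    (by fun_prop)

/-- Pointwise splitting into the reaction and the transport terms. -/
theorem exists_nonlinearTerm_le (hγ : 1 ≤ γ) (hC_W : 0 < C_W) (hs : 1 / (2 + γ) < s) (hs1 : s < 1)
    (hlam' : 0 < lam') (hlam : lam' < lam0) (hσ : 0 ≤ σ) (β : ℝ) :
    ∃ C : ℝ, 0 < C ∧ ∀ (What : (Fin d → ℤ) → ℂ) (f : ℝ → E d → E d → ℂ) (S p : ℝ),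
      (∀ k : Fin d → ℤ, k ≠ 0 → ‖What k‖ ≤ C_W * ‖vec k‖ ^ (-1 - γ)) →
      (∀ τ ∈ Set.Icc 0 S, ∀ m ξ,
        multA γ s lam0 lam' σ (-β) τ m ξ * ‖modeHat (f τ) m ξ‖ ≤ p) →
      ∀ k : Fin d → ℤ, k ≠ 0 → ∀ t τ, 0 ≤ τ → τ ≤ t → t ≤ S → ∀ l,
        ENNReal.ofReal (multA γ s lam0 lam' σ 0 t k (t • vec k)) * ‖nonlinearTerm What f k t τ l‖ₑ ≤
          ENNReal.ofReal (C * p) *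
            (reactionKernel (k, t) (l, τ) * densityAmplitude γ s lam0 lam' σ f S (l, τ)) +
          ENNReal.ofReal C * (transportWeight (l, τ) * (densityAmplitude γ s lam0 lam' σ f S (l, τ) *
            profileAmplitude γ s lam0 lam' σ f S (k, t) (l, τ))) := by
  obtain ⟨C₁, hC₁, hre⟩ := exists_reaction_bound (d := d) hγ hs hs1 hlam' hlam hσ β (d + 4)
  obtain ⟨C₂, hC₂, htr⟩ := exists_transport_bound (d := d) hγ hs hs1 hlam' hlam hσ ((d + 11) / 2)
  refine ⟨C_W * (C₁ + C₂), by positivity, fun What f S p hW hp k hk t τ hτ hτt htS l => ?_⟩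
  have hτS : τ ∈ Set.Icc 0 S := ⟨hτ, hτt.trans htS⟩
  by_cases hl : l = 0
  · simp [hl, nonlinearTerm, vec_zero]
  have hN := norm_nonlinearTerm_le (f := f) hC_W hW k hl hτt
  simp only [reactionKernel, densityAmplitude, profileAmplitude, transportWeight, hk, hl, or_self,
    if_false, clamp_of_mem hτS, ← ofReal_norm]
  set F := ‖modeHat (f τ) (k - l) (t • vec k - τ • vec l)‖ with hF
  set ρ := ‖densityHat f τ l‖ with hρ
  set w := multA γ s lam0 lam' σ 0 t k (t • vec k) with hw
  set A := multA γ s lam0 lam' σ 0 τ l (τ • vec l) with hA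
  set Y := japPair (k - l) (t • vec k - τ • vec l) with hY
  set X := japPair l (τ • vec l) with hX
  have hw0 : 0 < w := multA_pos _ _ _ _
  have hA0 : 0 < A := multA_pos _ _ _ _
  have hF0 : 0 ≤ F := norm_nonneg _
  have hρ0 : 0 ≤ ρ := norm_nonneg _
  have hp' := hp τ hτS (k - l) (t • vec k - τ • vec l)
  have hp0 : 0 ≤ p := (mul_nonneg (multA_pos _ _ _ _).le (norm_nonneg _)).trans hp'
  have hYN : 0 ≤ Y ^ (-(d + 4) : ℝ) := Real.rpow_nonneg (japPair_pos _ _).le _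
  have hXN : 0 ≤ X ^ (-((d + 11) / 2) : ℝ) := Real.rpow_nonneg (japPair_pos _ _).le _
  have hlhs : w * ‖nonlinearTerm What f k t τ l‖ ≤
      C_W * (w * (‖vec l‖ ^ (-γ) * (‖vec k‖ * (t - τ)))) * (ρ * F) :=
    (mul_le_mul_of_nonneg_left hN hw0.le).trans_eq (by ring)
  -- Reaction if the density carries the larger frequency: the profile is then bounded pointwise by
  -- p. Transport otherwise: the profile stays in the amplitude.
  rcases le_total Y X with hYX | hXY
  · refine le_trans ?_ le_self_add
    rw [← ENNReal.ofReal_mul hw0.le, ← ENNReal.ofReal_mul hA0.le,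
      ← ENNReal.ofReal_mul (by positivity), ← ENNReal.ofReal_mul (by positivity)]
    apply ENNReal.ofReal_le_ofReal
    have h1 := hre k l τ t hk hl hτ hτt hYX
    calc _ ≤ _ := hlhs
      _ ≤ C_W * (C₁ * (‖vec l‖ * Y ^ (-(d + 4) : ℝ)) *
          (A * multA γ s lam0 lam' σ (-β) τ (k - l) (t • vec k - τ • vec l))) * (ρ * F) := by
          gcongr
      _ = C_W * C₁ * (‖vec l‖ * Y ^ (-(d + 4) : ℝ)) * (A * ρ) *
          (multA γ s lam0 lam' σ (-β) τ (k - l) (t • vec k - τ • vec l) * F) := by ring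
      _ ≤ C_W * (C₁ + C₂) * (‖vec l‖ * Y ^ (-(d + 4) : ℝ)) * (A * ρ) * p := by
          have h3 : 0 ≤ multA γ s lam0 lam' σ (-β) τ (k - l) (t • vec k - τ • vec l) :=
            (multA_pos _ _ _ _).le
          have h4 : C₁ ≤ C₁ + C₂ := by linarith
          gcongr
      _ = _ := by ring
  · refine le_trans ?_ le_add_self
    have hA1 : 0 < multA γ s lam0 lam' σ 1 τ (k - l) (t • vec k - τ • vec l) := multA_pos _ _ _ _
    rw [← ENNReal.ofReal_mul hw0.le, ← ENNReal.ofReal_mul hA0.le, ← ENNReal.ofReal_mul hA1.le,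
      ← ENNReal.ofReal_mul (by positivity), ← ENNReal.ofReal_mul hXN,
      ← ENNReal.ofReal_mul (by positivity)]
    apply ENNReal.ofReal_le_ofReal
    have h1 := htr k l τ t hl hτ hτt hXY
    calc _ ≤ _ := hlhs
      _ ≤ C_W * (C₂ * X ^ (-((d + 11) / 2) : ℝ) *
          (A * multA γ s lam0 lam' σ 1 τ (k - l) (t • vec k - τ • vec l))) * (ρ * F) := by
          gcongr
      _ ≤ C_W * ((C₁ + C₂) * X ^ (-((d + 11) / 2) : ℝ) *
          (A * multA γ s lam0 lam' σ 1 τ (k - l) (t • vec k - τ • vec l))) * (ρ * F) := by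
          gcongr
          linarith
      _ = _ := by ring

theorem measurable_reaction_add_transport {a : (Fin d → ℤ) × ℝ → ℝ≥0∞}
    {b : (Fin d → ℤ) × ℝ → (Fin d → ℤ) × ℝ → ℝ≥0∞} (ha : Measurable a)
    (hb : Measurable (Function.uncurry b)) (c₁ c₂ : ℝ≥0∞) :
    Measurable (Function.uncurry fun q r : (Fin d → ℤ) × ℝ =>
      c₁ * (reactionKernel q r * a r) + c₂ * (transportWeight r * (a r * b q r))) := by
  have ha' : Measurable fun x : ((Fin d → ℤ) × ℝ) × ((Fin d → ℤ) × ℝ) => a x.2 :=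
    ha.comp measurable_snd
  exact ((measurable_reactionKernel.mul ha').const_mul c₁).add
    (((measurable_transportWeight.comp measurable_snd).mul (ha'.mul hb)).const_mul c₂)

theorem exists_reaction_add_transport_schur (d : ℕ) :
    ∃ C : ℝ, 0 < C ∧ ∀ (S D : ℝ) (a : (Fin d → ℤ) × ℝ → ℝ≥0∞)
      (b : (Fin d → ℤ) × ℝ → (Fin d → ℤ) × ℝ → ℝ≥0∞) (c₁ c₂ : ℝ), 0 ≤ D → 0 ≤ c₁ → 0 ≤ c₂ →
      Measurable a → Measurable (Function.uncurry b) →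
      (∀ l, ∀ τ ∈ Set.Icc 0 S, ∫⁻ q, b q (l, τ) ^ 2 ∂modeTime d S ≤ ENNReal.ofReal (D * jap τ ^ 7)) →
      ∫⁻ q, (∫⁻ r, (ENNReal.ofReal c₁ * (reactionKernel q r * a r) +
          ENNReal.ofReal c₂ * (transportWeight r * (a r * b q r))) ∂modeTime d S) ^ 2 ∂modeTime d S ≤
        ENNReal.ofReal (C * (c₁ ^ 2 + c₂ ^ 2 * D)) * ∫⁻ r, a r ^ 2 ∂modeTime d S := by
  obtain ⟨C₁, hC₁, hre⟩ := exists_reaction_schur d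
  obtain ⟨C₂, hC₂, htr⟩ := exists_transport_schur d
  refine ⟨4 * (C₁ + C₂), by positivity, fun S D a b c₁ c₂ hD hc₁ hc₂ ha hb hline => ?_⟩
  calc _ ≤ ∫⁻ q, (4 * ENNReal.ofReal c₁ ^ 2 * (∫⁻ r, reactionKernel q r * a r ∂modeTime d S) ^ 2 +
          4 * ENNReal.ofReal c₂ ^ 2 * (∫⁻ r, transportWeight r * (a r * b q r) ∂modeTime d S) ^ 2)
            ∂modeTime d S := by
        refine lintegral_mono fun q => ?_
        have hm1 : Measurable fun r => ENNReal.ofReal c₁ * (reactionKernel q r * a r) :=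
          ((measurable_reactionKernel.comp measurable_prodMk_left).mul ha).const_mul _
        rw [lintegral_add_left hm1, lintegral_const_mul' _ _ ENNReal.ofReal_ne_top,
          lintegral_const_mul' _ _ ENNReal.ofReal_ne_top]
        refine (add_sq_le_four_mul _ _).trans (le_of_eq ?_)
        ring
    _ = 4 * ENNReal.ofReal c₁ ^ 2 *
          ∫⁻ q, (∫⁻ r, reactionKernel q r * a r ∂modeTime d S) ^ 2 ∂modeTime d S +
          4 * ENNReal.ofReal c₂ ^ 2 *
          ∫⁻ q, (∫⁻ r, transportWeight r * (a r * b q r) ∂modeTime d S) ^ 2 ∂modeTime d S := by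
        have hm2 : Measurable (Function.uncurry fun q r => reactionKernel q r * a r) :=
          measurable_reactionKernel.mul (ha.comp measurable_snd)
        have hfin : ∀ x : ℝ, (4 : ℝ≥0∞) * ENNReal.ofReal x ^ 2 ≠ ⊤ := fun x =>
          ENNReal.mul_ne_top (by simp) (ENNReal.pow_ne_top ENNReal.ofReal_ne_top)
        rw [lintegral_add_left (((hm2.lintegral_prod_right (ν := modeTime d S)).pow_const 2).const_mul _),
          lintegral_const_mul' _ _ (hfin _), lintegral_const_mul' _ _ (hfin _)]
    _ ≤ 4 * ENNReal.ofReal c₁ ^ 2 * (ENNReal.ofReal C₁ * ∫⁻ r, a r ^ 2 ∂modeTime d S) +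
          4 * ENNReal.ofReal c₂ ^ 2 * (ENNReal.ofReal (C₂ * D) * ∫⁻ r, a r ^ 2 ∂modeTime d S) := by
        gcongr
        · exact hre S a ha
        · exact htr S D a b hD ha hb hline
    _ = ENNReal.ofReal (4 * c₁ ^ 2 * C₁ + 4 * c₂ ^ 2 * (C₂ * D)) *
          ∫⁻ r, a r ^ 2 ∂modeTime d S := by
        have h4 : ∀ c : ℝ, 0 ≤ c → ENNReal.ofReal (4 * c ^ 2) = 4 * ENNReal.ofReal c ^ 2 := by
          intro c hc
          rw [ENNReal.ofReal_mul (by norm_num), ENNReal.ofReal_pow hc, ENNReal.ofReal_ofNat]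
        rw [ENNReal.ofReal_add (by positivity) (by positivity),
          ENNReal.ofReal_mul (p := 4 * c₁ ^ 2) (by positivity),
          ENNReal.ofReal_mul (p := 4 * c₂ ^ 2) (by positivity), h4 c₁ hc₁, h4 c₂ hc₂]
        ring
    _ ≤ _ := by
        gcongr
        have h1 : 0 ≤ c₁ ^ 2 * C₂ := by positivity
        have h2 : 0 ≤ c₂ ^ 2 * D * C₁ := by positivity
        nlinarith

/-- The quadratic terms are controlled by the density. -/
theorem exists_nonlinear_estimate (hγ : 1 ≤ γ) (hC_W : 0 < C_W) (hs : 1 / (2 + γ) < s) (hs1 : s < 1)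
    (hlam' : 0 < lam') (hlam : lam' < lam0) (hσ : 0 ≤ σ) (β : ℝ) :
    ∃ C : ℝ, 0 < C ∧ ∀ (What : (Fin d → ℤ) → ℂ) (f0 : E d → ℂ) (hin : E d → E d → ℂ) (T CW B : ℝ)
      (f : ℝ → E d → E d → ℂ) (p D : ℝ), 0 ≤ D →
      (∀ k : Fin d → ℤ, k ≠ 0 → ‖What k‖ ≤ C_W * ‖vec k‖ ^ (-1 - γ)) →
      DecayingSolution What f0 hin T f CW B → ∀ S ∈ Set.Ico 0 T,
      (∀ τ ∈ Set.Icc 0 S, ∀ m ξ,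
        multA γ s lam0 lam' σ (-β) τ m ξ * ‖modeHat (f τ) m ξ‖ ≤ p) →
      (∀ τ ∈ Set.Icc 0 S, ∀ (l : Fin d → ℤ) (a : E d), ∑' k : Fin d → ℤ, (if k = 0 then 0 else
        ∫⁻ t : ℝ, ENNReal.ofReal (multA γ s lam0 lam' σ 1 τ (k - l) (t • vec k - a) ^ 2) *
          ‖modeHat (f τ) (k - l) (t • vec k - a)‖ₑ ^ 2) ≤ ENNReal.ofReal (D * jap τ ^ 7)) →
      ∑' k : Fin d → ℤ, (if k = 0 then 0 else ∫⁻ t in Set.Icc 0 S,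
        ENNReal.ofReal (multA γ s lam0 lam' σ 0 t k (t • vec k) ^ 2) *
          ‖∫ τ in 0..t, ∑' l, nonlinearTerm What f k t τ l‖ₑ ^ 2) ≤
        ENNReal.ofReal (C * (p ^ 2 + D)) * ∑' k, ∫⁻ t in Set.Icc 0 S,
          ENNReal.ofReal (multA γ s lam0 lam' σ 0 t k (t • vec k) ^ 2) * ‖densityHat f t k‖ₑ ^ 2 := by
  obtain ⟨C, hC, hpt⟩ := exists_nonlinearTerm_le (d := d) hγ hC_W hs hs1 hlam' hlam hσ β
  obtain ⟨C₁, hC₁, hschur⟩ := exists_reaction_add_transport_schur d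
  refine ⟨C₁ * C ^ 2, by positivity, fun What f0 hin T CW B f p D hD hW h S hS hp hline => ?_⟩
  have hp0 : 0 ≤ p := (mul_nonneg (multA_pos _ _ _ _).le (norm_nonneg _)).trans
    (hp 0 ⟨le_rfl, hS.1⟩ 0 0)
  have ham : Measurable (densityAmplitude γ s lam0 lam' σ f S) := h.measurable_densityAmplitude hS
  have hbm : Measurable (Function.uncurry (profileAmplitude γ s lam0 lam' σ f S)) :=
    h.measurable_profileAmplitude hS
  have hbline : ∀ l, ∀ τ ∈ Set.Icc 0 S,
      ∫⁻ q, profileAmplitude γ s lam0 lam' σ f S q (l, τ) ^ 2 ∂modeTime d S ≤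
        ENNReal.ofReal (D * jap τ ^ 7) := by
    intro l τ hτ
    have hm : Measurable fun q => profileAmplitude γ s lam0 lam' σ f S q (l, τ) ^ 2 :=
      (hbm.comp measurable_prodMk_right).pow_const 2
    rw [lintegral_modeTime hm]
    -- For a fixed interaction (l,τ) the profile is sampled on the lines t ↦ kt - a with a = lτ.
    refine le_trans (ENNReal.tsum_le_tsum fun k => ?_) (hline τ hτ l (τ • vec l))
    refine (setLIntegral_le_lintegral _ _).trans (le_of_eq ?_)
    simp only [profileAmplitude, clamp_of_mem hτ]
    split_ifs
    · simp
    · refine lintegral_congr fun t => ?_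
      rw [mul_pow, ENNReal.ofReal_pow (multA_pos _ _ _ _).le]
  have hfinal := hschur S D _ _ (C * p) C hD (by positivity) hC.le ham hbm hbline
  have hasq : ∫⁻ r, densityAmplitude γ s lam0 lam' σ f S r ^ 2 ∂modeTime d S =
      ∑' k, ∫⁻ t in Set.Icc 0 S,
      ENNReal.ofReal (multA γ s lam0 lam' σ 0 t k (t • vec k) ^ 2) * ‖densityHat f t k‖ₑ ^ 2 := by
    rw [lintegral_modeTime (ham.pow_const 2)]
    refine tsum_congr fun k => setLIntegral_congr_fun measurableSet_Icc fun t ht => ?_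
    simp only [densityAmplitude, clamp_of_mem ht, mul_pow]
    rw [ENNReal.ofReal_pow (multA_pos _ _ _ _).le]
  have hGm := measurable_reaction_add_transport ham hbm (ENNReal.ofReal (C * p)) (ENNReal.ofReal C)
  rw [hasq, lintegral_modeTime ((hGm.lintegral_prod_right (ν := modeTime d S)).pow_const 2),
    show C₁ * ((C * p) ^ 2 + C ^ 2 * D) = C₁ * C ^ 2 * (p ^ 2 + D) by ring] at hfinal
  refine le_trans (ENNReal.tsum_le_tsum fun k => ?_) hfinal
  split_ifs with hk
  · exact zero_le
  refine setLIntegral_mono' measurableSet_Icc fun t ht => ?_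
  rw [ENNReal.ofReal_pow (multA_pos _ _ _ _).le, ← mul_pow]
  refine pow_le_pow_left' ?_ 2
  have hGq := hGm.comp (measurable_prodMk_left (x := (k, t)))
  have htm : ∀ l : Fin d → ℤ, Measurable fun τ : ℝ => (l, τ) := fun l => measurable_prodMk_left
  refine le_trans ?_ (lintegral_modeTime hGq).ge
  refine le_trans ?_ (lintegral_tsum fun l => (hGq.comp (htm l)).aemeasurable).le
  rw [intervalIntegral.integral_of_le ht.1]
  calc _ ≤ ENNReal.ofReal (multA γ s lam0 lam' σ 0 t k (t • vec k)) *
        ∫⁻ τ in Set.Ioc 0 t, ∑' l, ‖nonlinearTerm What f k t τ l‖ₑ := by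
        gcongr
        exact (enorm_integral_le_lintegral_enorm _).trans
          (lintegral_mono fun τ => enorm_tsum_le_tsum_enorm)
    _ = ∫⁻ τ in Set.Ioc 0 t, ∑' l, ENNReal.ofReal (multA γ s lam0 lam' σ 0 t k (t • vec k)) *
          ‖nonlinearTerm What f k t τ l‖ₑ := by
        simp_rw [ENNReal.tsum_mul_left]
        rw [lintegral_const_mul' _ _ ENNReal.ofReal_ne_top]
    _ ≤ ∫⁻ τ in Set.Ioc 0 t, ∑' l, _ :=
        setLIntegral_mono' measurableSet_Ioc fun τ hτ => ENNReal.tsum_le_tsum fun l =>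
          hpt What f S p hW hp k hk t τ hτ.1.le hτ.2 ht.2 l
    _ ≤ _ := lintegral_mono_set (Set.Ioc_subset_Icc_self.trans (Set.Icc_subset_Icc_right ht.2))

end NonlinearEstimate

end LandauDamping

namespace LandauDamping

/-! ### The a priori estimate. -/

section Bootstrap

variable {d M : ℕ} {What : (Fin d → ℤ) → ℂ} {f0 : E d → ℂ} {hin : E d → E d → ℂ} {T CW B : ℝ}
  {f : ℝ → E d → E d → ℂ} {γ C_W C₀ lamBar κ s lam0 lam' σ β : ℝ}

theorem multiplierNormSq_le_of_le {m m' : (Fin d → ℤ) → E d → ℝ} {c : ℝ} (hc : 0 < c)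
    (hm' : ∀ k η, 0 ≤ m' k η) (h : ∀ k η, m' k η ≤ c * m k η) (g : E d → E d → ℂ) :
    multiplierNormSq m' g ≤ ENNReal.ofReal (c ^ 2) * multiplierNormSq m g := by
  unfold multiplierNormSq
  split_ifs with hg
  · rw [← ENNReal.tsum_mul_left]
    refine ENNReal.tsum_le_tsum fun k => ?_
    rw [← lintegral_const_mul' _ _ ENNReal.ofReal_ne_top]
    refine lintegral_mono fun η => ?_
    rw [← mul_assoc, ← ENNReal.ofReal_mul (by positivity), ← mul_pow]
    gcongr
    · exact hm' k η
    · exact h k η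
  · rw [ENNReal.mul_top (by simpa using by positivity)]

/-- The gap between λ'/2 and λ' ≤ λ(t) absorbs the polynomial factor. Thus the low bootstrap norm
dominates one fixed Gevrey norm, uniformly in time. -/
theorem exists_gevreyWeight_le_multA (hs0 : 0 < s) (hlam' : 0 < lam') (hlam : lam' < lam0) (σ' : ℝ) :
    ∃ C : ℝ, 0 < C ∧ ∀ (t : ℝ) (k : Fin d → ℤ) (η : E d),
      Real.exp (lam' / 2 * japPair k η ^ s) ≤ C * multA γ s lam0 lam' σ σ' t k η := by
  obtain ⟨C, hC, h⟩ := exists_rpow_le_exp (half_pos hlam') hs0 (-(σ + σ'))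
  refine ⟨C, hC, fun t k η => ?_⟩
  have hy := japPair_pos k η
  have h1 := h _ (one_le_japPair k η)
  have h2 := lam'_le_radius (γ := γ) (s := s) hlam t
  have hys : 0 ≤ japPair k η ^ s := Real.rpow_nonneg hy.le _
  have hyσ : 0 < japPair k η ^ (σ + σ') := Real.rpow_pos_of_pos hy _
  rw [Real.rpow_neg hy.le, inv_le_iff_one_le_mul₀ hyσ] at h1
  calc Real.exp (lam' / 2 * japPair k η ^ s)
      ≤ Real.exp (lam' / 2 * japPair k η ^ s) *
        (C * Real.exp (lam' / 2 * japPair k η ^ s) * japPair k η ^ (σ + σ')) :=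
        le_mul_of_one_le_right (Real.exp_pos _).le h1
    _ = C * (Real.exp (lam' * japPair k η ^ s) * japPair k η ^ (σ + σ')) := by
        rw [show lam' * japPair k η ^ s = lam' / 2 * japPair k η ^ s + lam' / 2 * japPair k η ^ s by
          ring, Real.exp_add]
        ring
    _ ≤ _ := by
        unfold multA
        gcongr

theorem exists_multA_le_gevreyWeight (hγ : 1 ≤ γ) (hs : 1 / (2 + γ) < s) (hlam : lam' < lam0) (σ' : ℝ) :
    ∃ C : ℝ, 0 < C ∧ ∀ (t : ℝ) (k : Fin d → ℤ) (η : E d), 0 ≤ t →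
      multA γ s lam0 lam' σ σ' t k η ≤ C * Real.exp (lam0 * japPair k η ^ s) := by
  obtain ⟨C, hC, h⟩ := exists_rpow_le_exp (c := (lam0 - lam') / 8) (by linarith) (s_pos hγ hs) (σ + σ')
  refine ⟨C, hC, fun t k η ht => ?_⟩
  have h1 := h _ (one_le_japPair k η)
  have h2 := radius_le (γ := γ) (s := s) hγ hs hlam ht
  have hys : 0 ≤ japPair k η ^ s := Real.rpow_nonneg (japPair_pos k η).le _
  unfold multA
  calc _ ≤ Real.exp ((7 * lam0 + lam') / 8 * japPair k η ^ s) *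
        (C * Real.exp ((lam0 - lam') / 8 * japPair k η ^ s)) := by
        have := Real.rpow_nonneg (japPair_pos k η).le (σ + σ')
        gcongr
    _ = C * (Real.exp ((7 * lam0 + lam') / 8 * japPair k η ^ s) *
        Real.exp ((lam0 - lam') / 8 * japPair k η ^ s)) := by ring
    _ = _ := by
        rw [← Real.exp_add]
        congr 2
        ring

theorem StabilityL.integrable (hd : 1 ≤ d) (hM : (d : ℝ) / 2 < M)
    (hL : StabilityL What f0 C₀ lamBar κ M) : Integrable f0 := by
  have h1 := integrable_zMode hd hM (m := fun k η => Real.exp (lamBar * japPair k η ^ (1 : ℝ)))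
    (g := fun _ v => f0 v) (hL.localized.trans_lt ENNReal.ofReal_lt_top).ne 0
  have h2 : zMode (fun _ v => f0 v) (0 : Fin d → ℤ) = f0 := funext fun v => by
    simp [zMode, torusCoeff_const]
  rwa [h2] at h1

/-- Solutions satisfying the low-norm bootstrap bound decay in Fourier space. -/
theorem exists_decayingSolution (hd : 1 ≤ d) (hM : (d : ℝ) / 2 < M) (hγ : 1 ≤ γ) (hC_W : 0 < C_W)
    (hs : 1 / (2 + γ) < s) (hs1 : s < 1) (hlam' : 0 < lam') (hlam : lam' < lam0) {N : ℝ} (hN : 0 ≤ N)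
    (hW : ∀ k : Fin d → ℤ, k ≠ 0 → ‖What k‖ ≤ C_W * ‖vec k‖ ^ (-1 - γ))
    (hL : StabilityL What f0 C₀ lamBar κ M) (hf : IsVlasovSolution What f0 hin T f)
    (hlow : ∀ t ∈ Set.Ico 0 T, energy γ s lam0 lam' σ (-β) M f t ≤ ENNReal.ofReal N) :
    ∃ B, DecayingSolution What f0 hin T f C_W B := by
  obtain ⟨c, hc, hw⟩ := exists_gevreyWeight_le_multA (d := d) (γ := γ) (σ := σ) (s_pos hγ hs) hlam' hlam
    (-β)
  obtain ⟨C, hC, hdec⟩ := exists_modeDecay (M := M) hd hM (half_pos hlam') (s_pos hγ hs) hs1.le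
  refine ⟨C * Real.sqrt (c ^ 2 * N), { hf with
    decay := fun t ht => ?_
    potential := fun k => ?_
    background := ?_
    integrable_background := hL.integrable hd hM }⟩
  · refine hdec (f t) _ (by positivity) (hf.smooth t ht).continuous
      (fun v k z => hf.periodic t ht k z v) ?_
    rw [ENNReal.ofReal_mul (by positivity)]
    refine le_trans ?_ (mul_le_mul_right (hlow t ht) _)
    rw [energy, Finset.mul_sum]
    exact Finset.sum_le_sum fun α _ =>
      multiplierNormSq_le_of_le hc (fun _ _ => (Real.exp_pos _).le) (hw t) _
  · rcases eq_or_ne k 0 with rfl | hk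
    · simpa [vec_zero] using hC_W.le
    · have h1 := norm_potential_mul_sq_le hγ hC_W hk (hW k hk)
      have h2 := one_le_norm_vec hk
      have h3 := norm_nonneg (What k)
      refine le_trans ?_ h1
      rw [mul_comm, sq, ← mul_assoc]
      exact le_mul_of_one_le_right (by positivity) h2
  · exact hL.analytic.contDiff

theorem DecayingSolution.modeHat_zero (h : DecayingSolution What f0 hin T f CW B) (hT : 0 < T)
    (hmean : (∫ z in cell d, ∫ v, hin z v) = 0) : modeHat hin 0 0 = 0 := by
  have hInt := h.integrable_solution (t := 0) ⟨le_rfl, hT⟩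
  rw [h.initial] at hInt
  have h1 := integral_planeWave_mul hInt 0 0
  have h2 : ∀ p : E d × E d, planeWave 0 0 p * hin p.1 p.2 = hin p.1 p.2 := fun p => by
    simp [planeWave, vec_zero]
  simp_rw [h2] at h1
  rw [integral_prod _ hInt, hmean] at h1
  have hpi : (((2 * Real.pi) ^ d : ℝ) : ℂ) ≠ 0 := by
    exact_mod_cast (pow_pos Real.two_pi_pos d).ne'
  exact (mul_eq_zero.mp h1.symm).resolve_left hpi

/-- The contribution of the initial datum to the density. -/
theorem exists_initial_estimate (hd : 1 ≤ d) (hM : (d : ℝ) / 2 < M) (hγ : 1 ≤ γ)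
    (hs : 1 / (2 + γ) < s) (hs1 : s < 1) (hlam' : 0 < lam') (hlam : lam' < lam0) :
    ∃ C : ℝ, 0 < C ∧ ∀ (hin : E d → E d → ℂ) (ε S : ℝ),
      ∑ α ∈ multiIndices d M, gevreyNormSq lam0 s (moment α hin) < ENNReal.ofReal (ε ^ 2) →
      ∑' k : Fin d → ℤ, (if k = 0 then 0 else ∫⁻ t in Set.Icc 0 S,
        ENNReal.ofReal (multA γ s lam0 lam' σ 0 t k (t • vec k) ^ 2) *
          ‖modeHat hin k (t • vec k)‖ₑ ^ 2) ≤ ENNReal.ofReal (C * ε ^ 2) := by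
  have hlam0 : 0 < lam0 := by linarith
  obtain ⟨C, hC, htr⟩ := exists_line_trace (M := M) hd hM (Real.exp lam0) (Real.exp_pos _)
  obtain ⟨C', hC', hw⟩ := exists_multA_le_gevreyWeight (d := d) (σ := σ) hγ hs hlam 0
  refine ⟨C' ^ 2 * C, by positivity, fun hin ε S hε => ?_⟩
  have h1 := (htr (fun k η => Real.exp (lam0 * japPair k η ^ s)) (measurable_gevreyWeight lam0 s)
    (fun _ _ => Real.exp_pos _)
    (fun k η ξ => gevreyWeight_le_of_near hlam0.le (s_pos hγ hs).le hs1.le k) hin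
    (hε.trans ENNReal.ofReal_lt_top).ne).2 0 0
  simp only [sub_zero] at h1
  rw [mul_assoc, ENNReal.ofReal_mul (by positivity), ENNReal.ofReal_mul hC.le]
  refine le_trans ?_ (mul_le_mul_right (h1.trans (mul_le_mul_right hε.le _)) _)
  rw [← ENNReal.tsum_mul_left]
  refine ENNReal.tsum_le_tsum fun k => ?_
  split_ifs
  · simp
  rw [← lintegral_const_mul' _ _ ENNReal.ofReal_ne_top]
  refine le_trans (setLIntegral_mono' measurableSet_Icc fun t ht => ?_) (setLIntegral_le_lintegral _ _)
  rw [← mul_assoc, ← ENNReal.ofReal_mul (by positivity), ← mul_pow]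
  gcongr
  · exact (multA_pos _ _ _ _).le
  · exact hw t k _ ht.1

theorem measurable_multA (σ' t : ℝ) (k : Fin d → ℤ) :
    Measurable (multA γ s lam0 lam' σ σ' t k) :=
  ((continuous_multA σ' k).comp (f := fun η : E d => (t, η)) (by fun_prop)).measurable

/-- At each fixed time the multiplier varies by a bounded factor over unit balls, so the trace
theorem applies with a constant independent of time. The pointwise bound serves the reaction term,
the line bound the transport term. -/
theorem exists_energy_sup_le (hd : 1 ≤ d) (hM : (d : ℝ) / 2 < M) (hγ : 1 ≤ γ)
    (hs : 1 / (2 + γ) < s) (hs1 : s < 1) (hlam' : 0 < lam') (hlam : lam' < lam0) (σ' : ℝ) :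
    ∃ C : ℝ, 0 < C ∧ ∀ (f : ℝ → E d → E d → ℂ) (t N : ℝ), 0 ≤ t → 0 ≤ N →
      energy γ s lam0 lam' σ σ' M f t ≤ ENNReal.ofReal N →
      (∀ m ξ, multA γ s lam0 lam' σ σ' t m ξ * ‖modeHat (f t) m ξ‖ ≤ Real.sqrt (C * N)) ∧
      ∀ (l : Fin d → ℤ) (a : E d), ∑' k : Fin d → ℤ, (if k = 0 then 0 else
        ∫⁻ τ : ℝ, ENNReal.ofReal (multA γ s lam0 lam' σ σ' t (k - l) (τ • vec k - a) ^ 2) *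
          ‖modeHat (f t) (k - l) (τ • vec k - a)‖ₑ ^ 2) ≤ ENNReal.ofReal (C * N) := by
  obtain ⟨c, hc, hnear⟩ := exists_multA_le_of_near (d := d) (σ := σ) hγ hs hs1 hlam' hlam σ'
  obtain ⟨C, hC, htr⟩ := exists_line_trace (M := M) hd hM c hc
  refine ⟨C, hC, fun f t N ht hN hE => ?_⟩
  obtain ⟨h1, h2⟩ := htr (multA γ s lam0 lam' σ σ' t) (measurable_multA σ' t)
    (fun _ _ => multA_pos _ _ _ _) (fun k η ξ => hnear t k η ξ ht) (f t)
    (hE.trans_lt ENNReal.ofReal_lt_top).ne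
  have hE' := mul_le_mul_right hE (ENNReal.ofReal C)
  rw [← ENNReal.ofReal_mul hC.le] at hE'
  refine ⟨fun m ξ => ?_, fun l a => (h2 l a).trans hE'⟩
  have h3 := (h1 m ξ).trans hE'
  rw [← ofReal_norm, ← ENNReal.ofReal_pow (norm_nonneg _), ← ENNReal.ofReal_mul (by positivity),
    ENNReal.ofReal_le_ofReal_iff (by positivity), ← mul_pow] at h3
  exact Real.le_sqrt_of_sq_le h3

theorem DecayingSolution.lintegral_densityNormSq (h : DecayingSolution What f0 hin T f CW B) {S : ℝ}
    (hS : S ∈ Set.Ico 0 T) :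
    ∫⁻ t in Set.Icc 0 S, densityNormSq γ s lam0 lam' σ f t = ∑' k, ∫⁻ t in Set.Icc 0 S,
      ENNReal.ofReal (multA γ s lam0 lam' σ 0 t k (t • vec k) ^ 2) * ‖densityHat f t k‖ₑ ^ 2 := by
  have hm : ∀ k : Fin d → ℤ, Measurable fun t =>
      ENNReal.ofReal (multA γ s lam0 lam' σ 0 t k (t • vec k) ^ 2) *
        ‖densityHat f (clamp S t) k‖ₑ ^ 2 := by
    intro k
    have hw : Measurable fun t : ℝ => multA γ s lam0 lam' σ 0 t k (t • vec k) :=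
      ((continuous_multA 0 k).comp (f := fun t : ℝ => (t, t • vec k)) (by fun_prop)).measurable
    exact (hw.pow_const 2).ennreal_ofReal.mul ((h.measurable_densityHat hS k).enorm.pow_const 2)
  have h1 : ∫⁻ t in Set.Icc 0 S, densityNormSq γ s lam0 lam' σ f t = ∫⁻ t in Set.Icc 0 S, ∑' k,
      ENNReal.ofReal (multA γ s lam0 lam' σ 0 t k (t • vec k) ^ 2) *
        ‖densityHat f (clamp S t) k‖ₑ ^ 2 :=
    setLIntegral_congr_fun measurableSet_Icc fun t ht => by
      simp only [densityNormSq, clamp_of_mem ht]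
  rw [h1, lintegral_tsum fun k => (hm k).aemeasurable]
  refine tsum_congr fun k => setLIntegral_congr_fun measurableSet_Icc fun t ht => ?_
  simp only [clamp_of_mem ht]

/-- The a priori estimate for the density on a compact time interval. -/
theorem exists_density_estimate (hd : 1 ≤ d) (hM : (d : ℝ) / 2 < M) (hγ : 1 ≤ γ) (hC_W : 0 < C_W)
    (hC₀ : 0 < C₀) (hlamBar : 0 < lamBar) (hκ : 0 < κ) (hs : 1 / (2 + γ) < s) (hs1 : s < 1)
    (hlam' : 0 < lam') (hlam : lam' < lam0) (hσ : 0 ≤ σ) (β : ℝ) :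
    ∃ C : ℝ, 0 < C ∧ ∀ (What : (Fin d → ℤ) → ℂ) (f0 : E d → ℂ) (hin : E d → E d → ℂ)
      (ε T : ℝ) (f : ℝ → E d → E d → ℂ) (K₁ K₂ K₃ : ℝ), 0 < K₁ → 0 < K₂ → 0 < T →
      (∀ k : Fin d → ℤ, k ≠ 0 → ‖What k‖ ≤ C_W * ‖vec k‖ ^ (-1 - γ)) →
      StabilityL What f0 C₀ lamBar κ M → (∫ z in cell d, ∫ v, hin z v) = 0 →
      ∑ α ∈ multiIndices d M, gevreyNormSq lam0 s (moment α hin) < ENNReal.ofReal (ε ^ 2) →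
      IsVlasovSolution What f0 hin T f → Bootstrap γ s lam0 lam' σ β M K₁ K₂ K₃ ε T f →
      ∀ S ∈ Set.Ico 0 T, ∫⁻ t in Set.Ioc 0 S, densityNormSq γ s lam0 lam' σ f t ≤
        ENNReal.ofReal (C * ε ^ 2) + ENNReal.ofReal (C * (K₁ + K₂) * ε ^ 2) *
          ∫⁻ t in Set.Ioc 0 S, densityNormSq γ s lam0 lam' σ f t := by
  obtain ⟨CL, hCL, hlin⟩ := exists_linear_estimate (d := d) (M := M) (σ := σ) hd hM hγ hC_W hC₀ hlamBar
    hκ hs hs1 hlam' hlam hσ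
  obtain ⟨CN, hCN, hnon⟩ := exists_nonlinear_estimate (d := d) (σ := σ) hγ hC_W hs hs1 hlam' hlam hσ β
  obtain ⟨CI, hCI, hini⟩ := exists_initial_estimate (d := d) (M := M) (σ := σ) hd hM hγ hs hs1 hlam' hlam
  obtain ⟨C₁, hC₁, hhigh⟩ := exists_energy_sup_le (d := d) (M := M) (σ := σ) hd hM hγ hs hs1 hlam' hlam 1
  obtain ⟨C₂, hC₂, hlow⟩ := exists_energy_sup_le (d := d) (M := M) (σ := σ) hd hM hγ hs hs1 hlam' hlam
    (-β)
  refine ⟨4 * CL * CI + 16 * CL * CN * (C₁ + C₂), by positivity,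
    fun What f0 hin ε T f K₁ K₂ K₃ hK₁ hK₂ hT hW hL hmean hε hf hboot S hS => ?_⟩
  obtain ⟨B, h⟩ := exists_decayingSolution (N := 4 * K₂ * ε ^ 2) hd hM hγ hC_W hs hs1 hlam' hlam
    (by positivity) hW hL hf hboot.low
  have hSmem : ∀ t ∈ Set.Icc 0 S, t ∈ Set.Ico 0 T := fun t ht => ⟨ht.1, ht.2.trans_lt hS.2⟩
  have hjap : ∀ τ, 0 < jap τ ^ 7 := fun τ => pow_pos (jap_pos τ) 7
  have hN := hnon What f0 hin T C_W B f (Real.sqrt (C₂ * (4 * K₂ * ε ^ 2))) (C₁ * (4 * K₁ * ε ^ 2))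
    (by positivity) hW h S hS
    (fun τ hτ => (hlow f τ _ hτ.1 (by positivity) (hboot.low τ (hSmem τ hτ))).1)
    (fun τ hτ l a => by
      have h1 := (hhigh f τ _ hτ.1 (by have := hjap τ; positivity) (hboot.high τ (hSmem τ hτ))).2 l a
      rwa [show C₁ * (4 * K₁ * jap τ ^ 7 * ε ^ 2) = C₁ * (4 * K₁ * ε ^ 2) * jap τ ^ 7 by ring] at h1)
  rw [Real.sq_sqrt (by positivity)] at hN
  have hI := hini hin ε S hε
  have hhat : ∀ k, Continuous (modeHat hin k) := fun k => by
    have := (h.decay 0 ⟨le_rfl, hT⟩).continuous_modeHat k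
    rwa [h.initial] at this
  -- The mode 0, to which the linear estimate does not apply, vanishes identically.
  have hzero : ∀ t ∈ Set.Ico 0 T, densityHat f t 0 = 0 := fun t ht => by
    rw [h.densityHat_zero ht, h.modeHat_zero hT hmean]
  rw [Measure.restrict_congr_set Ioc_ae_eq_Icc, h.lintegral_densityNormSq hS]
  set Q := ∑' k, ∫⁻ t in Set.Icc 0 S,
      ENNReal.ofReal (multA γ s lam0 lam' σ 0 t k (t • vec k) ^ 2) * ‖densityHat f t k‖ₑ ^ 2 with hQ
  have hmode : ∀ k : Fin d → ℤ, ∫⁻ t in Set.Icc 0 S,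
      ENNReal.ofReal (multA γ s lam0 lam' σ 0 t k (t • vec k) ^ 2) * ‖densityHat f t k‖ₑ ^ 2 ≤
      ENNReal.ofReal (4 * CL) * (if k = 0 then 0 else ∫⁻ t in Set.Icc 0 S,
        ENNReal.ofReal (multA γ s lam0 lam' σ 0 t k (t • vec k) ^ 2) *
          ‖modeHat hin k (t • vec k)‖ₑ ^ 2) +
      ENNReal.ofReal (4 * CL) * (if k = 0 then 0 else ∫⁻ t in Set.Icc 0 S,
        ENNReal.ofReal (multA γ s lam0 lam' σ 0 t k (t • vec k) ^ 2) *
          ‖∫ τ in 0..t, ∑' l, nonlinearTerm What f k t τ l‖ₑ ^ 2) := by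
    intro k
    split_ifs with hk
    · subst hk
      have : ∫⁻ t in Set.Icc 0 S, ENNReal.ofReal (multA γ s lam0 lam' σ 0 t 0 (t • vec (0 : Fin d → ℤ)) ^ 2) *
          ‖densityHat f t 0‖ₑ ^ 2 = ∫⁻ t in Set.Icc 0 S, 0 :=
        setLIntegral_congr_fun measurableSet_Icc fun t ht => by simp [hzero t (hSmem t ht)]
      rw [this]
      simp
    have hm : Measurable fun t : ℝ => 4 * (ENNReal.ofReal (multA γ s lam0 lam' σ 0 t k (t • vec k) ^ 2) *
        ‖modeHat hin k (t • vec k)‖ₑ ^ 2) := by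
      have hw : Measurable fun t : ℝ => multA γ s lam0 lam' σ 0 t k (t • vec k) :=
        ((continuous_multA 0 k).comp (f := fun t : ℝ => (t, t • vec k)) (by fun_prop)).measurable
      have hh : Measurable fun t : ℝ => modeHat hin k (t • vec k) :=
        ((hhat k).comp (by fun_prop)).measurable
      exact ((hw.pow_const 2).ennreal_ofReal.mul (hh.enorm.pow_const 2)).const_mul 4
    rw [mul_comm 4 CL, ENNReal.ofReal_mul hCL.le, ENNReal.ofReal_ofNat, mul_assoc, mul_assoc, ← mul_add,
      ← lintegral_const_mul' 4 _ (by simp), ← lintegral_const_mul' 4 _ (by simp),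
      ← lintegral_add_left hm]
    refine (hlin What f0 hin T C_W B f hW hL h S hS k hk).trans ?_
    gcongr with t
    calc _ ≤ ENNReal.ofReal (multA γ s lam0 lam' σ 0 t k (t • vec k) ^ 2) *
          (4 * ‖modeHat hin k (t • vec k)‖ₑ ^ 2 +
            4 * ‖∫ τ in 0..t, ∑' l, nonlinearTerm What f k t τ l‖ₑ ^ 2) := by
          gcongr
          exact (pow_le_pow_left' (enorm_sub_le) 2).trans (add_sq_le_four_mul _ _)
      _ = _ := by ring
  calc Q ≤ ENNReal.ofReal (4 * CL) * ENNReal.ofReal (CI * ε ^ 2) + ENNReal.ofReal (4 * CL) *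
        (ENNReal.ofReal (CN * (C₂ * (4 * K₂ * ε ^ 2) + C₁ * (4 * K₁ * ε ^ 2))) * Q) := by
        refine (ENNReal.tsum_le_tsum hmode).trans ?_
        rw [ENNReal.tsum_add, ENNReal.tsum_mul_left, ENNReal.tsum_mul_left]
        gcongr
    _ ≤ _ := by
        rw [← mul_assoc, ← ENNReal.ofReal_mul (by positivity), ← ENNReal.ofReal_mul (by positivity)]
        refine add_le_add (ENNReal.ofReal_le_ofReal ?_)
          (mul_le_mul_left (ENNReal.ofReal_le_ofReal ?_) _)
        · have : 0 ≤ 16 * CL * CN * (C₁ + C₂) * ε ^ 2 := by positivity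
          nlinarith
        · have h1 : 0 ≤ 4 * CL * CI * (K₁ + K₂) * ε ^ 2 := by positivity
          have h2 : 0 ≤ 16 * CL * CN * (C₁ * K₂ + C₂ * K₁) * ε ^ 2 := by positivity
          nlinarith

/-- Monotone convergence along S ↑ T, the endpoint being a null set; it extends the bound to t = T,
where no hypothesis on the solution is available. -/
theorem lintegral_Ioc_le_of_forall_lt {F : ℝ → ℝ≥0∞} {T : ℝ} {N : ℝ≥0∞} (hT : 0 < T)
    (h : ∀ S ∈ Set.Ico 0 T, ∫⁻ t in Set.Ioc 0 S, F t ≤ N) {t : ℝ} (ht : t ∈ Set.Icc 0 T) :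
    ∫⁻ τ in Set.Ioc 0 t, F τ ≤ N := by
  obtain ⟨u, hu, hul, hut⟩ := exists_seq_strictMono_tendsto' hT
  have h1 : Set.Ioo 0 T = ⋃ n, Set.Ioc 0 (u n) := by
    ext x
    simp only [Set.mem_Ioo, Set.mem_iUnion, Set.mem_Ioc]
    constructor
    · rintro ⟨h0, hx⟩
      obtain ⟨n, hn⟩ := (hut.eventually (lt_mem_nhds hx)).exists
      exact ⟨n, h0, hn.le⟩
    · rintro ⟨n, h0, hx⟩
      exact ⟨h0, hx.trans_lt (hul n).2⟩
  calc ∫⁻ τ in Set.Ioc 0 t, F τ ≤ ∫⁻ τ in Set.Ioc 0 T, F τ :=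
        lintegral_mono_set (Set.Ioc_subset_Ioc_right ht.2)
    _ = ∫⁻ τ in Set.Ioo 0 T, F τ := by rw [Measure.restrict_congr_set Ioo_ae_eq_Ioc]
    _ = ⨆ n, ∫⁻ τ in Set.Ioc 0 (u n), F τ := by
        rw [h1, setLIntegral_iUnion_of_directed]
        exact directed_of_isDirected_le fun m n hmn => Set.Ioc_subset_Ioc_right (hu.monotone hmn)
    _ ≤ N := iSup_le fun n => h _ ⟨(hul n).1.le, (hul n).2⟩

end Bootstrap

end LandauDamping

/-! ### Closing the bootstrap. -/

open LandauDamping in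
theorem mainTheorem3
    (d M : ℕ) (hd : 1 ≤ d) (hM : (d : ℝ) / 2 < M)
    (γ C_W : ℝ) (hγ : 1 ≤ γ) (hC_W : 0 < C_W)
    (C₀ lamBar κ : ℝ) (hC₀ : 0 < C₀) (hlamBar : 0 < lamBar) (hκ : 0 < κ)
    (s lam0 lam' : ℝ) (hs : 1 / (2 + γ) < s) (hs1 : s < 1)
    (hlam' : 0 < lam') (hlam : lam' < lam0)
    (σ β : ℝ) (hσ : (d : ℝ) + 8 < σ) (hβ : 2 < β) :
    ∃ K₃₀ : ℝ, 1 ≤ K₃₀ ∧ ∀ K₃ : ℝ, K₃₀ ≤ K₃ → ∀ K₁ K₂ : ℝ, 0 < K₁ → 0 < K₂ →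
      ∃ ε₀ : ℝ, 0 < ε₀ ∧
        ∀ (What : (Fin d → ℤ) → ℂ) (f0 : E d → ℂ) (hin : E d → E d → ℂ)
          (ε T : ℝ) (f : ℝ → E d → E d → ℂ),
          (∀ k : Fin d → ℤ, k ≠ 0 → ‖What k‖ ≤ C_W * ‖vec k‖ ^ (-1 - γ)) →
          StabilityL What f0 C₀ lamBar κ M →
          0 < ε → ε ≤ ε₀ → 0 < T →
          (∫ z in cell d, ∫ v, hin z v) = 0 →
          ∑ α ∈ multiIndices d M, gevreyNormSq lam0 s (moment α hin) < ENNReal.ofReal (ε ^ 2) →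
          IsVlasovSolution What f0 hin T f →
          Bootstrap γ s lam0 lam' σ β M K₁ K₂ K₃ ε T f →
          ∀ t ∈ Set.Icc 0 T,
            ∫⁻ τ in Set.Ioc 0 t, densityNormSq γ s lam0 lam' σ f τ
              < ENNReal.ofReal (2 * K₃ * ε ^ 2) := by
  obtain ⟨C, hC, hest⟩ := exists_density_estimate (d := d) (M := M) (σ := σ) hd hM hγ hC_W hC₀ hlamBar hκ
    hs hs1 hlam' hlam (by linarith [(Nat.cast_nonneg d : (0 : ℝ) ≤ d)]) β
  -- With K₃ ≥ 2C the datum contributes at most K₃ε²/2.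
  refine ⟨max 1 (2 * C), le_max_left _ _, fun K₃ hK₃ K₁ K₂ hK₁ hK₂ => ?_⟩
  have hK₃1 : 1 ≤ K₃ := (le_max_left _ _).trans hK₃
  have hK₃C : 2 * C ≤ K₃ := (le_max_right _ _).trans hK₃
  -- The quadratic part is at most C(K₁+K₂)ε² · 4K₃ε²; the factor 8 makes this at most K₃ε²/2, and ε
  -- ≤ 1 allows ε² to be replaced by ε.
  refine ⟨min 1 (1 / (8 * C * (K₁ + K₂))), by positivity,
    fun What f0 hin ε T f hW hL hε hε₀ hT hmean hin_le hf hboot t ht => ?_⟩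
  have hε1 : ε ≤ 1 := hε₀.trans (min_le_left _ _)
  have hsmall : 8 * C * (K₁ + K₂) * ε ^ 2 ≤ 1 := by
    have h1 : ε * (8 * C * (K₁ + K₂)) ≤ 1 :=
      (le_div_iff₀ (by positivity)).mp (hε₀.trans (min_le_right _ _))
    calc 8 * C * (K₁ + K₂) * ε ^ 2 = ε * (8 * C * (K₁ + K₂)) * ε := by ring
      _ ≤ 1 * 1 := by gcongr
      _ = 1 := one_mul 1
  have key : ∀ S ∈ Set.Ico 0 T, ∫⁻ τ in Set.Ioc 0 S, densityNormSq γ s lam0 lam' σ f τ ≤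
      ENNReal.ofReal (K₃ * ε ^ 2) := by
    intro S hS
    refine (hest What f0 hin ε T f K₁ K₂ K₃ hK₁ hK₂ hT hW hL hmean hin_le hf hboot S hS).trans ?_
    refine (add_le_add_right (mul_le_mul_right (hboot.mid S hS) _) _).trans ?_
    rw [← ENNReal.ofReal_mul (by positivity), ← ENNReal.ofReal_add (by positivity) (by positivity)]
    apply ENNReal.ofReal_le_ofReal
    have hε2 : 0 < ε ^ 2 := by positivity
    have h1 : C * (K₁ + K₂) * ε ^ 2 * (4 * K₃ * ε ^ 2) =
        8 * C * (K₁ + K₂) * ε ^ 2 * (K₃ * ε ^ 2 / 2) := by ring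
    have h2 : 8 * C * (K₁ + K₂) * ε ^ 2 * (K₃ * ε ^ 2 / 2) ≤ 1 * (K₃ * ε ^ 2 / 2) := by gcongr
    nlinarith
  -- The bound K₃ε² is better than required by a factor 2, so the inequality remains strict after
  -- the passage to the endpoint.
  refine (lintegral_Ioc_le_of_forall_lt hT key ht).trans_lt ?_
  refine (ENNReal.ofReal_lt_ofReal_iff (by positivity)).mpr ?_
  have : 0 < K₃ * ε ^ 2 := by positivity
  linarith
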